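/- Let $k\ge 1$ and $n\ge 0$ be integers. A $k$-CRV is a random vector with values in the standard basis $\{e_1,\dots,e_k\}$ of $\mathbb{R}^k$; an $(n,k)$-PMD is the law of the sum of $n$ independent (not necessarily identically distributed) $k$-CRVs; an $(n,k)$-GMD is the projection of an $(n,k)$-PMD to all but one (say, the last) of its coordinates, hence a distribution on $\mathbb{R}^{k-1}$. It is given by an $n\times k$ matrix whose rows are the probability vectors of the $n$ CRVs. Let $\mu\in\mathbb{Q}^{k-1}$ and let $\Sigma\in\mathbb{Q}^{(k-1)\times(k-1)}$ be symmetric positive semidefinite (the parameters of a discretized Gaussian $\lfloor\mathcal{N}(\mu,\Sigma)\rceil$), let $\varepsilon_1,\varepsilon_2\in\mathbb{Q}$, and suppose that there exists an $(n,k)$-GMD $\rho$ with mean $\mu^{\rho}$ and covariance $\Sigma^{\rho}$ such that for all vectors $v\in\mathbb{R}^{k-1}$ $$|v^T(\mu-\mu^{\rho})|\le \varepsilon_1\sqrt{v^T\Sigma v}\quad\text{and}\quad |v^T(\Sigma-\Sigma^{\rho})v|\le\varepsilon_2\, v^T\Sigma v .$$ Then, given $n,k,\mu,\Sigma,\varepsilon_1,\varepsilon_2$,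 one can compute in time $n^{O(k)}$ an $(n,k)$-GMD $\rho'$ with mean $\mu^{\rho'}$ and covariance $\Sigma^{\rho'}$ such that for all vectors $v\in\mathbb{R}^{k-1}$ $$|v^T(\mu-\mu^{\rho'})|\le \varepsilon_1\sqrt{v^T\Sigma v}+3k^{2.5}\|v\|_2\quad\text{and}\quad |v^T(\Sigma-\Sigma^{\rho'})v|\le\varepsilon_2\, v^T\Sigma v+3k^{3}\|v\|_2^2 .$$ Precisely: there are a universal constant $C$ and a single deterministic random access machine program with logarithmic cost (each operation is charged the bit lengths of the integers that it handles) which, for all $n,k,\mu,\Sigma,\varepsilon_1,\varepsilon_2$ as above, with every rational number given in binary by its numerator and denominator, halts in time at most $(n+1)^{Ck}(b+1)^{C}$, where $b$ is the largest bit length of an integer in the input, and outputs the rational $n\times k$ matrix of probabilities (as numerators and positive denominators) of such a GMD $\rho'$. In particular, for inputs made of $O(\log n)$-bit integers and $n\ge 2$ the running time is $n^{O(k)}$. -/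

import Mathlib

open MeasureTheory ProbabilityTheory
open scoped Matrix

noncomputable section

/-! ## Poisson multinomial and generalized multinomial distributions -/

/-- The law of a `k`-categorical random vector: it takes the value `e_j` with probability `p j`. -/
def crvLaw {k : ℕ} (p : Fin k → ℝ) : Measure (Fin k → ℝ) :=
  ∑ j, ENNReal.ofReal (p j) • Measure.dirac (Pi.single j 1)

/-- The law of the sum of `n` independent categorical random vectors,
the `i`-th one having the probability vector `π i`. -/
def pmdLaw {n k : ℕ} (π : Fin n → Fin k → ℝ) : Measure (Fin k → ℝ) :=
  (Measure.pi fun i => crvLaw (π i)).map fun x => ∑ i, x i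

/-- The projection of the Poisson multinomial law in dimension `d + 1` to all but
the last coordinate. -/
def gmdLaw {n d : ℕ} (π : Fin n → Fin (d + 1) → ℝ) : Measure (Fin d → ℝ) :=
  (pmdLaw π).map fun x j => x j.castSucc

/-- Each row of `π` is a probability vector. -/
def IsRowStochastic {n k : ℕ} (π : Fin n → Fin k → ℝ) : Prop :=
  ∀ i, π i ∈ stdSimplex ℝ (Fin k)

/-- `ν` is an `(n, d + 1)`-GMD (a distribution on `ℝ^d`). -/
def IsGMD (n : ℕ) {d : ℕ} (ν : Measure (Fin d → ℝ)) : Prop :=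
  ∃ π : Fin n → Fin (d + 1) → ℝ, IsRowStochastic π ∧ ν = gmdLaw π

/-- The mean vector of a distribution on `ℝ^d`. -/
def meanVec {d : ℕ} (ν : Measure (Fin d → ℝ)) : Fin d → ℝ :=
  fun j => ∫ x, x j ∂ν

/-- The covariance matrix of a distribution on `ℝ^d`. -/
def covMat {d : ℕ} (ν : Measure (Fin d → ℝ)) : Matrix (Fin d) (Fin d) ℝ :=
  Matrix.of fun i j => covariance (fun x => x i) (fun x => x j) ν

/-- The mean and covariance of `ν` are spectrally close to `(μ, S)`, with relative errors
`ε₁`, `ε₂` and additive errors `a ‖v‖₂`, `b ‖v‖₂²`. -/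
def SpectrallyClose {d : ℕ} (μ : Fin d → ℝ) (S : Matrix (Fin d) (Fin d) ℝ)
    (ν : Measure (Fin d → ℝ)) (ε₁ ε₂ a b : ℝ) : Prop :=
  ∀ v : EuclideanSpace ℝ (Fin d),
    |v.ofLp ⬝ᵥ (μ - meanVec ν)| ≤ ε₁ * √(v.ofLp ⬝ᵥ S *ᵥ v.ofLp) + a * ‖v‖ ∧
    |v.ofLp ⬝ᵥ (S - covMat ν) *ᵥ v.ofLp| ≤ ε₂ * (v.ofLp ⬝ᵥ S *ᵥ v.ofLp) + b * ‖v‖ ^ 2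

end

/-! ## A random access machine with logarithmic cost

Structured programs over integer registers and integer arrays. Every operation is charged the bit
lengths of the numbers that it handles, so that the running time is polynomially related
to that of a word RAM or of a Turing machine. -/

/-- The number of binary digits of an integer. -/
def bitLen (z : ℤ) : ℕ := z.natAbs.size

/-- The memory: registers, and arrays that can be addressed indirectly. -/
structure RamState where
  reg : ℕ → ℤ
  arr : ℕ → ℕ → ℤ

/-- Arithmetic expressions; `get a e` reads the cell of array `a` whose index is the value of `e`,
and `div` is integer division. -/
inductive RamExpr where
  | lit (z : ℤ)
  | reg (x : ℕ)
  | get (a : ℕ) (e : RamExpr)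
  | add (e f : RamExpr)
  | sub (e f : RamExpr)
  | mul (e f : RamExpr)
  | div (e f : RamExpr)

def RamExpr.eval (s : RamState) : RamExpr → ℤ
  | .lit z => z
  | .reg x => s.reg x
  | .get a e => s.arr a (e.eval s).toNat
  | .add e f => e.eval s + f.eval s
  | .sub e f => e.eval s - f.eval s
  | .mul e f => e.eval s * f.eval s
  | .div e f => e.eval s / f.eval s

/-- The cost of evaluating an expression: each node of the expression costs one
plus the bit length of its value. -/
def RamExpr.cost (s : RamState) : RamExpr → ℕ
  | .lit z => 1 + bitLen z
  | .reg x => 1 + bitLen (s.reg x)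
  | .get a e => e.cost s + (1 + bitLen ((RamExpr.get a e).eval s))
  | .add e f => e.cost s + f.cost s + (1 + bitLen ((RamExpr.add e f).eval s))
  | .sub e f => e.cost s + f.cost s + (1 + bitLen ((RamExpr.sub e f).eval s))
  | .mul e f => e.cost s + f.cost s + (1 + bitLen ((RamExpr.mul e f).eval s))
  | .div e f => e.cost s + f.cost s + (1 + bitLen ((RamExpr.div e f).eval s))

/-- Programs. Branches and loops test whether an expression is positive. -/
inductive RamProg where
  | skip
  | set (x : ℕ) (e : RamExpr)
  | put (a : ℕ) (i e : RamExpr)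
  | seq (p q : RamProg)
  | ite (e : RamExpr) (p q : RamProg)
  | loop (e : RamExpr) (p : RamProg)

/-- Assignment to a register. -/
def RamState.setReg (s : RamState) (x : ℕ) (z : ℤ) : RamState where
  reg := Function.update s.reg x z
  arr := s.arr

/-- Assignment to an array cell. -/
def RamState.setArr (s : RamState) (a i : ℕ) (z : ℤ) : RamState where
  reg := s.reg
  arr := Function.update s.arr a (Function.update (s.arr a) i z)

/-- `RamRuns p s t s'`: started in the state `s`, the program `p` halts in the state `s'`
after time `t`. -/
inductive RamRuns : RamProg → RamState → ℕ → RamState → Prop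
  | skip (s : RamState) : RamRuns .skip s 1 s
  | set (s : RamState) (x : ℕ) (e : RamExpr) :
      RamRuns (.set x e) s (1 + e.cost s) (s.setReg x (e.eval s))
  | put (s : RamState) (a : ℕ) (i e : RamExpr) :
      RamRuns (.put a i e) s (1 + i.cost s + e.cost s) (s.setArr a (i.eval s).toNat (e.eval s))
  | seq {p q : RamProg} {s s' s'' : RamState} {t t' : ℕ} :
      RamRuns p s t s' → RamRuns q s' t' s'' → RamRuns (.seq p q) s (t + t') s''
  | ite_pos {e : RamExpr} {p q : RamProg} {s s' : RamState} {t : ℕ} :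
      0 < e.eval s → RamRuns p s t s' → RamRuns (.ite e p q) s (1 + e.cost s + t) s'
  | ite_neg {e : RamExpr} {p q : RamProg} {s s' : RamState} {t : ℕ} :
      ¬ 0 < e.eval s → RamRuns q s t s' → RamRuns (.ite e p q) s (1 + e.cost s + t) s'
  | loop_pos {e : RamExpr} {p : RamProg} {s s' s'' : RamState} {t t' : ℕ} :
      0 < e.eval s → RamRuns p s t s' → RamRuns (.loop e p) s' t' s'' →
      RamRuns (.loop e p) s (1 + e.cost s + t + t') s''
  | loop_neg {e : RamExpr} {p : RamProg} {s : RamState} :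
      ¬ 0 < e.eval s → RamRuns (.loop e p) s (1 + e.cost s) s

/-- The initial memory: the input is stored in array `0`, and everything else is zero. -/
def ramInit (input : List ℤ) : RamState where
  reg := fun _ => 0
  arr := fun a i => if a = 0 then input.getD i 0 else 0

/-! ## Input and output -/

/-- A rational number is given by its numerator and denominator. -/
def encodeRat (q : ℚ) : List ℤ := [q.num, (q.den : ℤ)]

/-- The input of the algorithm: `n`, `k = d + 1`, `ε₁`, `ε₂`, the entries of `μ`, and the entries
of `S`, row by row. -/
def encodeInput (n : ℕ) {d : ℕ} (μ : Fin d → ℚ) (S : Matrix (Fin d) (Fin d) ℚ) (ε₁ ε₂ : ℚ) :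
    List ℤ :=
  [(n : ℤ), (d : ℤ) + 1] ++ encodeRat ε₁ ++ encodeRat ε₂ ++
    (List.ofFn μ).flatMap encodeRat ++
    (List.ofFn fun i => (List.ofFn (S i)).flatMap encodeRat).flatten

/-- The largest bit length of a number in the list. -/
def maxBitLen (l : List ℤ) : ℕ := (l.map bitLen).foldr max 0

/-- The arrays `1` and `2` of the final memory hold the numerators and the (positive) denominators
of the entries of the matrix `π`, row by row. -/
def RamState.Outputs {n k : ℕ} (s : RamState) (π : Fin n → Fin k → ℝ) : Prop :=
  ∀ (i : Fin n) (j : Fin k), 0 < s.arr 2 (i * k + j) ∧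
    π i j = (s.arr 1 (i * k + j) : ℝ) / (s.arr 2 (i * k + j) : ℝ)

/-!
The first `d = k - 1` coordinates of a row of a realization form its *type*, a subprobability
vector. The law depends only on the multiset of types: the mean is the sum of the types `x`, and the
covariance matrix is the sum of the matrices `diag x - x xᵀ`. If types are rounded to multiples of
`1 / (2 n ^ 4)`, there are `n ^ O(d)` of them, and a choice of `n` types is a 0/1 vector indexed by
`n` copies of the grid. The conditions on mean and covariance are imposed in the directions `v` with
integral coordinates of size at most `n ^ 4` only. They extend to all directions with a small error
(`form_le_of_net`, `dotProduct_sub_le_of_net`), because the forms and means involved are bounded by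
small powers of `n`. This gives a linear system of `n ^ O(d)` rows and columns, which a rounded
realization solves (`GridBounds.roundInv_start`).

The right hand sides of the system have to be computed by rational arithmetic.

* The support function of the ellipsoid around `μ` is replaced by the maximum of `v ⬝ᵥ g` over the
  grid points `g` that are near the ellipsoid. This is decided up to a factor in the distance: with
  `X = ε₁ ^ 2 • S`, one looks for a number `lam` among `1, 2, 4, …` for which
  `w = (X + lam)⁻¹ (g - μ)` has `w ⬝ᵥ X *ᵥ w ≤ 1` and `lam * ‖w‖` small
  (`IsScaled.meanTest_sound`, `IsScaled.meanTest_complete`).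
* The upper bound `Y = (1 + ε₂) • S` for the covariance matrix may be so large that an error
  proportional to its norm cannot be afforded. It is replaced by `K Y (K + Y)⁻¹` with `K = n ^ 2`,
  which is bounded by `K` and still dominates, up to the factor `1 + 1 / n`, every covariance matrix
  below `Y` (`form_le_capForm`).
* Inverse matrices come, up to an integral factor, from the Faddeev–LeVerrier algorithm
  (`mul_flSeq`).

The columns of the system span a space of dimension at most `d + d ^ 2 + 1`, because variances are
quadratic in `v` (`rowCoef_rank`). So if more variables are free, a solution in the cube can be
moved along a face until one more variable is `0` or `1` (`exists_onFace_update`). In several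
passes, the program tries to fix the variables one after the other. Whether a face of the cube is
nearly feasible is decided by a greedy method: in each round it selects the vertex that is best for
the accumulated violations, and if the system is feasible, the norm of the violations grows only
like the square root of the number of rounds (`violation_le_of_faceFeasible`). Each trial increases
the tolerance by one; the rows are scaled so that all of it is less than one unit. At the end at
most `d + d ^ 2 + 1` variables are free (`card_freeVars_roundPasses_le`). Setting them to `0` or `1`
so that the sum is `n` (`exists_completion`) changes mean and covariance by the allowed amount
(`IsRealizedBy.spectrallyClose_of_net`). If `n ≤ 2 (d + 1) ^ 2` or `d = 0`, the zero vector is close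
enough (`IsRealizedBy.spectrallyClose_single`).

The program is written in a language of for-loops over arithmetic expressions with sums, and
compiled to the random access machine (`FProg.comp_spec`). The running time is polynomial in a bound
`R` for the bit lengths and the numbers of rounds (`FProg.polyBdd_time`), and `R` is polynomial in
`n ^ d` and in the bit length of the input (`FProg.polyBdd_gmdBound`, `size_le`).
-/

open Finset Matrix Function
open Int (toNat_natCast)

/-! ### For-programs and their compilation -/

/-- Arithmetic expressions with sums. `sum y x e` is the sum of the values of `e` when the
register `y` runs through `0, …, reg x - 1`, and `ind e` is the indicator of `0 < e`. -/
inductive FExpr where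
  | lit (z : ℤ)
  | reg (x : ℕ)
  | get (a : ℕ) (e : FExpr)
  | add (e f : FExpr)
  | sub (e f : FExpr)
  | mul (e f : FExpr)
  | div (e f : FExpr)
  | ind (e : FExpr)
  | sum (y x : ℕ) (e : FExpr)

namespace FExpr

instance : Add FExpr := ⟨add⟩
instance : Sub FExpr := ⟨sub⟩
instance : Mul FExpr := ⟨mul⟩
instance : Div FExpr := ⟨div⟩

/-- The value of an expression. -/
def eval : FExpr → RamState → ℤ
  | lit z, _ => z
  | reg x, s => s.reg x
  | get a e, s => s.arr a (e.eval s).toNat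
  | add e f, s => e.eval s + f.eval s
  | sub e f, s => e.eval s - f.eval s
  | mul e f, s => e.eval s * f.eval s
  | div e f, s => e.eval s / f.eval s
  | ind e, s => if 0 < e.eval s then 1 else 0
  | sum y x e, s => ∑ i ∈ range (s.reg x).toNat, e.eval (s.setReg y i)

/-- Every sum in the expression has at most `R` terms. -/
def Ok (R : ℕ) : FExpr → RamState → Prop
  | lit _, _ | reg _, _ => True
  | get _ e, s => e.Ok R s
  | add e f, s | sub e f, s | mul e f, s | div e f, s => e.Ok R s ∧ f.Ok R s
  | ind e, s => e.Ok R s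
  | sum y x e, s => (s.reg x).toNat ≤ R ∧ ∀ i < (s.reg x).toNat, e.Ok R (s.setReg y i)

/-- All registers mentioned in the expression are below `K`. -/
def Below (K : ℕ) : FExpr → Prop
  | lit _ => True
  | reg x => x < K
  | get _ e => e.Below K
  | add e f | sub e f | mul e f | div e f => e.Below K ∧ f.Below K
  | ind e => e.Below K
  | sum y x e => y < K ∧ x < K ∧ e.Below K

/-- A measure of the size of an expression, which controls the bit length of its values. -/
def size : FExpr → ℕ
  | lit z => z.natAbs + 1
  | reg _ => 1
  | get _ e => e.size + 1
  | add e f | sub e f | mul e f | div e f => e.size + f.size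
  | ind e => e.size + 1
  | sum _ _ e => e.size + 1

/-- The code that computes the value of an expression in the register `k`, with scratch registers
above `k`. -/
def comp : FExpr → ℕ → RamProg
  | lit z, k => .set k (.lit z)
  | reg x, k => .set k (.reg x)
  | get a e, k => .seq (e.comp k) (.set k (.get a (.reg k)))
  | add e f, k => .seq (e.comp k) (.seq (f.comp (k + 1)) (.set k (.add (.reg k) (.reg (k + 1)))))
  | sub e f, k => .seq (e.comp k) (.seq (f.comp (k + 1)) (.set k (.sub (.reg k) (.reg (k + 1)))))
  | mul e f, k => .seq (e.comp k) (.seq (f.comp (k + 1)) (.set k (.mul (.reg k) (.reg (k + 1)))))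
  | div e f, k => .seq (e.comp k) (.seq (f.comp (k + 1)) (.set k (.div (.reg k) (.reg (k + 1)))))
  | ind e, k => .seq (e.comp k) (.ite (.reg k) (.set k (.lit 1)) (.set k (.lit 0)))
  | sum y x e, k =>
    .seq (.set (k + 1) (.reg x)) <| .seq (.set (k + 2) (.reg y)) <|
    .seq (.set k (.lit 0)) <| .seq (.set y (.lit 0)) <|
    .seq (.loop (.sub (.reg (k + 1)) (.reg y))
      (.seq (e.comp (k + 3)) (.seq (.set k (.add (.reg k) (.reg (k + 3))))
        (.set y (.add (.reg y) (.lit 1))))))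
      (.set y (.reg (k + 2)))

/-- A bound for the running time of a bounded number of elementary steps on the values of an
expression, when all numbers in the memory have at most `R` bits. -/
def unit (R σ : ℕ) : ℕ := 20 * ((R + 1) * σ + 3)

/-- A bound for the running time of the compiled expression. -/
def time (R : ℕ) : FExpr → ℕ
  | lit z => unit R (lit z).size
  | reg x => unit R (reg x).size
  | get a e => e.time R + unit R (get a e).size
  | add e f | sub e f | mul e f | div e f => e.time R + f.time R + unit R (add e f).size
  | ind e => e.time R + unit R (ind e).size
  | sum y x e => (R + 1) * (e.time R + unit R (sum y x e).size) + unit R (sum y x e).size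

end FExpr

namespace RamState

@[simp] theorem setReg_arr (s : RamState) (x : ℕ) (z : ℤ) : (s.setReg x z).arr = s.arr := rfl

@[simp] theorem setReg_self (s : RamState) (x : ℕ) (z : ℤ) : (s.setReg x z).reg x = z := by
  simp [setReg]

theorem setReg_reg (s : RamState) (x y : ℕ) (z : ℤ) :
    (s.setReg x z).reg y = if y = x then z else s.reg y := by
  simp [setReg, update_apply]

@[simp] theorem setReg_ne (s : RamState) {x y : ℕ} (h : y ≠ x) (z : ℤ) :
    (s.setReg x z).reg y = s.reg y := by
  simp [setReg_reg, h]

@[simp] theorem setArr_reg (s : RamState) (a i : ℕ) (z : ℤ) : (s.setArr a i z).reg = s.reg := rfl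

theorem setArr_arr (s : RamState) (a i : ℕ) (z : ℤ) (a' i' : ℕ) :
    (s.setArr a i z).arr a' i' = if a' = a ∧ i' = i then z else s.arr a' i' := by
  by_cases h : a' = a
  · subst h; by_cases h' : i' = i <;> simp [setArr, h']
  · simp [setArr, h]

@[simp] theorem setArr_arr_ne (s : RamState) {a a' : ℕ} (h : a' ≠ a) (i : ℕ) (z : ℤ) :
    (s.setArr a i z).arr a' = s.arr a' := by
  simp [setArr, h]

/-- The states agree on the arrays and on the registers below `K`. -/
structure Agree (K : ℕ) (s t : RamState) : Prop where
  reg : ∀ x < K, t.reg x = s.reg x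
  arr : t.arr = s.arr

theorem Agree.refl (K : ℕ) (s : RamState) : Agree K s s := ⟨fun _ _ => rfl, rfl⟩

theorem Agree.trans {K : ℕ} {s t u : RamState} (h : Agree K s t) (h' : Agree K t u) :
    Agree K s u := ⟨fun x hx => (h'.reg x hx).trans (h.reg x hx), h'.arr.trans h.arr⟩

theorem Agree.mono {K K' : ℕ} {s t : RamState} (h : Agree K s t) (hK : K' ≤ K) :
    Agree K' s t := ⟨fun x hx => h.reg x (hx.trans_le hK), h.arr⟩

theorem Agree.setReg {K : ℕ} {s t : RamState} (h : Agree K s t) (x : ℕ) (z : ℤ) :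
    Agree K (s.setReg x z) (t.setReg x z) :=
  ⟨fun y hy => by simp [setReg_reg, h.reg y hy], h.arr⟩

theorem Agree.setReg_right {K : ℕ} {s t : RamState} (h : Agree K s t) {x : ℕ} (hx : K ≤ x)
    (z : ℤ) : Agree K s (t.setReg x z) :=
  ⟨fun y hy => by rw [setReg_ne _ (by omega), h.reg y hy], h.arr⟩

theorem Agree.setArr {K : ℕ} {s t : RamState} (h : Agree K s t) (a i : ℕ) (z : ℤ) :
    Agree K (s.setArr a i z) (t.setArr a i z) :=
  ⟨fun y hy => by simp [h.reg y hy], by simp [RamState.setArr, h.arr]⟩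

/-- All numbers in the arrays and in the registers below `K` are at most `2 ^ R` in size. -/
structure Bdd (K R : ℕ) (s : RamState) : Prop where
  reg : ∀ x < K, |s.reg x| ≤ 2 ^ R
  arr : ∀ a i, |s.arr a i| ≤ 2 ^ R

theorem Bdd.setReg {K R : ℕ} {s : RamState} (h : Bdd K R s) {x : ℕ} {z : ℤ} (hz : |z| ≤ 2 ^ R) :
    Bdd K R (s.setReg x z) :=
  ⟨fun y hy => by
    rw [setReg_reg]; split_ifs
    · exact hz
    · exact h.reg y hy, h.arr⟩

theorem Bdd.setArr {K R : ℕ} {s : RamState} (h : Bdd K R s) {a i : ℕ} {z : ℤ}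
    (hz : |z| ≤ 2 ^ R) : Bdd K R (s.setArr a i z) :=
  ⟨h.reg, fun b j => by
    rw [setArr_arr]; split_ifs
    · exact hz
    · exact h.arr b j⟩

end RamState

theorem abs_natCast_le_two_pow {i R : ℕ} (h : i ≤ R) : |(i : ℤ)| ≤ 2 ^ R := by
  rw [abs_of_nonneg (by positivity)]
  exact_mod_cast h.trans Nat.lt_two_pow_self.le

theorem bitLen_le_of_abs_le {z : ℤ} {w : ℕ} (h : |z| ≤ 2 ^ w) : bitLen z ≤ w + 1 := by
  unfold bitLen
  rw [Nat.size_le, pow_succ]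
  have : (z.natAbs : ℤ) ≤ 2 ^ w := by rwa [Int.natCast_natAbs]
  have h2 : z.natAbs ≤ 2 ^ w := by exact_mod_cast this
  have := Nat.pow_pos (n := w) (show 0 < 2 by norm_num)
  omega

theorem abs_ediv_le_abs (a b : ℤ) : |a / b| ≤ |a| := by
  rw [Int.abs_eq_natAbs, Int.abs_eq_natAbs]
  exact_mod_cast Int.natAbs_ediv_le_natAbs a b

namespace FExpr
open RamState

theorem size_pos (e : FExpr) : 0 < e.size := by
  induction e <;> simp only [size] <;> omega

theorem abs_sum_le {R σ m : ℕ} (hm : m ≤ R) {f : ℕ → ℤ}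
    (hf : ∀ i < m, |f i| ≤ 2 ^ ((R + 1) * σ)) :
    |∑ i ∈ range m, f i| ≤ 2 ^ ((R + 1) * (σ + 1)) := by
  refine (abs_sum_le_sum_abs _ _).trans ((sum_le_card_nsmul _ _ _ fun i hi =>
    hf i (mem_range.1 hi)).trans ?_)
  rw [card_range, nsmul_eq_mul, mul_add, pow_add, mul_comm, mul_one]
  gcongr
  exact_mod_cast hm.trans (Nat.lt_two_pow_self.le.trans (Nat.pow_le_pow_right two_pos R.le_succ))

theorem abs_eval_le {K R : ℕ} {e : FExpr} (he : e.Below K) {s : RamState} (hs : Bdd K R s)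
    (ho : e.Ok R s) : |e.eval s| ≤ 2 ^ ((R + 1) * e.size) := by
  have hmul : ∀ {e f : FExpr} {x y : ℤ}, |x| ≤ 2 ^ ((R + 1) * e.size) →
      |y| ≤ 2 ^ ((R + 1) * f.size) → |x| * |y| ≤ 2 ^ ((R + 1) * (e.size + f.size)) := by
    intro e f x y hx hy
    rw [mul_add, pow_add]
    exact mul_le_mul hx hy (abs_nonneg _) (by positivity)
  have hadd : ∀ {e f : FExpr} {x y : ℤ}, |x| ≤ 2 ^ ((R + 1) * e.size) →
      |y| ≤ 2 ^ ((R + 1) * f.size) → |x| + |y| ≤ 2 ^ ((R + 1) * (e.size + f.size)) := by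
    intro e f x y hx hy
    have h2 : ∀ e : FExpr, (2 : ℤ) ≤ 2 ^ ((R + 1) * e.size) := fun e => by
      have : 1 ≤ (R + 1) * e.size := Nat.mul_pos (by omega) e.size_pos
      calc (2 : ℤ) = 2 ^ 1 := by norm_num
        _ ≤ _ := pow_le_pow_right₀ (by norm_num) this
    rw [mul_add, pow_add]
    nlinarith [h2 e, h2 f]
  induction e generalizing s with
  | lit z =>
    simp only [eval, size]
    have : |z| ≤ 2 ^ z.natAbs := by
      rw [Int.abs_eq_natAbs]; exact_mod_cast Nat.lt_two_pow_self.le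
    refine this.trans (pow_le_pow_right₀ (by norm_num) ?_)
    nlinarith [Nat.zero_le (R * (z.natAbs + 1))]
  | reg x =>
    simp only [eval, size]
    exact (hs.reg x he).trans (pow_le_pow_right₀ (by norm_num) (by omega))
  | get a e ih =>
    simp only [eval, size]
    refine (hs.arr _ _).trans (pow_le_pow_right₀ (by norm_num) ?_)
    nlinarith [Nat.zero_le ((R + 1) * e.size)]
  | add e f ihe ihf =>
    exact (abs_add_le _ _).trans (hadd (ihe he.1 hs ho.1) (ihf he.2 hs ho.2))
  | sub e f ihe ihf =>
    exact (abs_sub _ _).trans (hadd (ihe he.1 hs ho.1) (ihf he.2 hs ho.2))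
  | mul e f ihe ihf =>
    simp only [eval, abs_mul]
    exact hmul (ihe he.1 hs ho.1) (ihf he.2 hs ho.2)
  | div e f ihe ihf =>
    refine (abs_ediv_le_abs _ _).trans ((ihe he.1 hs ho.1).trans
      (pow_le_pow_right₀ (by norm_num) ?_))
    simp only [size]; gcongr; omega
  | ind e ih =>
    have : (1 : ℤ) ≤ 2 ^ ((R + 1) * (ind e).size) := one_le_pow₀ (by norm_num)
    simp only [eval]; split_ifs <;> simp [this]
  | sum y x e ih =>
    exact abs_sum_le ho.1 fun i hi =>
      ih he.2.2 (hs.setReg (abs_natCast_le_two_pow (hi.le.trans ho.1))) (ho.2 i hi)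

theorem abs_sum_range_le {K R y x : ℕ} {e : FExpr} (he : e.Below K) {s : RamState}
    (hs : Bdd K R s) (ho : (sum y x e).Ok R s) {m : ℕ} (hm : m ≤ (s.reg x).toNat) :
    |∑ i ∈ range m, e.eval (s.setReg y i)| ≤ 2 ^ ((R + 1) * (sum y x e).size) :=
  abs_sum_le (hm.trans ho.1) fun i hi => abs_eval_le he
    (hs.setReg (abs_natCast_le_two_pow (hi.le.trans (hm.trans ho.1)))) (ho.2 i (hi.trans_le hm))

end FExpr

/-- A loop whose test fails exactly after `m` rounds. -/
theorem RamRuns.exists_loop {e : RamExpr} {p : RamProg} (I : ℕ → RamState → Prop) (m c : ℕ)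
    (hstep : ∀ i < m, ∀ t, I i t → 0 < e.eval t ∧
      ∃ τ t', RamRuns p t τ t' ∧ 1 + e.cost t + τ ≤ c ∧ I (i + 1) t')
    (hend : ∀ t, I m t → ¬ 0 < e.eval t ∧ 1 + e.cost t ≤ c) (t : RamState) (h0 : I 0 t) :
    ∃ τ t', RamRuns (.loop e p) t τ t' ∧ τ ≤ (m + 1) * c ∧ I m t' := by
  have key : ∀ j i, i + j = m → ∀ t, I i t →
      ∃ τ t', RamRuns (.loop e p) t τ t' ∧ τ ≤ (j + 1) * c ∧ I m t' := by
    intro j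
    induction j with
    | zero =>
      intro i hi t ht
      obtain rfl : i = m := by omega
      exact ⟨_, t, .loop_neg (hend t ht).1, by simpa using (hend t ht).2, ht⟩
    | succ j ih =>
      intro i hi t ht
      obtain ⟨hpos, τ, t', hrun, hτ, hI⟩ := hstep i (by omega) t ht
      obtain ⟨τ', t'', hrun', hτ', hI'⟩ := ih (i + 1) (by omega) t' hI
      refine ⟨_, t'', .loop_pos hpos hrun hrun', ?_, hI'⟩
      calc _ ≤ c + (j + 1) * c := by omega
        _ = _ := by ring
  exact key m 0 (by omega) t h0

namespace FExpr
open RamState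

theorem size_le_size_sum (y x : ℕ) (e : FExpr) : e.size ≤ (sum y x e).size := by simp [size]

theorem two_pow_mono_size {R a b : ℕ} (h : a ≤ b) {z : ℤ} (hz : |z| ≤ 2 ^ ((R + 1) * a)) :
    bitLen z ≤ (R + 1) * b + 1 :=
  (bitLen_le_of_abs_le hz).trans (by gcongr)

theorem comp_spec {K R : ℕ} {e : FExpr} (he : e.Below K) {k : ℕ} (hk : K ≤ k) {s t : RamState}
    (h : Agree K s t) (hs : Bdd K R s) (ho : e.Ok R s) :
    ∃ τ t', RamRuns (e.comp k) t τ t' ∧ τ ≤ e.time R ∧ Agree k t t' ∧ t'.reg k = e.eval s := by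
  have hval : ∀ {e : FExpr} {s : RamState} (b : ℕ), e.Below K → Bdd K R s → e.Ok R s →
      e.size ≤ b → bitLen (e.eval s) ≤ (R + 1) * b + 1 :=
    fun b he hs ho hb => two_pow_mono_size hb (abs_eval_le he hs ho)
  induction e generalizing k s t with
  | lit z =>
    refine ⟨_, _, .set _ _ _, ?_, (Agree.refl k t).setReg_right le_rfl _,
      by simp [RamExpr.eval, eval]⟩
    have := hval _ he hs ho le_rfl
    simp only [eval] at this
    simp only [RamExpr.cost, time, unit]; omega
  | reg x =>
    refine ⟨_, _, .set _ _ _, ?_, (Agree.refl k t).setReg_right le_rfl _,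
      by simp [RamExpr.eval, eval, h.reg x he]⟩
    have := hval _ he hs ho le_rfl
    simp only [eval, ← h.reg x he] at this
    simp only [RamExpr.cost, time, unit]; omega
  | get a e ih =>
    obtain ⟨τ, t', hr, hτ, ha, hv⟩ := ih he hk h hs ho
    refine ⟨_, _, .seq hr (.set _ _ _), ?_, ha.trans ((Agree.refl k t').setReg_right le_rfl _), ?_⟩
    · have h1 := hval (get a e).size he hs ho le_rfl
      have h2 := hval (e := e) (get a e).size he hs ho (by simp [size])
      simp only [eval] at h1
      simp only [RamExpr.cost, RamExpr.eval, time, unit, hv, ha.arr, h.arr]; omega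
    · simp [RamExpr.eval, hv, eval, ha.arr, h.arr]
  | add e f ihe ihf | sub e f ihe ihf | mul e f ihe ihf | div e f ihe ihf =>
    obtain ⟨τ, t', hr, hτ, ha, hv⟩ := ihe he.1 hk h hs ho.1
    obtain ⟨τ', t'', hr', hτ', ha', hv'⟩ := ihf (k := k + 1) he.2 (by omega)
      (h.trans (ha.mono hk)) hs ho.2
    have hvk : t''.reg k = e.eval s := by rw [ha'.reg k (by omega), hv]
    refine ⟨_, _, .seq hr (.seq hr' (.set _ _ _)), ?_,
      ha.trans ((ha'.mono (by omega)).setReg_right le_rfl _), ?_⟩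
    · have h1 := hval (add e f).size he.1 hs ho.1 (by simp [size])
      have h2 := hval (add e f).size he.2 hs ho.2 (by simp [size])
      have h3 := hval (add e f).size he hs ho (by simp [size])
      simp only [eval] at h3
      simp only [RamExpr.cost, RamExpr.eval, time, unit, hvk, hv']; omega
    · simp [RamExpr.eval, hvk, hv', eval]
  | ind e ih =>
    obtain ⟨τ, t', hr, hτ, ha, hv⟩ := ih he hk h hs ho
    have h2 := hval (e := e) (ind e).size he hs ho (by simp [size])
    by_cases hp : 0 < e.eval s
    · refine ⟨_, _, .seq hr (.ite_pos (by simpa [RamExpr.eval, hv] using hp) (.set _ _ _)), ?_,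
        ha.trans ((Agree.refl k t').setReg_right le_rfl _), by simp [RamExpr.eval, eval, hp]⟩
      have : bitLen 1 ≤ 1 := by decide
      simp only [RamExpr.cost, time, unit, hv]; omega
    · refine ⟨_, _, .seq hr (.ite_neg (by simpa [RamExpr.eval, hv] using hp) (.set _ _ _)), ?_,
        ha.trans ((Agree.refl k t').setReg_right le_rfl _), by simp [RamExpr.eval, eval, hp]⟩
      have : bitLen 0 ≤ 1 := by decide
      simp only [RamExpr.cost, time, unit, hv]; omega
  | sum y x e ih =>
    obtain ⟨hy, hx, he⟩ := he
    set σ := (sum y x e).size with hσ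
    set m := (s.reg x).toNat with hm
    have hbit : ∀ {z : ℤ}, |z| ≤ 2 ^ R → bitLen z ≤ (R + 1) * σ + 1 := fun hz =>
      (bitLen_le_of_abs_le hz).trans (by
        have : 1 ≤ σ := size_pos _
        nlinarith)
    have hrx := hbit (hs.reg x hx)
    have hry := hbit (hs.reg y hy)
    have hmR : m ≤ R := ho.1
    set t1 := (((t.setReg (k + 1) (t.reg x)).setReg (k + 2) (t.reg y)).setReg k 0).setReg y 0
      with ht1
    -- the invariant of the summation loop
    let I : ℕ → RamState → Prop := fun i u =>
      Agree K (s.setReg y i) u ∧ (∀ z, K ≤ z → z < k → u.reg z = t.reg z) ∧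
      u.reg (k + 1) = s.reg x ∧ u.reg (k + 2) = s.reg y ∧
      u.reg k = ∑ j ∈ range i, e.eval (s.setReg y j)
    have hloop := RamRuns.exists_loop (e := .sub (.reg (k + 1)) (.reg y))
      (p := .seq (e.comp (k + 3)) (.seq (.set k (.add (.reg k) (.reg (k + 3))))
        (.set y (.add (.reg y) (.lit 1))))) I m (e.time R + unit R σ) ?_ ?_ t1 ?_
    · obtain ⟨τ, t2, hr, hτ, hI⟩ := hloop
      obtain ⟨hA, hf, h1, h2, h3⟩ := hI
      have hlast : RamRuns (.set y (.reg (k + 2))) t2 (1 + RamExpr.cost t2 (.reg (k + 2)))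
          (t2.setReg y (s.reg y)) := by
        have : RamRuns (.set y (.reg (k + 2))) t2 _ _ := .set _ _ _
        rwa [show RamExpr.eval t2 (.reg (k + 2)) = s.reg y from h2] at this
      have ht1' : t1 = (((t.setReg (k + 1) (t.reg x)).setReg (k + 2)
          ((t.setReg (k + 1) (t.reg x)).reg y)).setReg k 0).setReg y 0 := by
        rw [setReg_ne _ (show y ≠ k + 1 by omega)]
      rw [ht1'] at hr
      refine ⟨_, _, .seq (.set _ _ _) (.seq (.set _ _ _) (.seq (.set _ _ _)
        (.seq (.set _ _ _) (.seq hr hlast)))), ?_, ⟨fun z hz => ?_, ?_⟩, ?_⟩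
      · have hτ2 : τ ≤ (R + 1) * (e.time R + unit R σ) := hτ.trans (by gcongr)
        have : bitLen 0 ≤ 1 := by decide
        simp only [RamExpr.cost, time, ← hσ]
        rw [setReg_ne _ (show y ≠ k + 1 by omega), h2, h.reg x hx, h.reg y hy]
        have hu : unit R σ = 20 * ((R + 1) * σ + 3) := rfl
        omega
      · by_cases hzy : z = y
        · subst hzy; simp [h.reg z hy]
        · rw [setReg_ne _ hzy]
          by_cases hzK : z < K
          · rw [hA.reg z hzK, setReg_ne _ hzy, h.reg z hzK]
          · exact hf z (by omega) hz
      · rw [setReg_arr, hA.arr, setReg_arr, h.arr]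
      · rw [setReg_ne _ (by omega), h3, eval]
    · intro i hi u hI
      obtain ⟨hA, hf, h1, h2, h3⟩ := hI
      have huy : u.reg y = i := by rw [hA.reg y hy]; simp
      have hbi : |(i : ℤ)| ≤ 2 ^ R := abs_natCast_le_two_pow (by omega)
      have hbi1 : |((i : ℤ) + 1)| ≤ 2 ^ R := by
        have := abs_natCast_le_two_pow (i := i + 1) (R := R) (by omega)
        simpa using this
      obtain ⟨τ, u', hr, hτ, ha, hv⟩ := ih (k := k + 3) he (by omega) hA
        (hs.setReg hbi) (ho.2 i hi)
      have e1 : u'.reg k = ∑ j ∈ range i, e.eval (s.setReg y j) := by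
        rw [ha.reg k (by omega), h3]
      have e2 : u'.reg y = i := by rw [ha.reg y (by omega), huy]
      have hpos : (i : ℤ) < s.reg x := by omega
      refine ⟨by simp only [RamExpr.eval, h1, huy]; omega, _, _,
        .seq hr (.seq (.set _ _ _) (.set _ _ _)), ?_, ⟨fun z hz => ?_, ?_⟩, fun z hz hzk => ?_,
        ?_, ?_, ?_⟩
      · have b1 := two_pow_mono_size (le_refl σ)
          (abs_sum_range_le he hs (y := y) (x := x) ho (m := i) hi.le)
        have b2 := two_pow_mono_size (le_refl σ)
          (abs_sum_range_le he hs (y := y) (x := x) ho (m := i + 1) hi)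
        have b3 := hval σ he (hs.setReg hbi) (ho.2 i hi) (size_le_size_sum y x e)
        rw [sum_range_succ] at b2
        have b4 := hbit hbi
        have b5 := hbit hbi1
        have b6 : bitLen (s.reg x - i) ≤ (R + 1) * σ + 1 := by
          refine hbit (le_trans ?_ (hs.reg x hx))
          rw [abs_of_nonneg (by omega), abs_of_nonneg (by omega)]; omega
        have b7 : bitLen 1 ≤ 1 := by decide
        have hyk : y ≠ k := by omega
        simp only [RamExpr.cost, RamExpr.eval, h1, huy, hv, e1, setReg_ne _ hyk, e2]
        have hu : unit R σ = 20 * ((R + 1) * σ + 3) := rfl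
        omega
      · simp only [RamExpr.eval, setReg_reg, e2, if_neg (show y ≠ k by omega)]
        split_ifs with hzy
        · push_cast; ring
        · omega
        · rw [ha.reg z (by omega), hA.reg z hz, setReg_ne _ hzy]
      · simp only [setReg_arr, ha.arr, hA.arr]
      · rw [setReg_ne _ (by omega), setReg_ne _ (by omega), ha.reg z (by omega), hf z hz hzk]
      · rw [setReg_ne _ (by omega), setReg_ne _ (by omega), ha.reg _ (by omega), h1]
      · rw [setReg_ne _ (by omega), setReg_ne _ (by omega), ha.reg _ (by omega), h2]
      · rw [setReg_ne _ (by omega), setReg_self]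
        simp only [RamExpr.eval, e1, hv, sum_range_succ]
    · rintro u ⟨hA, hf, h1, h2, h3⟩
      have huy : u.reg y = m := by rw [hA.reg y hy]; simp
      have hbi := hbit (abs_natCast_le_two_pow (i := m) (R := R) (by omega))
      have b6 : bitLen (s.reg x - m) ≤ (R + 1) * σ + 1 := by
        refine hbit ((hs.reg x hx).trans' ?_)
        rw [hm]
        rcases le_total 0 (s.reg x) with hx0 | hx0
        · rw [Int.toNat_of_nonneg hx0]; simp
        · rw [Int.toNat_of_nonpos hx0]; simp
      simp only [RamExpr.eval, RamExpr.cost, h1, huy]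
      refine ⟨by omega, ?_⟩
      have hu : unit R σ = 20 * ((R + 1) * σ + 3) := rfl
      omega
    · refine ⟨⟨fun z hz => ?_, ?_⟩, fun z hz hzk => ?_, ?_, ?_, ?_⟩
      · simp only [ht1, setReg_reg, if_neg (show z ≠ k by omega),
          if_neg (show z ≠ k + 1 by omega), if_neg (show z ≠ k + 2 by omega)]
        split_ifs
        · simp
        · exact h.reg z hz
      · simp [ht1, h.arr]
      · simp only [ht1]
        rw [setReg_ne _ (by omega), setReg_ne _ (by omega), setReg_ne _ (by omega),
          setReg_ne _ (by omega)]
      · simp only [ht1]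
        rw [setReg_ne _ (by omega), setReg_ne _ (by omega), setReg_ne _ (by omega),
          setReg_self, h.reg x hx]
      · simp only [ht1]
        rw [setReg_ne _ (by omega), setReg_ne _ (by omega), setReg_self, h.reg y hy]
      · simp only [ht1]
        rw [setReg_ne _ (by omega), setReg_self, sum_range_zero]

end FExpr

/-- For-programs: `bits x e` assigns to `x` the bit length of the value of `e` (which should be
nonnegative), and `forTo y x p` runs `p` for `y = 0, …, reg x - 1`, where the number of rounds
is determined at the start. -/
inductive FProg where
  | set (x : ℕ) (e : FExpr)
  | put (a : ℕ) (i e : FExpr)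
  | bits (x : ℕ) (e : FExpr)
  | seq (p q : FProg)
  | ite (e : FExpr) (p q : FProg)
  | forTo (y x : ℕ) (p : FProg)

namespace FProg
open RamState

/-- The memory after the first `i` rounds of a for-loop with index register `y`. -/
def rounds (y : ℕ) (f : RamState → RamState) (s : RamState) : ℕ → RamState
  | 0 => s
  | i + 1 => f ((rounds y f s i).setReg y i)

/-- The memory after the execution of a for-program. -/
def exec : FProg → RamState → RamState
  | set x e => fun s => s.setReg x (e.eval s)
  | put a i e => fun s => s.setArr a (i.eval s).toNat (e.eval s)
  | bits x e => fun s => s.setReg x (Nat.size (e.eval s).toNat)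
  | seq p q => fun s => q.exec (p.exec s)
  | ite e p q => fun s => if 0 < e.eval s then p.exec s else q.exec s
  | forTo y x p => fun s => rounds y p.exec s (s.reg x).toNat

/-- Along the execution, all assigned values are at most `2 ^ R` in size, and the loops and sums
have at most `R` rounds. -/
def Ok (R : ℕ) : FProg → RamState → Prop
  | set _ e | bits _ e => fun s => e.Ok R s ∧ |e.eval s| ≤ 2 ^ R
  | put _ i e => fun s => i.Ok R s ∧ e.Ok R s ∧ |e.eval s| ≤ 2 ^ R
  | seq p q => fun s => p.Ok R s ∧ q.Ok R (p.exec s)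
  | ite e p q => fun s => e.Ok R s ∧ if 0 < e.eval s then p.Ok R s else q.Ok R s
  | forTo y x p => fun s => (s.reg x).toNat ≤ R ∧
      ∀ i < (s.reg x).toNat, p.Ok R ((rounds y p.exec s i).setReg y i)

/-- All registers mentioned in the program are below `K`. -/
def Below (K : ℕ) : FProg → Prop
  | set x e | bits x e => x < K ∧ e.Below K
  | put _ i e => i.Below K ∧ e.Below K
  | seq p q => p.Below K ∧ q.Below K
  | ite e p q => e.Below K ∧ p.Below K ∧ q.Below K
  | forTo y x p => y < K ∧ x < K ∧ p.Below K

/-- The compiled program, with scratch registers from `k` on. -/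
def comp : FProg → ℕ → RamProg
  | set x e, k => .seq (e.comp k) (.set x (.reg k))
  | put a i e, k => .seq (i.comp k) (.seq (e.comp (k + 1)) (.put a (.reg k) (.reg (k + 1))))
  | bits x e, k => .seq (e.comp k) (.seq (.set x (.lit 0)) (.loop (.reg k)
      (.seq (.set k (.div (.reg k) (.lit 2))) (.set x (.add (.reg x) (.lit 1))))))
  | seq p q, k => .seq (p.comp k) (q.comp k)
  | ite e p q, k => .seq (e.comp k) (.ite (.reg k) (p.comp k) (q.comp k))
  | forTo y x p, k => .seq (.set k (.reg x)) (.seq (.set (k + 1) (.lit 0))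
      (.loop (.sub (.reg k) (.reg (k + 1)))
        (.seq (.set y (.reg (k + 1))) (.seq (p.comp (k + 2))
          (.set (k + 1) (.add (.reg (k + 1)) (.lit 1)))))))

/-- A bound for the running time of the compiled program. -/
def time (R : ℕ) : FProg → ℕ
  | set _ e => e.time R + FExpr.unit R e.size
  | put _ i e => i.time R + e.time R + FExpr.unit R (i.size + e.size)
  | bits _ e => e.time R + (R + 3) * FExpr.unit R e.size
  | seq p q => p.time R + q.time R
  | ite e p q => e.time R + p.time R + q.time R + FExpr.unit R e.size
  | forTo _ _ p => (R + 1) * (p.time R + FExpr.unit R 1) + FExpr.unit R 1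

/-- The compiled program simulates the for-program, up to the scratch registers. -/
theorem comp_spec {K R : ℕ} {p : FProg} (hp : p.Below K) {k : ℕ} (hk : K ≤ k) {s t : RamState}
    (h : Agree K s t) (hs : Bdd K R s) (ho : p.Ok R s) :
    ∃ τ t', RamRuns (p.comp k) t τ t' ∧ τ ≤ p.time R ∧ Agree K (p.exec s) t' ∧
      (∀ x, K ≤ x → x < k → t'.reg x = t.reg x) ∧ Bdd K R (p.exec s) := by
  have hval : ∀ {e : FExpr} {s : RamState} (b : ℕ), e.Below K → Bdd K R s → e.Ok R s →
      e.size ≤ b → bitLen (e.eval s) ≤ (R + 1) * b + 1 :=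
    fun b he hs ho hb => FExpr.two_pow_mono_size hb (FExpr.abs_eval_le he hs ho)
  have b0 : bitLen 0 = 0 := by decide
  have b1 : bitLen 1 = 1 := by decide
  have b2 : bitLen 2 = 2 := by decide
  induction p generalizing k s t with
  | set x e =>
    obtain ⟨τ, t', hr, hτ, ha, hv⟩ := FExpr.comp_spec hp.2 hk h hs ho.1
    have hb := hval e.size hp.2 hs ho.1 le_rfl
    refine ⟨_, _, .seq hr (.set _ _ _), ?_, ?_, fun z hz hzk => ?_, hs.setReg ho.2⟩
    · simp only [RamExpr.cost, time, FExpr.unit, hv]; omega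
    · simp only [RamExpr.eval, hv]
      exact (h.trans (ha.mono hk)).setReg x _
    · rw [setReg_ne _ (by have := hp.1; omega), ha.reg z hzk]
  | put a i e =>
    obtain ⟨τ, t', hr, hτ, ha, hv⟩ := FExpr.comp_spec hp.1 hk h hs ho.1
    obtain ⟨τ', t'', hr', hτ', ha', hv'⟩ := FExpr.comp_spec (k := k + 1) hp.2 (by omega)
      (h.trans (ha.mono hk)) hs ho.2.1
    have hvk : t''.reg k = i.eval s := by rw [ha'.reg k (by omega), hv]
    have hb := hval (i.size + e.size) hp.1 hs ho.1 (by omega)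
    have hb' := hval (i.size + e.size) hp.2 hs ho.2.1 (by omega)
    refine ⟨_, _, .seq hr (.seq hr' (.put _ _ _ _)), ?_, ?_, fun z hz hzk => ?_, hs.setArr ho.2.2⟩
    · simp only [RamExpr.cost, time, FExpr.unit, hv', hvk]; omega
    · simp only [RamExpr.eval, hvk, hv']
      exact ((h.trans (ha.mono hk)).trans (ha'.mono (by omega))).setArr a _ _
    · rw [setArr_reg, ha'.reg z (by omega), ha.reg z hzk]
  | bits x e =>
    obtain ⟨τ, t', hr, hτ, ha, hv⟩ := FExpr.comp_spec hp.2 hk h hs ho.1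
    have hb := hval e.size hp.2 hs ho.1 le_rfl
    have hxK := hp.1
    obtain ⟨v, hv0⟩ : ∃ v, v = e.eval s := ⟨_, rfl⟩
    rw [← hv0] at hv hb
    have hvR : |v| ≤ 2 ^ R := hv0 ▸ ho.2
    set m := v.toNat with hm
    have hmv : (m : ℤ) ≤ |v| := by
      rw [hm, Int.ofNat_toNat]
      exact max_le (le_abs_self v) (abs_nonneg v)
    have hmR : Nat.size m ≤ R + 1 := by
      rw [Nat.size_le, pow_succ]
      have h2 : m ≤ 2 ^ R := by exact_mod_cast hmv.trans hvR
      have := Nat.pow_pos (n := R) (show 0 < 2 by norm_num)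
      omega
    have hszR : ∀ i ≤ Nat.size m, bitLen (i : ℤ) ≤ R + 2 := fun i hi =>
      bitLen_le_of_abs_le (abs_natCast_le_two_pow (by omega))
    have hbv : ∀ w z : ℤ, bitLen (w / z) ≤ bitLen w := fun w z =>
      Nat.size_le_size (Int.natAbs_ediv_le_natAbs w z)
    have hpos : ∀ i, 0 < v / 2 ^ i ↔ i < Nat.size m := fun i => by
      have h1 : ((2 ^ i : ℕ) : ℤ) = 2 ^ i := by push_cast; rfl
      have := Nat.pow_pos (n := i) two_pos
      rw [Nat.lt_size, ← Int.add_one_le_iff, zero_add, Int.le_ediv_iff_mul_le (by positivity), ← h1]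
      omega
    have hu : FExpr.unit R e.size = 20 * ((R + 1) * e.size + 3) := rfl
    -- the loop halves the number until it vanishes
    let I : ℕ → RamState → Prop := fun i u =>
      Agree K (s.setReg x i) u ∧ (∀ z, K ≤ z → z < k → u.reg z = t.reg z) ∧ u.reg k = v / 2 ^ i
    have hloop := RamRuns.exists_loop (e := .reg k)
      (p := .seq (.set k (.div (.reg k) (.lit 2))) (.set x (.add (.reg x) (.lit 1)))) I
      (Nat.size m) (FExpr.unit R e.size) ?_ ?_ (t'.setReg x 0) ?_
    · obtain ⟨τ', t'', hr', hτ', hA, hf, -⟩ := hloop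
      refine ⟨_, _, .seq hr (.seq (.set _ _ _) hr'), ?_, by subst hv0; exact hA, hf, hs.setReg ?_⟩
      · simp only [RamExpr.cost, time, b0]
        have h2 : τ' ≤ (R + 2) * FExpr.unit R e.size :=
          hτ'.trans (Nat.mul_le_mul_right _ (by omega))
        rw [show (R + 3) * FExpr.unit R e.size
          = (R + 2) * FExpr.unit R e.size + FExpr.unit R e.size by ring]
        omega
      · rw [← hv0, Nat.abs_cast]
        exact (Nat.cast_le.2 (Nat.size_le.2 Nat.lt_two_pow_self)).trans (hmv.trans hvR)
    · rintro i hi u ⟨hA, hf, hk'⟩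
      have hux : u.reg x = i := by rw [hA.reg x hxK]; simp
      refine ⟨by simpa only [RamExpr.eval, hk', hpos] using hi, _, _,
        .seq (.set _ _ _) (.set _ _ _), ?_, ⟨fun z hz => ?_, ?_⟩, fun z hz hzk => ?_, ?_⟩
      · simp only [RamExpr.cost, RamExpr.eval]
        rw [setReg_ne _ (by omega : x ≠ k), hux, hk']
        have h3 := hbv v (2 ^ i)
        have h6 := hbv (v / 2 ^ i) 2
        have h4 := hszR i hi.le
        have h5 := hszR (i + 1) hi
        push_cast at h5
        have h7 : R + 1 ≤ (R + 1) * e.size := Nat.le_mul_of_pos_right _ e.size_pos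
        omega
      · simp only [RamExpr.eval, setReg_reg, hux, if_neg (show x ≠ k by omega)]
        split_ifs with hzx
        · push_cast; ring
        · omega
        · rw [hA.reg z hz, setReg_ne _ hzx]
      · simp [hA.arr]
      · rw [setReg_ne _ (by omega), setReg_ne _ (by omega), hf z hz hzk]
      · rw [setReg_ne _ (by omega), setReg_self, pow_succ,
          ← Int.ediv_ediv_of_nonneg (by positivity)]
        simp only [RamExpr.eval, hk']
    · rintro u ⟨hA, hf, hk'⟩
      refine ⟨by simp [RamExpr.eval, hk', hpos], ?_⟩
      have := hbv v (2 ^ Nat.size m)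
      simp only [RamExpr.cost, hk']
      omega
    · refine ⟨by simpa using (h.trans (ha.mono hk)).setReg x 0, fun z hz hzk => ?_, ?_⟩
      · rw [setReg_ne _ (by omega), ha.reg z hzk]
      · rw [setReg_ne _ (by omega), hv]; simp
  | seq p q ihp ihq =>
    obtain ⟨τ, t', hr, hτ, ha, hf, hB⟩ := ihp hp.1 hk h hs ho.1
    obtain ⟨τ', t'', hr', hτ', ha', hf', hB'⟩ := ihq hp.2 hk ha hB ho.2
    exact ⟨_, _, .seq hr hr', by simp only [time]; omega, ha',
      fun x hx hxk => (hf' x hx hxk).trans (hf x hx hxk), hB'⟩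
  | ite e p q ihp ihq =>
    obtain ⟨τ, t', hr, hτ, ha, hv⟩ := FExpr.comp_spec hp.1 hk h hs ho.1
    have hb := hval e.size hp.1 hs ho.1 le_rfl
    have ho2 := ho.2
    by_cases hpos : 0 < e.eval s
    · rw [if_pos hpos] at ho2
      obtain ⟨τ', t'', hr', hτ', ha', hf', hB'⟩ := ihp hp.2.1 hk (h.trans (ha.mono hk)) hs ho2
      refine ⟨_, _, .seq hr (.ite_pos (by simpa [RamExpr.eval, hv] using hpos) hr'), ?_,
        by simpa [exec, hpos] using ha', fun x hx hxk => (hf' x hx hxk).trans (ha.reg x hxk),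
        by simpa [exec, hpos] using hB'⟩
      simp only [RamExpr.cost, time, FExpr.unit, hv]; omega
    · rw [if_neg hpos] at ho2
      obtain ⟨τ', t'', hr', hτ', ha', hf', hB'⟩ := ihq hp.2.2 hk (h.trans (ha.mono hk)) hs ho2
      refine ⟨_, _, .seq hr (.ite_neg (by simpa [RamExpr.eval, hv] using hpos) hr'), ?_,
        by simpa [exec, hpos] using ha', fun x hx hxk => (hf' x hx hxk).trans (ha.reg x hxk),
        by simpa [exec, hpos] using hB'⟩
      simp only [RamExpr.cost, time, FExpr.unit, hv]; omega
  | forTo y x p ih =>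
    obtain ⟨hy, hx, hp⟩ := hp
    set m := (s.reg x).toNat with hm
    have hmR : m ≤ R := ho.1
    have hbx : bitLen (s.reg x) ≤ R + 1 := bitLen_le_of_abs_le (hs.reg x hx)
    have hbi : ∀ i ≤ m, bitLen (i : ℤ) ≤ R + 1 := fun i hi =>
      bitLen_le_of_abs_le (abs_natCast_le_two_pow (by omega))
    have hbs : ∀ i ≤ m, bitLen (s.reg x - i) ≤ R + 1 := fun i hi => by
      refine bitLen_le_of_abs_le ((hs.reg x hx).trans' ?_)
      rcases le_total 0 (s.reg x) with h0 | h0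
      · rw [abs_of_nonneg (by omega), abs_of_nonneg h0]; omega
      · have : i = 0 := by omega
        simp [this]
    have hu : FExpr.unit R 1 = 20 * ((R + 1) + 3) := by simp [FExpr.unit]
    let I : ℕ → RamState → Prop := fun i u =>
      Agree K (rounds y p.exec s i) u ∧ (∀ z, K ≤ z → z < k → u.reg z = t.reg z) ∧
      u.reg k = s.reg x ∧ u.reg (k + 1) = i ∧ Bdd K R (rounds y p.exec s i)
    have hloop := RamRuns.exists_loop
      (e := .sub (.reg k) (.reg (k + 1)))
      (p := .seq (.set y (.reg (k + 1))) (.seq (p.comp (k + 2))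
          (.set (k + 1) (.add (.reg (k + 1)) (.lit 1))))) I m (p.time R + FExpr.unit R 1) ?_ ?_
      ((t.setReg k (t.reg x)).setReg (k + 1) 0) ?_
    · obtain ⟨τ', t'', hr', hτ', hA, hf, -, -, hB⟩ := hloop
      refine ⟨_, _, .seq (.set _ _ _) (.seq (.set _ _ _) hr'), ?_, hA, hf, hB⟩
      have : τ' ≤ (R + 1) * (p.time R + FExpr.unit R 1) := hτ'.trans (by gcongr)
      simp only [RamExpr.cost, time, b0, h.reg x hx]
      omega
    · rintro i hi u ⟨hA, hf, h1, h2, hB⟩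
      obtain ⟨τ, u', hr, hτ, ha, hfr, hB'⟩ := ih (k := k + 2) (t := u.setReg y i) hp (by omega)
        (hA.setReg y i) (hB.setReg (abs_natCast_le_two_pow (by omega))) (ho.2 i hi)
      have hk1 : u'.reg (k + 1) = i := by
        rw [hfr _ (by omega) (by omega), setReg_ne _ (by omega), h2]
      have hset : RamRuns (.set y (.reg (k + 1))) u (1 + RamExpr.cost u (.reg (k + 1)))
          (u.setReg y i) := by
        have : RamRuns (.set y (.reg (k + 1))) u _ _ := .set _ _ _
        rwa [show RamExpr.eval u (.reg (k + 1)) = i from h2] at this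
      refine ⟨?_, _, _, .seq hset (.seq hr (.set _ _ _)), ?_, ha.setReg_right (by omega) _,
        fun z hz hzk => ?_, ?_, ?_, hB'⟩
      · simp only [RamExpr.eval, h1, h2]; omega
      · have e1 := hbi i hi.le
        have e2 := hbi (i + 1) hi
        have e3 := hbs i hi.le
        push_cast at e2
        simp only [RamExpr.cost, RamExpr.eval, h1, h2, hk1, b1]
        omega
      · rw [setReg_ne _ (by omega), hfr z hz (by omega), setReg_ne _ (by omega), hf z hz hzk]
      · rw [setReg_ne _ (by omega), hfr _ (by omega) (by omega), setReg_ne _ (by omega), h1]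
      · rw [setReg_self]; simp [RamExpr.eval, hk1]
    · rintro u ⟨hA, hf, h1, h2, hB⟩
      simp only [RamExpr.eval, RamExpr.cost, h1, h2]
      have e1 := hbi m le_rfl
      have e3 := hbs m le_rfl
      exact ⟨by omega, by omega⟩
    · refine ⟨(h.setReg_right hk _).setReg_right (by omega) _, fun z hz hzk => ?_, ?_, ?_, hs⟩
      · rw [setReg_ne _ (by omega), setReg_ne _ (by omega)]
      · rw [setReg_ne _ (by omega), setReg_self, h.reg x hx]
      · simp

/-! ### The running time is polynomial -/

/-- The function is bounded by a polynomial. -/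
def PolyBdd (f : ℕ → ℕ) : Prop := ∃ c h : ℕ, ∀ R, f R ≤ c * (R + 1) ^ h

theorem PolyBdd.const (c : ℕ) : PolyBdd fun _ => c := ⟨c, 0, fun R => by simp⟩

theorem PolyBdd.id : PolyBdd fun R => R := ⟨1, 1, fun R => by simp⟩

theorem PolyBdd.add {f g : ℕ → ℕ} (hf : PolyBdd f) (hg : PolyBdd g) :
    PolyBdd fun R => f R + g R := by
  obtain ⟨c, h, H⟩ := hf
  obtain ⟨c', h', H'⟩ := hg
  refine ⟨c + c', h + h', fun R => ?_⟩
  have h1 : (R + 1) ^ h ≤ (R + 1) ^ (h + h') := Nat.pow_le_pow_right (by omega) (by omega)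
  have h2 : (R + 1) ^ h' ≤ (R + 1) ^ (h + h') := Nat.pow_le_pow_right (by omega) (by omega)
  calc f R + g R ≤ c * (R + 1) ^ h + c' * (R + 1) ^ h' := add_le_add (H R) (H' R)
    _ ≤ c * (R + 1) ^ (h + h') + c' * (R + 1) ^ (h + h') := by gcongr
    _ = _ := by ring

theorem PolyBdd.mul {f g : ℕ → ℕ} (hf : PolyBdd f) (hg : PolyBdd g) :
    PolyBdd fun R => f R * g R := by
  obtain ⟨c, h, H⟩ := hf
  obtain ⟨c', h', H'⟩ := hg
  refine ⟨c * c', h + h', fun R => ?_⟩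
  calc f R * g R ≤ (c * (R + 1) ^ h) * (c' * (R + 1) ^ h') := Nat.mul_le_mul (H R) (H' R)
    _ = _ := by ring

theorem polyBdd_unit (σ : ℕ) : PolyBdd fun R => FExpr.unit R σ :=
  (PolyBdd.const 20).mul (((PolyBdd.id.add (.const 1)).mul (.const σ)).add (.const 3))

theorem _root_.FExpr.polyBdd_time (e : FExpr) : PolyBdd fun R => e.time R := by
  induction e with
  | lit | reg => exact polyBdd_unit _
  | get _ _ ih | ind _ ih => exact ih.add (polyBdd_unit _)
  | add _ _ ihe ihf | sub _ _ ihe ihf | mul _ _ ihe ihf | div _ _ ihe ihf =>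
    exact (ihe.add ihf).add (polyBdd_unit _)
  | sum y x e ih =>
    exact ((PolyBdd.id.add (.const 1)).mul (ih.add (polyBdd_unit _))).add (polyBdd_unit _)

theorem polyBdd_time (p : FProg) : PolyBdd fun R => p.time R := by
  induction p with
  | set x e => exact e.polyBdd_time.add (polyBdd_unit _)
  | put a i e => exact (i.polyBdd_time.add e.polyBdd_time).add (polyBdd_unit _)
  | bits x e =>
    exact e.polyBdd_time.add ((PolyBdd.id.add (.const 3)).mul (polyBdd_unit _))
  | seq p q ihp ihq => exact ihp.add ihq
  | ite e p q ihp ihq =>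
    exact ((e.polyBdd_time.add ihp).add ihq).add (polyBdd_unit _)
  | forTo y x p ih =>
    exact ((PolyBdd.id.add (.const 1)).mul (ih.add (polyBdd_unit _))).add (polyBdd_unit _)

/-! ### Reasoning about for-programs -/

/-- The registers that the program may change. -/
def wregs : FProg → List ℕ
  | set x _ | bits x _ => [x]
  | put _ _ _ => []
  | seq p q | ite _ p q => p.wregs ++ q.wregs
  | forTo y _ p => y :: p.wregs

/-- The arrays that the program may change. -/
def warrs : FProg → List ℕ
  | set _ _ | bits _ _ => []
  | put a _ _ => [a]
  | seq p q | ite _ p q => p.warrs ++ q.warrs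
  | forTo _ _ p => p.warrs

/-- `s'` arises from `s` by changing only registers and arrays that `p` may change. -/
structure Frame (p : FProg) (s s' : RamState) : Prop where
  reg : ∀ x, x ∉ p.wregs → s'.reg x = s.reg x
  arr : ∀ a, a ∉ p.warrs → s'.arr a = s.arr a

theorem frame_rounds {p : FProg} (hp : ∀ s, Frame p s (p.exec s)) (y x : ℕ) (s : RamState)
    (i : ℕ) : Frame (forTo y x p) s (rounds y p.exec s i) := by
  induction i with
  | zero => exact ⟨fun _ _ => rfl, fun _ _ => rfl⟩
  | succ i ih =>
    refine ⟨fun z hz => ?_, fun a ha => ?_⟩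
    · simp only [wregs, List.mem_cons, not_or] at hz
      rw [rounds, (hp _).reg z hz.2, setReg_ne _ hz.1]
      exact ih.reg z (by simp [wregs, hz])
    · rw [rounds, (hp _).arr a ha, setReg_arr, ih.arr a ha]

/-- A program changes only the registers and arrays that it mentions as targets. -/
theorem frame (p : FProg) (s : RamState) : Frame p s (p.exec s) := by
  induction p generalizing s with
  | set x e | bits x e =>
    exact ⟨fun y hy => by simp only [wregs, List.mem_singleton] at hy; simp [exec, hy],
      fun _ _ => rfl⟩
  | put a i e =>
    exact ⟨fun _ _ => rfl,
      fun b hb => by simp only [warrs, List.mem_singleton] at hb; simp [exec, hb]⟩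
  | seq p q ihp ihq | ite e p q ihp ihq =>
    refine ⟨fun x hx => ?_, fun a ha => ?_⟩
    · simp only [wregs, List.mem_append, not_or] at hx
      simp only [exec]
      try split_ifs
      all_goals simp only [(ihp _).reg x hx.1, (ihq _).reg x hx.2]
    · simp only [warrs, List.mem_append, not_or] at ha
      simp only [exec]
      try split_ifs
      all_goals simp only [(ihp _).arr a ha.1, (ihq _).arr a ha.2]
  | forTo y x p ih => exact frame_rounds ih y x s _

/-- The invariant rule for for-loops. -/
theorem forTo_spec {R y x : ℕ} {p : FProg} {s : RamState} (I : ℕ → RamState → Prop)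
    (hR : (s.reg x).toNat ≤ R) (h0 : I 0 s)
    (hstep : ∀ i < (s.reg x).toNat, ∀ t, Frame (forTo y x p) s t → I i t →
      p.Ok R (t.setReg y i) ∧ I (i + 1) (p.exec (t.setReg y i))) :
    (forTo y x p).Ok R s ∧ I (s.reg x).toNat ((forTo y x p).exec s) := by
  have key : ∀ i ≤ (s.reg x).toNat, I i (rounds y p.exec s i) := by
    intro i hi
    induction i with
    | zero => exact h0
    | succ i ih =>
      exact (hstep i hi _ (frame_rounds p.frame y x s i) (ih (by omega))).2
  exact ⟨⟨hR, fun i hi => (hstep i hi _ (frame_rounds p.frame y x s i) (key i hi.le)).1⟩,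
    key _ le_rfl⟩

end FProg

/-! ### Mean and covariance of a generalized multinomial distribution -/

section Moments

variable {k : ℕ}

theorem isProbabilityMeasure_crvLaw {p : Fin k → ℝ} (hp : p ∈ stdSimplex ℝ (Fin k)) :
    IsProbabilityMeasure (crvLaw p) := by
  constructor
  simp only [crvLaw, Measure.finsetSum_apply, Measure.smul_apply, measure_univ, smul_eq_mul,
    mul_one]
  rw [← ENNReal.ofReal_sum_of_nonneg fun j _ => hp.1 j, hp.2, ENNReal.ofReal_one]

theorem integrable_crvLaw (p : Fin k → ℝ) (f : (Fin k → ℝ) → ℝ) : Integrable f (crvLaw p) := by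
  rw [crvLaw, integrable_finsetSum_measure]
  intro j _
  exact (integrable_dirac (by simp)).smul_measure ENNReal.ofReal_ne_top

theorem integral_crvLaw {p : Fin k → ℝ} (hp : p ∈ stdSimplex ℝ (Fin k)) (f : (Fin k → ℝ) → ℝ) :
    ∫ x, f x ∂(crvLaw p) = ∑ j, p j * f (Pi.single j 1) := by
  rw [crvLaw, integral_finsetSum_measure]
  · refine sum_congr rfl fun j _ => ?_
    rw [integral_smul_measure, integral_dirac, ENNReal.toReal_ofReal (hp.1 j), smul_eq_mul]
  · intro j _
    exact (integrable_dirac (by simp)).smul_measure ENNReal.ofReal_ne_top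

theorem memLp_crvLaw (p : Fin k → ℝ) {f : (Fin k → ℝ) → ℝ} (hf : Measurable f) :
    MemLp f 2 (crvLaw p) :=
  (memLp_two_iff_integrable_sq hf.aestronglyMeasurable).2 (integrable_crvLaw p _)

variable {n d : ℕ}

/-- The variance in the direction `v` of the projection to `ℝ^d` of a categorical random vector
with the probability vector `p`. -/
def dirVar (v : Fin d → ℝ) (p : Fin (d + 1) → ℝ) : ℝ :=
  ∑ j, v j ^ 2 * p j.castSucc - (∑ j, v j * p j.castSucc) ^ 2

theorem sum_mul_single_castSucc (v : Fin d → ℝ) (i : Fin (d + 1)) :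
    ∑ j : Fin d, v j * (Pi.single i (1 : ℝ) : Fin (d + 1) → ℝ) j.castSucc =
      Fin.lastCases (motive := fun _ => ℝ) 0 v i := by
  induction i using Fin.lastCases with
  | last => simp [Fin.castSucc_ne_last]
  | cast i => simp [Pi.single_apply]

theorem variance_crvLaw {p : Fin (d + 1) → ℝ} (hp : p ∈ stdSimplex ℝ (Fin (d + 1)))
    (v : Fin d → ℝ) : Var[fun x => ∑ j, v j * x j.castSucc; crvLaw p] = dirVar v p := by
  have := isProbabilityMeasure_crvLaw hp
  rw [variance_eq_sub (memLp_crvLaw p (by fun_prop)), integral_crvLaw hp, integral_crvLaw hp]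
  simp only [Pi.pow_apply, sum_mul_single_castSucc, dirVar, Fin.sum_univ_castSucc (n := d)]
  simp [mul_comm]

/-- The map that takes independent categorical vectors to the projection of their sum. -/
def projSum (n d : ℕ) (x : Fin n → Fin (d + 1) → ℝ) : Fin d → ℝ :=
  fun j => (∑ i, x i) j.castSucc

theorem measurable_projSum (n d : ℕ) : Measurable (projSum n d) := by
  unfold projSum; fun_prop

theorem gmdLaw_eq (π : Fin n → Fin (d + 1) → ℝ) :
    gmdLaw π = (Measure.pi fun i => crvLaw (π i)).map (projSum n d) := by
  rw [gmdLaw, pmdLaw, Measure.map_map (by fun_prop) (by fun_prop)]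
  rfl

theorem meanVec_gmdLaw {π : Fin n → Fin (d + 1) → ℝ} (hπ : IsRowStochastic π) (j : Fin d) :
    meanVec (gmdLaw π) j = ∑ i, π i j.castSucc := by
  have := fun i => isProbabilityMeasure_crvLaw (hπ i)
  rw [meanVec, gmdLaw_eq, integral_map (measurable_projSum n d).aemeasurable
    (measurable_pi_apply j).aestronglyMeasurable]
  simp only [projSum, Finset.sum_apply]
  rw [integral_finsetSum]
  · refine sum_congr rfl fun i _ => ?_
    rw [integral_comp_eval (μ := fun i => crvLaw (π i)) (i := i)
      (f := fun x : Fin (d + 1) → ℝ => x j.castSucc)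
      (measurable_pi_apply _).aestronglyMeasurable, integral_crvLaw (hπ i)]
    simp [Pi.single_apply]
  · intro i _
    exact integrable_comp_eval (μ := fun i => crvLaw (π i)) (i := i)
      (f := fun x : Fin (d + 1) → ℝ => x j.castSucc) (integrable_crvLaw _ _)

theorem dotProduct_covMat_gmdLaw {π : Fin n → Fin (d + 1) → ℝ} (hπ : IsRowStochastic π)
    (v : Fin d → ℝ) : v ⬝ᵥ covMat (gmdLaw π) *ᵥ v = ∑ i, dirVar v (π i) := by
  have := fun i => isProbabilityMeasure_crvLaw (hπ i)
  have hprob : IsProbabilityMeasure (gmdLaw π) := by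
    rw [gmdLaw_eq]; exact Measure.isProbabilityMeasure_map (measurable_projSum n d).aemeasurable
  have hM : ∀ w : Fin d → ℝ, Measurable fun x : Fin d → ℝ => ∑ j, w j * x j := by
    intro w; fun_prop
  have hM' : Measurable fun y : Fin (d + 1) → ℝ => ∑ j : Fin d, v j * y j.castSucc := by fun_prop
  have hL : ∀ (w : Fin d → ℝ), MemLp (fun x : Fin d → ℝ => ∑ j, w j * x j) 2 (gmdLaw π) := by
    intro w
    rw [gmdLaw_eq, memLp_map_measure_iff (hM w).aestronglyMeasurable
      (measurable_projSum n d).aemeasurable]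
    have : (fun x : Fin d → ℝ => ∑ j, w j * x j) ∘ projSum n d =
        fun x => ∑ i, (fun y : Fin (d + 1) → ℝ => ∑ j, w j * y j.castSucc) (x i) := by
      ext x
      simp only [Function.comp, projSum, Finset.sum_apply, mul_sum]
      exact sum_comm
    rw [this]
    refine memLp_finsetSum _ fun i _ => ?_
    exact (memLp_crvLaw (π i) (f := fun y : Fin (d + 1) → ℝ => ∑ j, w j * y j.castSucc)
      (by fun_prop)).comp_measurePreserving
      (measurePreserving_eval (fun i => crvLaw (π i)) i)
  have hL1 : ∀ j : Fin d, MemLp (fun x : Fin d → ℝ => x j) 2 (gmdLaw π) := by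
    intro j
    have := hL (Pi.single j 1)
    simpa [Pi.single_apply] using this
  have h1 : v ⬝ᵥ covMat (gmdLaw π) *ᵥ v = Var[fun x => ∑ j, v j * x j; gmdLaw π] := by
    rw [← covariance_self (hM v).aemeasurable,
      covariance_fun_sum_fun_sum (X := fun (j : Fin d) (x : Fin d → ℝ) => v j * x j)
      (Y := fun (j : Fin d) (x : Fin d → ℝ) => v j * x j) (fun j => (hL1 j).const_mul _)
      (fun j => (hL1 j).const_mul _)]
    simp only [dotProduct, mulVec, covMat, Matrix.of_apply, covariance_const_mul_left,
      covariance_const_mul_right, mul_sum]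
    refine sum_congr rfl fun i _ => sum_congr rfl fun j _ => by ring
  rw [h1, gmdLaw_eq, variance_map (hM v).aemeasurable (measurable_projSum n d).aemeasurable]
  have : (fun x : Fin d → ℝ => ∑ j, v j * x j) ∘ projSum n d =
      ∑ i : Fin n, fun x => (fun y : Fin (d + 1) → ℝ => ∑ j, v j * y j.castSucc) (x i) := by
    ext x
    simp only [Function.comp, projSum, Finset.sum_apply, mul_sum]
    exact sum_comm
  rw [this, variance_sum_pi (μ := fun i => crvLaw (π i))
    (X := fun _ y => ∑ j : Fin d, v j * y j.castSucc)
    fun i => memLp_crvLaw (π i) hM']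
  exact sum_congr rfl fun i _ => variance_crvLaw (hπ i) v

end Moments

/-! ### The Faddeev–LeVerrier algorithm -/

section FaddeevLeVerrier

open Polynomial

variable {d : ℕ}

/-- The matrices of the Faddeev–LeVerrier algorithm. For symmetric `A` the integer division in the
recursion is exact. -/
def flSeq (A : Matrix (Fin d) (Fin d) ℤ) : ℕ → Matrix (Fin d) (Fin d) ℤ
  | 0 => 1
  | k + 1 => A * flSeq A k - ((A * flSeq A k).trace / (k + 1)) • 1

theorem abs_flSeq_le {A : Matrix (Fin d) (Fin d) ℤ} {a : ℤ} (hA : ∀ i j, |A i j| ≤ a)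
    (k : ℕ) (i j : Fin d) : |flSeq A k i j| ≤ (2 * d ^ 2 * a) ^ k := by
  have ha : 0 ≤ a := (abs_nonneg _).trans (hA i j)
  have hd : (1 : ℤ) ≤ d := by have := i.pos; omega
  induction k generalizing i j with
  | zero => rw [flSeq, Matrix.one_apply]; split_ifs <;> simp
  | succ k ih =>
    set b := (2 * (d : ℤ) ^ 2 * a) ^ k with hb
    have hb0 : 0 ≤ b := by positivity
    have h1 : ∀ i j, |(A * flSeq A k) i j| ≤ d * (a * b) := by
      intro i j
      rw [Matrix.mul_apply]
      refine (abs_sum_le_sum_abs _ _).trans ((sum_le_card_nsmul _ _ (a * b)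
        fun l _ => ?_).trans (by simp))
      rw [abs_mul]
      exact mul_le_mul (hA _ _) (ih _ _) (abs_nonneg _) ha
    have h2 : |(A * flSeq A k).trace / ((k : ℤ) + 1)| ≤ d * (d * (a * b)) := by
      refine (abs_ediv_le_abs _ _).trans ?_
      rw [trace]
      refine (abs_sum_le_sum_abs _ _).trans ((sum_le_card_nsmul _ _ (d * (a * b))
        fun l _ => h1 _ _).trans (by simp))
    have h3 : |(((A * flSeq A k).trace / ((k : ℤ) + 1)) • (1 : Matrix (Fin d) (Fin d) ℤ)) i j| ≤
        d * (d * (a * b)) := by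
      rw [Matrix.smul_apply, Matrix.one_apply]
      split_ifs
      · simpa using h2
      · simp; positivity
    rw [flSeq, Matrix.sub_apply]
    refine (abs_sub _ _).trans ((add_le_add (h1 i j) h3).trans ?_)
    rw [pow_succ, ← hb]
    nlinarith [mul_nonneg (mul_nonneg (by positivity : (0 : ℤ) ≤ d) (sub_nonneg.2 hd))
      (mul_nonneg ha hb0)]

/-- For a symmetric matrix `A`, the last Faddeev–LeVerrier matrix is a multiple of the inverse. -/
theorem mul_flSeq {A : Matrix (Fin d) (Fin d) ℤ} (hd : 0 < d)
    (hA : (A.map (Int.cast : ℤ → ℝ)).PosDef) :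
    ∃ D : ℤ, D ≠ 0 ∧ A * flSeq A (d - 1) = D • 1 := by
  set A' := A.map (Int.cast : ℤ → ℝ) with hA'
  have hH := hA.isHermitian
  set U : Matrix (Fin d) (Fin d) ℝ := (hH.eigenvectorUnitary : Matrix (Fin d) (Fin d) ℝ) with hU
  set lam := hH.eigenvalues with hlam
  have hUU : star U * U = 1 := Unitary.coe_star_mul_self hH.eigenvectorUnitary
  have hUU' : U * star U = 1 := Unitary.coe_mul_star_self hH.eigenvectorUnitary
  have hspec : A' = U * diagonal lam * star U := by
    have := hH.spectral_theorem
    rw [Unitary.conjStarAlgAut_apply] at this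
    simpa using this
  -- the characteristic polynomial and its quotients by the linear factors
  set χ : ℝ[X] := ∏ i, (X - C (lam i)) with hχ
  set q : Fin d → ℝ[X] := fun i => ∏ j ∈ univ.erase i, (X - C (lam j)) with hq
  have hχA : A.charpoly.map (Int.castRingHom ℝ) = χ := by
    have h1 : A'.charpoly = A.charpoly.map (Int.castRingHom ℝ) := by
      rw [← charpoly_map]; rfl
    rw [← h1, hH.charpoly_eq]; rfl
  have hχc : ∀ m, χ.coeff m = (A.charpoly.coeff m : ℤ) := fun m => by
    rw [← hχA, coeff_map]; rfl
  have hqχ : ∀ i, q i * (X - C (lam i)) = χ := fun i =>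
    prod_erase_mul _ _ (mem_univ i)
  have hrec : ∀ i m, (q i).coeff m = lam i * (q i).coeff (m + 1) + χ.coeff (m + 1) := by
    intro i m
    rw [← hqχ i, mul_sub, coeff_sub, coeff_mul_X, coeff_mul_C]; ring
  have hrec0 : ∀ i, lam i * (q i).coeff 0 = - χ.coeff 0 := by
    intro i
    rw [← hqχ i, mul_sub, coeff_sub, coeff_mul_C, coeff_mul_X_zero]; ring
  have hqdeg : ∀ i, (q i).natDegree = d - 1 := by
    intro i
    rw [hq, natDegree_prod_of_monic _ _ fun j _ => monic_X_sub_C _]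
    simp
  have hqtop : ∀ i, (q i).coeff (d - 1) = 1 := by
    intro i
    rw [← hqdeg i]
    exact (monic_prod_of_monic _ _ fun j _ => monic_X_sub_C _).coeff_natDegree
  have hder : ∀ m, ∑ i, (q i).coeff m = (m + 1) * χ.coeff (m + 1) := by
    intro m
    have h1 : derivative χ = ∑ i, q i := by
      rw [hχ, derivative_prod_finset]
      simp [hq]
    rw [mul_comm, ← coeff_derivative, h1, finsetSum_coeff]
  have htr : ∀ f : Fin d → ℝ, (U * diagonal f * star U).trace = ∑ i, f i := by
    intro f
    rw [trace_mul_comm, ← mul_assoc, hUU, one_mul, trace_diagonal]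
  have hmul : ∀ f : Fin d → ℝ, A' * (U * diagonal f * star U) =
      U * diagonal (fun i => lam i * f i) * star U := by
    intro f
    rw [← diagonal_mul_diagonal]
    conv_lhs => rw [hspec]
    calc _ = U * diagonal lam * (star U * U) * diagonal f * star U := by
          simp only [mul_assoc]
      _ = _ := by rw [hUU]; simp only [mul_assoc, one_mul]
  have hmapmul : ∀ M : Matrix (Fin d) (Fin d) ℤ,
      (A * M).map (Int.cast : ℤ → ℝ) = A' * M.map (Int.cast : ℤ → ℝ) := fun M =>
    Matrix.map_mul (f := Int.castRingHom ℝ)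
  have hdiagc : ∀ c : ℝ, U * diagonal (fun _ => c) * star U = c • 1 := by
    intro c
    rw [← smul_one_eq_diagonal, mul_smul_comm, mul_one, smul_mul_assoc, hUU']
  have key : ∀ k ≤ d - 1, (flSeq A k).map (Int.cast : ℤ → ℝ) =
      U * diagonal (fun i => (q i).coeff (d - 1 - k)) * star U := by
    intro k hk
    induction k with
    | zero =>
      simp only [Nat.sub_zero, hqtop, hdiagc, one_smul, flSeq]
      exact Matrix.map_one _ (by simp) (by simp)
    | succ k ih =>
      obtain ⟨m, hm⟩ : ∃ m, d - 1 - k = m + 1 := ⟨d - 1 - k - 1, by omega⟩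
      have hm' : d - 1 - (k + 1) = m := by omega
      have hAM : (A * flSeq A k).map (Int.cast : ℤ → ℝ) =
          U * diagonal (fun i => lam i * (q i).coeff (m + 1)) * star U := by
        rw [hmapmul, ih (by omega), hmul, hm]
      have htrace : ((A * flSeq A k).trace : ℝ) = ((k + 1) * (-A.charpoly.coeff (m + 1)) : ℤ) := by
        have h1 : ((A * flSeq A k).trace : ℝ) = ((A * flSeq A k).map (Int.cast : ℤ → ℝ)).trace := by
          simp [trace]
        have h2 : ∑ i, lam i * (q i).coeff (m + 1) =
            ∑ i, ((q i).coeff m - χ.coeff (m + 1)) :=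
          sum_congr rfl fun i _ => by rw [hrec i m]; ring
        have h3 : (d : ℝ) = m + k + 2 := by
          have : d = m + k + 2 := by omega
          exact_mod_cast this
        rw [h1, hAM, htr, h2, sum_sub_distrib, hder, sum_const, card_univ,
          Fintype.card_fin, nsmul_eq_mul, hχc, h3]
        push_cast; ring
      have htrace' : (A * flSeq A k).trace = (k + 1) * (-A.charpoly.coeff (m + 1)) := by
        exact_mod_cast htrace
      have hdiv : (A * flSeq A k).trace / ((k : ℤ) + 1) = -A.charpoly.coeff (m + 1) := by
        rw [htrace']; exact Int.mul_ediv_cancel_left _ (by omega)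
      rw [flSeq, hdiv, hm', Matrix.map_sub _ (by simp), hAM]
      have h4 : ((-A.charpoly.coeff (m + 1)) • (1 : Matrix (Fin d) (Fin d) ℤ)).map
          (Int.cast : ℤ → ℝ) = U * diagonal (fun _ => -χ.coeff (m + 1)) * star U := by
        rw [hdiagc, hχc]
        ext i j
        rw [Matrix.map_apply, Matrix.smul_apply, Matrix.smul_apply, Matrix.one_apply,
          Matrix.one_apply]
        split_ifs <;> simp
      rw [h4, ← sub_mul, ← mul_sub, diagonal_sub]
      congr 3
      ext i
      rw [hrec i m]; ring
  refine ⟨-A.charpoly.coeff 0, fun h0 => ?_, ?_⟩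
  · have h1 : χ.coeff 0 = 0 := by rw [hχc]; exact_mod_cast neg_eq_zero.1 h0
    rw [hχ, coeff_zero_eq_eval_zero, eval_prod, prod_eq_zero_iff] at h1
    obtain ⟨i, _, hi⟩ := h1
    have := hA.eigenvalues_pos i
    simp only [eval_sub, eval_X, eval_C] at hi
    linarith
  · have h1 : (A * flSeq A (d - 1)).map (Int.cast : ℤ → ℝ) = (-χ.coeff 0) • 1 := by
      rw [hmapmul, key _ le_rfl, hmul, ← hdiagc]
      simp [hrec0]
    ext i j
    have h2 := congrFun (congrFun h1 i) j
    rw [Matrix.map_apply, hχc] at h2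
    have : (((A * flSeq A (d - 1)) i j : ℤ) : ℝ) =
        (((-A.charpoly.coeff 0) • (1 : Matrix (Fin d) (Fin d) ℤ)) i j : ℤ) := by
      rw [h2, Matrix.smul_apply, Matrix.smul_apply, Matrix.one_apply, Matrix.one_apply]
      split_ifs <;> simp
    exact_mod_cast this

end FaddeevLeVerrier

/-! ### Approximate feasibility of linear systems on faces of the cube, and rounding -/

section CubeLP

/-- A partial assignment of `N` variables: the values `0` and `1` are fixed, and `2` stands for
a variable that is free to take values in `[0, 1]`. -/
def IsPartial (N : ℕ) (F : ℕ → ℤ) : Prop := ∀ j < N, F j = 0 ∨ F j = 1 ∨ F j = 2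

/-- The point `f` lies on the face of the cube given by the partial assignment `F`. -/
def OnFace (N : ℕ) (F : ℕ → ℤ) (f : ℕ → ℝ) : Prop :=
  ∀ j < N, 0 ≤ f j ∧ f j ≤ 1 ∧ (F j ≠ 2 → f j = F j)

/-- The system `∑ j, a i j * f j ≤ h i + σ` has a solution on the face `F`. -/
def FaceFeasible (a : ℕ → ℕ → ℤ) (h : ℕ → ℤ) (m N : ℕ) (F : ℕ → ℤ) (σ : ℤ) : Prop :=
  ∃ f : ℕ → ℝ, OnFace N F f ∧ ∀ i < m, ∑ j ∈ range N, (a i j : ℝ) * f j ≤ h i + σ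

/-- The vertex of the face `F` that is best for the violations `r`. -/
def vertexSel (a : ℕ → ℕ → ℤ) (m : ℕ) (F r : ℕ → ℤ) (j : ℕ) : ℤ :=
  if 1 < F j then
    if 0 < 0 - ∑ i ∈ range m, (if 0 < r i then r i else 0) * a i j then 1 else 0
  else F j

/-- The accumulated violations of the system by the vertices that are selected greedily in the
first `t` rounds. -/
def violation (a : ℕ → ℕ → ℤ) (h : ℕ → ℤ) (m N : ℕ) (F : ℕ → ℤ) (σ : ℤ) : ℕ → ℕ → ℤ
  | 0, _ => 0
  | t + 1, i => violation a h m N F σ t i +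
      (∑ j ∈ range N, a i j * vertexSel a m F (violation a h m N F σ t) j - h i - σ)

variable {a : ℕ → ℕ → ℤ} {h : ℕ → ℤ} {m N : ℕ} {F : ℕ → ℤ} {σ : ℤ}

theorem vertexSel_eq (hF : IsPartial N F) (r : ℕ → ℤ) {j : ℕ} (hj : j < N) :
    vertexSel a m F r j = 0 ∨ vertexSel a m F r j = 1 := by
  unfold vertexSel
  rcases hF j hj with h | h | h <;> simp [h]
  omega

theorem violation_eq_sum (t i : ℕ) : violation a h m N F σ t i =
    ∑ j ∈ range N,
      a i j * (∑ u ∈ range t, vertexSel a m F (violation a h m N F σ u) j)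
      - t * (h i + σ) := by
  induction t with
  | zero => simp [violation]
  | succ t ih =>
    rw [violation, ih]
    simp only [sum_range_succ _ t, mul_add, sum_add_distrib]
    push_cast; ring

/-- Small accumulated violations show that the average of the selected vertices is nearly
feasible. -/
theorem faceFeasible_of_violation_le (hF : IsPartial N F) {T : ℕ} (hT : 0 < T)
    (hv : ∀ i < m, violation a h m N F σ T i ≤ T) : FaceFeasible a h m N F (σ + 1) := by
  have hT' : (0 : ℝ) < T := by exact_mod_cast hT
  set s := fun (u j : ℕ) => vertexSel a m F (violation a h m N F σ u) j with hs
  refine ⟨fun j => (∑ u ∈ range T, (s u j : ℝ)) / T, fun j hj => ⟨?_, ?_, fun hFj => ?_⟩,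
    fun i hi => ?_⟩
  · refine div_nonneg (sum_nonneg fun u _ => ?_) hT'.le
    rcases vertexSel_eq (a := a) (m := m) hF (violation a h m N F σ u) hj with h | h <;>
      simp [hs, h]
  · rw [div_le_one hT']
    refine (sum_le_card_nsmul _ _ 1 fun u _ => ?_).trans (by simp)
    rcases vertexSel_eq (a := a) (m := m) hF (violation a h m N F σ u) hj with h | h <;>
      simp [hs, h]
  · have : ∀ u, s u j = F j := fun u => by
      simp only [hs, vertexSel]
      rcases hF j hj with h | h | h <;> simp_all
    simp only [this, sum_const, card_range, nsmul_eq_mul]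
    field_simp
  · have h1 := hv i hi
    rw [violation_eq_sum] at h1
    have h2 : (∑ j ∈ range N, (a i j : ℝ) * (∑ u ∈ range T, (s u j : ℝ)))
        - T * (h i + σ) ≤ T := by exact_mod_cast h1
    have h3 : ∑ j ∈ range N, (a i j : ℝ) * ((∑ u ∈ range T, (s u j : ℝ)) / T) =
        (∑ j ∈ range N, (a i j : ℝ) * (∑ u ∈ range T, (s u j : ℝ))) / T := by
      rw [sum_div]
      exact sum_congr rfl fun j _ => by ring
    rw [h3, div_le_iff₀ hT']
    push_cast
    nlinarith

theorem sq_posPart_add_le (x y : ℝ) :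
    (max (x + y) 0) ^ 2 ≤ (max x 0) ^ 2 + 2 * max x 0 * y + y ^ 2 := by
  rcases le_total x 0 with hx | hx <;> rcases le_total (x + y) 0 with hy | hy <;>
    simp only [max_eq_left, max_eq_right, hx, hy] <;> nlinarith

/-- If the system is feasible, the greedy selection keeps the violations small: in each round the
sum of the squares of their positive parts grows by at most a constant. -/
theorem violation_le_of_faceFeasible (hF : IsPartial N F) (hfeas : FaceFeasible a h m N F σ)
    {B T : ℕ} (hB : ∀ s : ℕ → ℤ, (∀ j < N, s j = 0 ∨ s j = 1) → ∀ i < m,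
      |∑ j ∈ range N, a i j * s j - h i - σ| ≤ B)
    (hT : m * B ^ 2 ≤ T) : ∀ i < m, violation a h m N F σ T i ≤ T := by
  obtain ⟨f, hf, hfa⟩ := hfeas
  set r := violation a h m N F σ with hr
  set p := fun t i => max (r t i : ℝ) 0 with hp
  have hpcast : ∀ t i, p t i = ((if 0 < r t i then r t i else 0 : ℤ) : ℝ) := by
    intro t i
    simp only [hp]
    split_ifs with h0
    · exact max_eq_left (by exact_mod_cast h0.le)
    · rw [max_eq_right (by exact_mod_cast not_lt.1 h0)]; simp
  have hp0 : ∀ t i, 0 ≤ p t i := fun t i => le_max_right _ _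
  have key : ∀ t : ℕ, ∑ i ∈ range m, (p t i) ^ 2 ≤ t * (m * (B : ℝ) ^ 2) := by
    intro t
    induction t with
    | zero => simp [hp, hr, violation]
    | succ t ih =>
      set s := vertexSel a m F (r t) with hs
      set y := fun i => ∑ j ∈ range N, (a i j : ℝ) * s j - h i - σ with hy
      have hrs : ∀ i, (r (t + 1) i : ℝ) = r t i + y i := by
        intro i
        simp only [hr, violation, hy]; push_cast; rfl
      have hys : ∀ i < m, y i ^ 2 ≤ (B : ℝ) ^ 2 := by
        intro i hi
        have h1 := hB s (fun j hj => vertexSel_eq hF _ hj) i hi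
        have h2 : |y i| ≤ B := by simp only [hy]; exact_mod_cast h1
        exact sq_le_sq' (by linarith [(abs_le.1 h2).1]) (abs_le.1 h2).2
      -- the selected vertex minimizes the weighted violation over the face
      have hmin : ∑ i ∈ range m, p t i * y i ≤ 0 := by
        have h1 : ∀ g : ℕ → ℝ, ∑ i ∈ range m,
            p t i * (∑ j ∈ range N, (a i j : ℝ) * g j) =
            ∑ j ∈ range N, (∑ i ∈ range m, p t i * a i j) * g j := by
          intro g
          simp only [mul_sum, sum_mul]
          rw [sum_comm]
          exact sum_congr rfl fun _ _ => sum_congr rfl fun _ _ => by ring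
        have h2 : ∑ j ∈ range N, (∑ i ∈ range m, p t i * a i j) * s j ≤
            ∑ j ∈ range N, (∑ i ∈ range m, p t i * a i j) * f j := by
          refine sum_le_sum fun j hj => ?_
          have hj' := mem_range.1 hj
          obtain ⟨f0, f1, f2⟩ := hf j hj'
          by_cases hFj : F j = 2
          · set c := ∑ i ∈ range m, (if 0 < r t i then r t i else 0) * a i j with hc
            have hpc : ∑ i ∈ range m, p t i * a i j = c := by
              rw [hc]; push_cast
              exact sum_congr rfl fun i _ => by rw [hpcast]; push_cast; ring
            have hsj : s j = if 0 < 0 - c then 1 else 0 := by simp [hs, vertexSel, hFj, hc]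
            rw [hpc, hsj]
            split_ifs with hneg
            · have : (c : ℝ) < 0 := by exact_mod_cast (by linarith : c < 0)
              push_cast
              nlinarith
            · have : (0 : ℝ) ≤ c := by exact_mod_cast (by linarith : 0 ≤ c)
              push_cast
              nlinarith
          · have : s j = F j := by
              simp only [hs, vertexSel]
              rcases hF j hj' with h | h | h <;> simp_all
            rw [f2 hFj, this]
        have h3 : ∑ i ∈ range m, p t i * y i =
            ∑ i ∈ range m, p t i * (∑ j ∈ range N, (a i j : ℝ) * s j) -
            ∑ i ∈ range m, p t i * (h i + σ) := by
          rw [← sum_sub_distrib]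
          exact sum_congr rfl fun i _ => by simp only [hy]; ring
        have h4 : ∑ i ∈ range m, p t i * (∑ j ∈ range N, (a i j : ℝ) * f j) ≤
            ∑ i ∈ range m, p t i * (h i + σ) :=
          sum_le_sum fun i hi =>
            mul_le_mul_of_nonneg_left (hfa i (mem_range.1 hi)) (hp0 t i)
        rw [h3, h1]
        rw [h1] at h4
        linarith
      have h5 : ∑ i ∈ range m, (p (t + 1) i) ^ 2 ≤
          ∑ i ∈ range m, ((p t i) ^ 2 + 2 * (p t i * y i) + (B : ℝ) ^ 2) := by
        refine sum_le_sum fun i hi => ?_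
        have := sq_posPart_add_le (r t i) (y i)
        have h6 := hys i (mem_range.1 hi)
        simp only [hp, hrs]
        linarith
      rw [sum_add_distrib, sum_add_distrib, ← mul_sum] at h5
      simp only [sum_const, card_range, nsmul_eq_mul] at h5
      push_cast
      linarith
  intro i hi
  have h1 : (p T i) ^ 2 ≤ (T : ℝ) ^ 2 := by
    have h2 := single_le_sum (f := fun i => (p T i) ^ 2) (fun i _ => sq_nonneg _)
      (mem_range.2 hi)
    have h3 : (m * (B : ℝ) ^ 2) ≤ T := by exact_mod_cast hT
    have h4 : (T : ℝ) * (m * (B : ℝ) ^ 2) ≤ T * T := by gcongr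
    have := key T
    nlinarith
  have h2 : p T i ≤ T := (abs_le_of_sq_le_sq' h1 (by positivity)).2
  have h3 : (r T i : ℝ) ≤ T := (le_max_left _ _).trans h2
  exact_mod_cast h3

theorem abs_violation_le (hF : IsPartial N F) {B : ℕ}
    (hB : ∀ s : ℕ → ℤ, (∀ j < N, s j = 0 ∨ s j = 1) → ∀ i < m,
      |∑ j ∈ range N, a i j * s j - h i - σ| ≤ B) (t : ℕ) {i : ℕ} (hi : i < m) :
    |violation a h m N F σ t i| ≤ t * B := by
  induction t with
  | zero => simp [violation]
  | succ t ih =>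
    rw [violation]
    refine (abs_add_le _ _).trans ?_
    have := hB _ (fun j hj => vertexSel_eq (a := a) (m := m) hF (violation a h m N F σ t) hj) i hi
    push_cast
    linarith

/-- When the columns of the system span a space of dimension at most `D` and more than `D`
variables are free, one can move a solution along a kernel vector until one more variable becomes
integral. -/
theorem exists_onFace_update {D : ℕ} {u w : ℕ → ℕ → ℝ}
    (ha : ∀ i < m, ∀ j < N, (a i j : ℝ) = ∑ e ∈ range D, u i e * w e j)
    {f : ℕ → ℝ} (hf : OnFace N F f) (hD : D < {j ∈ range N | F j = 2}.card) :
    ∃ j < N, F j = 2 ∧ ∃ v : ℤ, (v = 0 ∨ v = 1) ∧ ∃ f', OnFace N (update F j v) f' ∧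
      ∀ i < m, ∑ j ∈ range N, (a i j : ℝ) * f' j =
        ∑ j ∈ range N, (a i j : ℝ) * f j := by
  set S := {j ∈ range N | F j = 2} with hS
  -- a nontrivial linear relation between the free columns
  obtain ⟨z, hz0, hzS, hzw⟩ : ∃ z : ℕ → ℝ, (∃ j, z j ≠ 0) ∧ (∀ j, j ∉ S → z j = 0) ∧
      ∀ e < D, ∑ j ∈ S, w e j * z j = 0 := by
    let φ : (S → ℝ) →ₗ[ℝ] (Fin D → ℝ) := mulVecLin (of fun e j => w e j)
    have hker : LinearMap.ker φ ≠ ⊥ := LinearMap.ker_ne_bot_of_finrank_lt (by simpa using hD)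
    obtain ⟨z, hz, hz0⟩ := (Submodule.ne_bot_iff _).1 hker
    obtain ⟨j0, hj0⟩ : ∃ j, z j ≠ 0 := by
      by_contra hcon; push Not at hcon; exact hz0 (funext hcon)
    refine ⟨fun j => if hj : j ∈ S then z ⟨j, hj⟩ else 0, ⟨j0, by simpa using hj0⟩,
      fun j hj => by simp [hj], fun e he => ?_⟩
    have h1 := congrFun (LinearMap.mem_ker.1 hz) ⟨e, he⟩
    simp only [φ, Matrix.mulVecLin_apply, mulVec, dotProduct, Matrix.of_apply,
      Pi.zero_apply] at h1
    rw [← h1, ← sum_coe_sort S]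
    exact sum_congr rfl fun j _ => by simp
  have hsum : ∀ i < m, ∑ j ∈ range N, (a i j : ℝ) * z j = 0 := by
    intro i hi
    have h1 : ∑ j ∈ range N, (a i j : ℝ) * z j = ∑ j ∈ S, (a i j : ℝ) * z j := by
      symm
      refine sum_subset (filter_subset _ _) fun j _ hj => by rw [hzS j hj, mul_zero]
    rw [h1]
    calc ∑ j ∈ S, (a i j : ℝ) * z j
        = ∑ j ∈ S, ∑ e ∈ range D, u i e * (w e j * z j) := by
          refine sum_congr rfl fun j hj => ?_
          rw [ha i hi j (mem_range.1 (mem_filter.1 hj).1), sum_mul]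
          exact sum_congr rfl fun _ _ => by ring
      _ = ∑ e ∈ range D, u i e * ∑ j ∈ S, w e j * z j := by
          rw [sum_comm]; simp only [mul_sum]
      _ = 0 := sum_eq_zero fun e he => by rw [hzw e (mem_range.1 he), mul_zero]
  -- the first time at which a coordinate reaches the boundary
  set Z := {j ∈ S | z j ≠ 0} with hZ
  have hmemZ : ∀ {j}, z j ≠ 0 → j ∈ Z := fun {j} hj =>
    mem_filter.2 ⟨by_contra fun hc => hj (hzS j hc), hj⟩
  have hZne : Z.Nonempty := hz0.imp fun _ => hmemZ
  set τ : ℕ → ℝ := fun j => if 0 < z j then (1 - f j) / z j else f j / (- z j) with hτ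
  obtain ⟨j0, hj0, hmin⟩ := exists_min_image Z τ hZne
  have hj0S : j0 ∈ S := (mem_filter.1 hj0).1
  have hj0z : z j0 ≠ 0 := (mem_filter.1 hj0).2
  have hj0N : j0 < N := mem_range.1 (mem_filter.1 hj0S).1
  have hj0F : F j0 = 2 := (mem_filter.1 hj0S).2
  have hτ0 : 0 ≤ τ j0 := by
    obtain ⟨h0, h1, -⟩ := hf j0 hj0N
    simp only [hτ]
    split_ifs with hpos
    · exact div_nonneg (by linarith) hpos.le
    · exact div_nonneg h0 (by linarith)
  set f' : ℕ → ℝ := fun j => f j + τ j0 * z j with hf'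
  have hrange : ∀ j < N, 0 ≤ f' j ∧ f' j ≤ 1 := by
    intro j hj
    obtain ⟨h0, h1, -⟩ := hf j hj
    simp only [hf']
    rcases lt_trichotomy (z j) 0 with hneg | hzero | hpos
    · have h2 := hmin j (hmemZ hneg.ne)
      rw [show τ j = f j / (- z j) from if_neg (by linarith), le_div_iff₀ (by linarith)] at h2
      constructor <;> nlinarith
    · rw [hzero]; constructor <;> linarith
    · have h2 := hmin j (hmemZ hpos.ne')
      rw [show τ j = (1 - f j) / z j from if_pos hpos, le_div_iff₀ hpos] at h2
      constructor <;> nlinarith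
  have hval : ∃ v : ℤ, (v = 0 ∨ v = 1) ∧ f' j0 = v := by
    rcases lt_or_gt_of_ne hj0z with hneg | hpos
    · refine ⟨0, Or.inl rfl, ?_⟩
      simp only [hf']
      rw [show τ j0 = f j0 / (- z j0) from if_neg (by linarith)]
      field_simp; simp
    · refine ⟨1, Or.inr rfl, ?_⟩
      simp only [hf']
      rw [show τ j0 = (1 - f j0) / z j0 from if_pos hpos]
      field_simp; simp
  obtain ⟨v, hv, hfv⟩ := hval
  refine ⟨j0, hj0N, hj0F, v, hv, f', fun j hj => ⟨(hrange j hj).1, (hrange j hj).2, fun hFj => ?_⟩,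
    fun i hi => ?_⟩
  · by_cases hjj : j = j0
    · subst hjj; simpa using hfv
    · rw [update_of_ne hjj] at hFj ⊢
      have : j ∉ S := fun hjS => hFj (mem_filter.1 hjS).2
      simp only [hf', hzS j this, mul_zero, add_zero]
      exact (hf j hj).2.2 hFj
  · simp only [hf', mul_add, sum_add_distrib]
    have : ∑ j ∈ range N, (a i j : ℝ) * (τ j0 * z j) = 0 := by
      rw [← mul_zero (τ j0), ← hsum i hi, mul_sum]
      exact sum_congr rfl fun _ _ => by ring
    rw [this, add_zero]

end CubeLP

section CubeRounding

variable (a : ℕ → ℕ → ℤ) (h : ℕ → ℤ) (m N T : ℕ)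

open Classical in
/-- Fix the variable `j` to the value `v`, if it is free and the greedy selection certifies that
the smaller face is nearly feasible. -/
noncomputable def tryFix (F : ℕ → ℤ) (σ : ℤ) (j : ℕ) (v : ℤ) : ℕ → ℤ :=
  if 1 < F j ∧ ∀ i < m, violation a h m N (update F j v) σ T i ≤ T then
    update F j v else F

/-- The result of trying to fix the variables `0, …, J - 1`, one after the other. The tolerance
`σ` increases with each trial. -/
noncomputable def roundPass (F : ℕ → ℤ) (σ : ℤ) : ℕ → ℕ → ℤ
  | 0 => F
  | J + 1 => tryFix a h m N T
      (tryFix a h m N T (roundPass F σ J) (σ + 2 * J) J 0) (σ + 2 * J + 1) J 1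

/-- The result of `A` passes over all variables. -/
noncomputable def roundPasses (F : ℕ → ℤ) : ℕ → ℕ → ℤ
  | 0 => F
  | A + 1 => roundPass a h m N T (roundPasses F A) (2 * N * A) N

/-- The free variables of a partial assignment. -/
def freeVars (N : ℕ) (F : ℕ → ℤ) : Finset ℕ := {j ∈ range N | F j = 2}

variable {a h m N T} {F : ℕ → ℤ} {σ : ℤ}

theorem IsPartial.update (hF : IsPartial N F) (j : ℕ) {v : ℤ} (hv : v = 0 ∨ v = 1) :
    IsPartial N (update F j v) := by
  intro l hl
  by_cases hlj : l = j
  · subst hlj; simp only [update_self]; tauto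
  · simpa [hlj] using hF l hl

theorem IsPartial.tryFix (hF : IsPartial N F) (j : ℕ) {v : ℤ} (hv : v = 0 ∨ v = 1) :
    IsPartial N (tryFix a h m N T F σ j v) := by
  unfold _root_.tryFix; split_ifs
  · exact hF.update j hv
  · exact hF

theorem IsPartial.roundPass (hF : IsPartial N F) (J : ℕ) :
    IsPartial N (roundPass a h m N T F σ J) := by
  induction J with
  | zero => exact hF
  | succ J ih => exact (ih.tryFix J (Or.inl rfl)).tryFix J (Or.inr rfl)

theorem tryFix_of_ne {j : ℕ} {v : ℤ} {l : ℕ} (hl : F l ≠ 2) (hF : IsPartial N F) (hlN : l < N) :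
    tryFix a h m N T F σ j v l = F l := by
  unfold tryFix; split_ifs with h1
  · rw [update_of_ne]
    rintro rfl
    rcases hF l hlN with h2 | h2 | h2 <;> omega
  · rfl

theorem freeVars_tryFix_subset (F : ℕ → ℤ) (σ : ℤ) (j : ℕ) {v : ℤ} (hv : v = 0 ∨ v = 1) :
    freeVars N (tryFix a h m N T F σ j v) ⊆ freeVars N F := by
  intro l hl
  simp only [freeVars, mem_filter] at hl ⊢
  refine ⟨hl.1, ?_⟩
  have h2 := hl.2
  unfold tryFix at h2
  split_ifs at h2 with h3
  · by_cases hlj : l = j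
    · subst hlj; rw [update_self] at h2; omega
    · rwa [update_of_ne hlj] at h2
  · exact h2

theorem freeVars_update_ssubset {j : ℕ} (hj : j < N) (hFj : F j = 2) {v : ℤ}
    (hv : v = 0 ∨ v = 1) : freeVars N (update F j v) ⊂ freeVars N F := by
  refine (ssubset_iff_of_subset fun l hl => ?_).2 ⟨j, ?_, ?_⟩
  · simp only [freeVars, mem_filter] at hl ⊢
    refine ⟨hl.1, ?_⟩
    by_cases hlj : l = j
    · subst hlj; exact hFj
    · have := hl.2; rwa [update_of_ne hlj] at this
  · simp [freeVars, hj, hFj]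
  · simp only [freeVars, mem_filter, update_self, not_and]
    intro _; omega

theorem tryFix_eq_or (F : ℕ → ℤ) (σ : ℤ) {j : ℕ} (hj : j < N) {v : ℤ} (hF : IsPartial N F)
    (hv : v = 0 ∨ v = 1) : tryFix a h m N T F σ j v = F ∨
      (freeVars N (tryFix a h m N T F σ j v)).card < (freeVars N F).card := by
  unfold tryFix
  split_ifs with h1
  · right
    exact card_lt_card (freeVars_update_ssubset hj
      (by rcases hF j hj with h2 | h2 | h2 <;> omega) hv)
  · exact Or.inl rfl

theorem FaceFeasible.mono {σ τ : ℤ} (hσ : σ ≤ τ) (hf : FaceFeasible a h m N F σ) :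
    FaceFeasible a h m N F τ := by
  obtain ⟨f, h1, h2⟩ := hf
  have : (σ : ℝ) ≤ τ := by exact_mod_cast hσ
  exact ⟨f, h1, fun i hi => (h2 i hi).trans (by linarith)⟩

theorem FaceFeasible.tryFix (hF : IsPartial N F) (hT : 0 < T) {j : ℕ} {v : ℤ}
    (hv : v = 0 ∨ v = 1) (hf : FaceFeasible a h m N F σ) :
    FaceFeasible a h m N (tryFix a h m N T F σ j v) (σ + 1) := by
  unfold _root_.tryFix; split_ifs with h1
  · exact faceFeasible_of_violation_le (hF.update j hv) hT h1.2
  · exact hf.mono (by omega)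

/-- The properties that all partial assignments reached from `F` share. -/
structure RoundInv (a : ℕ → ℕ → ℤ) (h : ℕ → ℤ) (m N : ℕ) (F₀ F : ℕ → ℤ) (σ : ℤ) : Prop where
  isPartial : IsPartial N F
  feasible : FaceFeasible a h m N F σ
  keeps : ∀ j < N, F₀ j ≠ 2 → F j = F₀ j
  subset : freeVars N F ⊆ freeVars N F₀

theorem RoundInv.tryFix {F₀ : ℕ → ℤ} (hI : RoundInv a h m N F₀ F σ) (hT : 0 < T) (j : ℕ) {v : ℤ}
    (hv : v = 0 ∨ v = 1) : RoundInv a h m N F₀ (tryFix a h m N T F σ j v) (σ + 1) :=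
  ⟨hI.isPartial.tryFix j hv, hI.feasible.tryFix hI.isPartial hT hv, fun l hl h0 => by
    rw [tryFix_of_ne (by rw [hI.keeps l hl h0]; exact h0) hI.isPartial hl, hI.keeps l hl h0],
    (freeVars_tryFix_subset _ _ _ hv).trans hI.subset⟩

theorem RoundInv.roundPass {F₀ : ℕ → ℤ} (hI : RoundInv a h m N F₀ F σ) (hT : 0 < T) (J : ℕ) :
    RoundInv a h m N F₀ (roundPass a h m N T F σ J) (σ + 2 * J) := by
  induction J with
  | zero => simpa [_root_.roundPass] using hI
  | succ J ih =>
    have := (ih.tryFix hT J (Or.inl rfl)).tryFix hT J (Or.inr rfl)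
    rw [_root_.roundPass]
    convert this using 1
    push_cast; ring

theorem RoundInv.roundPasses {F₀ : ℕ → ℤ} (hI : RoundInv a h m N F₀ F₀ 0) (hT : 0 < T) (A : ℕ) :
    RoundInv a h m N F₀ (roundPasses a h m N T F₀ A) (2 * N * A) := by
  induction A with
  | zero => simpa [_root_.roundPasses] using hI
  | succ A ih =>
    have := ih.roundPass hT N
    rw [_root_.roundPasses]
    convert this using 1
    push_cast; ring

/-- The hypotheses under which the greedy selection detects feasibility: all violations in a
single round are at most `B`, for tolerances up to `2 N ^ 2`, and there are enough rounds. -/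
def DetectsUpTo (a : ℕ → ℕ → ℤ) (h : ℕ → ℤ) (m N T B : ℕ) : Prop :=
  m * B ^ 2 ≤ T ∧ ∀ σ : ℤ, 0 ≤ σ → σ ≤ 2 * N * N → ∀ s : ℕ → ℤ, (∀ j < N, s j = 0 ∨ s j = 1) →
    ∀ i < m, |∑ j ∈ range N, a i j * s j - h i - σ| ≤ B

/-- As long as more than `D` variables are free, each pass fixes at least one of them. -/
theorem card_freeVars_roundPass_lt {B D : ℕ} (hB : DetectsUpTo a h m N T B) {u w : ℕ → ℕ → ℝ}
    (ha : ∀ i < m, ∀ j < N, (a i j : ℝ) = ∑ e ∈ range D, u i e * w e j)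
    (hF : IsPartial N F) (hf : FaceFeasible a h m N F σ) (hσ : 0 ≤ σ)
    (hσ' : σ + 2 * N ≤ 2 * N * N) (hD : D < (freeVars N F).card) :
    (freeVars N (roundPass a h m N T F σ N)).card < (freeVars N F).card := by
  obtain ⟨f, hface, hfa⟩ := hf
  obtain ⟨j0, hj0, hFj0, v, hv, f', hf', hsum⟩ := exists_onFace_update ha hface hD
  have hfeas : ∀ τ : ℤ, σ ≤ τ → FaceFeasible a h m N (update F j0 v) τ := fun τ hτ => by
    have : (σ : ℝ) ≤ τ := by exact_mod_cast hτ
    exact ⟨f', hf', fun i hi => by rw [hsum i hi]; linarith [hfa i hi]⟩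
  -- the trial of `j0` succeeds if the assignment is still `F` at that time
  have hdet : ∀ τ : ℤ, σ ≤ τ → τ ≤ 2 * N * N →
      tryFix a h m N T F τ j0 v = update F j0 v := fun τ hτ hτ' => by
    unfold tryFix
    rw [if_pos]
    exact ⟨by omega, violation_le_of_faceFeasible (hF.update j0 hv) (hfeas τ hτ)
      (hB.2 τ (hσ.trans hτ) hτ') hB.1⟩
  have hlt := card_lt_card (freeVars_update_ssubset hj0 hFj0 hv)
  have hmono : ∀ {F' : ℕ → ℤ} {τ : ℤ} {j : ℕ} {v : ℤ}, (v = 0 ∨ v = 1) →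
      (freeVars N F').card < (freeVars N F).card →
      (freeVars N (tryFix a h m N T F' τ j v)).card < (freeVars N F).card := fun hv h1 =>
    (card_le_card (freeVars_tryFix_subset _ _ _ hv)).trans_lt h1
  have key : ∀ J ≤ N, (roundPass a h m N T F σ J = F ∧ J ≤ j0) ∨
      (freeVars N (roundPass a h m N T F σ J)).card < (freeVars N F).card := by
    intro J hJ
    induction J with
    | zero => exact Or.inl ⟨rfl, Nat.zero_le _⟩
    | succ J ih =>
      rw [roundPass]
      rcases ih (by omega) with ⟨h1, h2⟩ | h1
      · rw [h1]
        rcases tryFix_eq_or (a := a) (h := h) (m := m) (T := T) F (σ + 2 * J)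
          (show J < N by omega) hF (Or.inl rfl : (0 : ℤ) = 0 ∨ _) with h3 | h3
        · rcases tryFix_eq_or (a := a) (h := h) (m := m) (T := T) F (σ + 2 * J + 1)
            (show J < N by omega) hF (Or.inr rfl : _ ∨ (1 : ℤ) = 1) with h4 | h4
          · rcases h2.lt_or_eq with h5 | h5
            · exact Or.inl ⟨by rw [h3, h4], h5⟩
            · exfalso
              subst h5
              have hcard : ∀ τ, σ ≤ τ → τ ≤ 2 * N * N →
                  tryFix a h m N T F τ J v ≠ F := fun τ hτ hτ' heq => by
                rw [hdet τ hτ hτ'] at heq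
                rw [heq] at hlt
                exact hlt.ne rfl
              rcases hv with rfl | rfl
              · exact hcard _ (by omega) (by omega) h3
              · exact hcard _ (by omega) (by omega) h4
          · right; rw [h3]; exact h4
        · exact Or.inr (hmono (Or.inr rfl) h3)
      · exact Or.inr (hmono (Or.inr rfl) (hmono (Or.inl rfl) h1))
  rcases key N le_rfl with ⟨_, h2⟩ | h2
  · omega
  · exact h2

/-- After `N` passes, at most `D` variables are free. -/
theorem card_freeVars_roundPasses_le {B D : ℕ} (hB : DetectsUpTo a h m N T B)
    {u w : ℕ → ℕ → ℝ}
    (ha : ∀ i < m, ∀ j < N, (a i j : ℝ) = ∑ e ∈ range D, u i e * w e j) (hT : 0 < T)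
    (hI : RoundInv a h m N F F 0) : (freeVars N (roundPasses a h m N T F N)).card ≤ D := by
  have key : ∀ A ≤ N, (freeVars N (roundPasses a h m N T F A)).card ≤ D ∨
      (freeVars N (roundPasses a h m N T F A)).card + A ≤ N := by
    intro A hA
    induction A with
    | zero =>
      right
      simp only [freeVars, roundPasses, add_zero]
      exact (card_filter_le _ _).trans_eq (card_range N)
    | succ A ih =>
      have hIA := hI.roundPasses hT A
      have hsub : (freeVars N (roundPasses a h m N T F (A + 1))).card ≤
          (freeVars N (roundPasses a h m N T F A)).card := by
        refine card_le_card ?_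
        have h0 : RoundInv a h m N (roundPasses a h m N T F A) (roundPasses a h m N T F A)
          (2 * N * A) := ⟨hIA.isPartial, hIA.feasible, fun _ _ _ => rfl, subset_rfl⟩
        exact (h0.roundPass hT N).subset
      by_cases hD : (freeVars N (roundPasses a h m N T F A)).card ≤ D
      · exact Or.inl (hsub.trans hD)
      · right
        have h1 := card_freeVars_roundPass_lt hB ha hIA.isPartial hIA.feasible (by positivity)
          (by
            have : (A : ℤ) + 1 ≤ N := by exact_mod_cast hA
            nlinarith) (not_le.1 hD)
        have h2 := (ih (by omega)).resolve_left hD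
        rw [roundPasses]
        omega
  rcases key N le_rfl with h1 | h1
  · exact h1
  · omega

end CubeRounding

/-! ### Quadratic forms -/

section QuadraticForms

variable {d : ℕ} {M : Matrix (Fin d) (Fin d) ℝ}

theorem smul_form (c : ℝ) (M : Matrix (Fin d) (Fin d) ℝ) (v w : Fin d → ℝ) :
    v ⬝ᵥ (c • M) *ᵥ w = c * (v ⬝ᵥ M *ᵥ w) := by
  rw [smul_mulVec, dotProduct_smul, smul_eq_mul]

theorem Matrix.PosSemidef.form_nonneg (hM : M.PosSemidef) (v : Fin d → ℝ) : 0 ≤ v ⬝ᵥ M *ᵥ v := by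
  simpa using hM.dotProduct_mulVec_nonneg v

theorem Matrix.IsHermitian.form_comm (hM : M.IsHermitian) (u w : Fin d → ℝ) :
    u ⬝ᵥ M *ᵥ w = w ⬝ᵥ M *ᵥ u := by
  have hT : Mᵀ = M := by simpa [conjTranspose_eq_transpose_of_trivial] using hM.eq
  rw [dotProduct_mulVec, ← mulVec_transpose, hT, dotProduct_comm]

theorem Matrix.IsHermitian.form_add_smul (hM : M.IsHermitian) (u w : Fin d → ℝ) (t : ℝ) :
    (u + t • w) ⬝ᵥ M *ᵥ (u + t • w) =
      u ⬝ᵥ M *ᵥ u + 2 * t * (u ⬝ᵥ M *ᵥ w) + t ^ 2 * (w ⬝ᵥ M *ᵥ w) := by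
  simp only [mulVec_add, mulVec_smul, add_dotProduct, dotProduct_add,
    smul_dotProduct, dotProduct_smul, smul_eq_mul, hM.form_comm w u]
  ring

theorem Matrix.PosSemidef.sq_form_le (hM : M.PosSemidef) (u w : Fin d → ℝ) :
    (u ⬝ᵥ M *ᵥ w) ^ 2 ≤ (u ⬝ᵥ M *ᵥ u) * (w ⬝ᵥ M *ᵥ w) := by
  have h := discrim_le_zero (a := w ⬝ᵥ M *ᵥ w) (b := 2 * (u ⬝ᵥ M *ᵥ w)) (c := u ⬝ᵥ M *ᵥ u)
    fun t => by
      have := hM.form_nonneg (u + t • w)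
      rw [hM.isHermitian.form_add_smul] at this
      nlinarith
  rw [discrim] at h
  nlinarith

theorem Matrix.PosSemidef.abs_form_le (hM : M.PosSemidef) (u w : Fin d → ℝ) :
    |u ⬝ᵥ M *ᵥ w| ≤ √(u ⬝ᵥ M *ᵥ u) * √(w ⬝ᵥ M *ᵥ w) := by
  rw [← Real.sqrt_mul (hM.form_nonneg u)]
  exact Real.abs_le_sqrt (hM.sq_form_le u w)

theorem abs_dotProduct_le (u w : Fin d → ℝ) : |u ⬝ᵥ w| ≤ √(u ⬝ᵥ u) * √(w ⬝ᵥ w) := by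
  have := (PosSemidef.one (n := Fin d) (R := ℝ)).abs_form_le u w
  simpa using this

theorem dotProduct_self_nonneg' (v : Fin d → ℝ) : 0 ≤ v ⬝ᵥ v :=
  sum_nonneg fun _ _ => mul_self_nonneg _

/-- A quadratic form between `0` and `c` changes little when an integral vector of size about `L`
is perturbed. -/
theorem Matrix.PosSemidef.abs_form_sub_le (hM : M.PosSemidef) {c L : ℝ} (hL : 1 ≤ L)
    (hc : ∀ v : Fin d → ℝ, v ⬝ᵥ M *ᵥ v ≤ c * (v ⬝ᵥ v)) (hc0 : 0 ≤ c) {u w : Fin d → ℝ}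
    (hu : ∀ i, |u i| ≤ 1) (hw : ∀ i, |w i| ≤ L) :
    |(w + u) ⬝ᵥ M *ᵥ (w + u) - w ⬝ᵥ M *ᵥ w| ≤ 3 * c * d * L := by
  have hu2 : u ⬝ᵥ u ≤ d := by
    refine (sum_le_card_nsmul _ _ 1 fun i _ => ?_).trans (by simp)
    have := hu i
    rw [← abs_mul_abs_self]; nlinarith [abs_nonneg (u i)]
  have hw2 : w ⬝ᵥ w ≤ d * L ^ 2 := by
    refine (sum_le_card_nsmul _ _ (L ^ 2) fun i _ => ?_).trans (by simp)
    have := hw i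
    rw [← abs_mul_abs_self]; nlinarith [abs_nonneg (w i)]
  have hqu : u ⬝ᵥ M *ᵥ u ≤ c * d := (hc u).trans (by gcongr)
  have hqw : w ⬝ᵥ M *ᵥ w ≤ c * (d * L ^ 2) := (hc w).trans (by gcongr)
  have hqu0 := hM.form_nonneg u
  have hqw0 := hM.form_nonneg w
  have h1 : (w + u) ⬝ᵥ M *ᵥ (w + u) =
      w ⬝ᵥ M *ᵥ w + 2 * (w ⬝ᵥ M *ᵥ u) + u ⬝ᵥ M *ᵥ u := by
    have := hM.isHermitian.form_add_smul w u 1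
    simpa using this
  have hsq := hM.sq_form_le w u
  have h2 : |w ⬝ᵥ M *ᵥ u| ≤ c * d * L := by
    refine abs_le_of_sq_le_sq (hsq.trans ?_) (by positivity)
    calc _ ≤ (c * (d * L ^ 2)) * (c * d) := by gcongr
      _ = _ := by ring
  have h3 : c * d ≤ c * d * L := by
    have : 0 ≤ c * d := by positivity
    nlinarith
  rw [h1, abs_le]
  rw [abs_le] at h2
  constructor <;> linarith

/-! ### Approximate membership in an ellipsoid -/

/-- A solution `w` of `X w + lam w = y` that is small in the norms of `X` and of `lam ^ 2`
certifies that `y` is near the ellipsoid with the support function `√(v ⬝ᵥ X *ᵥ v)`. -/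
theorem abs_dotProduct_le_of_resolvent {X : Matrix (Fin d) (Fin d) ℝ} (hX : X.PosSemidef)
    {lam η : ℝ} (hlam : 0 ≤ lam) (hη : 0 ≤ η) {w y : Fin d → ℝ} (hy : X *ᵥ w + lam • w = y)
    (h1 : w ⬝ᵥ X *ᵥ w ≤ 1) (h2 : lam ^ 2 * (w ⬝ᵥ w) ≤ η ^ 2) (v : Fin d → ℝ) :
    |v ⬝ᵥ y| ≤ √(v ⬝ᵥ X *ᵥ v) + η * √(v ⬝ᵥ v) := by
  rw [← hy, dotProduct_add, dotProduct_smul, smul_eq_mul]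
  refine (abs_add_le _ _).trans (add_le_add ?_ ?_)
  · refine (hX.abs_form_le v w).trans (mul_le_of_le_one_right (Real.sqrt_nonneg _) ?_)
    exact Real.sqrt_le_one.2 h1
  · rw [abs_mul, abs_of_nonneg hlam]
    have h3 : lam * √(w ⬝ᵥ w) ≤ η := by
      rw [← Real.sqrt_sq hlam, ← Real.sqrt_mul (sq_nonneg _)]
      exact (Real.sqrt_le_sqrt h2).trans_eq (Real.sqrt_sq hη)
    calc lam * |v ⬝ᵥ w| ≤ lam * (√(v ⬝ᵥ v) * √(w ⬝ᵥ w)) := by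
          gcongr; exact abs_dotProduct_le v w
      _ = (lam * √(w ⬝ᵥ w)) * √(v ⬝ᵥ v) := by ring
      _ ≤ _ := by gcongr

/-- For `y` near the ellipsoid, one of the resolvents with the parameters `1, 2, 4, …` gives
such a certificate, namely the first one that is small in the norm of `X`. -/
theorem exists_resolvent_small {X : Matrix (Fin d) (Fin d) ℝ} (hX : X.PosSemidef) {η : ℝ}
    (hη : 1 ≤ η) {y : Fin d → ℝ} (hy : ∀ v, |v ⬝ᵥ y| ≤ √(v ⬝ᵥ X *ᵥ v) + η * √(v ⬝ᵥ v))
    (w : ℕ → Fin d → ℝ) (hw : ∀ t, X *ᵥ w t + (2 : ℝ) ^ t • w t = y) {b : ℕ}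
    (hb : y ⬝ᵥ y ≤ 2 ^ b) :
    ∃ t ≤ b, w t ⬝ᵥ X *ᵥ w t ≤ 1 ∧ ((2 : ℝ) ^ t) ^ 2 * (w t ⬝ᵥ w t) ≤ (2 * η) ^ 2 := by
  classical
  have hid : ∀ t, w t ⬝ᵥ y = w t ⬝ᵥ X *ᵥ w t + 2 ^ t * (w t ⬝ᵥ w t) := fun t => by
    conv_lhs => rw [← hw t]
    rw [dotProduct_add, dotProduct_smul, smul_eq_mul]
  have hle : ∀ t, w t ⬝ᵥ X *ᵥ w t + 2 ^ t * √(w t ⬝ᵥ w t) ^ 2 ≤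
      √(w t ⬝ᵥ X *ᵥ w t) + η * √(w t ⬝ᵥ w t) := fun t => by
    rw [Real.sq_sqrt (dotProduct_self_nonneg' _), ← hid]
    exact (le_abs_self _).trans (hy _)
  -- as `y ⬝ᵥ y ≤ 2 ^ b`, the resolvent with the parameter `2 ^ b` is small
  have hwb : w b ⬝ᵥ X *ᵥ w b ≤ 1 := by
    have h1 : w b ⬝ᵥ y ≤ √(w b ⬝ᵥ w b) * √(y ⬝ᵥ y) := (le_abs_self _).trans (abs_dotProduct_le _ _)
    set r := √(w b ⬝ᵥ w b) with hr
    set s := √(y ⬝ᵥ y) with hs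
    have hr2 : r ^ 2 = w b ⬝ᵥ w b := Real.sq_sqrt (dotProduct_self_nonneg' _)
    have hs2 : s ^ 2 ≤ 2 ^ b := by rw [hs, Real.sq_sqrt (dotProduct_self_nonneg' _)]; exact hb
    have h2 := hid b
    rw [← hr2] at h2
    have hX0 := hX.form_nonneg (w b)
    have hp : (0 : ℝ) < 2 ^ b := by positivity
    have h3 : (2 : ℝ) ^ b * r ^ 2 ≤ r * s := by linarith
    by_contra hcon
    push Not at hcon
    have h4 : 1 < r * s := by nlinarith
    have h5 : (r * s) ^ 2 ≤ r * s := by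
      calc (r * s) ^ 2 = r ^ 2 * s ^ 2 := by ring
        _ ≤ r ^ 2 * 2 ^ b := by gcongr
        _ ≤ r * s := by linarith
    nlinarith
  have hex : ∃ t, w t ⬝ᵥ X *ᵥ w t ≤ 1 := ⟨b, hwb⟩
  have hfind := Nat.find_spec hex
  set t := Nat.find hex with ht
  have htb : t ≤ b := Nat.find_min' hex hwb
  refine ⟨t, htb, hfind, ?_⟩
  have hsuff : ∀ {t : ℕ}, (2 : ℝ) ^ t * √(w t ⬝ᵥ w t) ≤ 2 * η →
      ((2 : ℝ) ^ t) ^ 2 * (w t ⬝ᵥ w t) ≤ (2 * η) ^ 2 := fun {t} h => by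
    rw [← Real.sq_sqrt (dotProduct_self_nonneg' (w t)), ← mul_pow]
    exact pow_le_pow_left₀ (by positivity) h 2
  refine hsuff ?_
  rcases Nat.eq_zero_or_pos t with h0 | hpos
  · rw [h0] at hfind ⊢
    have h1 := hle 0
    have h2 := hX.form_nonneg (w 0)
    set q := √(w 0 ⬝ᵥ X *ᵥ w 0) with hq
    set r := √(w 0 ⬝ᵥ w 0) with hr
    have hq2 : q ^ 2 = w 0 ⬝ᵥ X *ᵥ w 0 := Real.sq_sqrt h2
    rw [← hq2] at h1
    simp only [pow_zero, one_mul] at h1 ⊢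
    by_contra hcon
    push Not at hcon
    nlinarith [sq_nonneg (q - 1 / 2)]
  · obtain ⟨t', htt⟩ : ∃ t', t = t' + 1 := ⟨t - 1, by omega⟩
    have hprev : 1 < w t' ⬝ᵥ X *ᵥ w t' := by
      have := Nat.find_min hex (m := t') (by omega)
      exact not_le.1 this
    have h1 := hle t'
    set q := √(w t' ⬝ᵥ X *ᵥ w t') with hq
    set r := √(w t' ⬝ᵥ w t') with hr
    have hq2 : q ^ 2 = w t' ⬝ᵥ X *ᵥ w t' := Real.sq_sqrt (hX.form_nonneg _)
    have hq1 : 1 < q := by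
      rw [hq]; exact (Real.lt_sqrt zero_le_one).2 (by simpa using hprev)
    rw [← hq2] at h1
    have hr0 : 0 ≤ r := Real.sqrt_nonneg _
    have h2 : (2 : ℝ) ^ t' * r ≤ η := by
      by_contra hcon
      push Not at hcon
      have : η * r ≤ 2 ^ t' * r * r := by gcongr
      nlinarith
    -- the norm of the resolvent decreases with the parameter
    have h3 : √(w t ⬝ᵥ w t) ≤ r := by
      have e1 : X *ᵥ w t + (2 : ℝ) ^ t • w t = X *ᵥ w t' + (2 : ℝ) ^ t' • w t' := by
        rw [hw, hw]
      have e2 := congrArg (fun x => (w t' - w t) ⬝ᵥ x) e1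
      simp only [dotProduct_add, dotProduct_smul, smul_eq_mul] at e2
      have e3 := hX.form_nonneg (w t' - w t)
      rw [mulVec_sub, dotProduct_sub] at e3
      set A := (w t' - w t) ⬝ᵥ X *ᵥ w t
      set B := (w t' - w t) ⬝ᵥ X *ᵥ w t'
      have hp : (2 : ℝ) ^ t = 2 * 2 ^ t' := by rw [htt, pow_succ]; ring
      rw [hp, sub_dotProduct, sub_dotProduct, dotProduct_comm (w t') (w t)] at e2
      have hpp : (0 : ℝ) < 2 ^ t' := by positivity
      have e4 : 2 * (w t ⬝ᵥ w t') - 2 * (w t ⬝ᵥ w t) ≥ w t' ⬝ᵥ w t' - w t ⬝ᵥ w t' := by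
        by_contra hcon
        push Not at hcon
        nlinarith
      have e5 := abs_dotProduct_le (w t) (w t')
      have e6 := (le_abs_self _).trans e5
      set ρ := √(w t ⬝ᵥ w t) with hρ
      have hρ2 : ρ ^ 2 = w t ⬝ᵥ w t := Real.sq_sqrt (dotProduct_self_nonneg' _)
      have hr2 : r ^ 2 = w t' ⬝ᵥ w t' := Real.sq_sqrt (dotProduct_self_nonneg' _)
      rw [← hρ2, ← hr2] at e4
      have hρ0 : 0 ≤ ρ := Real.sqrt_nonneg _
      by_contra hcon
      push Not at hcon
      nlinarith
    rw [htt, pow_succ] at *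
    nlinarith [mul_le_mul_of_nonneg_left h3 (by positivity : (0 : ℝ) ≤ 2 ^ t')]

/-! ### Capping a quadratic form -/

section Cap

variable {Y P : Matrix (Fin d) (Fin d) ℝ} {K : ℝ}

/-- The cap of `Y` at the level `K`, that is, `K Y (K + Y)⁻¹`, when `P` is the inverse
of `K + Y`. -/
def capForm (K : ℝ) (P : Matrix (Fin d) (Fin d) ℝ) : Matrix (Fin d) (Fin d) ℝ :=
  K • 1 - K ^ 2 • P

theorem capForm_eq (hP : (K • 1 + Y) * P = 1) (v : Fin d → ℝ) :
    v ⬝ᵥ capForm K P *ᵥ v =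
      K ^ 2 * ((P *ᵥ v) ⬝ᵥ Y *ᵥ (P *ᵥ v)) + K * ((Y *ᵥ P *ᵥ v) ⬝ᵥ (Y *ᵥ P *ᵥ v)) ∧
    v = Y *ᵥ P *ᵥ v + K • P *ᵥ v := by
  have hv : v = Y *ᵥ P *ᵥ v + K • P *ᵥ v := by
    have := congrArg (fun A => A *ᵥ v) hP
    simp only [one_mulVec, ← mulVec_mulVec, add_mulVec, smul_mulVec] at this
    rw [add_comm, this]
  refine ⟨?_, hv⟩
  set t := P *ᵥ v with ht
  have hsym : (Y *ᵥ t) ⬝ᵥ t = t ⬝ᵥ Y *ᵥ t := dotProduct_comm _ _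
  rw [capForm, sub_mulVec, smul_mulVec, smul_mulVec, one_mulVec, ← ht, hv]
  simp only [add_dotProduct, dotProduct_add, dotProduct_sub, smul_dotProduct, dotProduct_smul,
    smul_eq_mul, hsym]
  ring

theorem capForm_le (hY : Y.PosSemidef) (hP : (K • 1 + Y) * P = 1) (hK : 0 ≤ K)
    (v : Fin d → ℝ) : v ⬝ᵥ capForm K P *ᵥ v ≤ v ⬝ᵥ Y *ᵥ v := by
  obtain ⟨h1, hv⟩ := capForm_eq hP v
  set t := P *ᵥ v with ht
  rw [h1]
  have h2 := hY.isHermitian.form_add_smul (Y *ᵥ t) t K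
  rw [← hv] at h2
  have h3 := hY.form_nonneg (Y *ᵥ t)
  have h4 := mul_nonneg hK (dotProduct_self_nonneg' (Y *ᵥ t))
  rw [h2]; linarith

theorem capForm_le_level (hY : Y.PosSemidef) (hP : (K • 1 + Y) * P = 1) (hK : 0 ≤ K)
    (v : Fin d → ℝ) : v ⬝ᵥ capForm K P *ᵥ v ≤ K * (v ⬝ᵥ v) := by
  obtain ⟨-, hv⟩ := capForm_eq hP v
  set t := P *ᵥ v with ht
  have h1 : v ⬝ᵥ capForm K P *ᵥ v = K * (v ⬝ᵥ v) - K ^ 2 * (v ⬝ᵥ t) := by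
    rw [capForm, sub_mulVec, smul_mulVec, smul_mulVec, one_mulVec,
      dotProduct_sub, dotProduct_smul, dotProduct_smul, smul_eq_mul, smul_eq_mul]
  have h2 : 0 ≤ v ⬝ᵥ t := by
    conv_rhs => rw [hv]
    rw [add_dotProduct, smul_dotProduct, smul_eq_mul, dotProduct_comm (Y *ᵥ t)]
    exact add_nonneg (hY.form_nonneg t) (mul_nonneg hK (dotProduct_self_nonneg' t))
  rw [h1]
  nlinarith [mul_nonneg (sq_nonneg K) h2]

theorem posSemidef_capForm (hY : Y.PosSemidef) (hP : (K • 1 + Y) * P = 1) (hK : 0 ≤ K) :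
    (capForm K P).PosSemidef := by
  have hH : (K • 1 + Y).IsHermitian :=
    ((PosSemidef.one (n := Fin d) (R := ℝ)).smul hK).isHermitian.add hY.isHermitian
  have hPH : P.IsHermitian := by
    have h1 : P = (K • 1 + Y)⁻¹ := (inv_eq_right_inv hP).symm
    rw [h1]; exact hH.inv
  refine PosSemidef.of_dotProduct_mulVec_nonneg ?_ fun v => ?_
  · rw [IsHermitian, capForm, conjTranspose_sub, conjTranspose_smul,
      conjTranspose_smul, hPH.eq, conjTranspose_one, star_trivial, star_trivial]
  · rw [star_trivial, (capForm_eq hP v).1]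
    have h3 := hY.form_nonneg (P *ᵥ v)
    have h4 := mul_nonneg hK (dotProduct_self_nonneg' (Y *ᵥ P *ᵥ v))
    positivity

/-- The cap of `Y` dominates, up to the factor `1 + c / K`, every form that is below `Y` and below
`c`. -/
theorem form_le_capForm (hP : (K • 1 + Y) * P = 1) (hK : 0 < K) {c : ℝ}
    (hc : 0 < c) {Q : Matrix (Fin d) (Fin d) ℝ} (hQ : Q.PosSemidef)
    (hQY : ∀ v : Fin d → ℝ, v ⬝ᵥ Q *ᵥ v ≤ v ⬝ᵥ Y *ᵥ v)
    (hQc : ∀ v : Fin d → ℝ, v ⬝ᵥ Q *ᵥ v ≤ c * (v ⬝ᵥ v)) (v : Fin d → ℝ) :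
    v ⬝ᵥ Q *ᵥ v ≤ (1 + c / K) * (v ⬝ᵥ capForm K P *ᵥ v) := by
  obtain ⟨h1, hv⟩ := capForm_eq hP v
  set t := P *ᵥ v with ht
  rw [h1]
  have hexp := hQ.isHermitian.form_add_smul (Y *ᵥ t) t K
  rw [← hv] at hexp
  -- weighted arithmetic-geometric mean inequality for the mixed term
  have hmix := hQ.form_nonneg (Y *ᵥ t + (-c) • t)
  rw [hQ.isHermitian.form_add_smul] at hmix
  have h2 := hQY t
  have h3 := hQc (Y *ᵥ t)
  set α := t ⬝ᵥ Q *ᵥ t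
  set β := (Y *ᵥ t) ⬝ᵥ Q *ᵥ t
  set γ := (Y *ᵥ t) ⬝ᵥ Q *ᵥ (Y *ᵥ t)
  set α' := t ⬝ᵥ Y *ᵥ t
  set γ' := (Y *ᵥ t) ⬝ᵥ (Y *ᵥ t)
  rw [hexp]
  have e1 : 2 * K * β ≤ K * c * α + K / c * γ := by
    have := mul_nonneg (by positivity : 0 ≤ K / c) hmix
    have e : K / c * (γ + 2 * -c * β + (-c) ^ 2 * α) = K * c * α - 2 * K * β + K / c * γ := by
      field_simp; ring
    linarith
  have e2 : (K ^ 2 + K * c) * α ≤ (K ^ 2 + K * c) * α' := by gcongr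
  have e3 : (1 + K / c) * γ ≤ (1 + K / c) * (c * γ') := by gcongr
  have e4 : (1 + c / K) * (K ^ 2 * α' + K * γ') =
      (K ^ 2 + K * c) * α' + (1 + K / c) * (c * γ') := by
    field_simp; ring
  rw [e4]
  nlinarith

end Cap

end QuadraticForms

/-! ### From integral vectors to all vectors -/

section Net

variable {d : ℕ}

/-- A multiple of a nonzero vector whose largest entry has absolute value `L`, rounded down. -/
theorem exists_floor_smul {v : Fin d → ℝ} (hv : v ≠ 0) (L : ℕ) (hL : 1 ≤ L) :
    ∃ c : ℝ, 0 < c ∧ ∃ w : Fin d → ℤ, (∀ i, |w i| ≤ L) ∧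
      (∀ i, 0 ≤ c * v i - w i ∧ c * v i - w i ≤ 1) ∧ (L : ℝ) ^ 2 ≤ c ^ 2 * (v ⬝ᵥ v) := by
  have hL' : (1 : ℝ) ≤ L := by exact_mod_cast hL
  have hn : 0 < ‖v‖ := norm_pos_iff.2 hv
  have hne : Nonempty (Fin d) := by
    by_contra h
    rw [not_nonempty_iff] at h
    exact hv (Subsingleton.elim _ _)
  obtain ⟨i₀, hi₀⟩ : ∃ i, ‖v‖ = |v i| := by
    obtain ⟨i, -, hi⟩ := exists_mem_eq_sup' (f := fun i => |v i|)
      (univ_nonempty (α := Fin d))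
    refine ⟨i, le_antisymm ?_ ?_⟩
    · rw [pi_norm_le_iff_of_nonneg (abs_nonneg _)]
      intro j
      rw [← hi]
      exact le_sup' (fun i => |v i|) (mem_univ j)
    · exact norm_le_pi_norm v i
  have hc : 0 < L / ‖v‖ := by positivity
  have habs : ∀ i, |L / ‖v‖ * v i| ≤ L := fun i => by
    rw [abs_mul, abs_of_pos hc]
    have := norm_le_pi_norm v i
    rw [Real.norm_eq_abs] at this
    calc L / ‖v‖ * |v i| ≤ L / ‖v‖ * ‖v‖ := by gcongr
      _ = L := by field_simp
  refine ⟨L / ‖v‖, hc, fun i => ⌊L / ‖v‖ * v i⌋, fun i => ?_, fun i => ⟨?_, ?_⟩, ?_⟩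
  · have := abs_le.1 (habs i)
    rw [abs_le]
    constructor
    · rw [Int.le_floor]; push_cast; exact this.1
    · exact_mod_cast (Int.floor_le _).trans this.2
  · linarith [Int.floor_le (L / ‖v‖ * v i)]
  · linarith [Int.lt_floor_add_one (L / ‖v‖ * v i)]
  · have h1 : v i₀ * v i₀ ≤ v ⬝ᵥ v :=
      single_le_sum (f := fun i => v i * v i) (fun i _ => mul_self_nonneg _)
        (mem_univ i₀)
    calc (L : ℝ) ^ 2 = (L / ‖v‖) ^ 2 * (v i₀ * v i₀) := by
          rw [← abs_mul_abs_self, ← hi₀]; field_simp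
      _ ≤ _ := by gcongr

/-- The integral vectors with coordinates of size at most `L`. -/
def intNet (d L : ℕ) : Set (Fin d → ℝ) :=
  {y | ∃ w : Fin d → ℤ, (∀ i, |w i| ≤ L) ∧ y = fun i => (w i : ℝ)}

/-- An inequality between quadratic forms on integral vectors extends to all vectors, up to
a small error. -/
theorem form_le_of_net {Q U : Matrix (Fin d) (Fin d) ℝ} (hQ : Q.PosSemidef) (hU : U.PosSemidef)
    {a b δ : ℝ} (hQa : ∀ v : Fin d → ℝ, v ⬝ᵥ Q *ᵥ v ≤ a * (v ⬝ᵥ v))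
    (hUb : ∀ v : Fin d → ℝ, v ⬝ᵥ U *ᵥ v ≤ b * (v ⬝ᵥ v)) (ha : 0 ≤ a) (hb : 0 ≤ b) (hδ : 0 ≤ δ)
    {L : ℕ} (hL : 1 ≤ L)
    (h : ∀ y ∈ intNet d L, y ⬝ᵥ Q *ᵥ y ≤ y ⬝ᵥ U *ᵥ y + δ) (v : Fin d → ℝ) :
    v ⬝ᵥ Q *ᵥ v ≤ v ⬝ᵥ U *ᵥ v + (δ + 3 * (a + b) * d * L) / L ^ 2 * (v ⬝ᵥ v) := by
  have hL' : (1 : ℝ) ≤ L := by exact_mod_cast hL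
  by_cases hv : v = 0
  · subst hv; simp
  obtain ⟨c, hc, w, hwL, hw, hcv⟩ := exists_floor_smul hv L hL
  set wr : Fin d → ℝ := fun i => (w i : ℝ) with hwr
  have hcw : c • v = wr + (c • v - wr) := by abel
  have hu : ∀ i, |(c • v - wr) i| ≤ 1 := fun i => by
    simp only [Pi.sub_apply, Pi.smul_apply, smul_eq_mul, hwr]
    rw [abs_of_nonneg (hw i).1]; exact (hw i).2
  have hwL' : ∀ i, |wr i| ≤ L := fun i => by simp only [hwr]; exact_mod_cast hwL i
  have h1 := hQ.abs_form_sub_le hL' hQa ha hu hwL'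
  have h2 := hU.abs_form_sub_le hL' hUb hb hu hwL'
  rw [← hcw] at h1 h2
  have h3 := h wr ⟨w, hwL, rfl⟩
  have hs : ∀ M : Matrix (Fin d) (Fin d) ℝ, (c • v) ⬝ᵥ M *ᵥ (c • v) = c ^ 2 * (v ⬝ᵥ M *ᵥ v) := by
    intro M
    rw [mulVec_smul, smul_dotProduct, dotProduct_smul, smul_eq_mul, smul_eq_mul]; ring
  rw [hs] at h1 h2
  have hc2 : 0 < c ^ 2 := by positivity
  have hvv := dotProduct_self_nonneg' v
  -- `L ^ 2 ≤ c ^ 2 * (v ⬝ᵥ v)` turns the absolute error into a relative one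
  have h4 : δ + 3 * (a + b) * d * L ≤
      c ^ 2 * ((δ + 3 * (a + b) * d * L) / L ^ 2 * (v ⬝ᵥ v)) := by
    have e : (0 : ℝ) ≤ (δ + 3 * (a + b) * d * L) / L ^ 2 := by positivity
    calc δ + 3 * (a + b) * d * L = (δ + 3 * (a + b) * d * L) / L ^ 2 * L ^ 2 := by field_simp
      _ ≤ (δ + 3 * (a + b) * d * L) / L ^ 2 * (c ^ 2 * (v ⬝ᵥ v)) := by gcongr
      _ = _ := by ring
  have h5 : c ^ 2 * (v ⬝ᵥ Q *ᵥ v) ≤ c ^ 2 * (v ⬝ᵥ U *ᵥ v + (δ + 3 * (a + b) * d * L) / L ^ 2 *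
      (v ⬝ᵥ v)) := by
    rw [mul_add]
    have := abs_le.1 h1
    have := abs_le.1 h2
    linarith
  exact le_of_mul_le_mul_left h5 hc2

/-- If, in every integral direction, `m` is not much farther out than some nonnegative vector
close to `μ`, then `m` is close to `μ`. -/
theorem dotProduct_sub_le_of_net {m μ : Fin d → ℝ} {a b δ : ℝ} {X : Matrix (Fin d) (Fin d) ℝ}
    (hm : ∀ i, m i ≤ a) (ha : 0 ≤ a) (hδ : 0 ≤ δ) {L : ℕ} (hL : 1 ≤ L)
    (h : ∀ y ∈ intNet d L, ∃ g : Fin d → ℝ, 0 ≤ g ∧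
      (∀ v : Fin d → ℝ, v ⬝ᵥ (g - μ) ≤ √(v ⬝ᵥ X *ᵥ v) + b * √(v ⬝ᵥ v)) ∧
      y ⬝ᵥ m ≤ y ⬝ᵥ g + δ) (v : Fin d → ℝ) :
    v ⬝ᵥ (m - μ) ≤ √(v ⬝ᵥ X *ᵥ v) + (b + (δ + d * a) / L) * √(v ⬝ᵥ v) := by
  have hL' : (1 : ℝ) ≤ L := by exact_mod_cast hL
  by_cases hv : v = 0
  · subst hv; simp
  obtain ⟨c, hc, w, hwL, hw, hcv⟩ := exists_floor_smul hv L hL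
  obtain ⟨g, hg, hgv, hgm⟩ := h _ ⟨w, hwL, rfl⟩
  set wr : Fin d → ℝ := fun i => (w i : ℝ) with hwr
  -- the entries of `c • v - wr` are nonnegative, so no upper bound for `g` is needed
  have h1 : (c • v - wr) ⬝ᵥ (m - g) ≤ d * a := by
    refine (sum_le_card_nsmul _ _ a fun i _ => ?_).trans (by simp)
    simp only [Pi.sub_apply, Pi.smul_apply, smul_eq_mul, hwr]
    have e1 := hw i
    have e2 : m i - g i ≤ a := by linarith [hm i, hg i, show (0 : Fin d → ℝ) i = 0 from rfl]
    nlinarith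
  have h2 := hgv v
  have h3 : (c • v) ⬝ᵥ (m - μ) =
      (wr ⬝ᵥ m - wr ⬝ᵥ g) + (c • v - wr) ⬝ᵥ (m - g) + c * (v ⬝ᵥ (g - μ)) := by
    simp only [sub_dotProduct, dotProduct_sub, smul_dotProduct, smul_eq_mul]; ring
  rw [smul_dotProduct, smul_eq_mul] at h3
  have h4 : (L : ℝ) ≤ c * √(v ⬝ᵥ v) := by
    rw [← Real.sqrt_sq hc.le, ← Real.sqrt_mul (sq_nonneg c)]
    exact Real.le_sqrt_of_sq_le hcv
  have h5 : δ + d * a ≤ c * ((δ + d * a) / L * √(v ⬝ᵥ v)) := by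
    calc δ + d * a = (δ + d * a) / L * L := by field_simp
      _ ≤ (δ + d * a) / L * (c * √(v ⬝ᵥ v)) := by gcongr
      _ = _ := by ring
  have h6 : c * (v ⬝ᵥ (g - μ)) ≤ c * (√(v ⬝ᵥ X *ᵥ v) + b * √(v ⬝ᵥ v)) := by gcongr
  refine le_of_mul_le_mul_left ?_ hc
  rw [h3]
  have : c * (√(v ⬝ᵥ X *ᵥ v) + (b + (δ + d * a) / L) * √(v ⬝ᵥ v)) =
    c * (√(v ⬝ᵥ X *ᵥ v) + b * √(v ⬝ᵥ v)) + c * ((δ + d * a) / L * √(v ⬝ᵥ v)) := by ring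
  rw [this]
  linarith

end Net

/-! ### Covariance matrices of categorical vectors -/

section TypeCov

variable {d : ℕ}

/-- The covariance matrix of the projection of a categorical random vector, where `x` holds
all but the last of the probabilities. -/
def typeCov (x : Fin d → ℝ) : Matrix (Fin d) (Fin d) ℝ := diagonal x - vecMulVec x x

theorem typeCov_form (x v : Fin d → ℝ) :
    v ⬝ᵥ typeCov x *ᵥ v = ∑ i, v i ^ 2 * x i - (v ⬝ᵥ x) ^ 2 := by
  rw [typeCov, sub_mulVec, dotProduct_sub]
  congr 1
  · simp only [dotProduct, mulVec_diagonal]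
    exact sum_congr rfl fun i _ => by ring
  · have : vecMulVec x x *ᵥ v = (v ⬝ᵥ x) • x := by
      ext i
      simp only [mulVec, Matrix.vecMulVec_apply, dotProduct, Pi.smul_apply, smul_eq_mul,
        sum_mul]
      exact sum_congr rfl fun j _ => by ring
    rw [this, dotProduct_smul, smul_eq_mul]; ring

theorem typeCov_form_eq_dirVar (p : Fin (d + 1) → ℝ) (v : Fin d → ℝ) :
    v ⬝ᵥ typeCov (fun i => p i.castSucc) *ᵥ v = dirVar v p := by
  rw [typeCov_form]; rfl

/-- The vectors of all but the last of the probabilities in a probability vector. -/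
def IsSubprob (x : Fin d → ℝ) : Prop := 0 ≤ x ∧ ∑ i, x i ≤ 1

theorem IsSubprob.sq_dotProduct_le {x : Fin d → ℝ} (hx : IsSubprob x) (v : Fin d → ℝ) :
    (v ⬝ᵥ x) ^ 2 ≤ ∑ i, v i ^ 2 * x i := by
  have h := sum_mul_sq_le_sq_mul_sq univ (fun i => v i * √(x i)) fun i => √(x i)
  have e1 : ∀ i, v i * √(x i) * √(x i) = v i * x i := fun i => by
    rw [mul_assoc, Real.mul_self_sqrt (hx.1 i)]
  have e2 : ∀ i, (v i * √(x i)) ^ 2 = v i ^ 2 * x i := fun i => by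
    rw [mul_pow, Real.sq_sqrt (hx.1 i)]
  have e3 : ∀ i, √(x i) ^ 2 = x i := fun i => Real.sq_sqrt (hx.1 i)
  simp only [e1, e2, e3] at h
  refine h.trans (mul_le_of_le_one_right ?_ hx.2)
  exact sum_nonneg fun i _ => mul_nonneg (sq_nonneg _) (hx.1 i)

theorem IsSubprob.sum_sq_mul_le {x : Fin d → ℝ} (hx : IsSubprob x) (v : Fin d → ℝ) :
    ∑ i, v i ^ 2 * x i ≤ v ⬝ᵥ v := by
  refine sum_le_sum fun i _ => ?_
  have : x i ≤ 1 := (single_le_sum (fun j _ => hx.1 j) (mem_univ i)).trans hx.2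
  nlinarith [sq_nonneg (v i)]

theorem IsSubprob.abs_dotProduct_le {x : Fin d → ℝ} (hx : IsSubprob x) (v : Fin d → ℝ) :
    |v ⬝ᵥ x| ≤ √(v ⬝ᵥ v) :=
  Real.abs_le_sqrt ((hx.sq_dotProduct_le v).trans (hx.sum_sq_mul_le v))

theorem IsSubprob.typeCov_form_nonneg {x : Fin d → ℝ} (hx : IsSubprob x) (v : Fin d → ℝ) :
    0 ≤ v ⬝ᵥ typeCov x *ᵥ v := by
  rw [typeCov_form]; linarith [hx.sq_dotProduct_le v]

theorem IsSubprob.typeCov_form_le {x : Fin d → ℝ} (hx : IsSubprob x) (v : Fin d → ℝ) :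
    v ⬝ᵥ typeCov x *ᵥ v ≤ v ⬝ᵥ v := by
  rw [typeCov_form]; linarith [hx.sum_sq_mul_le v, sq_nonneg (v ⬝ᵥ x)]

theorem IsSubprob.posSemidef_typeCov {x : Fin d → ℝ} (hx : IsSubprob x) :
    (typeCov x).PosSemidef := by
  refine PosSemidef.of_dotProduct_mulVec_nonneg ?_ fun v => ?_
  · ext i j
    simp only [typeCov, Matrix.conjTranspose_apply, Matrix.sub_apply, Matrix.vecMulVec_apply,
      Matrix.diagonal_apply, star_trivial, mul_comm (x j), eq_comm (a := j)]
    split_ifs with h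
    · rw [h]
    · rfl
  · simpa using hx.typeCov_form_nonneg v

theorem isSubprob_of_mem_stdSimplex {p : Fin (d + 1) → ℝ} (hp : p ∈ stdSimplex ℝ (Fin (d + 1))) :
    IsSubprob fun i => p i.castSucc := by
  refine ⟨fun i => hp.1 _, ?_⟩
  have := hp.2
  rw [Fin.sum_univ_castSucc] at this
  linarith [hp.1 (Fin.last d)]

/-- The weighted sum of covariance matrices of categorical vectors. -/
def mixCov {ι : Type*} (s : Finset ι) (f : ι → ℝ) (x : ι → Fin d → ℝ) :
    Matrix (Fin d) (Fin d) ℝ := ∑ c ∈ s, f c • typeCov (x c)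

variable {ι : Type*} {s : Finset ι} {f f' : ι → ℝ} {x : ι → Fin d → ℝ}

theorem mixCov_form (v : Fin d → ℝ) :
    v ⬝ᵥ mixCov s f x *ᵥ v = ∑ c ∈ s, f c * (v ⬝ᵥ typeCov (x c) *ᵥ v) := by
  rw [mixCov, sum_mulVec, dotProduct_sum]
  simp only [smul_form]

theorem posSemidef_mixCov (hf : ∀ c ∈ s, 0 ≤ f c) (hx : ∀ c ∈ s, f c ≠ 0 → IsSubprob (x c)) :
    (mixCov s f x).PosSemidef := by
  refine posSemidef_sum s fun c hc => ?_
  by_cases h : f c = 0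
  · rw [h, zero_smul]; exact PosSemidef.zero
  · exact (hx c hc h).posSemidef_typeCov.smul (hf c hc)

theorem mixCov_form_le (hf : ∀ c ∈ s, 0 ≤ f c) (hx : ∀ c ∈ s, f c ≠ 0 → IsSubprob (x c))
    (v : Fin d → ℝ) : v ⬝ᵥ mixCov s f x *ᵥ v ≤ (∑ c ∈ s, f c) * (v ⬝ᵥ v) := by
  rw [mixCov_form, sum_mul]
  refine sum_le_sum fun c hc => ?_
  by_cases h : f c = 0
  · simp [h]
  · exact mul_le_mul_of_nonneg_left ((hx c hc h).typeCov_form_le v) (hf c hc)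

end TypeCov

/-! ### Spectral closeness of a rounded fractional solution -/

section Closeness

variable {n d : ℕ} {μ : Fin d → ℝ} {S : Matrix (Fin d) (Fin d) ℝ} {ε₁ ε₂ : ℝ}

/-- What the theorem assumes of the given mean and covariance, in terms of the rows
of a matrix that realizes them approximately. -/
structure IsRealizedBy (μ : Fin d → ℝ) (S : Matrix (Fin d) (Fin d) ℝ) (ε₁ ε₂ : ℝ)
    (π : Fin n → Fin (d + 1) → ℝ) : Prop where
  posSemidef : S.PosSemidef
  stochastic : IsRowStochastic π
  mean : ∀ v : Fin d → ℝ, |v ⬝ᵥ (μ - meanVec (gmdLaw π))| ≤ ε₁ * √(v ⬝ᵥ S *ᵥ v)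
  cov : ∀ v : Fin d → ℝ, |v ⬝ᵥ (S - covMat (gmdLaw π)) *ᵥ v| ≤ ε₂ * (v ⬝ᵥ S *ᵥ v)

theorem norm_eq_sqrt_dotProduct (v : EuclideanSpace ℝ (Fin d)) : ‖v‖ = √(v.ofLp ⬝ᵥ v.ofLp) := by
  rw [EuclideanSpace.norm_eq]
  congr 1
  exact sum_congr rfl fun i _ => by rw [Real.norm_eq_abs, sq_abs, sq]

theorem dotProduct_meanVec_gmdLaw {π : Fin n → Fin (d + 1) → ℝ} (hπ : IsRowStochastic π)
    (v : Fin d → ℝ) : v ⬝ᵥ meanVec (gmdLaw π) = ∑ i, v ⬝ᵥ fun j : Fin d => π i j.castSucc := by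
  simp only [dotProduct]
  rw [sum_comm]
  exact sum_congr rfl fun j _ => by rw [meanVec_gmdLaw hπ, mul_sum]

theorem covMat_gmdLaw_form {π : Fin n → Fin (d + 1) → ℝ} (hπ : IsRowStochastic π)
    (v : Fin d → ℝ) : v ⬝ᵥ covMat (gmdLaw π) *ᵥ v =
      ∑ i, v ⬝ᵥ typeCov (fun j => π i j.castSucc) *ᵥ v := by
  rw [dotProduct_covMat_gmdLaw hπ]
  exact sum_congr rfl fun i _ => (typeCov_form_eq_dirVar _ _).symm

theorem covMat_gmdLaw_form_le {π : Fin n → Fin (d + 1) → ℝ} (hπ : IsRowStochastic π)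
    (v : Fin d → ℝ) : v ⬝ᵥ covMat (gmdLaw π) *ᵥ v ≤ n * (v ⬝ᵥ v) := by
  rw [covMat_gmdLaw_form hπ]
  exact (sum_le_card_nsmul _ _ _ fun i _ =>
    (isSubprob_of_mem_stdSimplex (hπ i)).typeCov_form_le v).trans (by simp)

theorem exists_isRealizedBy (hS : S.PosSemidef)
    (h : ∃ ρ : Measure (Fin d → ℝ), IsGMD n ρ ∧ SpectrallyClose μ S ρ ε₁ ε₂ 0 0) :
    ∃ π : Fin n → Fin (d + 1) → ℝ, IsRealizedBy μ S ε₁ ε₂ π := by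
  obtain ⟨ρ, ⟨π, hπ, rfl⟩, hρ⟩ := h
  exact ⟨π, hS, hπ, fun v => by simpa using (hρ (WithLp.toLp 2 v)).1,
    fun v => by simpa using (hρ (WithLp.toLp 2 v)).2⟩

namespace IsRealizedBy

variable {π : Fin n → Fin (d + 1) → ℝ} (H : IsRealizedBy μ S ε₁ ε₂ π)
include H

theorem sqrt_form_le (v : Fin d → ℝ) :
    √(v ⬝ᵥ (ε₁ ^ 2 • S) *ᵥ v) ≤ ε₁ * √(v ⬝ᵥ S *ᵥ v) := by
  have h := (abs_nonneg _).trans (H.mean v)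
  rw [smul_form, Real.sqrt_mul (sq_nonneg _),
    Real.sqrt_sq_eq_abs]
  rcases le_total 0 ε₁ with h1 | h1
  · rw [abs_of_nonneg h1]
  · have h0 : ε₁ * √(v ⬝ᵥ S *ᵥ v) = 0 :=
      le_antisymm (mul_nonpos_of_nonpos_of_nonneg h1 (Real.sqrt_nonneg _)) h
    rw [abs_of_nonpos h1]; linarith

theorem mul_form_nonneg (v : Fin d → ℝ) : 0 ≤ ε₂ * (v ⬝ᵥ S *ᵥ v) :=
  (abs_nonneg _).trans (H.cov v)

theorem posSemidef_upper : ((1 + ε₂) • S).PosSemidef := by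
  refine PosSemidef.of_dotProduct_mulVec_nonneg ?_ fun v => ?_
  · rw [IsHermitian, conjTranspose_smul, H.posSemidef.isHermitian.eq, star_trivial]
  · rw [star_trivial, smul_form]
    linarith [H.mul_form_nonneg v, H.posSemidef.form_nonneg v]

theorem cov_form (v : Fin d → ℝ) : v ⬝ᵥ covMat (gmdLaw π) *ᵥ v =
    v ⬝ᵥ mixCov univ (fun _ => (1 : ℝ)) (fun i j => π i j.castSucc) *ᵥ v := by
  simp only [covMat_gmdLaw_form H.stochastic, mixCov_form, one_mul]

theorem cov_form_le_upper (v : Fin d → ℝ) :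
    v ⬝ᵥ covMat (gmdLaw π) *ᵥ v ≤ v ⬝ᵥ ((1 + ε₂) • S) *ᵥ v := by
  have := abs_le.1 (H.cov v)
  rw [sub_mulVec, dotProduct_sub] at this
  rw [smul_form]
  linarith

theorem lower_le_cov_form (v : Fin d → ℝ) :
    v ⬝ᵥ (max (1 - ε₂) 0 • S) *ᵥ v ≤ v ⬝ᵥ covMat (gmdLaw π) *ᵥ v := by
  rw [smul_form]
  rcases le_total (1 - ε₂) 0 with h | h
  · rw [max_eq_right h, zero_mul, H.cov_form]
    exact (posSemidef_mixCov (fun _ _ => zero_le_one) fun i _ _ =>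
      isSubprob_of_mem_stdSimplex (H.stochastic i)).form_nonneg v
  · rw [max_eq_left h]
    have := abs_le.1 (H.cov v)
    rw [sub_mulVec, dotProduct_sub] at this
    linarith

theorem abs_mean_dotProduct_le (v : Fin d → ℝ) :
    |v ⬝ᵥ meanVec (gmdLaw π)| ≤ n * √(v ⬝ᵥ v) := by
  rw [dotProduct_meanVec_gmdLaw H.stochastic]
  refine (abs_sum_le_sum_abs _ _).trans ((sum_le_card_nsmul _ _ _ fun i _ =>
    (isSubprob_of_mem_stdSimplex (H.stochastic i)).abs_dotProduct_le v).trans (by simp))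

end IsRealizedBy

theorem sq_le_rpow_five_half {k : ℝ} (hk : 1 ≤ k) : k ^ 2 ≤ k ^ (5 / 2 : ℝ) := by
  rw [← Real.rpow_natCast]
  exact Real.rpow_le_rpow_of_exponent_le hk (by norm_num)

/-- When there are few summands, a deterministic vector is good enough. -/
theorem IsRealizedBy.spectrallyClose_single {π : Fin n → Fin (d + 1) → ℝ}
    (H : IsRealizedBy μ S ε₁ ε₂ π) (hn : d * (n - 2 * (d + 1) ^ 2 : ℤ) ≤ 0) :
    SpectrallyClose μ S (gmdLaw fun _ : Fin n => Pi.single (Fin.last d) 1) ε₁ ε₂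
      (3 * ((d : ℝ) + 1) ^ (5 / 2 : ℝ)) (3 * ((d : ℝ) + 1) ^ 3) := by
  have hst : IsRowStochastic fun _ : Fin n => (Pi.single (Fin.last d) 1 : Fin (d + 1) → ℝ) :=
    fun _ => single_mem_stdSimplex ℝ _
  have hm : meanVec (gmdLaw fun _ : Fin n => (Pi.single (Fin.last d) 1 : Fin (d + 1) → ℝ)) = 0 := by
    ext j
    rw [meanVec_gmdLaw hst]
    simp [Fin.ext_iff, j.2.ne]
  have hc : ∀ v : Fin d → ℝ,
      v ⬝ᵥ covMat (gmdLaw fun _ : Fin n => (Pi.single (Fin.last d) 1 : Fin (d + 1) → ℝ)) *ᵥ v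
        = 0 := fun v => by
    rw [dotProduct_covMat_gmdLaw hst]
    simp [dirVar, Fin.ext_iff, Nat.ne_of_lt]
  have hk1 : (1 : ℝ) ≤ (d : ℝ) + 1 := by linarith [(Nat.cast_nonneg d : (0 : ℝ) ≤ d)]
  have hr := sq_le_rpow_five_half hk1
  intro v
  have hnv : (n : ℝ) * (v.ofLp ⬝ᵥ v.ofLp) ≤ 2 * ((d : ℝ) + 1) ^ 2 * (v.ofLp ⬝ᵥ v.ofLp) ∧
      (n : ℝ) * √(v.ofLp ⬝ᵥ v.ofLp) ≤ 2 * ((d : ℝ) + 1) ^ 2 * √(v.ofLp ⬝ᵥ v.ofLp) := by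
    rcases Nat.eq_zero_or_pos d with rfl | hd
    · simp [dotProduct]
    · have h1 : (n : ℤ) ≤ 2 * (d + 1) ^ 2 := by
        have : (0 : ℤ) < d := by exact_mod_cast hd
        nlinarith
      have h2 : (n : ℝ) ≤ 2 * ((d : ℝ) + 1) ^ 2 := by exact_mod_cast h1
      have := dotProduct_self_nonneg' v.ofLp
      exact ⟨by gcongr, by gcongr⟩
  have hv0 := dotProduct_self_nonneg' v.ofLp
  have hs0 := Real.sqrt_nonneg (v.ofLp ⬝ᵥ v.ofLp)
  constructor
  · rw [norm_eq_sqrt_dotProduct, hm]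
    have h1 := H.mean v.ofLp
    have h2 := H.abs_mean_dotProduct_le v.ofLp
    rw [dotProduct_sub] at h1 ⊢
    rw [dotProduct_zero, sub_zero]
    have h3 : |v.ofLp ⬝ᵥ μ| ≤ |v.ofLp ⬝ᵥ μ - v.ofLp ⬝ᵥ meanVec (gmdLaw π)| +
        |v.ofLp ⬝ᵥ meanVec (gmdLaw π)| := by
      have := abs_add_le (v.ofLp ⬝ᵥ μ - v.ofLp ⬝ᵥ meanVec (gmdLaw π))
        (v.ofLp ⬝ᵥ meanVec (gmdLaw π))
      rwa [sub_add_cancel] at this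
    have h4 : 2 * ((d : ℝ) + 1) ^ 2 * √(v.ofLp ⬝ᵥ v.ofLp) ≤
        3 * ((d : ℝ) + 1) ^ (5 / 2 : ℝ) * √(v.ofLp ⬝ᵥ v.ofLp) := by
      gcongr; nlinarith
    linarith [hnv.2]
  · rw [norm_eq_sqrt_dotProduct, Real.sq_sqrt hv0, sub_mulVec, dotProduct_sub, hc, sub_zero]
    have h1 := H.cov v.ofLp
    rw [sub_mulVec, dotProduct_sub] at h1
    have h2 := covMat_gmdLaw_form_le H.stochastic v.ofLp
    have h3 := H.posSemidef.form_nonneg v.ofLp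
    rw [abs_of_nonneg h3]
    have h4 : 2 * ((d : ℝ) + 1) ^ 2 * (v.ofLp ⬝ᵥ v.ofLp) ≤
        3 * ((d : ℝ) + 1) ^ 3 * (v.ofLp ⬝ᵥ v.ofLp) := by
      have : ((d : ℝ) + 1) ^ 2 ≤ ((d : ℝ) + 1) ^ 3 := pow_le_pow_right₀ hk1 (by norm_num)
      gcongr
      nlinarith [sq_nonneg ((d : ℝ) + 1)]
    linarith [hnv.1, (abs_le.1 h1).2]

/-- The mean of a fractional combination of types. -/
def mixMean {ι : Type*} (s : Finset ι) (f : ι → ℝ) (x : ι → Fin d → ℝ) : Fin d → ℝ :=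
  ∑ c ∈ s, f c • x c

theorem dotProduct_mixMean {ι : Type*} (s : Finset ι) (f : ι → ℝ) (x : ι → Fin d → ℝ)
    (v : Fin d → ℝ) : v ⬝ᵥ mixMean s f x = ∑ c ∈ s, f c * (v ⬝ᵥ x c) := by
  simp only [mixMean, dotProduct_sum, dotProduct_smul, smul_eq_mul]

/-- If a fractional combination of types passes the tests of mean and covariance in all integral
directions of size at most `n ^ 4`, and it is nearly integral, then the integral combination
nearby is spectrally close to the target. -/
theorem IsRealizedBy.spectrallyClose_of_net {π₀ : Fin n → Fin (d + 1) → ℝ}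
    (H : IsRealizedBy μ S ε₁ ε₂ π₀) (hd : 1 ≤ d) (hn : 2 * (d + 1) ^ 2 < n)
    {P : Matrix (Fin d) (Fin d) ℝ} (hP : ((n : ℝ) ^ 2 • 1 + (1 + ε₂) • S) * P = 1)
    {ι : Type*} {s : Finset ι} {f F : ι → ℝ} {x : ι → Fin d → ℝ}
    (hf : ∀ c ∈ s, 0 ≤ f c) (hfx : ∀ c ∈ s, f c ≠ 0 → IsSubprob (x c))
    (hFx : ∀ c ∈ s, F c ≠ 0 → IsSubprob (x c))
    (hfn : ∑ c ∈ s, f c ≤ n + 1)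
    (hfF : ∑ c ∈ s, |F c - f c| ≤ ((d : ℝ) + 1) ^ 2)
    (hM : ∀ y ∈ intNet d (n ^ 4), ∃ g : Fin d → ℝ, 0 ≤ g ∧
      (∀ v : Fin d → ℝ, v ⬝ᵥ (g - μ) ≤ √(v ⬝ᵥ (ε₁ ^ 2 • S) *ᵥ v) + 2 * √d * √(v ⬝ᵥ v)) ∧
      y ⬝ᵥ mixMean s f x ≤ y ⬝ᵥ g + (2 * n ^ 4 * d + 1))
    (hU : ∀ y ∈ intNet d (n ^ 4), y ⬝ᵥ mixCov s f x *ᵥ y ≤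
      y ⬝ᵥ ((1 + n / (n : ℝ) ^ 2) • capForm ((n : ℝ) ^ 2) P) *ᵥ y + (2 * d * n * n ^ 4 + 3))
    (hLo : ∀ y ∈ intNet d (n ^ 4), y ⬝ᵥ (max (1 - ε₂) 0 • S) *ᵥ y ≤
      y ⬝ᵥ mixCov s f x *ᵥ y + (2 * d * n * n ^ 4 + 3))
    {π : Fin n → Fin (d + 1) → ℝ} (hπ : IsRowStochastic π)
    (hπF : ∀ g : (Fin d → ℝ) → ℝ, ∑ i, g (fun j => π i j.castSucc) = ∑ c ∈ s, F c * g (x c)) :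
    SpectrallyClose μ S (gmdLaw π) ε₁ ε₂ (3 * ((d : ℝ) + 1) ^ (5 / 2 : ℝ))
      (3 * ((d : ℝ) + 1) ^ 3) := by
  have hdn : 9 ≤ n ∧ d ≤ n := by constructor <;> nlinarith
  have hn9 : (9 : ℝ) ≤ n := by exact_mod_cast hdn.1
  have hdn' : (d : ℝ) ≤ n := by exact_mod_cast hdn.2
  have hd1 : (1 : ℝ) ≤ d := by exact_mod_cast hd
  have hn0 : (0 : ℝ) < n := by linarith
  have hL1 : 1 ≤ n ^ 4 := Nat.one_le_pow _ _ (by omega)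
  have hK : (0 : ℝ) < (n : ℝ) ^ 2 := by positivity
  have hY := H.posSemidef_upper
  set Y := (1 + ε₂) • S with hYdef
  set Q := mixCov s f x with hQ
  have hQpsd : Q.PosSemidef := posSemidef_mixCov hf hfx
  have hQle : ∀ v : Fin d → ℝ, v ⬝ᵥ Q *ᵥ v ≤ (n + 1) * (v ⬝ᵥ v) := fun v =>
    (mixCov_form_le hf hfx v).trans
      (mul_le_mul_of_nonneg_right hfn (dotProduct_self_nonneg' v))
  have hZpsd : ((1 + n / (n : ℝ) ^ 2) • capForm ((n : ℝ) ^ 2) P).PosSemidef :=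
    (posSemidef_capForm hY hP hK.le).smul (by positivity)
  have hZle : ∀ v : Fin d → ℝ, v ⬝ᵥ ((1 + n / (n : ℝ) ^ 2) • capForm ((n : ℝ) ^ 2) P) *ᵥ v ≤
      (n ^ 2 + n) * (v ⬝ᵥ v) := fun v => by
    rw [smul_form]
    have h1 := capForm_le_level hY hP hK.le v
    calc _ ≤ (1 + n / (n : ℝ) ^ 2) * ((n : ℝ) ^ 2 * (v ⬝ᵥ v)) := by gcongr
      _ = _ := by field_simp
  have hlpsd : (max (1 - ε₂) 0 • S).PosSemidef := H.posSemidef.smul (le_max_right _ _)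
  have hlle : ∀ v : Fin d → ℝ, v ⬝ᵥ (max (1 - ε₂) 0 • S) *ᵥ v ≤ n * (v ⬝ᵥ v) := fun v =>
    (H.lower_le_cov_form v).trans (covMat_gmdLaw_form_le H.stochastic v)
  -- the errors of the net are negligible
  have hsmall : 2 * d * n * n ^ 4 + 3 + 3 * ((n + 1 : ℝ) + (n ^ 2 + n)) * d * n ^ 4 ≤
      ((n : ℝ) ^ 4) ^ 2 := by
    have h1 : (2 * n + 3 + 3 * ((n + 1 : ℝ) + (n ^ 2 + n))) * n ≤ (n : ℝ) ^ 4 := by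
      have : (9 : ℝ) * n ≤ n ^ 2 := by nlinarith
      have : (9 : ℝ) * n ^ 2 ≤ n ^ 3 := by nlinarith [sq_nonneg (n : ℝ)]
      have : (9 : ℝ) * n ^ 3 ≤ n ^ 4 := by nlinarith [pow_pos hn0 3]
      nlinarith
    have h2 : (3 : ℝ) ≤ 3 * n * n ^ 4 := by
      have : (1 : ℝ) ≤ n ^ 4 := by exact_mod_cast hL1
      nlinarith
    calc _ ≤ 2 * (n : ℝ) * n * n ^ 4 + 3 * n * n ^ 4 +
          3 * ((n + 1 : ℝ) + (n ^ 2 + n)) * n * n ^ 4 := by gcongr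
      _ = (2 * n + 3 + 3 * ((n + 1 : ℝ) + (n ^ 2 + n))) * n * n ^ 4 := by ring
      _ ≤ n ^ 4 * n ^ 4 := by gcongr
      _ = _ := by ring
  have hQU : ∀ v : Fin d → ℝ, v ⬝ᵥ Q *ᵥ v ≤
      (1 + n / (n : ℝ) ^ 2) * (v ⬝ᵥ capForm ((n : ℝ) ^ 2) P *ᵥ v) + v ⬝ᵥ v := fun v => by
    have h1 := form_le_of_net hQpsd hZpsd hQle hZle (by positivity) (by positivity)
      (by positivity) hL1 hU v
    rw [smul_form] at h1
    refine h1.trans (add_le_add le_rfl (mul_le_of_le_one_left (dotProduct_self_nonneg' v) ?_))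
    rw [div_le_one (by positivity)]
    push_cast
    exact hsmall
  have hQL : ∀ v : Fin d → ℝ, (1 - ε₂) * (v ⬝ᵥ S *ᵥ v) ≤ v ⬝ᵥ Q *ᵥ v + v ⬝ᵥ v := fun v => by
    have h1 := form_le_of_net hlpsd hQpsd hlle hQle (by positivity) (by positivity)
      (by positivity) hL1 hLo v
    rw [smul_form] at h1
    have h2 : (1 - ε₂) * (v ⬝ᵥ S *ᵥ v) ≤ max (1 - ε₂) 0 * (v ⬝ᵥ S *ᵥ v) :=
      mul_le_mul_of_nonneg_right (le_max_left _ _) (H.posSemidef.form_nonneg v)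
    refine h2.trans (h1.trans (add_le_add le_rfl
      (mul_le_of_le_one_left (dotProduct_self_nonneg' v) ?_)))
    rw [div_le_one (by positivity)]
    push_cast
    refine le_trans ?_ hsmall
    have : (n : ℝ) ≤ n ^ 2 + n := by nlinarith
    have : (n : ℝ) + (n + 1) ≤ n + 1 + (n ^ 2 + n) := by linarith
    gcongr
  have hm : ∀ i, mixMean s f x i ≤ n + 1 := fun i => by
    have : mixMean s f x i = ∑ c ∈ s, f c * x c i := by simp [mixMean]
    rw [this]
    refine (sum_le_sum fun c hc => ?_).trans hfn
    by_cases h0 : f c = 0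
    · simp [h0]
    · exact mul_le_of_le_one_right (hf c hc) ((single_le_sum
        (fun j _ => (hfx c hc h0).1 j) (mem_univ i)).trans (hfx c hc h0).2)
  have hmean : ∀ v : Fin d → ℝ, v ⬝ᵥ (mixMean s f x - μ) ≤ ε₁ * √(v ⬝ᵥ S *ᵥ v) +
      (2 * √d + 2 * d + 1) * √(v ⬝ᵥ v) := fun v => by
    have h1 := dotProduct_sub_le_of_net hm (by positivity) (by positivity) hL1 hM v
    refine h1.trans (add_le_add (H.sqrt_form_le v) (mul_le_mul_of_nonneg_right ?_
      (Real.sqrt_nonneg _)))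
    have hL0 : (0 : ℝ) < (n ^ 4 : ℕ) := by exact_mod_cast hL1
    suffices (2 * n ^ 4 * d + 1 + d * (n + 1)) / ((n ^ 4 : ℕ) : ℝ) ≤ 2 * (d : ℝ) + 1 by linarith
    rw [div_le_iff₀ hL0]
    push_cast
    have h2 : (n + 1 : ℝ) ≤ 2 * n := by linarith
    have : (1 : ℝ) + d * (n + 1) ≤ n ^ 4 := by
      calc (1 : ℝ) + d * (n + 1) ≤ 1 + n * (2 * n) := by gcongr
        _ ≤ n ^ 4 := by nlinarith [sq_nonneg (n : ℝ), sq_nonneg ((n : ℝ) ^ 2 - 2)]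
    linarith
  -- passing from `f` to `F` costs at most `(d + 1) ^ 2` times the bound for a single type
  have hdiff : ∀ (φ : (Fin d → ℝ) → ℝ) (b : ℝ), (∀ y, IsSubprob y → |φ y| ≤ b) → 0 ≤ b →
      |∑ i, φ (fun j => π i j.castSucc) - ∑ c ∈ s, f c * φ (x c)| ≤ ((d : ℝ) + 1) ^ 2 * b := by
    intro φ b hφ hb
    rw [hπF, ← sum_sub_distrib]
    refine (abs_sum_le_sum_abs _ _).trans (le_trans ?_ (mul_le_mul_of_nonneg_right hfF hb))
    rw [sum_mul]
    refine sum_le_sum fun c hc => ?_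
    rw [← sub_mul, abs_mul]
    by_cases h0 : f c = 0 ∧ F c = 0
    · simp [h0.1, h0.2]
    · have : IsSubprob (x c) := by
        rw [not_and_or] at h0
        exact h0.elim (hfx c hc) (hFx c hc)
      exact mul_le_mul_of_nonneg_left (hφ _ this) (abs_nonneg _)
  have hk1 : (1 : ℝ) ≤ (d : ℝ) + 1 := by linarith
  have hr := sq_le_rpow_five_half hk1
  intro v
  rw [norm_eq_sqrt_dotProduct]
  generalize v.ofLp = v
  have hv0 := dotProduct_self_nonneg' v
  constructor
  · have h1 := hdiff (fun y => v ⬝ᵥ y) _ (fun y hy => hy.abs_dotProduct_le v) (Real.sqrt_nonneg _)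
    rw [← dotProduct_mixMean] at h1
    rw [← dotProduct_meanVec_gmdLaw hπ] at h1
    have h2 := hmean v
    have h3 := hmean (-v)
    simp only [mulVec_neg, neg_dotProduct, dotProduct_neg, neg_neg] at h3
    rw [dotProduct_sub] at h2 h3 ⊢
    have h4 : (2 * √d + 2 * d + 1 + ((d : ℝ) + 1) ^ 2) * √(v ⬝ᵥ v) ≤
        3 * ((d : ℝ) + 1) ^ (5 / 2 : ℝ) * √(v ⬝ᵥ v) := by
      gcongr
      have hsd : √(d : ℝ) ≤ d := Real.sqrt_le_iff.2 ⟨by linarith, by nlinarith⟩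
      nlinarith
    have := abs_le.1 h1
    rw [abs_le]
    constructor <;> linarith
  · have h1 := hdiff (fun y => v ⬝ᵥ typeCov y *ᵥ v) (v ⬝ᵥ v) (fun y hy => by
      rw [abs_of_nonneg (hy.typeCov_form_nonneg v)]; exact hy.typeCov_form_le v) hv0
    rw [← mixCov_form] at h1
    rw [← covMat_gmdLaw_form hπ] at h1
    have h2 := hQU v
    have h3 := hQL v
    have h4 := covMat_gmdLaw_form_le hπ v
    have h5 : (((d : ℝ) + 1) ^ 2 + 2) * (v ⬝ᵥ v) ≤ 3 * ((d : ℝ) + 1) ^ 3 * (v ⬝ᵥ v) := by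
      gcongr
      nlinarith [sq_nonneg ((d : ℝ) + 1)]
    have h6 : v ⬝ᵥ Y *ᵥ v = (1 + ε₂) * (v ⬝ᵥ S *ᵥ v) := by
      rw [hYdef, smul_form]
    have h7 := abs_le.1 h1
    rw [Real.sq_sqrt hv0, sub_mulVec, dotProduct_sub, abs_le]
    refine ⟨?_, by linarith⟩
    -- beyond the level `n` of the form of `Y`, the upper bound is trivial
    rcases le_total (n * (v ⬝ᵥ v)) (v ⬝ᵥ Y *ᵥ v) with h8 | h8
    · have : 0 ≤ 3 * ((d : ℝ) + 1) ^ 3 * (v ⬝ᵥ v) := by positivity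
      linarith
    · have h9 := capForm_le hY hP hK.le v
      have h10 : (1 + n / (n : ℝ) ^ 2) * (v ⬝ᵥ capForm ((n : ℝ) ^ 2) P *ᵥ v) ≤
          v ⬝ᵥ Y *ᵥ v + v ⬝ᵥ v := by
        calc _ ≤ (1 + n / (n : ℝ) ^ 2) * (v ⬝ᵥ Y *ᵥ v) := by gcongr
          _ = v ⬝ᵥ Y *ᵥ v + n / (n : ℝ) ^ 2 * (v ⬝ᵥ Y *ᵥ v) := by ring
          _ ≤ v ⬝ᵥ Y *ᵥ v + n / (n : ℝ) ^ 2 * (n * (v ⬝ᵥ v)) := by gcongr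
          _ = _ := by field_simp
      linarith

end Closeness

/-! ### The grid of directions, types and means -/

section Grid

/-- The number of values of a coordinate in the grid: the directions have integral coordinates
between `-n ^ 4` and `n ^ 4`. -/
def gridB (n : ℕ) : ℕ := 2 * n ^ 4 + 1

/-- The size of the grid. -/
def gridV (n d : ℕ) : ℕ := gridB n ^ d

/-- The digits of the indices of grid points. -/
def dig (n t i : ℕ) : ℕ := t / gridB n ^ i % gridB n

/-- The scalar product of the direction `t` with the digits of `c`. -/
def gridLin (n d t c : ℕ) : ℤ := ∑ i ∈ range d, ((dig n t i : ℤ) - n ^ 4) * dig n c i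

/-- The scalar product of the square of the direction `t` with the digits of `c`. -/
def gridSq (n d t c : ℕ) : ℤ := ∑ i ∈ range d, ((dig n t i : ℤ) - n ^ 4) ^ 2 * dig n c i

/-- The variance of the type `c` in the direction `t`, scaled to be an integer. -/
def gridQuad (n d t c : ℕ) : ℤ := 2 * n ^ 4 * gridSq n d t c - gridLin n d t c ^ 2

/-- The bound for the mean in the direction `t` that comes from the mean `g`, with an allowance for
the rounding of types and means to the grid. -/
def gridVal (n d t g : ℕ) : ℤ := 2 * n ^ 4 * (gridLin n d t g + 2 * n ^ 4 * d)

/-- The factor by which the rows of the system are scaled, so that the tolerances in the rounding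
procedure sum up to less than one unit. -/
def gridE (n d : ℕ) : ℤ := 2 * (n * gridV n d) * (n * gridV n d) + 1

/-- The coefficients of the linear system: the upper bounds for the mean, the upper and lower
bounds for the variance in each direction, and the upper and lower bound for the sum. -/
def rowCoef (n d i j : ℕ) : ℤ :=
  gridE n d *
    (if i / gridV n d = 0 then gridLin n d (i % gridV n d) j
    else if i / gridV n d = 1 then gridQuad n d (i % gridV n d) j
    else if i / gridV n d = 2 then -gridQuad n d (i % gridV n d) j
    else if i / gridV n d = 3 then 1 else -1)

/-- The right hand sides of the linear system. -/
def rowBound (n d : ℕ) (hm hu hl : ℕ → ℤ) (i : ℕ) : ℤ :=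
  gridE n d *
    (if i / gridV n d = 0 then hm (i % gridV n d)
    else if i / gridV n d = 1 then hu (i % gridV n d)
    else if i / gridV n d = 2 then -hl (i % gridV n d)
    else if i / gridV n d = 3 then n else -n)

/-- The columns of the system: `n` copies of each grid point, of which only those with the sum of
digits at most `2 * n ^ 4` stand for a type. -/
def gridStart (n d j : ℕ) : ℤ :=
  if ∑ i ∈ range d, (dig n j i : ℤ) ≤ 2 * n ^ 4 then 2 else 0

/-- The direction with the index `t`. -/
noncomputable def gridVec (n d t : ℕ) : Fin d → ℝ := fun i => (dig n t i : ℝ) - n ^ 4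

/-- The mean with the index `g`. -/
noncomputable def gridMean (n d g : ℕ) : Fin d → ℝ := fun i => dig n g i

/-- The type with the index `c`. -/
noncomputable def gridType (n d c : ℕ) : Fin d → ℝ := fun i => dig n c i / (2 * n ^ 4)

variable {n d : ℕ}

theorem gridB_pos (n : ℕ) : 0 < gridB n := Nat.succ_pos _

theorem gridV_pos (n d : ℕ) : 0 < gridV n d := Nat.pow_pos (gridB_pos n)

theorem dig_lt (n t i : ℕ) : dig n t i < gridB n := Nat.mod_lt _ (gridB_pos n)

theorem dig_le (n t i : ℕ) : dig n t i ≤ 2 * n ^ 4 := Nat.lt_succ_iff.1 (dig_lt n t i)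

theorem dig_mul_add {i : ℕ} (hi : i < d) (r t : ℕ) :
    dig n (r * gridV n d + t) i = dig n t i := by
  obtain ⟨e, rfl⟩ : ∃ e, d = i + 1 + e := ⟨d - (i + 1), by omega⟩
  have : r * gridV n (i + 1 + e) + t = t + gridB n ^ i * (gridB n * (gridB n ^ e * r)) := by
    rw [gridV]; ring
  rw [dig, this, Nat.add_mul_div_left _ _ (Nat.pow_pos (gridB_pos n)), Nat.add_mul_mod_self_left,
    dig]

theorem exists_dig_eq (D : Fin d → ℕ) (hD : ∀ i, D i ≤ 2 * n ^ 4) :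
    ∃ t < gridV n d, ∀ i : Fin d, dig n t i = D i := by
  let D' : Fin d → Fin (gridB n) := fun i => ⟨D i, Nat.lt_succ_iff.2 (hD i)⟩
  refine ⟨finFunctionFinEquiv D', (finFunctionFinEquiv D').2, fun i => ?_⟩
  exact congrArg Fin.val (congrFun (finFunctionFinEquiv.symm_apply_apply D') i)

theorem exists_gridVec_eq {y : Fin d → ℝ} (hy : y ∈ intNet d (n ^ 4)) :
    ∃ t < gridV n d, gridVec n d t = y := by
  obtain ⟨w, hw, rfl⟩ := hy
  obtain ⟨t, ht, h⟩ := exists_dig_eq (n := n) (fun i => (w i + n ^ 4).toNat) fun i => by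
    have := abs_le.1 (hw i); push_cast at this; zify; rw [Int.toNat_of_nonneg (by linarith)]
    linarith
  refine ⟨t, ht, funext fun i => ?_⟩
  have h0 := abs_le.1 (hw i)
  push_cast at h0
  have h1 : ((dig n t i : ℕ) : ℤ) = w i + n ^ 4 := by
    rw [h i, Int.toNat_of_nonneg (by linarith)]
  have h2 : ((dig n t i : ℕ) : ℝ) = w i + n ^ 4 := by exact_mod_cast h1
  rw [gridVec, h2]; ring

theorem abs_gridVec_le (t : ℕ) (i : Fin d) : |gridVec n d t i| ≤ n ^ 4 := by
  have h : (dig n t i : ℝ) ≤ 2 * n ^ 4 := by exact_mod_cast dig_le n t i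
  have h0 : (0 : ℝ) ≤ dig n t i := Nat.cast_nonneg _
  rw [gridVec, abs_le]
  constructor <;> linarith

theorem cast_gridLin (t c : ℕ) : (gridLin n d t c : ℝ) = gridVec n d t ⬝ᵥ gridMean n d c := by
  rw [gridLin, sum_range]
  push_cast
  rfl

theorem cast_gridLin' (hn : 0 < n) (t c : ℕ) :
    (gridLin n d t c : ℝ) = 2 * n ^ 4 * (gridVec n d t ⬝ᵥ gridType n d c) := by
  have hn' : (n : ℝ) ≠ 0 := by exact_mod_cast hn.ne'
  rw [cast_gridLin, dotProduct, dotProduct, mul_sum]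
  refine sum_congr rfl fun i _ => ?_
  rw [gridMean, gridType]
  field_simp

theorem cast_gridQuad (hn : 0 < n) (t c : ℕ) : (gridQuad n d t c : ℝ) =
    (2 * n ^ 4) ^ 2 * (gridVec n d t ⬝ᵥ typeCov (gridType n d c) *ᵥ gridVec n d t) := by
  have hn' : (n : ℝ) ≠ 0 := by exact_mod_cast hn.ne'
  rw [gridQuad, typeCov_form]
  push_cast
  rw [cast_gridLin' hn, gridSq, sum_range]
  push_cast
  have : ∑ i : Fin d, ((dig n t i : ℝ) - n ^ 4) ^ 2 * (dig n c i : ℝ) =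
      2 * n ^ 4 * ∑ i, gridVec n d t i ^ 2 * gridType n d c i := by
    rw [mul_sum]
    refine sum_congr rfl fun i _ => ?_
    rw [gridVec, gridType]
    field_simp
  rw [this]; ring

theorem isSubprob_gridType (hn : 0 < n) {c : ℕ} (hc : gridStart n d c ≠ 0) :
    IsSubprob (gridType n d c) := by
  refine ⟨fun i => by simp only [gridType, Pi.zero_apply]; positivity, ?_⟩
  rw [gridStart] at hc
  have h : ∑ i ∈ range d, (dig n c i : ℤ) ≤ 2 * n ^ 4 := by
    by_contra h; exact hc (if_neg h)
  rw [sum_range] at h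
  have h' : ∑ i : Fin d, (dig n c i : ℝ) ≤ 2 * n ^ 4 := by exact_mod_cast h
  have hn' : (0 : ℝ) < 2 * n ^ 4 := by positivity
  simp only [gridType]
  rw [← sum_div, div_le_one hn']
  exact h'

theorem gridE_pos (n d : ℕ) : 0 < gridE n d := by unfold gridE; positivity

theorem mul_add_div_mod {V q t : ℕ} (ht : t < V) :
    (q * V + t) / V = q ∧ (q * V + t) % V = t := by
  rw [add_comm, Nat.add_mul_div_right _ _ (by omega), Nat.div_eq_of_lt ht, zero_add,
    Nat.add_mul_mod_self_right, Nat.mod_eq_of_lt ht]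
  exact ⟨rfl, rfl⟩

/-- The rows of the system are products of few factors that depend on the row and on
the column. -/
theorem rowCoef_rank (n d : ℕ) : ∃ u w : ℕ → ℕ → ℝ, ∀ i j,
    (rowCoef n d i j : ℝ) = ∑ e ∈ range (d + d * d + 1), u i e * w e j := by
  classical
  set V := gridV n d with hV
  let α : ℕ → ℝ := fun i => gridE n d * (if i / V = 0 then 1 else 0)
  let β : ℕ → ℝ := fun i => gridE n d * (if i / V = 1 then 1 else if i / V = 2 then -1 else 0)
  let γ : ℕ → ℝ := fun i => gridE n d *
    (if i / V = 0 then 0 else if i / V = 1 then 0 else if i / V = 2 then 0 else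
      if i / V = 3 then 1 else -1)
  let c : ℕ → ℕ → ℝ := fun i e => (dig n (i % V) e : ℝ) - n ^ 4
  let U : ℕ → ℕ → ℝ := fun i e => if e < d then α i * c i e + β i * (2 * n ^ 4 * c i e ^ 2) else
    if e < d + d * d then -β i * (c i ((e - d) / d) * c i ((e - d) % d)) else γ i
  let W : ℕ → ℕ → ℝ := fun e j => if e < d then (dig n j e : ℝ) else
    if e < d + d * d then (dig n j ((e - d) / d) : ℝ) * dig n j ((e - d) % d) else 1
  refine ⟨U, W, fun i j => ?_⟩
  have hrow : (rowCoef n d i j : ℝ) =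
      α i * gridLin n d (i % V) j + β i * gridQuad n d (i % V) j + γ i := by
    simp only [rowCoef, α, β, γ, ← hV]
    split_ifs with h1 h2 h3 h4 <;> push_cast <;> (try omega) <;> ring
  rw [sum_range_succ, sum_range_add, hrow]
  have e1 : ∑ e ∈ range d, U i e * W e j =
      α i * gridLin n d (i % V) j + β i * (2 * n ^ 4 * gridSq n d (i % V) j) := by
    rw [gridLin, gridSq]
    push_cast
    simp only [mul_sum]
    rw [← sum_add_distrib]
    refine sum_congr rfl fun e he => ?_
    simp only [U, W, c, if_pos (mem_range.1 he)]; ring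
  have e2 : ∑ e ∈ range (d * d), U i (d + e) * W (d + e) j =
      -β i * gridLin n d (i % V) j ^ 2 := by
    have e3 : ∀ e ∈ range (d * d), U i (d + e) * W (d + e) j =
        -β i * ((c i (e / d) * dig n j (e / d)) * (c i (e % d) * dig n j (e % d))) := by
      intro e he
      have := mem_range.1 he
      simp only [U, W]
      rw [if_neg (by omega), if_pos (by omega), if_neg (by omega), if_pos (by omega),
        Nat.add_sub_cancel_left]
      ring
    rw [sum_congr rfl e3, ← mul_sum]
    congr 1
    have e4 : (gridLin n d (i % V) j : ℝ) = ∑ e : Fin d, c i e * dig n j e := by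
      rw [gridLin, sum_range]; push_cast; rfl
    rw [sum_range, e4, sq, sum_mul_sum,
      ← (finProdFinEquiv (m := d) (n := d)).sum_comp, Fintype.sum_prod_type]
    refine sum_congr rfl fun a _ => sum_congr rfl fun b _ => ?_
    have h := finProdFinEquiv.symm_apply_apply (a, b)
    have h1 : (finProdFinEquiv (a, b) : ℕ) / d = a := congrArg (fun p => (p.1 : ℕ)) h
    have h2 : (finProdFinEquiv (a, b) : ℕ) % d = b := congrArg (fun p => (p.2 : ℕ)) h
    rw [h1, h2]
  have e3 : U i (d + d * d) * W (d + d * d) j = γ i := by simp [U, W]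
  rw [e1, e2, e3, gridQuad]
  push_cast
  ring

end Grid

/-! ### The linear system of the grid -/

section GridSystem

variable {n d : ℕ} {μ : Fin d → ℝ} {S P : Matrix (Fin d) (Fin d) ℝ} {ε₁ ε₂ : ℝ}

/-- The error term in the bounds for the variance, which allows for the rounding of types to
the grid. -/
def gridSlack (n d : ℕ) : ℤ := 3 * d * n * (n ^ 4) ^ 2 * (2 * n ^ 4)

/-- The bounds `hm`, `hu`, `hl` of the linear system are those that the target prescribes, where
the means with the property `good` are near the given mean. -/
structure GridBounds (n d : ℕ) (μ : Fin d → ℝ) (S P : Matrix (Fin d) (Fin d) ℝ) (ε₁ ε₂ : ℝ)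
    (good : ℕ → Prop) (hm hu hl : ℕ → ℤ) : Prop where
  sound : ∀ g < gridV n d, good g → ∀ v : Fin d → ℝ, |v ⬝ᵥ (gridMean n d g - μ)| ≤
    √(v ⬝ᵥ (ε₁ ^ 2 • S) *ᵥ v) + 2 * √d * √(v ⬝ᵥ v)
  complete : ∀ g < gridV n d, (∀ v : Fin d → ℝ, |v ⬝ᵥ (gridMean n d g - μ)| ≤
    √(v ⬝ᵥ (ε₁ ^ 2 • S) *ᵥ v) + √d * √(v ⬝ᵥ v)) → good g
  mean_le : (∃ g < gridV n d, good g) → ∀ t < gridV n d, ∃ g < gridV n d, good g ∧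
    hm t ≤ gridVal n d t g
  le_mean : ∀ t < gridV n d, ∀ g < gridV n d, good g → gridVal n d t g ≤ hm t
  le_upper : ∀ t < gridV n d, (2 * (n : ℝ) ^ 4) ^ 2 * (gridVec n d t ⬝ᵥ
    ((1 + n / (n : ℝ) ^ 2) • capForm ((n : ℝ) ^ 2) P) *ᵥ gridVec n d t) + gridSlack n d ≤ hu t
  upper_le : ∀ t < gridV n d, (hu t : ℝ) ≤ (2 * (n : ℝ) ^ 4) ^ 2 * (gridVec n d t ⬝ᵥ
    ((1 + n / (n : ℝ) ^ 2) • capForm ((n : ℝ) ^ 2) P) *ᵥ gridVec n d t) + gridSlack n d + 2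
  lower_le : ∀ t < gridV n d, (hl t : ℝ) ≤ (2 * (n : ℝ) ^ 4) ^ 2 * (gridVec n d t ⬝ᵥ
    (max (1 - ε₂) 0 • S) *ᵥ gridVec n d t) - gridSlack n d
  le_lower : ∀ t < gridV n d, (2 * (n : ℝ) ^ 4) ^ 2 * (gridVec n d t ⬝ᵥ
    (max (1 - ε₂) 0 • S) *ᵥ gridVec n d t) - gridSlack n d - 2 ≤ hl t

variable {good : ℕ → Prop} {hm hu hl : ℕ → ℤ} {π : Fin n → Fin (d + 1) → ℝ}

theorem isPartial_gridStart (n d N : ℕ) : IsPartial N (gridStart n d) := by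
  intro j _
  unfold gridStart
  split_ifs <;> simp

/-- Rounding down the entries of a subprobability vector to multiples of `1 / (2 n ^ 4)`. -/
theorem exists_gridMean_floor {x : Fin d → ℝ} (hx : 0 ≤ x) (hx' : ∀ i, x i ≤ 2 * n ^ 4) :
    ∃ t < gridV n d, ∀ i, 0 ≤ x i - gridMean n d t i ∧ x i - gridMean n d t i ≤ 1 := by
  obtain ⟨t, ht, h⟩ := exists_dig_eq (n := n) (fun i => ⌊x i⌋₊) fun i => by
    refine Nat.floor_le_of_le ?_
    push_cast
    exact hx' i
  refine ⟨t, ht, fun i => ?_⟩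
  rw [gridMean, h i]
  exact ⟨by linarith [Nat.floor_le (hx i)], by linarith [Nat.lt_floor_add_one (x i)]⟩

theorem gridStart_eq_two {t : ℕ} (h : ∑ i, gridMean n d t i ≤ 2 * n ^ 4) :
    gridStart n d t = 2 := by
  rw [gridStart, if_pos]
  rw [sum_range]
  have : (∑ i : Fin d, (dig n t i : ℝ)) ≤ 2 * n ^ 4 := h
  exact_mod_cast this

theorem gridMean_mul_add (r t : ℕ) : gridMean n d (r * gridV n d + t) = gridMean n d t :=
  funext fun i => by rw [gridMean, gridMean, dig_mul_add i.2]

theorem abs_gridVec_dotProduct_le (t : ℕ) (y : Fin d → ℝ) :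
    |gridVec n d t ⬝ᵥ y| ≤ n ^ 4 * ∑ i, |y i| := by
  rw [dotProduct, mul_sum]
  refine (abs_sum_le_sum_abs _ _).trans (sum_le_sum fun i _ => ?_)
  rw [abs_mul]
  exact mul_le_mul_of_nonneg_right (abs_gridVec_le t i) (abs_nonneg _)

/-- The effect of rounding a type to the grid on the scaled variance. -/
theorem abs_scaled_var_sub_le (t : ℕ) {p y : Fin d → ℝ} (hp : IsSubprob p)
    (hy : 0 ≤ y) (hpy : ∀ i, 0 ≤ 2 * (n : ℝ) ^ 4 * p i - y i ∧ 2 * (n : ℝ) ^ 4 * p i - y i ≤ 1) :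
    |(2 * (n : ℝ) ^ 4 * ∑ i, gridVec n d t i ^ 2 * y i - (gridVec n d t ⬝ᵥ y) ^ 2) -
      (2 * (n : ℝ) ^ 4) ^ 2 * (gridVec n d t ⬝ᵥ typeCov p *ᵥ gridVec n d t)| ≤
      3 * (d : ℝ) * ((n : ℝ) ^ 4) ^ 2 * (2 * n ^ 4) := by
  set v := gridVec n d t with hv
  set G : ℝ := 2 * (n : ℝ) ^ 4 with hG
  have hG0 : 0 ≤ G := by positivity
  set q : Fin d → ℝ := fun i => G * p i - y i with hq
  have hqs : ∑ i, |q i| ≤ d := by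
    refine (sum_le_card_nsmul _ _ 1 fun i _ => ?_).trans (by simp)
    rw [abs_of_nonneg (hpy i).1]; exact (hpy i).2
  have hGp : ∑ i, |G * p i + y i| ≤ 2 * G := by
    have h1 : ∀ i, |G * p i + y i| ≤ 2 * G * p i := fun i => by
      rw [abs_of_nonneg (add_nonneg (mul_nonneg hG0 (hp.1 i)) (hy i))]
      linarith [(hpy i).1]
    refine (sum_le_sum fun i _ => h1 i).trans ?_
    rw [← mul_sum]
    exact mul_le_of_le_one_right (by positivity) hp.2
  have e : (G * ∑ i, v i ^ 2 * y i - (v ⬝ᵥ y) ^ 2) - G ^ 2 * (v ⬝ᵥ typeCov p *ᵥ v) =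
      -(G * ∑ i, v i ^ 2 * q i) + (v ⬝ᵥ q) * (v ⬝ᵥ fun i => G * p i + y i) := by
    rw [typeCov_form]
    have e1 : ∑ i, v i ^ 2 * q i = G * ∑ i, v i ^ 2 * p i - ∑ i, v i ^ 2 * y i := by
      rw [mul_sum, ← sum_sub_distrib]
      exact sum_congr rfl fun i _ => by simp only [hq]; ring
    have e2 : v ⬝ᵥ q = G * (v ⬝ᵥ p) - v ⬝ᵥ y := by
      simp only [dotProduct]
      rw [mul_sum, ← sum_sub_distrib]
      exact sum_congr rfl fun i _ => by simp only [hq]; ring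
    have e3 : (v ⬝ᵥ fun i => G * p i + y i) = G * (v ⬝ᵥ p) + v ⬝ᵥ y := by
      simp only [dotProduct]
      rw [mul_sum, ← sum_add_distrib]
      exact sum_congr rfl fun i _ => by ring
    rw [e1, e2, e3]; ring
  rw [e]
  have h1 : |∑ i, v i ^ 2 * q i| ≤ d * (n ^ 4) ^ 2 := by
    refine (abs_sum_le_sum_abs _ _).trans ((sum_le_card_nsmul _ _
      (((n : ℝ) ^ 4) ^ 2) fun i _ => ?_).trans (by simp))
    rw [abs_mul, abs_pow]
    have := abs_gridVec_le (n := n) t i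
    rw [abs_of_nonneg (hpy i).1]
    calc |v i| ^ 2 * q i ≤ (n ^ 4) ^ 2 * 1 := by
          gcongr
          · exact (hpy i).1
          · exact (hpy i).2
      _ = _ := mul_one _
  have h2 : |v ⬝ᵥ q| ≤ n ^ 4 * d := (abs_gridVec_dotProduct_le t q).trans (by gcongr)
  have h3 : |v ⬝ᵥ fun i => G * p i + y i| ≤ n ^ 4 * (2 * G) :=
    (abs_gridVec_dotProduct_le t _).trans (by gcongr)
  refine (abs_add_le _ _).trans ?_
  rw [abs_neg, abs_mul G, abs_mul (v ⬝ᵥ q), abs_of_nonneg hG0]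
  calc G * |∑ i, v i ^ 2 * q i| + |v ⬝ᵥ q| * |v ⬝ᵥ fun i => G * p i + y i|
      ≤ G * (d * (n ^ 4) ^ 2) + (n ^ 4 * d) * (n ^ 4 * (2 * G)) := by gcongr
    _ = _ := by ring

/-- The mean of the realization, rounded down, is a good grid point. -/
theorem IsRealizedBy.exists_good (H : IsRealizedBy μ S ε₁ ε₂ π)
    (hc : ∀ g < gridV n d, (∀ v : Fin d → ℝ, |v ⬝ᵥ (gridMean n d g - μ)| ≤
      √(v ⬝ᵥ (ε₁ ^ 2 • S) *ᵥ v) + √d * √(v ⬝ᵥ v)) → good g) : ∃ g < gridV n d, good g ∧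
      ∀ j, 0 ≤ meanVec (gmdLaw π) j - gridMean n d g j ∧
        meanVec (gmdLaw π) j - gridMean n d g j ≤ 1 := by
  have hsub := fun i => isSubprob_of_mem_stdSimplex (H.stochastic i)
  have hn4 : (n : ℝ) ≤ n ^ 4 := by exact_mod_cast Nat.le_self_pow (by norm_num) n
  set m := meanVec (gmdLaw π) with hm'
  have hmi : ∀ j, m j = ∑ i, π i j.castSucc := meanVec_gmdLaw H.stochastic
  obtain ⟨g, hgV, hg⟩ := exists_gridMean_floor (n := n) (x := m)
    (fun j => by rw [hmi]; exact sum_nonneg fun i _ => (hsub i).1 j) fun j => by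
      rw [hmi]
      refine (sum_le_card_nsmul _ _ (1 : ℝ) fun i _ => (single_le_sum
        (fun j _ => (hsub i).1 j) (mem_univ j)).trans (hsub i).2).trans ?_
      simp only [card_univ, Fintype.card_fin, nsmul_eq_mul, mul_one]
      linarith
  have hgood : good g := by
    refine hc g hgV fun v => ?_
    have h1 : v ⬝ᵥ (gridMean n d g - μ) = -(v ⬝ᵥ (μ - m)) - v ⬝ᵥ (m - gridMean n d g) := by
      simp only [dotProduct_sub]; ring
    rw [h1]
    have h2 := H.mean v
    have h3 : |v ⬝ᵥ (m - gridMean n d g)| ≤ √d * √(v ⬝ᵥ v) := by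
      refine (abs_dotProduct_le _ _).trans ?_
      rw [mul_comm]
      gcongr
      refine (sum_le_card_nsmul _ _ 1 fun j _ => ?_).trans (by simp)
      have := hg j
      simp only [Pi.sub_apply]
      nlinarith
    have h4 : |v ⬝ᵥ (μ - m)| ≤ √(v ⬝ᵥ (ε₁ ^ 2 • S) *ᵥ v) := by
      refine h2.trans ?_
      rw [smul_form, Real.sqrt_mul (sq_nonneg _), Real.sqrt_sq_eq_abs]
      gcongr
      exact le_abs_self _
    refine (abs_sub _ _).trans ?_
    rw [abs_neg]
    exact add_le_add h4 h3
  exact ⟨g, hgV, hgood, hg⟩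

/-- Rounding the rows of a realization of the target to the grid yields a solution of the linear
system. -/
theorem GridBounds.roundInv_start (hB : GridBounds n d μ S P ε₁ ε₂ good hm hu hl)
    (H : IsRealizedBy μ S ε₁ ε₂ π) (hn : 0 < n)
    (hP : ((n : ℝ) ^ 2 • 1 + (1 + ε₂) • S) * P = 1) :
    RoundInv (rowCoef n d) (rowBound n d hm hu hl) (5 * gridV n d) (n * gridV n d)
      (gridStart n d) (gridStart n d) 0 := by
  classical
  refine ⟨isPartial_gridStart _ _ _, ?_, fun _ _ _ => rfl, subset_rfl⟩
  set V := gridV n d with hV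
  have hV0 : 0 < V := gridV_pos n d
  have hn1 : (1 : ℝ) ≤ n := by exact_mod_cast hn
  have hn4 : (n : ℝ) ≤ n ^ 4 := le_self_pow₀ hn1 (by norm_num)
  have hG0 : (0 : ℝ) < 2 * (n : ℝ) ^ 4 := by positivity
  have hsub := fun i => isSubprob_of_mem_stdSimplex (H.stochastic i)
  have hfl : ∀ i : Fin n, ∃ t < V, ∀ j : Fin d,
      0 ≤ 2 * (n : ℝ) ^ 4 * π i j.castSucc - gridMean n d t j ∧
      2 * (n : ℝ) ^ 4 * π i j.castSucc - gridMean n d t j ≤ 1 := fun i =>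
    exists_gridMean_floor (x := fun j => 2 * (n : ℝ) ^ 4 * π i j.castSucc)
      (fun j => mul_nonneg hG0.le ((hsub i).1 j)) fun j =>
        mul_le_of_le_one_right hG0.le ((single_le_sum
        (fun j _ => (hsub i).1 j) (mem_univ j)).trans (hsub i).2)
  choose t htV ht using hfl
  let c : Fin n → ℕ := fun i => i * V + t i
  have hcdiv : ∀ i, c i / V = i := fun i => (mul_add_div_mod (htV i)).1
  have hcN : ∀ i, c i < n * V := fun i => by
    rw [← Nat.div_lt_iff_lt_mul hV0, hcdiv]; exact i.2
  have hcinj : Function.Injective c := fun i j hij => by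
    apply Fin.ext; rw [← hcdiv i, ← hcdiv j, hij]
  have hcmean : ∀ i, gridMean n d (c i) = gridMean n d (t i) := fun i => gridMean_mul_add _ _
  have hclin : ∀ s i, (gridLin n d s (c i) : ℝ) = gridVec n d s ⬝ᵥ gridMean n d (t i) :=
    fun s i => by rw [cast_gridLin, hcmean]
  have hstart : ∀ i, gridStart n d (c i) = 2 := fun i => by
    apply gridStart_eq_two
    rw [hcmean]
    calc ∑ j, gridMean n d (t i) j ≤ ∑ j : Fin d, 2 * (n : ℝ) ^ 4 * π i j.castSucc :=
          sum_le_sum fun j _ => by linarith [(ht i j).1]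
      _ = 2 * (n : ℝ) ^ 4 * ∑ j : Fin d, π i j.castSucc := by rw [mul_sum]
      _ ≤ 2 * (n : ℝ) ^ 4 * 1 := by gcongr; exact (hsub i).2
      _ = _ := mul_one _
  set f : ℕ → ℝ := fun j => if j ∈ image c univ then 1 else 0 with hf
  have hsum : ∀ φ : ℕ → ℝ, ∑ j ∈ range (n * V), φ j * f j = ∑ i, φ (c i) := fun φ => by
    simp only [hf, mul_ite, mul_one, mul_zero]
    rw [← sum_filter, filter_mem_eq_inter, inter_eq_right.2,
      sum_image hcinj.injOn]
    intro j hj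
    obtain ⟨i, -, rfl⟩ := mem_image.1 hj
    exact mem_range.2 (hcN i)
  refine ⟨f, fun j hj => ⟨?_, ?_, fun hj2 => ?_⟩, fun i hi => ?_⟩
  · simp only [hf]; split_ifs <;> norm_num
  · simp only [hf]; split_ifs <;> norm_num
  · have : j ∉ image c univ := by
      intro hmem
      obtain ⟨i, -, rfl⟩ := mem_image.1 hmem
      exact hj2 (hstart i)
    simp only [hf, if_neg this]
    rw [gridStart] at hj2 ⊢
    split_ifs at hj2 ⊢
    · exact absurd rfl hj2
    · simp
  rw [hsum]
  have hE : (0 : ℝ) ≤ gridE n d := by exact_mod_cast (gridE_pos n d).le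
  have hs : i % V < V := Nat.mod_lt _ hV0
  have hq : i / V < 5 := Nat.div_lt_of_lt_mul (by linarith)
  set s := i % V
  simp only [rowCoef, rowBound, ← hV, Int.cast_mul, ← mul_sum, Int.cast_zero, add_zero]
  refine mul_le_mul_of_nonneg_left ?_ hE
  -- the variances
  have hvar : |∑ i, (gridQuad n d s (c i) : ℝ) - (2 * (n : ℝ) ^ 4) ^ 2 *
      (gridVec n d s ⬝ᵥ covMat (gmdLaw π) *ᵥ gridVec n d s)| ≤ (gridSlack n d : ℝ) := by
    rw [H.cov_form, mixCov_form, mul_sum, ← sum_sub_distrib]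
    refine (abs_sum_le_sum_abs _ _).trans ((sum_le_card_nsmul _ _
      (3 * d * ((n : ℝ) ^ 4) ^ 2 * (2 * n ^ 4)) fun i _ => ?_).trans_eq ?_)
    · have := abs_scaled_var_sub_le s (hsub i) (y := gridMean n d (t i))
        (fun j => Nat.cast_nonneg _) (ht i)
      rw [← hcmean] at this
      have e : (gridQuad n d s (c i) : ℝ) = 2 * (n : ℝ) ^ 4 *
          ∑ j, gridVec n d s j ^ 2 * gridMean n d (c i) j -
          (gridVec n d s ⬝ᵥ gridMean n d (c i)) ^ 2 := by
        rw [gridQuad, gridSq, sum_range]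
        push_cast
        rw [cast_gridLin]
        rfl
      rw [e, one_mul]
      exact this
    · simp only [card_univ, Fintype.card_fin, nsmul_eq_mul, gridSlack]
      push_cast; ring
  have hvar' := abs_le.1 hvar
  interval_cases hq' : i / V
  · simp only [if_true]
    obtain ⟨g, hgV, hgood, hg⟩ := H.exists_good hB.complete
    set m := meanVec (gmdLaw π) with hm'
    have h1 := hB.le_mean s hs g hgV hgood
    have h1' : 2 * (n : ℝ) ^ 4 * (gridVec n d s ⬝ᵥ gridMean n d g + 2 * n ^ 4 * d) ≤ hm s := by
      rw [gridVal] at h1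
      rw [← cast_gridLin]
      exact_mod_cast h1
    refine le_trans ?_ h1'
    simp only [hclin]
    have h2 : ∑ i, gridVec n d s ⬝ᵥ gridMean n d (t i) =
        2 * (n : ℝ) ^ 4 * (gridVec n d s ⬝ᵥ gridMean n d g) +
        2 * (n : ℝ) ^ 4 * (gridVec n d s ⬝ᵥ (m - gridMean n d g)) -
        ∑ i, gridVec n d s ⬝ᵥ fun j => 2 * (n : ℝ) ^ 4 * π i j.castSucc - gridMean n d (t i) j := by
      have e1 := dotProduct_meanVec_gmdLaw H.stochastic (gridVec n d s)
      have e2 : ∀ i, (gridVec n d s ⬝ᵥ fun j =>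
          2 * (n : ℝ) ^ 4 * π i j.castSucc - gridMean n d (t i) j) =
          2 * (n : ℝ) ^ 4 * (gridVec n d s ⬝ᵥ fun j => π i j.castSucc) -
          gridVec n d s ⬝ᵥ gridMean n d (t i) := fun i => by
        simp only [dotProduct]
        rw [mul_sum, ← sum_sub_distrib]
        exact sum_congr rfl fun j _ => by ring
      rw [dotProduct_sub, e1]
      simp only [e2]
      rw [sum_sub_distrib, ← mul_sum]
      ring
    have habs : ∀ q : Fin d → ℝ, (∀ j, 0 ≤ q j ∧ q j ≤ 1) →
        |gridVec n d s ⬝ᵥ q| ≤ n ^ 4 * d := fun q hq => by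
      refine (abs_gridVec_dotProduct_le s q).trans ?_
      gcongr
      refine (sum_le_card_nsmul _ _ 1 fun j _ => ?_).trans (by simp)
      rw [abs_of_nonneg (hq j).1]; exact (hq j).2
    have h3 := (abs_le.1 (habs (m - gridMean n d g) hg)).2
    have h4 : -(∑ i, gridVec n d s ⬝ᵥ fun j =>
        2 * (n : ℝ) ^ 4 * π i j.castSucc - gridMean n d (t i) j) ≤ n * (n ^ 4 * d) := by
      rw [← sum_neg_distrib]
      refine (sum_le_card_nsmul _ _ ((n : ℝ) ^ 4 * d) fun i _ => ?_).trans (by simp)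
      linarith [(abs_le.1 (habs _ (ht i))).1]
    have h5 : (n : ℝ) * (n ^ 4 * d) ≤ 2 * n ^ 4 * (n ^ 4 * d) := by
      gcongr; linarith
    have h6 := mul_le_mul_of_nonneg_left h3 hG0.le
    rw [h2]
    linarith
  · simp only [one_ne_zero, if_false, if_true]
    have h1 := hB.le_upper s hs
    have h2 := form_le_capForm hP (by positivity) (by positivity : (0 : ℝ) < n)
      (posSemidef_mixCov (fun _ _ => zero_le_one) fun i _ _ => hsub i)
      (fun v => by rw [← H.cov_form]; exact H.cov_form_le_upper v)
      (fun v => by rw [← H.cov_form]; exact covMat_gmdLaw_form_le H.stochastic v) (gridVec n d s)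
    rw [← H.cov_form] at h2
    rw [smul_form] at h1
    have h3 := mul_le_mul_of_nonneg_left h2 (sq_nonneg (2 * (n : ℝ) ^ 4))
    linarith
  · simp only [OfNat.ofNat_ne_zero, OfNat.ofNat_ne_one, if_false, if_true, Int.cast_neg,
      sum_neg_distrib]
    have h1 := hB.lower_le s hs
    have h2 := mul_le_mul_of_nonneg_left (H.lower_le_cov_form (gridVec n d s))
      (sq_nonneg (2 * (n : ℝ) ^ 4))
    linarith
  · norm_num
  · norm_num

end GridSystem

/-! ### Size of the linear system -/

section GridSize

variable {n d : ℕ}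

theorem grid_le (hd : 1 ≤ d) (hn : 1 ≤ n) : n ≤ gridV n d ∧ 2 * n ^ 4 < gridV n d ∧
    d ≤ gridV n d ∧ 3 ≤ gridV n d := by
  have hB : 3 ≤ gridB n := by
    have := Nat.one_le_pow 4 n hn
    unfold gridB; omega
  have hBV : gridB n ≤ gridV n d := Nat.le_self_pow (by omega) _
  have h4 : n ≤ n ^ 4 := Nat.le_self_pow (by norm_num) n
  refine ⟨?_, ?_, ?_, hB.trans hBV⟩
  · unfold gridB at hBV; omega
  · unfold gridB at hBV; omega
  · exact (Nat.lt_pow_self (by omega)).le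

theorem grid_le_int (hd : 1 ≤ d) (hn : 1 ≤ n) : (n : ℤ) ≤ gridV n d ∧
    (2 * n ^ 4 : ℤ) ≤ gridV n d ∧ (d : ℤ) ≤ gridV n d ∧ (3 : ℤ) ≤ gridV n d := by
  obtain ⟨h1, h2, h3⟩ := grid_le hd hn
  exact_mod_cast And.intro h1 (And.intro h2.le h3)

/-- The bounds of the linear system are at most polynomial in the size of the grid. -/
def GridBoundsLE (n d : ℕ) (hm hu hl : ℕ → ℤ) : Prop :=
  ∀ t < gridV n d, |hm t| ≤ (gridV n d : ℤ) ^ 9 ∧ |hu t| ≤ (gridV n d : ℤ) ^ 9 ∧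
    |hl t| ≤ (gridV n d : ℤ) ^ 9

variable (hd : 1 ≤ d) (hn : 1 ≤ n)
include hd hn

theorem dig_le_gridV (t i : ℕ) :
    |(dig n t i : ℤ) - n ^ 4| ≤ gridV n d ∧ (dig n t i : ℤ) ≤ gridV n d := by
  have h1 : (dig n t i : ℤ) ≤ 2 * n ^ 4 := by exact_mod_cast dig_le n t i
  have h2 := (grid_le_int hd hn).2.1
  have h3 : (0 : ℤ) ≤ dig n t i := Nat.cast_nonneg _
  have h4 : (0 : ℤ) ≤ n ^ 4 := by positivity
  rw [abs_le]; refine ⟨⟨?_, ?_⟩, ?_⟩ <;> linarith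

theorem abs_gridLin_le (t c : ℕ) : |gridLin n d t c| ≤ (gridV n d : ℤ) ^ 3 := by
  have hdV := (grid_le_int hd hn).2.2.1
  have h0 : (0 : ℤ) ≤ gridV n d := Nat.cast_nonneg _
  refine (abs_sum_le_sum_abs _ _).trans ((sum_le_card_nsmul _ _
    ((gridV n d : ℤ) * gridV n d) fun i _ => ?_).trans ?_)
  · rw [abs_mul, abs_of_nonneg (a := (dig n c i : ℤ)) (Nat.cast_nonneg _)]
    exact mul_le_mul (dig_le_gridV hd hn t i).1 (dig_le_gridV hd hn c i).2 (Nat.cast_nonneg _) h0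
  · rw [card_range, nsmul_eq_mul]
    calc (d : ℤ) * (gridV n d * gridV n d) ≤ gridV n d * (gridV n d * gridV n d) := by gcongr
      _ = _ := by ring

theorem abs_gridSq_le (t c : ℕ) : |gridSq n d t c| ≤ (gridV n d : ℤ) ^ 4 := by
  have hdV := (grid_le_int hd hn).2.2.1
  have h0 : (0 : ℤ) ≤ gridV n d := Nat.cast_nonneg _
  refine (abs_sum_le_sum_abs _ _).trans ((sum_le_card_nsmul _ _
    ((gridV n d : ℤ) ^ 2 * gridV n d) fun i _ => ?_).trans ?_)
  · rw [abs_mul, abs_pow, abs_of_nonneg (a := (dig n c i : ℤ)) (Nat.cast_nonneg _)]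
    exact mul_le_mul (pow_le_pow_left₀ (abs_nonneg _) (dig_le_gridV hd hn t i).1 2)
      (dig_le_gridV hd hn c i).2 (Nat.cast_nonneg _) (by positivity)
  · rw [card_range, nsmul_eq_mul]
    calc (d : ℤ) * (gridV n d ^ 2 * gridV n d) ≤ gridV n d * (gridV n d ^ 2 * gridV n d) := by
          gcongr
      _ = _ := by ring

theorem abs_gridQuad_le (t c : ℕ) : |gridQuad n d t c| ≤ (gridV n d : ℤ) ^ 7 := by
  obtain ⟨-, h2, -, h3⟩ := grid_le_int hd hn
  have h0 : (0 : ℤ) ≤ gridV n d := Nat.cast_nonneg _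
  set V : ℤ := (gridV n d : ℤ)
  have e : (0 : ℤ) ≤ 2 * n ^ 4 := by positivity
  rw [gridQuad]
  refine (abs_sub _ _).trans ?_
  rw [abs_mul, abs_pow, abs_of_nonneg e]
  calc 2 * (n : ℤ) ^ 4 * |gridSq n d t c| + |gridLin n d t c| ^ 2 ≤ V * V ^ 4 + (V ^ 3) ^ 2 := by
        gcongr
        · exact abs_gridSq_le hd hn t c
        · exact abs_gridLin_le hd hn t c
    _ ≤ V * V ^ 5 + V ^ 6 := by
        have : V ^ 4 ≤ V ^ 5 := pow_le_pow_right₀ (by omega) (by norm_num)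
        have e6 : (V ^ 3) ^ 2 = V ^ 6 := by ring
        rw [e6]
        gcongr
    _ = 2 * V ^ 6 := by ring
    _ ≤ V * V ^ 6 := by gcongr; omega
    _ = _ := by ring

theorem gridE_le : gridE n d ≤ (gridV n d : ℤ) ^ 5 := by
  obtain ⟨h1, -, -, h3⟩ := grid_le_int hd hn
  set V : ℤ := (gridV n d : ℤ) with hV
  have hV1 : 1 ≤ V ^ 4 := one_le_pow₀ (by omega)
  rw [gridE, ← hV]
  calc 2 * (n * V) * (n * V) + 1 ≤ 2 * (V * V) * (V * V) + V ^ 4 := by gcongr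
    _ = 3 * V ^ 4 := by ring
    _ ≤ V * V ^ 4 := by gcongr
    _ = _ := by ring

theorem abs_rowCoef_le (i j : ℕ) : |rowCoef n d i j| ≤ (gridV n d : ℤ) ^ 12 := by
  have h3 := (grid_le_int hd hn).2.2.2
  rw [rowCoef, abs_mul, abs_of_pos (gridE_pos n d)]
  have h37 : (gridV n d : ℤ) ^ 3 ≤ (gridV n d : ℤ) ^ 7 :=
    pow_le_pow_right₀ (by omega) (by norm_num)
  have h07 : (1 : ℤ) ≤ (gridV n d : ℤ) ^ 7 := one_le_pow₀ (by omega)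
  calc _ ≤ (gridV n d : ℤ) ^ 5 * (gridV n d : ℤ) ^ 7 := by
        refine mul_le_mul (gridE_le hd hn) ?_ (abs_nonneg _) (by positivity)
        split_ifs
        · exact (abs_gridLin_le hd hn _ _).trans h37
        · exact abs_gridQuad_le hd hn _ _
        · rw [abs_neg]; exact abs_gridQuad_le hd hn _ _
        · simpa using h07
        · simpa using h07
    _ = _ := by ring

theorem abs_rowBound_le {hm hu hl : ℕ → ℤ}
    (hh : GridBoundsLE n d hm hu hl) (i : ℕ) :
    |rowBound n d hm hu hl i| ≤ (gridV n d : ℤ) ^ 14 := by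
  obtain ⟨h1, -, -, h3⟩ := grid_le_int hd hn
  have hi := Nat.mod_lt i (gridV_pos n d)
  rw [rowBound, abs_mul, abs_of_pos (gridE_pos n d)]
  have h19 : (gridV n d : ℤ) ≤ (gridV n d : ℤ) ^ 9 := le_self_pow₀ (by omega) (by norm_num)
  have hn9 : |(n : ℤ)| ≤ (gridV n d : ℤ) ^ 9 := by
    rw [abs_of_nonneg (Nat.cast_nonneg _)]; omega
  calc _ ≤ (gridV n d : ℤ) ^ 5 * (gridV n d : ℤ) ^ 9 := by
        refine mul_le_mul (gridE_le hd hn) ?_ (abs_nonneg _) (by positivity)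
        split_ifs
        · exact (hh _ hi).1
        · exact (hh _ hi).2.1
        · rw [abs_neg]; exact (hh _ hi).2.2
        · exact hn9
        · rw [abs_neg]; exact hn9
    _ = _ := by ring

/-- The number of greedy rounds that the program performs is large enough. -/
theorem detectsUpTo_grid {hm hu hl : ℕ → ℤ}
    (hh : GridBoundsLE n d hm hu hl) :
    DetectsUpTo (rowCoef n d) (rowBound n d hm hu hl) (5 * gridV n d) (n * gridV n d)
      (gridV n d ^ 33) (gridV n d ^ 15) := by
  have h1 := (grid_le_int hd hn).1
  have h3 := (grid_le hd hn).2.2.2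
  have h3' : (3 : ℤ) ≤ gridV n d := by exact_mod_cast h3
  constructor
  · set V := gridV n d
    calc 5 * V * (V ^ 15) ^ 2 = 5 * V ^ 31 := by ring
      _ ≤ V ^ 2 * V ^ 31 := by gcongr; nlinarith
      _ = _ := by ring
  · intro σ h0 hσ s hs i _
    set V : ℤ := (gridV n d : ℤ) with hV
    have e1 : |∑ j ∈ range (n * gridV n d), rowCoef n d i j * s j| ≤ V ^ 14 := by
      refine (abs_sum_le_sum_abs _ _).trans ((sum_le_card_nsmul _ _
        (V ^ 12) fun j hj => ?_).trans ?_)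
      · rw [abs_mul]
        rcases hs j (mem_range.1 hj) with h | h <;> rw [h]
        · simp only [abs_zero, mul_zero]; positivity
        · rw [abs_one, mul_one]; exact abs_rowCoef_le hd hn i j
      · rw [card_range, nsmul_eq_mul]
        push_cast
        rw [← hV]
        calc n * V * V ^ 12 ≤ V * V * V ^ 12 := by gcongr
          _ = _ := by ring
    have e2 := abs_rowBound_le hd hn hh i
    rw [← hV] at e2
    have e3 : |σ| ≤ V ^ 14 := by
      rw [abs_of_nonneg h0]
      push_cast at hσ
      rw [← hV] at hσ
      calc σ ≤ 2 * (n * V) * (n * V) := hσ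
        _ ≤ V * (V * V) * (V * V) := by gcongr; omega
        _ = V ^ 5 := by ring
        _ ≤ V ^ 14 := pow_le_pow_right₀ (by omega) (by norm_num)
    refine (abs_sub _ _).trans ((add_le_add_left (abs_sub _ _) _).trans ?_)
    push_cast
    rw [← hV]
    calc _ ≤ V ^ 14 + V ^ 14 + V ^ 14 := by gcongr
      _ = 3 * V ^ 14 := by ring
      _ ≤ V * V ^ 14 := by gcongr
      _ = V ^ 15 := by ring

variable {μ : Fin d → ℝ} {S P : Matrix (Fin d) (Fin d) ℝ} {ε₁ ε₂ : ℝ} {good : ℕ → Prop}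
  {hm hu hl : ℕ → ℤ} {π : Fin n → Fin (d + 1) → ℝ}

theorem GridBounds.abs_le (hB : GridBounds n d μ S P ε₁ ε₂ good hm hu hl)
    (H : IsRealizedBy μ S ε₁ ε₂ π) (hP : ((n : ℝ) ^ 2 • 1 + (1 + ε₂) • S) * P = 1) :
    GridBoundsLE n d hm hu hl := by
  obtain ⟨h1, h2, h4, h3⟩ := grid_le_int hd hn
  have h2' : (n ^ 4 : ℤ) ≤ gridV n d := by
    have : (0 : ℤ) ≤ n ^ 4 := by positivity
    omega
  intro t ht
  set V : ℤ := (gridV n d : ℤ) with hV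
  have hV0 : 0 ≤ V := by omega
  have hV59 : V ^ 5 ≤ V ^ 9 := pow_le_pow_right₀ (by omega) (by norm_num)
  have hslack : gridSlack n d ≤ V ^ 6 := by
    rw [gridSlack]
    calc 3 * d * n * ((n : ℤ) ^ 4) ^ 2 * (2 * n ^ 4) ≤ V * V * V * V ^ 2 * V := by gcongr
      _ = _ := by ring
  have hslack0 : 0 ≤ gridSlack n d := by unfold gridSlack; positivity
  have hV9 : 9 * V ^ 7 ≤ V ^ 9 := by
    calc 9 * V ^ 7 ≤ (V * V) * V ^ 7 := by gcongr; nlinarith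
      _ = _ := by ring
  have hV67 : V ^ 6 ≤ V ^ 7 := pow_le_pow_right₀ (by omega) (by norm_num)
  have hV7 : 2 ≤ V ^ 7 := by
    calc (2 : ℤ) ≤ V := by omega
      _ ≤ V ^ 7 := le_self_pow₀ (by omega) (by norm_num)
  have hvv : gridVec n d t ⬝ᵥ gridVec n d t ≤ ((V ^ 3 : ℤ) : ℝ) := by
    refine (sum_le_card_nsmul _ _ (((V ^ 2 : ℤ)) : ℝ) fun i _ => ?_).trans ?_
    · rw [← abs_mul_abs_self, ← sq]
      have : |gridVec n d t i| ≤ ((V : ℤ) : ℝ) := by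
        refine (abs_gridVec_le t i).trans ?_
        exact_mod_cast h2'
      push_cast
      gcongr
    · simp only [card_univ, Fintype.card_fin, nsmul_eq_mul]
      norm_cast
      calc (d : ℤ) * V ^ 2 ≤ V * V ^ 2 := by gcongr
        _ = _ := by ring
  have hG2 : (2 * (n : ℝ) ^ 4) ^ 2 ≤ ((V ^ 2 : ℤ) : ℝ) := by
    have : (2 * (n : ℝ) ^ 4) ≤ ((V : ℤ) : ℝ) := by exact_mod_cast h2
    push_cast
    gcongr
  have hvv0 := dotProduct_self_nonneg' (gridVec n d t)
  have hn0 : (0 : ℝ) < n := by exact_mod_cast hn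
  have hnV : (n : ℝ) ≤ ((V : ℤ) : ℝ) := by exact_mod_cast h1
  refine ⟨?_, ?_, ?_⟩
  · obtain ⟨g0, hg0, hgood0, -⟩ := H.exists_good hB.complete
    obtain ⟨g, hg, -, hle⟩ := hB.mean_le ⟨g0, hg0, hgood0⟩ t ht
    have hle0 := hB.le_mean t ht g0 hg0 hgood0
    have hb : ∀ g, |gridVal n d t g| ≤ V ^ 5 := fun g => by
      rw [gridVal, abs_mul, abs_of_nonneg (by positivity : (0 : ℤ) ≤ 2 * n ^ 4)]
      have e : |gridLin n d t g + 2 * n ^ 4 * d| ≤ V ^ 3 + V * V := by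
        refine (abs_add_le _ _).trans (add_le_add (abs_gridLin_le hd hn t g) ?_)
        rw [abs_of_nonneg (by positivity)]
        gcongr
      calc _ ≤ V * (V ^ 3 + V * V) := by gcongr
        _ ≤ V * (V ^ 3 + V * V ^ 2) := by gcongr; nlinarith
        _ = 2 * V ^ 4 := by ring
        _ ≤ V * V ^ 4 := by gcongr; omega
        _ = _ := by ring
    have e1 := _root_.abs_le.1 (hb g)
    have e0 := _root_.abs_le.1 (hb g0)
    rw [_root_.abs_le]
    constructor <;> linarith
  · have hup := hB.upper_le t ht
    have hlo := hB.le_upper t ht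
    set A := gridVec n d t ⬝ᵥ
      ((1 + n / (n : ℝ) ^ 2) • capForm ((n : ℝ) ^ 2) P) *ᵥ gridVec n d t with hA
    have hA0 : 0 ≤ A := ((posSemidef_capForm H.posSemidef_upper hP (by positivity)).smul
      (by positivity : (0 : ℝ) ≤ 1 + n / (n : ℝ) ^ 2)).form_nonneg _
    have hA1 : A ≤ ((2 * V ^ 5 : ℤ) : ℝ) := by
      have e := capForm_le_level H.posSemidef_upper hP (by positivity) (gridVec n d t)
      rw [hA, smul_form]
      calc _ ≤ (1 + n / (n : ℝ) ^ 2) * ((n : ℝ) ^ 2 * (gridVec n d t ⬝ᵥ gridVec n d t)) := by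
            gcongr
        _ = ((n : ℝ) ^ 2 + n) * (gridVec n d t ⬝ᵥ gridVec n d t) := by field_simp
        _ ≤ ((V ^ 2 + V ^ 2 : ℤ) : ℝ) * ((V ^ 3 : ℤ) : ℝ) := by
            gcongr
            push_cast
            have e1 : (1 : ℝ) ≤ ((V : ℤ) : ℝ) := by exact_mod_cast (by omega : (1 : ℤ) ≤ V)
            gcongr
            nlinarith
        _ = _ := by push_cast; ring
    have hA2 : (2 * (n : ℝ) ^ 4) ^ 2 * A ≤ ((2 * V ^ 7 : ℤ) : ℝ) := by
      calc _ ≤ ((V ^ 2 : ℤ) : ℝ) * ((2 * V ^ 5 : ℤ) : ℝ) := by gcongr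
        _ = _ := by push_cast; ring
    have hA3 : 0 ≤ (2 * (n : ℝ) ^ 4) ^ 2 * A := by positivity
    have e1 : hu t ≤ 2 * V ^ 7 + gridSlack n d + 2 := by
      have : (hu t : ℝ) ≤ ((2 * V ^ 7 : ℤ) : ℝ) + gridSlack n d + 2 := by linarith
      exact_mod_cast this
    have e2 : 0 ≤ hu t := by
      have : (0 : ℝ) ≤ gridSlack n d := by exact_mod_cast hslack0
      have : (0 : ℝ) ≤ hu t := by linarith
      exact_mod_cast this
    rw [_root_.abs_le]
    constructor <;> linarith
  · have hup := hB.lower_le t ht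
    have hlo := hB.le_lower t ht
    set A := gridVec n d t ⬝ᵥ (max (1 - ε₂) 0 • S) *ᵥ gridVec n d t with hA
    have hA0 : 0 ≤ A := (H.posSemidef.smul (le_max_right _ _)).form_nonneg _
    have hA1 : A ≤ ((V ^ 4 : ℤ) : ℝ) := by
      have e := (H.lower_le_cov_form (gridVec n d t)).trans (covMat_gmdLaw_form_le H.stochastic _)
      calc A ≤ n * (gridVec n d t ⬝ᵥ gridVec n d t) := e
        _ ≤ ((V : ℤ) : ℝ) * ((V ^ 3 : ℤ) : ℝ) := by gcongr
        _ = _ := by push_cast; ring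
    have hA2 : (2 * (n : ℝ) ^ 4) ^ 2 * A ≤ ((V ^ 6 : ℤ) : ℝ) := by
      calc _ ≤ ((V ^ 2 : ℤ) : ℝ) * ((V ^ 4 : ℤ) : ℝ) := by gcongr
        _ = _ := by push_cast; ring
    have hA3 : 0 ≤ (2 * (n : ℝ) ^ 4) ^ 2 * A := by positivity
    have e1 : hl t ≤ V ^ 6 - gridSlack n d := by
      have : (hl t : ℝ) ≤ ((V ^ 6 : ℤ) : ℝ) - gridSlack n d := by linarith
      exact_mod_cast this
    have e2 : - gridSlack n d - 2 ≤ hl t := by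
      have : (- gridSlack n d - 2 : ℝ) ≤ hl t := by linarith
      exact_mod_cast this
    rw [_root_.abs_le]
    constructor <;> linarith

end GridSize

/-! ### The rounded solution -/

section Rounded

variable {n d : ℕ} {μ : Fin d → ℝ} {S P : Matrix (Fin d) (Fin d) ℝ} {ε₁ ε₂ : ℝ} {good : ℕ → Prop}
  {hm hu hl : ℕ → ℤ} {π₀ : Fin n → Fin (d + 1) → ℝ} {F : ℕ → ℤ}

/-- The accumulated tolerance of the rounding procedure is less than one unit in each row. -/
theorem exists_onFace_of_feasible
    (h : FaceFeasible (rowCoef n d) (rowBound n d hm hu hl) (5 * gridV n d) (n * gridV n d) F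
      (2 * (n * gridV n d : ℕ) * (n * gridV n d : ℕ))) :
    ∃ f : ℕ → ℝ, OnFace (n * gridV n d) F f ∧
      (∀ t < gridV n d,
        ∑ j ∈ range (n * gridV n d), (gridLin n d t j : ℝ) * f j ≤ hm t + 1 ∧
        ∑ j ∈ range (n * gridV n d), (gridQuad n d t j : ℝ) * f j ≤ hu t + 1 ∧
        hl t - 1 ≤ ∑ j ∈ range (n * gridV n d), (gridQuad n d t j : ℝ) * f j) ∧
      ∑ j ∈ range (n * gridV n d), f j < n + 1 ∧
      n - 1 < ∑ j ∈ range (n * gridV n d), f j := by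
  obtain ⟨f, hf, hrow⟩ := h
  set V := gridV n d with hV
  have hE : (0 : ℝ) < gridE n d := by exact_mod_cast gridE_pos n d
  have key : ∀ q t, q < 5 → t < V → ∑ j ∈ range (n * V),
      (if q = 0 then (gridLin n d t j : ℝ) else if q = 1 then gridQuad n d t j
        else if q = 2 then -gridQuad n d t j else if q = 3 then 1 else -1) * f j <
      (if q = 0 then (hm t : ℝ) else if q = 1 then hu t
        else if q = 2 then -hl t else if q = 3 then n else -n) + 1 := fun q t hq ht => by
    have hi : q * V + t < 5 * V := by nlinarith
    have h1 := hrow (q * V + t) hi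
    simp only [rowCoef, rowBound, ← hV, mul_add_div_mod ht, Int.cast_mul, mul_assoc,
      ← mul_sum] at h1
    have h2 : ((2 : ℤ) : ℝ) * ((((n * V : ℕ) : ℤ) : ℝ) * (((n * V : ℕ) : ℤ) : ℝ)) =
        gridE n d - 1 := by
      rw [gridE]; push_cast; ring
    rw [h2] at h1
    refine lt_of_mul_lt_mul_left ?_ hE.le
    have h3 : ∀ x y : ℝ, gridE n d * x ≤ gridE n d * y + (gridE n d - 1) →
        gridE n d * x < gridE n d * (y + 1) := fun x y h => by linarith
    refine h3 _ _ ?_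
    convert h1 using 3
    · split_ifs <;> push_cast <;> rfl
    · split_ifs <;> push_cast <;> rfl
  refine ⟨f, hf, fun t ht => ⟨?_, ?_, ?_⟩, ?_, ?_⟩
  · simpa using (key 0 t (by norm_num) ht).le
  · simpa using (key 1 t (by norm_num) ht).le
  · have := key 2 t (by norm_num) ht
    norm_num at this
    linarith
  · have := key 3 0 (by norm_num) (gridV_pos n d)
    norm_num at this
    exact this
  · have := key 4 0 (by norm_num) (gridV_pos n d)
    norm_num at this
    linarith

/-- The fixed variables with the value one are at most `n` in number, and together with the free
variables they are at least `n`. -/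
theorem count_ones_of_roundInv (hI : RoundInv (rowCoef n d) (rowBound n d hm hu hl)
      (5 * gridV n d) (n * gridV n d) (gridStart n d) F
      (2 * (n * gridV n d : ℕ) * (n * gridV n d : ℕ))) :
    {j ∈ range (n * gridV n d) | F j = 1}.card ≤ n ∧
      n ≤ {j ∈ range (n * gridV n d) | F j = 1}.card +
        (freeVars (n * gridV n d) F).card := by
  obtain ⟨f, hf, -, h1, h2⟩ := exists_onFace_of_feasible hI.feasible
  set N := n * gridV n d
  have e1 : ((({j ∈ range N | F j = 1}.card : ℕ)) : ℝ) ≤ ∑ j ∈ range N, f j := by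
    rw [card_filter]
    push_cast
    refine sum_le_sum fun j hj => ?_
    obtain ⟨h3, -, h5⟩ := hf j (mem_range.1 hj)
    split_ifs with h
    · rw [h5 (by omega), h]; simp
    · exact h3
  have e2 : ∑ j ∈ range N, f j ≤
      (({j ∈ range N | F j = 1}.card + (freeVars N F).card : ℕ) : ℝ) := by
    rw [freeVars, card_filter, card_filter]
    push_cast
    rw [← sum_add_distrib]
    refine sum_le_sum fun j hj => ?_
    obtain ⟨-, h4, h5⟩ := hf j (mem_range.1 hj)
    rcases hI.isPartial j (mem_range.1 hj) with h | h | h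
    · rw [h5 (by omega), h]; simp
    · rw [h5 (by omega), h]; simp
    · rw [h]; simpa using h4
  constructor
  · have : ((({j ∈ range N | F j = 1}.card : ℕ)) : ℝ) < ((n + 1 : ℕ) : ℝ) := by
      push_cast; linarith
    exact Nat.lt_succ_iff.1 (by exact_mod_cast this)
  · have : ((n : ℕ) : ℝ) < ((({j ∈ range N | F j = 1}.card + (freeVars N F).card : ℕ) + 1
        : ℕ) : ℝ) := by
      push_cast at e2 ⊢; linarith
    exact Nat.lt_succ_iff.1 (by exact_mod_cast this)

/-- A completion of the partial assignment found by the rounding procedure solves the problem. -/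
theorem GridBounds.spectrallyClose (hB : GridBounds n d μ S P ε₁ ε₂ good hm hu hl)
    (H : IsRealizedBy μ S ε₁ ε₂ π₀) (hd : 1 ≤ d) (hn : 2 * (d + 1) ^ 2 < n)
    (hP : ((n : ℝ) ^ 2 • 1 + (1 + ε₂) • S) * P = 1)
    (hI : RoundInv (rowCoef n d) (rowBound n d hm hu hl)
      (5 * gridV n d) (n * gridV n d) (gridStart n d) F
      (2 * (n * gridV n d : ℕ) * (n * gridV n d : ℕ)))
    (hcard : (freeVars (n * gridV n d) F).card ≤ d + d * d + 1) {F' : ℕ → ℤ}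
    (hF' : ∀ j < n * gridV n d, (F' j = 0 ∨ F' j = 1) ∧ (F j ≠ 2 → F' j = F j))
    {π : Fin n → Fin (d + 1) → ℝ} (hπ : IsRowStochastic π)
    (hπF : ∀ g : (Fin d → ℝ) → ℝ, ∑ i, g (fun j => π i j.castSucc) =
      ∑ j ∈ range (n * gridV n d), (F' j : ℝ) * g (gridType n d j)) :
    SpectrallyClose μ S (gmdLaw π) ε₁ ε₂ (3 * ((d : ℝ) + 1) ^ (5 / 2 : ℝ))
      (3 * ((d : ℝ) + 1) ^ 3) := by
  have hn0 : 0 < n := by nlinarith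
  have hn1 : (1 : ℝ) ≤ n := by exact_mod_cast hn0
  have hn4 : (1 : ℝ) ≤ (n : ℝ) ^ 4 := one_le_pow₀ hn1
  obtain ⟨f, hf, hrows, hs1, -⟩ := exists_onFace_of_feasible hI.feasible
  set V := gridV n d with hV
  set N := n * V with hN
  have hvalid : ∀ j < N, F j ≠ 0 → IsSubprob (gridType n d j) := fun j hj hFj => by
    refine isSubprob_gridType hn0 fun h0 => hFj ?_
    rw [hI.keeps j hj (by omega), h0]
  have hG : (0 : ℝ) < (2 * (n : ℝ) ^ 4) ^ 2 := by positivity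
  have hG1 : (1 : ℝ) ≤ (2 * (n : ℝ) ^ 4) ^ 2 := one_le_pow₀ (by linarith)
  have hquad : ∀ t, ∑ j ∈ range N, (gridQuad n d t j : ℝ) * f j = (2 * (n : ℝ) ^ 4) ^ 2 *
      (gridVec n d t ⬝ᵥ mixCov (range N) f (gridType n d) *ᵥ gridVec n d t) := fun t => by
    rw [mixCov_form, mul_sum]
    exact sum_congr rfl fun j _ => by rw [cast_gridQuad hn0]; ring
  have hslack : (gridSlack n d : ℝ) + 3 ≤ (2 * (n : ℝ) ^ 4) ^ 2 * (2 * d * n * n ^ 4 + 3) := by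
    have e : (2 * (n : ℝ) ^ 4) ^ 2 * (2 * d * n * n ^ 4) = gridSlack n d + 2 * d * n *
        ((n : ℝ) ^ 4) ^ 3 := by
      rw [gridSlack]; push_cast; ring
    have e2 : (0 : ℝ) ≤ 2 * d * n * ((n : ℝ) ^ 4) ^ 3 := by positivity
    linarith
  refine H.spectrallyClose_of_net (s := range N) (f := f) (F := fun j => (F' j : ℝ))
    (x := gridType n d) hd hn hP ?_ ?_ ?_ hs1.le ?_ ?_ ?_ ?_ hπ hπF
  · exact fun j hj => (hf j (mem_range.1 hj)).1
  · intro j hj hfj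
    refine hvalid j (mem_range.1 hj) fun h0 => hfj ?_
    rw [(hf j (mem_range.1 hj)).2.2 (by omega), h0, Int.cast_zero]
  · intro j hj hFj
    refine hvalid j (mem_range.1 hj) fun h0 => hFj ?_
    rw [(hF' j (mem_range.1 hj)).2 (by omega), h0, Int.cast_zero]
  -- only the free variables change, each of them by at most one
  · calc ∑ j ∈ range N, |(F' j : ℝ) - f j| ≤
          ∑ j ∈ range N, if F j = 2 then (1 : ℝ) else 0 := by
          refine sum_le_sum fun j hj => ?_
          obtain ⟨h3, h4, h5⟩ := hf j (mem_range.1 hj)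
          obtain ⟨h6, h7⟩ := hF' j (mem_range.1 hj)
          split_ifs with h
          · rw [_root_.abs_le]
            rcases h6 with h6 | h6 <;> rw [h6] <;> constructor <;> push_cast <;> linarith
          · rw [h5 h, h7 h, sub_self, abs_zero]
      _ = ((freeVars N F).card : ℝ) := by
          rw [freeVars, card_filter]; push_cast; rfl
      _ ≤ ((d + d * d + 1 : ℕ) : ℝ) := by exact_mod_cast hcard
      _ ≤ _ := by push_cast; nlinarith [(Nat.cast_nonneg d : (0 : ℝ) ≤ d)]
  -- `hm t` is the maximum over the good means, hence attained by one of them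
  · intro y hy
    obtain ⟨t, ht, rfl⟩ := exists_gridVec_eq hy
    obtain ⟨g0, hg0, hgood0, -⟩ := H.exists_good hB.complete
    obtain ⟨g, hg, hgood, hle⟩ := hB.mean_le ⟨g0, hg0, hgood0⟩ t ht
    refine ⟨gridMean n d g, fun i => Nat.cast_nonneg _, fun v =>
      (le_abs_self _).trans (hB.sound g hg hgood v), ?_⟩
    rw [dotProduct_mixMean]
    have h1 := (hrows t ht).1
    have h2 : ∑ j ∈ range N, (gridLin n d t j : ℝ) * f j = 2 * (n : ℝ) ^ 4 *
        ∑ j ∈ range N, f j * (gridVec n d t ⬝ᵥ gridType n d j) := by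
      rw [mul_sum]
      exact sum_congr rfl fun j _ => by rw [cast_gridLin' hn0]; ring
    have h3 : (hm t : ℝ) ≤ 2 * (n : ℝ) ^ 4 * (gridVec n d t ⬝ᵥ gridMean n d g + 2 * n ^ 4 * d) := by
      rw [gridVal] at hle; rw [← cast_gridLin]; exact_mod_cast hle
    rw [h2] at h1
    refine le_of_mul_le_mul_left ?_ (by positivity : (0 : ℝ) < 2 * (n : ℝ) ^ 4)
    linarith
  · intro y hy
    obtain ⟨t, ht, rfl⟩ := exists_gridVec_eq hy
    have h1 := (hrows t ht).2.1
    have h2 := hB.upper_le t ht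
    rw [hquad] at h1
    refine le_of_mul_le_mul_left ?_ hG
    rw [mul_add]
    linarith
  · intro y hy
    obtain ⟨t, ht, rfl⟩ := exists_gridVec_eq hy
    have h1 := (hrows t ht).2.2
    have h2 := hB.le_lower t ht
    rw [hquad] at h1
    refine le_of_mul_le_mul_left ?_ hG
    rw [mul_add]
    linarith

end Rounded

/-! ### Tests in integer arithmetic -/

section IntTests

variable {n d : ℕ} {μ : Fin d → ℝ} {S : Matrix (Fin d) (Fin d) ℝ} {ε₁ ε₂ : ℝ}

/-- The parameters with common denominators. -/
structure IsScaled (μ : Fin d → ℝ) (S : Matrix (Fin d) (Fin d) ℝ) (ε₁ ε₂ : ℝ) (D a₁ b₁ a₂ b₂ : ℤ)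
    (u : Fin d → ℤ) (s : Matrix (Fin d) (Fin d) ℤ) : Prop where
  den_pos : 0 < D
  b₁_pos : 0 < b₁
  b₂_pos : 0 < b₂
  ε₁_eq : ε₁ = a₁ / b₁
  ε₂_eq : ε₂ = a₂ / b₂
  mean : ∀ i, u i = D * μ i
  cov : ∀ i j, s i j = D * S i j

/-- The matrix whose adjugate decides whether a mean is good. -/
def meanMat (D a₁ b₁ : ℤ) (s : Matrix (Fin d) (Fin d) ℤ) (lam : ℤ) : Matrix (Fin d) (Fin d) ℤ :=
  (lam * b₁ ^ 2 * D) • 1 + a₁ ^ 2 • s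

/-- The certificate that the grid point `g` is near the mean in the ellipsoidal norm, in terms of
a multiple of the inverse of `meanMat`. -/
def MeanTest (D a₁ b₁ : ℤ) (u : Fin d → ℤ) (s : Matrix (Fin d) (Fin d) ℤ) (lam : ℤ)
    (g : Fin d → ℤ) : Prop :=
  ∃ E : ℤ, E ≠ 0 ∧ meanMat D a₁ b₁ s lam * flSeq (meanMat D a₁ b₁ s lam) (d - 1) = E • 1 ∧
    b₁ ^ 2 * a₁ ^ 2 * ((flSeq (meanMat D a₁ b₁ s lam) (d - 1) *ᵥ (D • g - u)) ⬝ᵥ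
      s *ᵥ (flSeq (meanMat D a₁ b₁ s lam) (d - 1) *ᵥ (D • g - u))) ≤ E ^ 2 * D ∧
    lam ^ 2 * b₁ ^ 4 * ((flSeq (meanMat D a₁ b₁ s lam) (d - 1) *ᵥ (D • g - u)) ⬝ᵥ
      (flSeq (meanMat D a₁ b₁ s lam) (d - 1) *ᵥ (D • g - u))) ≤ 4 * d * E ^ 2

/-- The matrix whose adjugate yields the cap of the covariance matrix. -/
def capMat (n : ℕ) (D a₂ b₂ : ℤ) (s : Matrix (Fin d) (Fin d) ℤ) : Matrix (Fin d) (Fin d) ℤ :=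
  ((n : ℤ) ^ 2 * b₂ * D) • 1 + (a₂ + b₂) • s

variable {D a₁ b₁ a₂ b₂ : ℤ} {u : Fin d → ℤ} {s : Matrix (Fin d) (Fin d) ℤ}

theorem cast_dotProduct (v w : Fin d → ℤ) :
    ((v ⬝ᵥ w : ℤ) : ℝ) = (fun i => (v i : ℝ)) ⬝ᵥ fun i => (w i : ℝ) := by
  simp [dotProduct]

theorem cast_mulVec (M : Matrix (Fin d) (Fin d) ℤ) (v : Fin d → ℤ) :
    (fun i => ((M *ᵥ v) i : ℝ)) = M.map (Int.cast : ℤ → ℝ) *ᵥ fun i => (v i : ℝ) := by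
  ext i; simp [mulVec, dotProduct]

theorem map_mul_cast (M N : Matrix (Fin d) (Fin d) ℤ) : (M * N).map (Int.cast : ℤ → ℝ) =
    M.map (Int.cast : ℤ → ℝ) * N.map (Int.cast : ℤ → ℝ) := by
  ext i j; simp [Matrix.mul_apply]

theorem map_smul_one_cast (E : ℤ) : ((E • 1 : Matrix (Fin d) (Fin d) ℤ)).map (Int.cast : ℤ → ℝ) =
    (E : ℝ) • 1 := by
  ext i j
  simp only [Matrix.map_apply, Matrix.smul_apply, Matrix.one_apply, smul_eq_mul]
  split_ifs <;> simp

theorem sq_resolvent_le_iff (E : ℤ) (hE : E ≠ 0) (lam : ℤ) (z : Fin d → ℤ) :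
    ((lam : ℝ) ^ 2 * ((((b₁ : ℝ) ^ 2 / E) • fun i => (z i : ℝ)) ⬝ᵥ
      (((b₁ : ℝ) ^ 2 / E) • fun i => (z i : ℝ))) ≤ (2 * √d) ^ 2 ↔
      lam ^ 2 * b₁ ^ 4 * (z ⬝ᵥ z) ≤ 4 * d * E ^ 2) := by
  have hE' : (0 : ℝ) < (E : ℝ) ^ 2 := by
    have : (E : ℝ) ≠ 0 := by exact_mod_cast hE
    positivity
  have h1 : (lam ^ 2 * b₁ ^ 4 * (z ⬝ᵥ z) ≤ 4 * d * E ^ 2) ↔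
      (lam : ℝ) ^ 2 * b₁ ^ 4 * ((z ⬝ᵥ z : ℤ) : ℝ) ≤ 4 * d * E ^ 2 := by exact_mod_cast Iff.rfl
  rw [h1, cast_dotProduct, smul_dotProduct, dotProduct_smul, mul_pow, Real.sq_sqrt
    (Nat.cast_nonneg d)]
  simp only [smul_eq_mul]
  set q := (fun i => (z i : ℝ)) ⬝ᵥ fun i => (z i : ℝ)
  have h2 : (lam : ℝ) ^ 2 * (b₁ ^ 2 / E * (b₁ ^ 2 / E * q)) =
      (lam ^ 2 * b₁ ^ 4 * q) / E ^ 2 := by field_simp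
  rw [h2, div_le_iff₀ hE']
  norm_num

namespace IsScaled

variable (h : IsScaled μ S ε₁ ε₂ D a₁ b₁ a₂ b₂ u s)
include h

theorem map_s : s.map (Int.cast : ℤ → ℝ) = (D : ℝ) • S := by
  ext i j; simp [h.cov]

theorem map_meanMat (lam : ℤ) : (meanMat D a₁ b₁ s lam).map (Int.cast : ℤ → ℝ) =
    ((b₁ : ℝ) ^ 2 * D) • ((lam : ℝ) • 1 + ε₁ ^ 2 • S) := by
  have hb : (b₁ : ℝ) ≠ 0 := by exact_mod_cast h.b₁_pos.ne'
  ext i j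
  simp only [meanMat, Matrix.map_apply, Matrix.add_apply, Matrix.smul_apply, smul_eq_mul,
    Int.cast_add, Int.cast_mul, Int.cast_pow, h.cov, h.ε₁_eq, Matrix.one_apply]
  split_ifs <;> push_cast <;> field_simp

theorem map_capMat : (capMat n D a₂ b₂ s).map (Int.cast : ℤ → ℝ) =
    ((b₂ : ℝ) * D) • ((n : ℝ) ^ 2 • 1 + (1 + ε₂) • S) := by
  have hb : (b₂ : ℝ) ≠ 0 := by exact_mod_cast h.b₂_pos.ne'
  ext i j
  simp only [capMat, Matrix.map_apply, Matrix.add_apply, Matrix.smul_apply, smul_eq_mul,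
    Int.cast_add, Int.cast_mul, Int.cast_pow, h.cov, h.ε₂_eq, Matrix.one_apply]
  split_ifs <;> push_cast <;> field_simp <;> ring

theorem exists_meanMat (hd : 1 ≤ d) (hS : S.PosSemidef) {lam : ℤ} (hlam : 0 < lam) :
    ∃ E : ℤ, E ≠ 0 ∧
      meanMat D a₁ b₁ s lam * flSeq (meanMat D a₁ b₁ s lam) (d - 1) = E • 1 := by
  have hb : (0 : ℝ) < b₁ := by exact_mod_cast h.b₁_pos
  have hD : (0 : ℝ) < D := by exact_mod_cast h.den_pos
  have hl : (0 : ℝ) < lam := by exact_mod_cast hlam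
  refine mul_flSeq hd ?_
  rw [h.map_meanMat]
  exact ((PosDef.one.smul hl).add_posSemidef (hS.smul (sq_nonneg _))).smul (by positivity)

theorem exists_capMat (hd : 1 ≤ d) (hn : 1 ≤ n) (hY : ((1 + ε₂) • S).PosSemidef) :
    ∃ E : ℤ, E ≠ 0 ∧ capMat n D a₂ b₂ s * flSeq (capMat n D a₂ b₂ s) (d - 1) = E • 1 := by
  have hb : (0 : ℝ) < b₂ := by exact_mod_cast h.b₂_pos
  have hD : (0 : ℝ) < D := by exact_mod_cast h.den_pos
  have hl : (0 : ℝ) < (n : ℝ) ^ 2 := by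
    have : (0 : ℝ) < n := by exact_mod_cast hn
    positivity
  refine mul_flSeq hd ?_
  rw [h.map_capMat]
  exact ((PosDef.one.smul hl).add_posSemidef hY).smul (by positivity)

/-- The resolvent in terms of a multiple of the inverse. -/
theorem resolvent_eq {lam E : ℤ} (hE : E ≠ 0) {M : Matrix (Fin d) (Fin d) ℤ}
    (hM : meanMat D a₁ b₁ s lam * M = E • 1) (g : Fin d → ℤ) :
    (ε₁ ^ 2 • S) *ᵥ (((b₁ : ℝ) ^ 2 / E) • fun i => ((M *ᵥ (D • g - u)) i : ℝ)) +
      (lam : ℝ) • (((b₁ : ℝ) ^ 2 / E) • fun i => ((M *ᵥ (D • g - u)) i : ℝ)) =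
      (fun i => (g i : ℝ)) - μ := by
  have hb : (b₁ : ℝ) ≠ 0 := by exact_mod_cast h.b₁_pos.ne'
  have hD : (D : ℝ) ≠ 0 := by exact_mod_cast h.den_pos.ne'
  have hE' : (E : ℝ) ≠ 0 := by exact_mod_cast hE
  have h1 := congrArg (fun A : Matrix (Fin d) (Fin d) ℤ => A.map (Int.cast : ℤ → ℝ)) hM
  simp only [map_mul_cast, map_smul_one_cast, h.map_meanMat] at h1
  have h2 := congrArg (fun A => A *ᵥ fun i => ((D • g - u) i : ℝ)) h1
  simp only [← mulVec_mulVec, smul_mulVec, one_mulVec] at h2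
  rw [← cast_mulVec, add_mulVec, smul_mulVec, one_mulVec] at h2
  rw [mulVec_smul]
  ext i
  have h3 := congrFun h2 i
  simp only [Pi.smul_apply, Pi.add_apply, smul_eq_mul, Pi.sub_apply, Int.cast_sub, Int.cast_mul,
    h.mean] at h3 ⊢
  set x := ((ε₁ ^ 2 • S) *ᵥ fun i => ((M *ᵥ (D • g - u)) i : ℝ)) i
  set y := ((M *ᵥ (D • g - u)) i : ℝ)
  field_simp
  have h4 : (D : ℝ) * (b₁ ^ 2 * (x + lam * y)) = D * (E * (g i - μ i)) := by
    linear_combination h3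
  exact mul_left_cancel₀ hD h4

theorem form_resolvent (E : ℤ) (hE : E ≠ 0) (z : Fin d → ℤ) :
    ((((b₁ : ℝ) ^ 2 / E) • fun i => (z i : ℝ)) ⬝ᵥ (ε₁ ^ 2 • S) *ᵥ
      (((b₁ : ℝ) ^ 2 / E) • fun i => (z i : ℝ)) ≤ 1 ↔
      b₁ ^ 2 * a₁ ^ 2 * (z ⬝ᵥ s *ᵥ z) ≤ E ^ 2 * D) := by
  have hb : (0 : ℝ) < b₁ := by exact_mod_cast h.b₁_pos
  have hD : (0 : ℝ) < D := by exact_mod_cast h.den_pos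
  have hE' : (0 : ℝ) < (E : ℝ) ^ 2 := by
    have : (E : ℝ) ≠ 0 := by exact_mod_cast hE
    positivity
  have e : ((z ⬝ᵥ s *ᵥ z : ℤ) : ℝ) = D * ((fun i => (z i : ℝ)) ⬝ᵥ S *ᵥ fun i => (z i : ℝ)) := by
    rw [cast_dotProduct, cast_mulVec, h.map_s, smul_form]
  have h1 : (b₁ ^ 2 * a₁ ^ 2 * (z ⬝ᵥ s *ᵥ z) ≤ E ^ 2 * D) ↔
      (b₁ : ℝ) ^ 2 * a₁ ^ 2 * ((z ⬝ᵥ s *ᵥ z : ℤ) : ℝ) ≤ E ^ 2 * D := by exact_mod_cast Iff.rfl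
  rw [h1, e, mulVec_smul, smul_mulVec, smul_dotProduct, dotProduct_smul,
    dotProduct_smul, h.ε₁_eq]
  simp only [smul_eq_mul]
  set q := (fun i => (z i : ℝ)) ⬝ᵥ S *ᵥ fun i => (z i : ℝ)
  have h2 : (b₁ : ℝ) ^ 2 / E * (b₁ ^ 2 / E * ((a₁ / b₁) ^ 2 * q)) =
      (b₁ ^ 2 * a₁ ^ 2 * q) / E ^ 2 := by field_simp
  rw [h2, div_le_one hE']
  have h3 : (b₁ : ℝ) ^ 2 * a₁ ^ 2 * (D * q) = (b₁ ^ 2 * a₁ ^ 2 * q) * D := by ring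
  rw [h3]
  exact (mul_le_mul_iff_left₀ hD).symm

/-- Grid points that pass the test are near the ellipsoid around the mean. -/
theorem meanTest_sound (hS : S.PosSemidef) {lam : ℤ} (hlam : 0 ≤ lam) {g : Fin d → ℤ}
    (ht : MeanTest D a₁ b₁ u s lam g) (v : Fin d → ℝ) :
    |v ⬝ᵥ ((fun i => (g i : ℝ)) - μ)| ≤
      √(v ⬝ᵥ (ε₁ ^ 2 • S) *ᵥ v) + 2 * √d * √(v ⬝ᵥ v) := by
  obtain ⟨E, hE, hM, h1, h2⟩ := ht
  exact abs_dotProduct_le_of_resolvent (hS.smul (sq_nonneg _)) (by exact_mod_cast hlam)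
    (by positivity) (h.resolvent_eq hE hM g) ((h.form_resolvent E hE _).2 h1)
    ((sq_resolvent_le_iff E hE lam _).2 h2) v

/-- Points closer to the ellipsoid pass the test for some power of two. -/
theorem meanTest_complete (hd : 1 ≤ d) (hS : S.PosSemidef) {g : Fin d → ℤ}
    (hg : ∀ v : Fin d → ℝ, |v ⬝ᵥ ((fun i => (g i : ℝ)) - μ)| ≤
      √(v ⬝ᵥ (ε₁ ^ 2 • S) *ᵥ v) + √d * √(v ⬝ᵥ v)) {b : ℕ}
    (hb : (D • g - u) ⬝ᵥ (D • g - u) ≤ 2 ^ b) : ∃ t ≤ b, MeanTest D a₁ b₁ u s (2 ^ t) g := by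
  have hE := fun t : ℕ => h.exists_meanMat hd hS (lam := 2 ^ t) (by positivity)
  choose E hE hM using hE
  have hD : (1 : ℝ) ≤ D := by exact_mod_cast h.den_pos
  set y := (fun i => (g i : ℝ)) - μ with hy
  have hyb : y ⬝ᵥ y ≤ 2 ^ b := by
    have e : (((D • g - u) ⬝ᵥ (D • g - u) : ℤ) : ℝ) = (D : ℝ) ^ 2 * (y ⬝ᵥ y) := by
      rw [cast_dotProduct]
      have : (fun i => ((D • g - u) i : ℝ)) = (D : ℝ) • y := by
        ext i; simp [hy, h.mean]; ring
      rw [this, smul_dotProduct, dotProduct_smul]; simp only [smul_eq_mul]; ring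
    have h1 : (((D • g - u) ⬝ᵥ (D • g - u) : ℤ) : ℝ) ≤ 2 ^ b := by exact_mod_cast hb
    rw [e] at h1
    have h2 := dotProduct_self_nonneg' y
    refine le_trans ?_ h1
    exact le_mul_of_one_le_left h2 (one_le_pow₀ hD)
  have hd1 : 1 ≤ √(d : ℝ) := Real.one_le_sqrt.2 (by exact_mod_cast hd)
  obtain ⟨t, htb, h1, h2⟩ := exists_resolvent_small (hS.smul (sq_nonneg ε₁)) hd1 hg
    (fun t => ((b₁ : ℝ) ^ 2 / E t) •
      fun i => ((flSeq (meanMat D a₁ b₁ s (2 ^ t)) (d - 1) *ᵥ (D • g - u)) i : ℝ))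
    (fun t => by
      have := h.resolvent_eq (hE t) (hM t) g
      push_cast at this
      exact this) hyb
  refine ⟨t, htb, E t, hE t, hM t, (h.form_resolvent (E t) (hE t) _).1 h1,
    (sq_resolvent_le_iff (E t) (hE t) (2 ^ t) _).1 ?_⟩
  push_cast
  exact h2

/-- The inverse that enters the cap. -/
theorem cap_inverse {E : ℤ} (hE : E ≠ 0) {M : Matrix (Fin d) (Fin d) ℤ}
    (hM : capMat n D a₂ b₂ s * M = E • 1) :
    ((n : ℝ) ^ 2 • 1 + (1 + ε₂) • S) * (((b₂ : ℝ) * D / E) • M.map (Int.cast : ℤ → ℝ)) = 1 := by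
  have hE' : (E : ℝ) ≠ 0 := by exact_mod_cast hE
  have h1 := congrArg (fun A : Matrix (Fin d) (Fin d) ℤ => A.map (Int.cast : ℤ → ℝ)) hM
  simp only [map_mul_cast, map_smul_one_cast, h.map_capMat] at h1
  rw [Matrix.mul_smul, div_eq_inv_mul, mul_smul, ← smul_mul, h1, smul_smul,
    inv_mul_cancel₀ hE', one_smul]

end IsScaled

theorem le_ediv_add_one {a b : ℤ} (hb : 0 < b) : (a : ℝ) / b ≤ (a / b : ℤ) + 1 := by
  have hb' : (0 : ℝ) < b := by exact_mod_cast hb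
  rw [div_le_iff₀ hb']
  have := (Int.lt_ediv_add_one_mul_self a hb).le
  exact_mod_cast this

theorem ediv_le_div {a b : ℤ} (hb : 0 < b) : ((a / b : ℤ) : ℝ) ≤ (a : ℝ) / b := by
  have hb' : (0 : ℝ) < b := by exact_mod_cast hb
  rw [le_div_iff₀ hb']
  exact_mod_cast Int.ediv_mul_le a hb.ne'

/-- The directions of the grid in integer arithmetic. -/
def gridDir (n d t : ℕ) : Fin d → ℤ := fun i => (dig n t i : ℤ) - n ^ 4

theorem cast_gridDir (n d t : ℕ) : (fun i => (gridDir n d t i : ℝ)) = gridVec n d t := by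
  ext i; simp [gridDir, gridVec]

/-- The upper bound for the scaled variance in the direction `t`. -/
def upperBound (n : ℕ) (D b₂ E : ℤ) (M : Matrix (Fin d) (Fin d) ℤ) (t : ℕ) : ℤ :=
  ((2 * n ^ 4) ^ 2 * (n ^ 2 + n) * (gridDir n d t ⬝ᵥ gridDir n d t * E ^ 2 -
    n ^ 2 * b₂ * D * (gridDir n d t ⬝ᵥ M *ᵥ gridDir n d t) * E)) / E ^ 2 + 1 + gridSlack n d

/-- The lower bound for the scaled variance in the direction `t`. -/
def lowerBound (n : ℕ) (D a₂ b₂ : ℤ) (s : Matrix (Fin d) (Fin d) ℤ) (t : ℕ) : ℤ :=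
  ((2 * n ^ 4) ^ 2 * max (b₂ - a₂) 0 * (gridDir n d t ⬝ᵥ s *ᵥ gridDir n d t)) / (b₂ * D) -
    gridSlack n d

/-- The bounds that are computed in integer arithmetic are those that the rounding procedure
needs. -/
theorem IsScaled.gridBounds (h : IsScaled μ S ε₁ ε₂ D a₁ b₁ a₂ b₂ u s) (hd : 1 ≤ d) (hn : 1 ≤ n)
    (hS : S.PosSemidef) {b : ℕ} (hb : ∀ g : ℕ, (D • (fun i : Fin d => (dig n g i : ℤ)) - u) ⬝ᵥ
      (D • (fun i : Fin d => (dig n g i : ℤ)) - u) ≤ 2 ^ b) {E : ℤ} (hE : E ≠ 0)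
    {M : Matrix (Fin d) (Fin d) ℤ} {good : ℕ → Prop}
    (hgood : ∀ g < gridV n d, (good g ↔
      ∃ t ≤ b, MeanTest D a₁ b₁ u s (2 ^ t) fun i => (dig n g i : ℤ))) {hm : ℕ → ℤ}
    (hm1 : (∃ g < gridV n d, good g) → ∀ t < gridV n d, ∃ g < gridV n d, good g ∧
      hm t ≤ gridVal n d t g)
    (hm2 : ∀ t < gridV n d, ∀ g < gridV n d, good g → gridVal n d t g ≤ hm t) :
    GridBounds n d μ S (((b₂ : ℝ) * D / E) • M.map (Int.cast : ℤ → ℝ)) ε₁ ε₂ good hm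
      (upperBound n D b₂ E M) (lowerBound n D a₂ b₂ s) := by
  have hn0 : (n : ℝ) ≠ 0 := by
    have : n ≠ 0 := by omega
    exact_mod_cast this
  have hE' : (E : ℝ) ≠ 0 := by exact_mod_cast hE
  have hE2 : 0 < E ^ 2 := by positivity
  have hb2 : (0 : ℝ) < b₂ := by exact_mod_cast h.b₂_pos
  have hD : (0 : ℝ) < D := by exact_mod_cast h.den_pos
  have hbD : 0 < b₂ * D := mul_pos h.b₂_pos h.den_pos
  let x : ℕ → ℤ := fun t =>
    (2 * n ^ 4) ^ 2 * (n ^ 2 + n) * (gridDir n d t ⬝ᵥ gridDir n d t * E ^ 2 -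
    n ^ 2 * b₂ * D * (gridDir n d t ⬝ᵥ M *ᵥ gridDir n d t) * E)
  let y : ℕ → ℤ := fun t =>
    (2 * n ^ 4) ^ 2 * max (b₂ - a₂) 0 * (gridDir n d t ⬝ᵥ s *ᵥ gridDir n d t)
  have hx : ∀ t, (upperBound n D b₂ E M t : ℝ) =
      (x t / E ^ 2 : ℤ) + 1 + gridSlack n d := fun t => by
    simp only [upperBound, x]; norm_cast
  have hy : ∀ t, (lowerBound n D a₂ b₂ s t : ℝ) =
      (y t / (b₂ * D) : ℤ) - gridSlack n d := fun t => by
    simp only [lowerBound, y]; norm_cast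
  have hup : ∀ t, (2 * (n : ℝ) ^ 4) ^ 2 * (gridVec n d t ⬝ᵥ
      ((1 + n / (n : ℝ) ^ 2) • capForm ((n : ℝ) ^ 2)
        (((b₂ : ℝ) * D / E) • M.map (Int.cast : ℤ → ℝ))) *ᵥ gridVec n d t) =
      (x t : ℝ) / ((E ^ 2 : ℤ) : ℝ) := fun t => by
    simp only [x]
    push_cast
    rw [cast_dotProduct, cast_dotProduct, cast_mulVec, cast_gridDir, capForm, smul_mulVec,
      sub_mulVec, smul_mulVec, smul_mulVec, smul_mulVec, one_mulVec]
    simp only [dotProduct_smul, dotProduct_sub, smul_eq_mul]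
    field_simp
  have hlo : ∀ t, (2 * (n : ℝ) ^ 4) ^ 2 * (gridVec n d t ⬝ᵥ
      (max (1 - ε₂) 0 • S) *ᵥ gridVec n d t) = (y t : ℝ) / ((b₂ * D : ℤ) : ℝ) := fun t => by
    simp only [y]
    push_cast
    rw [cast_dotProduct, cast_mulVec, cast_gridDir, h.map_s, smul_mulVec, smul_mulVec]
    simp only [dotProduct_smul, smul_eq_mul]
    have e : max (1 - ε₂) 0 = max ((b₂ : ℝ) - a₂) 0 / b₂ := by
      rw [← max_div_div_right hb2.le, h.ε₂_eq, sub_div, div_self hb2.ne', zero_div]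
    rw [e]
    field_simp
  refine ⟨fun g hg hgg v => ?_, fun g hg hv => ?_, hm1, hm2, fun t _ => ?_, fun t _ => ?_,
    fun t _ => ?_, fun t _ => ?_⟩
  · obtain ⟨t, -, ht⟩ := (hgood g hg).1 hgg
    have := h.meanTest_sound hS (by positivity) ht v
    simp only [Int.cast_natCast] at this
    exact this
  · refine (hgood g hg).2 (h.meanTest_complete hd hS (fun v => ?_) (hb g))
    simp only [Int.cast_natCast]
    exact hv v
  · rw [hup, hx]
    linarith [le_ediv_add_one hE2 (a := x t)]
  · rw [hup, hx]
    linarith [ediv_le_div hE2 (a := x t)]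
  · rw [hlo, hy]
    linarith [ediv_le_div hbD (a := y t)]
  · rw [hlo, hy]
    linarith [le_ediv_add_one hbD (a := y t)]

end IntTests

/-! ### Syntactic side conditions -/

namespace FExpr

section Eval

variable (e f : FExpr) (s : RamState)

theorem eval_lit (z : ℤ) : (lit z).eval s = z := rfl
theorem eval_reg (x : ℕ) : (reg x).eval s = s.reg x := rfl
theorem eval_get (a : ℕ) : (get a e).eval s = s.arr a (e.eval s).toNat := rfl
theorem eval_add : (e + f).eval s = e.eval s + f.eval s := rfl
theorem eval_sub : (e - f).eval s = e.eval s - f.eval s := rfl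
theorem eval_mul : (e * f).eval s = e.eval s * f.eval s := rfl
theorem eval_div : (e / f).eval s = e.eval s / f.eval s := rfl
theorem eval_ind : (ind e).eval s = if 0 < e.eval s then 1 else 0 := rfl
theorem eval_sum (y x : ℕ) :
    (sum y x e).eval s = ∑ i ∈ range (s.reg x).toNat, e.eval (s.setReg y i) := rfl

end Eval

/-- The arrays that the expression reads. -/
def arrs : FExpr → List ℕ
  | lit _ | reg _ => []
  | get a e => a :: e.arrs
  | add e f | sub e f | mul e f | div e f => e.arrs ++ f.arrs
  | ind e | sum _ _ e => e.arrs

/-- The registers that hold the numbers of terms of the sums. -/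
def counters : FExpr → List ℕ
  | lit _ | reg _ => []
  | add e f | sub e f | mul e f | div e f => e.counters ++ f.counters
  | get _ e | ind e => e.counters
  | sum _ x e => x :: e.counters

/-- The index registers of the sums. -/
def sumVars : FExpr → List ℕ
  | lit _ | reg _ => []
  | add e f | sub e f | mul e f | div e f => e.sumVars ++ f.sumVars
  | get _ e | ind e => e.sumVars
  | sum y _ e => y :: e.sumVars

/-- The registers whose values the expression depends on. -/
def regs : FExpr → List ℕ
  | lit _ => []
  | reg x => [x]
  | add e f | sub e f | mul e f | div e f => e.regs ++ f.regs
  | get _ e | ind e => e.regs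
  | sum y x e => x :: e.regs.filter (· ≠ y)

/-- A strict upper bound for the registers mentioned in the expression. -/
def maxReg : FExpr → ℕ
  | lit _ => 0
  | reg x => x + 1
  | add e f | sub e f | mul e f | div e f => max e.maxReg f.maxReg
  | get _ e | ind e => e.maxReg
  | sum y x e => max (max (y + 1) (x + 1)) e.maxReg

theorem below_of_maxReg_le {K : ℕ} {e : FExpr} (h : e.maxReg ≤ K) : e.Below K := by
  induction e with
  | lit z => trivial
  | reg x => exact h
  | add e f ihe ihf | sub e f ihe ihf | mul e f ihe ihf | div e f ihe ihf =>
    exact ⟨ihe ((le_max_left _ _).trans h), ihf ((le_max_right _ _).trans h)⟩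
  | get _ e ih | ind e ih => exact ih h
  | sum y x e ih =>
    simp only [maxReg, max_le_iff] at h
    exact ⟨h.1.1, h.1.2, ih h.2⟩

theorem eval_congr_on {e : FExpr} {s t : RamState} (hr : ∀ x ∈ e.regs, s.reg x = t.reg x)
    (ha : ∀ a ∈ e.arrs, s.arr a = t.arr a) : e.eval s = e.eval t := by
  induction e generalizing s t with
  | lit z => rfl
  | reg x => exact hr x (by simp [regs])
  | get a e ih =>
    simp only [arrs, List.mem_cons, forall_eq_or_imp] at ha
    simp only [eval, ih hr ha.2, ha.1]
  | add e f ihe ihf | sub e f ihe ihf | mul e f ihe ihf | div e f ihe ihf =>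
    simp only [arrs, regs, List.mem_append] at ha hr
    simp only [eval]
    rw [ihe (fun x h => hr x (Or.inl h)) fun a h => ha a (Or.inl h),
      ihf (fun x h => hr x (Or.inr h)) fun a h => ha a (Or.inr h)]
  | ind e ih => simp only [eval, ih hr ha]
  | sum y x e ih =>
    simp only [regs, List.mem_cons, forall_eq_or_imp, List.mem_filter, decide_eq_true_eq,
      and_imp] at hr
    simp only [eval, hr.1]
    refine sum_congr rfl fun i _ => ih (fun z hz => ?_) ha
    rw [RamState.setReg_reg, RamState.setReg_reg]
    split_ifs with hzy
    · rfl
    · exact hr.2 z hz hzy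

theorem ok_of_counters {R : ℕ} {e : FExpr} {s : RamState}
    (hc : ∀ x ∈ e.counters, (s.reg x).toNat ≤ R) (hd : ∀ x ∈ e.counters, x ∉ e.sumVars) :
    e.Ok R s := by
  induction e generalizing s with
  | lit z | reg x => trivial
  | add e f ihe ihf | sub e f ihe ihf | mul e f ihe ihf | div e f ihe ihf =>
    simp only [counters, sumVars, List.mem_append, not_or] at hc hd
    exact ⟨ihe (fun x hx => hc x (Or.inl hx)) fun x hx => (hd x (Or.inl hx)).1,
      ihf (fun x hx => hc x (Or.inr hx)) fun x hx => (hd x (Or.inr hx)).2⟩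
  | get _ e ih | ind e ih => exact ih hc hd
  | sum y x e ih =>
    simp only [counters, sumVars, List.mem_cons, not_or, forall_eq_or_imp] at hc hd
    refine ⟨hc.1, fun i _ => ih (fun z hz => ?_) fun z hz => (hd.2 z hz).2⟩
    rw [RamState.setReg_ne _ (hd.2 z hz).1]
    exact hc.2 z hz

theorem Ok.mono {R R' : ℕ} (hR : R ≤ R') {e : FExpr} {s : RamState} (h : e.Ok R s) :
    e.Ok R' s := by
  induction e generalizing s with
  | lit z | reg x => trivial
  | add e f ihe ihf | sub e f ihe ihf | mul e f ihe ihf | div e f ihe ihf =>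
    exact ⟨ihe h.1, ihf h.2⟩
  | get _ e ih | ind e ih => exact ih h
  | sum y x e ih => exact ⟨h.1.trans hR, fun i hi => ih (h.2 i hi)⟩

end FExpr

namespace RamState

/-- The registers in the list `X` and the arrays in the list `A` are bounded by `2 ^ R`, and the
registers in the list `C`, which serve as numbers of rounds, are bounded by `R`. -/
structure BddOn (R : ℕ) (X C A : List ℕ) (s : RamState) : Prop where
  reg : ∀ x ∈ X, |s.reg x| ≤ 2 ^ R
  cnt : ∀ c ∈ C, (s.reg c).toNat ≤ R
  arr : ∀ a ∈ A, ∀ i, |s.arr a i| ≤ 2 ^ R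

theorem Bdd.bddOn {K R : ℕ} {s : RamState} (h : Bdd K R s) {X C : List ℕ} (A : List ℕ)
    (hX : ∀ x ∈ X, x < K) (hC : ∀ c ∈ C, (s.reg c).toNat ≤ R) : BddOn R X C A s :=
  ⟨fun x hx => h.reg x (hX x hx), hC, fun a _ i => h.arr a i⟩

theorem BddOn.mono {R R' : ℕ} {X C A : List ℕ} {s : RamState} (h : BddOn R X C A s)
    (hR : R ≤ R') : BddOn R' X C A s := by
  have h2 : (2 : ℤ) ^ R ≤ 2 ^ R' := pow_le_pow_right₀ (by norm_num) hR
  exact ⟨fun x hx => (h.reg x hx).trans h2, fun c hc => (h.cnt c hc).trans hR,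
    fun a ha i => (h.arr a ha i).trans h2⟩

theorem BddOn.setReg {R : ℕ} {X C A : List ℕ} {s : RamState} (h : BddOn R X C A s) {y : ℕ}
    (hy : y ∉ C) {z : ℤ} (hz : |z| ≤ 2 ^ R) : BddOn R (y :: X) C A (s.setReg y z) := by
  refine ⟨fun x hx => ?_, fun c hc => ?_, h.arr⟩
  · rw [setReg_reg]; split_ifs with hxy
    · exact hz
    · exact h.reg x ((List.mem_cons.1 hx).resolve_left hxy)
  · rw [setReg_ne _ (by rintro rfl; exact hy hc)]; exact h.cnt c hc

theorem BddOn.of_eq {R : ℕ} {X C A : List ℕ} {s t : RamState} (h : BddOn R X C A s)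
    (hX : ∀ x ∈ X, t.reg x = s.reg x) (hC : ∀ x ∈ C, t.reg x = s.reg x)
    (hA : ∀ a ∈ A, t.arr a = s.arr a) : BddOn R X C A t :=
  ⟨fun x hx => by rw [hX x hx]; exact h.reg x hx, fun x hx => by rw [hC x hx]; exact h.cnt x hx,
    fun a ha => by rw [hA a ha]; exact h.arr a ha⟩

theorem BddOn.addArr {R : ℕ} {X C A : List ℕ} {s : RamState} (h : BddOn R X C A s) {a : ℕ}
    (ha : ∀ i, |s.arr a i| ≤ 2 ^ R) : BddOn R X C (a :: A) s :=
  ⟨h.reg, h.cnt, fun b hb => (List.mem_cons.1 hb).elim (fun e => e ▸ ha) (h.arr b)⟩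

end RamState

/-- The conditions on an expression that ensure the bound for its value. -/
def FExpr.Side (X C A : List ℕ) (e : FExpr) : Prop :=
  (∀ x ∈ e.regs, x ∈ X) ∧ (∀ b ∈ e.arrs, b ∈ A) ∧ ∀ c ∈ e.counters, c ∈ C ∧ c ∉ e.sumVars

instance (X C A : List ℕ) (e : FExpr) : Decidable (e.Side X C A) := by
  unfold FExpr.Side; infer_instance

theorem FExpr.Side.ok {R : ℕ} {X C A : List ℕ} {e : FExpr} (h : e.Side X C A) {s : RamState}
    (hs : s.BddOn R X C A) : e.Ok R s :=
  ok_of_counters (fun c hc => hs.cnt c (h.2.2 c hc).1) fun c hc => (h.2.2 c hc).2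

theorem FExpr.Side.abs_eval_le {R : ℕ} {X C A : List ℕ} {e : FExpr} (h : e.Side X C A)
    {s : RamState} (hs : s.BddOn R X C A) : |e.eval s| ≤ 2 ^ ((R + 1) * e.size) := by
  let t : RamState := ⟨fun x => if x ∈ X then s.reg x else 0,
    fun a i => if a ∈ A then s.arr a i else 0⟩
  have ht : e.eval s = e.eval t := eval_congr_on
    (fun x hx => (if_pos (h.1 x hx)).symm) fun a ha => by
      funext i; exact (if_pos (h.2.1 a ha)).symm
  have hB : t.Bdd e.maxReg R := ⟨fun x _ => by
    simp only [t]; split_ifs with hx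
    · exact hs.reg x hx
    · simp, fun a i => by
    simp only [t]; split_ifs with ha
    · exact hs.arr a ha i
    · simp⟩
  have hok : e.Ok R t := by
    refine ok_of_counters (fun c hc => ?_) fun c hc => (h.2.2 c hc).2
    simp only [t]
    split_ifs
    · exact hs.cnt c (h.2.2 c hc).1
    · simp
  rw [ht]
  exact FExpr.abs_eval_le (below_of_maxReg_le le_rfl) hB hok

namespace FProg
open RamState

/-- A strict upper bound for the registers mentioned in the program. -/
def maxReg : FProg → ℕ
  | set x e | bits x e => max (x + 1) e.maxReg
  | put _ i e => max i.maxReg e.maxReg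
  | seq p q => max p.maxReg q.maxReg
  | ite e p q => max e.maxReg (max p.maxReg q.maxReg)
  | forTo y x p => max (max (y + 1) (x + 1)) p.maxReg

theorem below_of_maxReg_le {K : ℕ} {p : FProg} (h : p.maxReg ≤ K) : p.Below K := by
  induction p <;> simp only [maxReg, max_le_iff] at h
  case set | bits => exact ⟨h.1, FExpr.below_of_maxReg_le h.2⟩
  case put => exact ⟨FExpr.below_of_maxReg_le h.1, FExpr.below_of_maxReg_le h.2⟩
  case seq p q ihp ihq => exact ⟨ihp h.1, ihq h.2⟩
  case ite e p q ihp ihq => exact ⟨FExpr.below_of_maxReg_le h.1, ihp h.2.1, ihq h.2.2⟩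
  case forTo y x p ih => exact ⟨h.1.1, h.1.2, ih h.2⟩

theorem Ok.mono {R R' : ℕ} (hR : R ≤ R') {p : FProg} {s : RamState} (h : p.Ok R s) :
    p.Ok R' s := by
  have h2 : (2 : ℤ) ^ R ≤ 2 ^ R' := pow_le_pow_right₀ (by norm_num) hR
  induction p generalizing s with
  | set x e | bits x e => exact ⟨h.1.mono hR, h.2.trans h2⟩
  | put a i e => exact ⟨h.1.mono hR, h.2.1.mono hR, h.2.2.trans h2⟩
  | seq p q ihp ihq => exact ⟨ihp h.1, ihq h.2⟩
  | ite e p q ihp ihq =>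
    refine ⟨h.1.mono hR, ?_⟩
    have h1 := h.2
    split_ifs at h1 ⊢
    · exact ihp h1
    · exact ihq h1
  | forTo y x p ih => exact ⟨h.1.trans hR, fun i hi => ih (h.2 i hi)⟩

theorem Ok.bdd {K R : ℕ} {p : FProg} (hp : p.maxReg ≤ K) {s : RamState} (hs : s.Bdd K R)
    (h : p.Ok R s) : (p.exec s).Bdd K R := by
  obtain ⟨-, -, -, -, -, -, hB⟩ :=
    comp_spec (below_of_maxReg_le hp) le_rfl (Agree.refl K s) hs h
  exact hB

theorem set_ok {R R' x : ℕ} {X C A : List ℕ} {e : FExpr} {s : RamState} (hs : s.BddOn R X C A)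
    (he : e.Side X C A) (hR : (R + 1) * e.size ≤ R') : (set x e).Ok R' s := by
  have h1 : R ≤ (R + 1) * e.size := by nlinarith [e.size_pos]
  exact ⟨(he.ok hs).mono (h1.trans hR),
    (he.abs_eval_le hs).trans (pow_le_pow_right₀ (by norm_num) hR)⟩

/-- The program that fills an initial segment of an array. -/
def fill (y x a : ℕ) (e : FExpr) : FProg := forTo y x (put a (.reg y) e)

/-- The conditions under which the values that are filled in do not depend on those filled in
before. -/
def FillSide (X C A : List ℕ) (y x a : ℕ) (e : FExpr) : Prop :=
  e.Side (y :: X) C A ∧ a ∉ e.arrs ∧ x ∈ C ∧ y ∉ C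

instance (X C A : List ℕ) (y x a : ℕ) (e : FExpr) : Decidable (FillSide X C A y x a e) := by
  unfold FillSide; infer_instance

theorem fill_ok {R R' y x a : ℕ} {X C A : List ℕ} {e : FExpr} {s : RamState}
    (hs : s.BddOn R X C A) (he : FillSide X C A y x a e) (hR : (R + 1) * e.size ≤ R') :
    (fill y x a e).Ok R' s := by
  obtain ⟨h1, h2, h3, h4⟩ := he
  have hRR : R ≤ R' := by nlinarith [e.size_pos]
  refine (forTo_spec (p := put a (.reg y) e) (fun _ _ => True) ((hs.cnt x h3).trans hRR) trivial
    fun j hj t ht _ => ⟨⟨trivial, set_ok (x := 0) (X := y :: X) (C := C) (A := e.arrs)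
      ⟨fun z hz => ?_, fun c hc => ?_, fun b hb => ?_⟩ ⟨h1.1, fun _ h => h, h1.2.2⟩ hR⟩,
      trivial⟩).1
  · rw [setReg_reg]; split_ifs with hzy
    · exact abs_natCast_le_two_pow (hj.le.trans (hs.cnt x h3))
    · rw [ht.reg z (by simp [wregs, hzy])]
      exact hs.reg z ((List.mem_cons.1 hz).resolve_left hzy)
  · have hcy : c ≠ y := by rintro rfl; exact h4 hc
    rw [setReg_ne _ hcy, ht.reg c (by simp [wregs, hcy])]
    exact hs.cnt c hc
  · rw [setReg_arr, ht.arr b (by simp only [warrs, List.mem_singleton]; rintro rfl; exact h2 hb)]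
    exact hs.arr b (h1.2.1 b hb)

theorem fill_val {y x a : ℕ} {e : FExpr} (ha : a ∉ e.arrs) (s : RamState) (j : ℕ) :
    ((fill y x a e).exec s).arr a j =
      if j < (s.reg x).toNat then e.eval (s.setReg y j) else s.arr a j := by
  have key : ∀ m, (∀ j, (rounds y (put a (.reg y) e).exec s m).arr a j =
      if j < m then e.eval (s.setReg y j) else s.arr a j) := by
    intro m
    induction m with
    | zero => intro j; rfl
    | succ m ih =>
      intro j
      have hf := frame_rounds (put a (.reg y) e).frame y x s m
      have hev : e.eval ((rounds y (put a (.reg y) e).exec s m).setReg y m) =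
          e.eval (s.setReg y m) := by
        refine FExpr.eval_congr_on (fun z _ => ?_) fun b hb => ?_
        · rw [setReg_reg, setReg_reg]
          split_ifs with hz
          · rfl
          · exact hf.reg z (by simp [wregs, hz])
        · exact hf.arr b (by simp only [warrs, List.mem_singleton]; rintro rfl; exact ha hb)
      rw [rounds]
      set t := rounds y (put a (.reg y) e).exec s m with ht
      simp only [exec, setArr_arr, FExpr.eval_reg, setReg_self, toNat_natCast,
        true_and, hev, setReg_arr, ih]
      rcases lt_trichotomy j m with hj | hj | hj
      · rw [if_neg hj.ne, if_pos hj, if_pos (by omega)]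
      · rw [if_pos hj, if_pos (by omega), hj]
      · rw [if_neg hj.ne', if_neg (by omega), if_neg (by omega)]
  exact key _ j

theorem fill_auto {R R' y x a : ℕ} {X C A : List ℕ} {e : FExpr} {s : RamState}
    (hs : s.BddOn R X C A) (he : FillSide X C A y x a e) (hR : (R + 1) * e.size ≤ R') :
    (fill y x a e).Ok R' s ∧ (∀ j, ((fill y x a e).exec s).arr a j =
      if j < (s.reg x).toNat then e.eval (s.setReg y j) else s.arr a j) ∧
      ∀ j < (s.reg x).toNat, |e.eval (s.setReg y j)| ≤ 2 ^ R' :=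
  ⟨fill_ok hs he hR, fill_val he.2.1 s, fun _ hj => (he.1.abs_eval_le (hs.setReg he.2.2.2
    (abs_natCast_le_two_pow (hj.le.trans (hs.cnt x he.2.2.1))))).trans
    (pow_le_pow_right₀ (by norm_num) hR)⟩

end FProg

/-! ### The program for the inverse matrix -/

/-- The array segment `f` holds the entries of the matrix `A`, row by row. -/
def IsFlat {d : ℕ} (f : ℕ → ℤ) (A : Matrix (Fin d) (Fin d) ℤ) : Prop :=
  ∀ i j : Fin d, f (i * d + j) = A i j

namespace FProg
open RamState FExpr

/-- The index of the row of an entry of a flat matrix. -/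
abbrev rowOf (e : FExpr) : FExpr := e / reg 1

/-- The index of the column of an entry of a flat matrix. -/
abbrev colOf (e : FExpr) : FExpr := e - reg 1 * (e / reg 1)

/-- The indicator of the diagonal entries of a flat matrix. -/
abbrev isDiag (e : FExpr) : FExpr :=
  ind (lit 1 - (rowOf e - colOf e) * (rowOf e - colOf e))

/-- The product of the flat matrices in the arrays `5` and `6`. -/
def flMul : FProg :=
  fill 21 26 7 (sum 22 1 (get 5 (reg 1 * rowOf (reg 21) + reg 22) *
    get 6 (reg 1 * reg 22 + colOf (reg 21))))

/-- One step of the Faddeev–LeVerrier recursion. -/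
def flStep : FProg :=
  seq flMul (fill 21 26 6 (get 7 (reg 21) - isDiag (reg 21) *
    (sum 22 1 (get 7 (reg 1 * reg 22 + reg 22)) / (reg 20 + lit 1))))

/-- The Faddeev–LeVerrier recursion for the flat matrix in the array `5`. The result is stored
in the array `6`, and the diagonal entry of the product in the register `18`. -/
def flProg : FProg :=
  seq (fill 21 26 6 (isDiag (reg 21))) (seq (forTo 20 27 flStep)
    (set 18 (sum 22 1 (get 5 (reg 22) * get 6 (reg 1 * reg 22)))))

theorem _root_.RamState.BddOn.of_subset {R : ℕ} {X C A X' C' A' : List ℕ} {s : RamState}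
    (h : s.BddOn R X C A) (hX : ∀ x ∈ X', x ∈ X) (hC : ∀ x ∈ C', x ∈ C) (hA : ∀ x ∈ A', x ∈ A) :
    s.BddOn R X' C' A' :=
  ⟨fun x hx => h.reg x (hX x hx), fun x hx => h.cnt x (hC x hx), fun x hx => h.arr x (hA x hx)⟩

theorem _root_.RamState.BddOn.of_frame {R : ℕ} {X C A : List ℕ} {p : FProg} {s t : RamState}
    (h : s.BddOn R X C A) (hf : Frame p s t) (hX : ∀ x ∈ X, x ∉ p.wregs)
    (hC : ∀ x ∈ C, x ∉ p.wregs) (hA : ∀ x ∈ A, x ∉ p.warrs) : t.BddOn R X C A :=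
  h.of_eq (fun x hx => hf.reg x (hX x hx)) (fun x hx => hf.reg x (hC x hx))
    fun x hx => hf.arr x (hA x hx)

theorem fill_arr_bdd {R y x a : ℕ} {e : FExpr} {s : RamState} (h : ∀ i, |s.arr a i| ≤ 2 ^ R)
    (hf : ∀ j, ((fill y x a e).exec s).arr a j =
      if j < (s.reg x).toNat then e.eval (s.setReg y j) else s.arr a j)
    (he : ∀ j < (s.reg x).toNat, |e.eval (s.setReg y j)| ≤ 2 ^ R) (i : ℕ) :
    |((fill y x a e).exec s).arr a i| ≤ 2 ^ R := by
  rw [hf]; split_ifs with hi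
  · exact he i hi
  · exact h i

theorem divMod_lt {d e : ℕ} (he : e < d * d) : e / d < d ∧ e % d < d ∧ e / d * d + e % d = e := by
  have hd : 0 < d := Nat.pos_of_ne_zero (by rintro rfl; simp at he)
  exact ⟨Nat.div_lt_of_lt_mul he, Nat.mod_lt _ hd, Nat.div_add_mod' e d⟩

theorem isFlat_of_forall {d : ℕ} {f : ℕ → ℤ} {A : Matrix (Fin d) (Fin d) ℤ}
    (h : ∀ e (he : e < d * d), f e = A ⟨e / d, (divMod_lt he).1⟩ ⟨e % d, (divMod_lt he).2.1⟩) :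
    IsFlat f A := by
  intro i j
  have hd : 0 < d := i.pos
  have hlt : (i : ℕ) * d + j < d * d := by nlinarith [i.2, j.2, Nat.mul_le_mul_right d i.2]
  have hdiv : ((i : ℕ) * d + j) / d = i := by
    rw [add_comm, Nat.add_mul_div_right _ _ hd, Nat.div_eq_of_lt j.2, zero_add]
  have hmod : ((i : ℕ) * d + j) % d = j := by
    rw [add_comm, Nat.add_mul_mod_self_right, Nat.mod_eq_of_lt j.2]
  rw [h _ hlt]
  congr 1 <;> ext <;> simp [hdiv, hmod]

theorem _root_.IsFlat.apply {d : ℕ} {f : ℕ → ℤ} {A : Matrix (Fin d) (Fin d) ℤ}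
    (h : IsFlat f A) (e : ℕ)
    (he : e < d * d) : f e = A ⟨e / d, (divMod_lt he).1⟩ ⟨e % d, (divMod_lt he).2.1⟩ := by
  rw [← h]; simp only [(divMod_lt he).2.2]

theorem eval_colOf {d e : ℕ} : (e : ℤ) - d * ((e : ℤ) / d) = ((e % d : ℕ) : ℤ) := by
  push_cast
  rw [Int.emod_def]

theorem eval_isDiag {d e : ℕ} : (if 0 < (1 : ℤ) - ((e : ℤ) / d - ((e % d : ℕ) : ℤ)) *
    ((e : ℤ) / d - ((e % d : ℕ) : ℤ)) then (1 : ℤ) else 0) = if e / d = e % d then 1 else 0 := by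
  have h : (e : ℤ) / d = ((e / d : ℕ) : ℤ) := by push_cast; rfl
  rw [h]
  by_cases h1 : e / d = e % d
  · simp [h1]
  · have h2 : ((e / d : ℕ) : ℤ) - ((e % d : ℕ) : ℤ) ≠ 0 := by omega
    rw [if_neg h1, if_neg]
    have := mul_self_pos.2 h2
    omega

/-- The registers with the dimensions that the matrix program uses. -/
structure FlRegs (d : ℕ) (s : RamState) : Prop where
  r1 : s.reg 1 = d
  r26 : s.reg 26 = (d * d : ℕ)
  r27 : s.reg 27 = (d - 1 : ℕ)

theorem FlRegs.of_frame {d : ℕ} {s t : RamState} (h : FlRegs d s) {p : FProg} (hf : Frame p s t)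
    (hp : 1 ∉ p.wregs ∧ 26 ∉ p.wregs ∧ 27 ∉ p.wregs) : FlRegs d t :=
  ⟨(hf.reg 1 hp.1).trans h.r1, (hf.reg 26 hp.2.1).trans h.r26, (hf.reg 27 hp.2.2).trans h.r27⟩

theorem FlRegs.setReg {d : ℕ} {s : RamState} (h : FlRegs d s) {x : ℕ} {z : ℤ}
    (hx : x ≠ 1 ∧ x ≠ 26 ∧ x ≠ 27) : FlRegs d (s.setReg x z) :=
  ⟨by rw [setReg_ne _ hx.1.symm, h.r1], by rw [setReg_ne _ hx.2.1.symm, h.r26],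
    by rw [setReg_ne _ hx.2.2.symm, h.r27]⟩

theorem flMul_spec {d R R' : ℕ} {s : RamState} (hr : FlRegs d s)
    (hs : s.BddOn R [1] [1, 26, 27] [5, 6]) (hR : (R + 1) * 100 ≤ R')
    {A M : Matrix (Fin d) (Fin d) ℤ} (hA : IsFlat (s.arr 5) A) (hM : IsFlat (s.arr 6) M)
    (h7 : ∀ i, |s.arr 7 i| ≤ 2 ^ R') :
    flMul.Ok R' s ∧ IsFlat ((flMul.exec s).arr 7) (A * M) ∧
      ∀ i, |(flMul.exec s).arr 7 i| ≤ 2 ^ R' := by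
  have h := fill_auto hs (y := 21) (x := 26) (a := 7) (e := sum 22 1 (get 5 (reg 1 * rowOf (reg 21)
    + reg 22) * get 6 (reg 1 * reg 22 + colOf (reg 21)))) (by decide)
    ((Nat.mul_le_mul_left (R + 1) (by decide)).trans hR)
  obtain ⟨h1, h2, h3⟩ := h
  refine ⟨h1, isFlat_of_forall fun e he => ?_, fill_arr_bdd h7 h2 h3⟩
  · have hlt : e < (s.reg 26).toNat := by rw [hr.r26, toNat_natCast]; exact he
    rw [flMul, h2, if_pos hlt]
    simp only [eval_sum, eval_mul, eval_get, eval_add, eval_sub, eval_div, eval_reg,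
      setReg_reg, setReg_arr, hr.r1]
    norm_num only [if_true, if_false]
    rw [Matrix.mul_apply, sum_range]
    refine sum_congr rfl fun l _ => ?_
    rw [eval_colOf, ← hA, ← hM]
    congr 2
    · have : (d : ℤ) * ((e : ℤ) / d) + (l : ℕ) = ((e / d * d + l : ℕ) : ℤ) := by push_cast; ring
      rw [this, toNat_natCast]
    · have : (d : ℤ) * (l : ℕ) + ((e % d : ℕ) : ℤ) = ((l * d + e % d : ℕ) : ℤ) := by
        push_cast; ring
      rw [this, toNat_natCast]

theorem FlRegs.zero_of_forall {d : ℕ} {s : RamState} (hr : FlRegs d s) {i : ℕ} :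
    i < (s.reg 26).toNat ↔ i < d * d := by rw [hr.r26, toNat_natCast]

theorem flStep_spec {d R R' k : ℕ} {s : RamState} (hr : FlRegs d s)
    (hs : s.BddOn R [1, 20] [1, 26, 27] [5, 6]) (hk : s.reg 20 = k)
    (hR : ((R + 1) * 100 + 1) * 100 ≤ R')
    {A : Matrix (Fin d) (Fin d) ℤ} (hA : IsFlat (s.arr 5) A) (hM : IsFlat (s.arr 6) (flSeq A k))
    (hB : ∀ i j, |flSeq A (k + 1) i j| ≤ 2 ^ R)
    (h7 : ∀ i, |s.arr 7 i| ≤ 2 ^ ((R + 1) * 100)) :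
    flStep.Ok R' s ∧ IsFlat ((flStep.exec s).arr 6) (flSeq A (k + 1)) ∧
      (∀ i, |(flStep.exec s).arr 6 i| ≤ 2 ^ R) ∧
      ∀ i, |(flStep.exec s).arr 7 i| ≤ 2 ^ ((R + 1) * 100) := by
  obtain ⟨h1, h2, h3⟩ := flMul_spec hr (hs.of_subset (by decide) (by decide) (by decide)) le_rfl
    hA hM h7
  have hf := frame flMul s
  set t := flMul.exec s with ht
  have hrt := hr.of_frame hf (by decide)
  have hst : t.BddOn ((R + 1) * 100) [1, 20] [1, 26, 27] [7] :=
    (((hs.of_subset (A' := []) (fun _ h => h) (fun _ h => h) (by simp)).of_frame hf (by decide)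
      (by decide) (by simp)).mono (by omega)).addArr h3
  obtain ⟨g1, g2, g3⟩ := fill_auto hst (y := 21) (x := 26) (a := 6)
    (e := get 7 (reg 21) - isDiag (reg 21) *
    (sum 22 1 (get 7 (reg 1 * reg 22 + reg 22)) / (reg 20 + lit 1))) (by decide)
    ((Nat.mul_le_mul_left _ (by decide)).trans hR)
  have hfl : IsFlat ((flStep.exec s).arr 6) (flSeq A (k + 1)) := by
    refine isFlat_of_forall fun e he => ?_
    show ((fill 21 26 6 _).exec t).arr 6 e = _
    rw [g2, if_pos (hrt.zero_of_forall.2 he)]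
    have hk' : t.reg 20 = k := by rw [hf.reg 20 (by decide), hk]
    simp only [eval_sum, eval_mul, eval_get, eval_add, eval_sub, eval_div, eval_reg, eval_ind,
      eval_lit, setReg_reg, setReg_arr, hrt.r1, hk']
    norm_num only [if_true, if_false]
    rw [eval_colOf, eval_isDiag, toNat_natCast, h2.apply e he, toNat_natCast]
    have htr : ∑ x ∈ range d, t.arr 7 ((d : ℤ) * x + x).toNat = (A * flSeq A k).trace := by
      rw [trace, sum_range]
      refine sum_congr rfl fun l _ => ?_
      rw [Matrix.diag_apply, ← h2 l l]
      congr 1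
      have : (d : ℤ) * (l : ℕ) + (l : ℕ) = ((l * d + l : ℕ) : ℤ) := by push_cast; ring
      rw [this, toNat_natCast]
    rw [htr, flSeq, Matrix.sub_apply, Matrix.smul_apply, Matrix.one_apply, smul_eq_mul]
    simp only [Fin.mk.injEq]
    congr 1
    exact mul_comm _ _
  refine ⟨⟨h1.mono (by omega), g1⟩, hfl, fun i => ?_, fun i => ?_⟩
  · by_cases hi : i < d * d
    · rw [hfl.apply i hi]; exact hB _ _
    · show |((fill 21 26 6 _).exec t).arr 6 i| ≤ _
      rw [g2, if_neg (by rwa [hrt.zero_of_forall]), hf.arr 6 (by decide)]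
      exact hs.arr 6 (by decide) i
  · show |((fill 21 26 6 _).exec t).arr 7 i| ≤ _
    rw [(frame _ t).arr 7 (by decide)]
    exact h3 i

/-- The Faddeev–LeVerrier program is correct if all matrices of the sequence are bounded. -/
theorem flProg_spec {d R R' : ℕ} (hd : 0 < d) {s : RamState} (hr : FlRegs d s)
    (hs : s.BddOn R [1] [1, 26, 27] [5, 6]) (hR : ((R + 1) * 100 + 1) * 100 ≤ R')
    {A : Matrix (Fin d) (Fin d) ℤ} (hA : IsFlat (s.arr 5) A)
    (hB : ∀ k < d, ∀ i j, |flSeq A k i j| ≤ 2 ^ R)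
    (h7 : ∀ i, |s.arr 7 i| ≤ 2 ^ ((R + 1) * 100)) :
    flProg.Ok R' s ∧ IsFlat ((flProg.exec s).arr 6) (flSeq A (d - 1)) ∧
      (∀ i, |(flProg.exec s).arr 6 i| ≤ 2 ^ R) ∧
      (∀ i, |(flProg.exec s).arr 7 i| ≤ 2 ^ ((R + 1) * 100)) ∧
      (flProg.exec s).reg 18 = (A * flSeq A (d - 1)) ⟨0, hd⟩ ⟨0, hd⟩ := by
  have hRR : R ≤ R' := by omega
  obtain ⟨g1, g2, g3⟩ := fill_auto (R' := (R + 1) * 100) hs (y := 21) (x := 26) (a := 6)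
    (e := isDiag (reg 21)) (by decide) (Nat.mul_le_mul_left _ (by decide))
  have hf := frame (fill 21 26 6 (isDiag (reg 21))) s
  set t := (fill 21 26 6 (isDiag (reg 21))).exec s with ht
  have hrt := hr.of_frame hf (by decide)
  have hfl : IsFlat (t.arr 6) (flSeq A 0) := by
    refine isFlat_of_forall fun e he => ?_
    rw [g2, if_pos (hr.zero_of_forall.2 he)]
    simp only [eval_mul, eval_sub, eval_div, eval_reg, eval_ind, eval_lit, setReg_reg, hr.r1]
    norm_num only [if_true, if_false]
    rw [eval_colOf, eval_isDiag, flSeq, Matrix.one_apply]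
    simp only [Fin.mk.injEq]
  have hb6 : ∀ i, |t.arr 6 i| ≤ 2 ^ R := fun i => by
    by_cases hi : i < d * d
    · rw [hfl.apply i hi]; exact hB 0 hd _ _
    · rw [g2, if_neg (by rwa [hr.zero_of_forall])]
      exact hs.arr 6 (by decide) i
  have hst : t.BddOn R [1] [1, 26, 27] [6, 5] :=
    ((hs.of_subset (A' := [5]) (fun _ h => h) (fun _ h => h) (by decide)).of_frame hf (by decide)
      (by decide) (by decide)).addArr hb6
  have hloop := forTo_spec (R := R') (y := 20) (x := 27) (p := flStep) (s := t)
    (fun k u => IsFlat (u.arr 6) (flSeq A k) ∧ (∀ i, |u.arr 6 i| ≤ 2 ^ R) ∧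
      ∀ i, |u.arr 7 i| ≤ 2 ^ ((R + 1) * 100))
    ((hst.cnt 27 (by decide)).trans hRR)
    ⟨hfl, hb6, fun i => by rw [hf.arr 7 (by decide)]; exact h7 i⟩ fun k hk u hu hI => by
      rw [hrt.r27, toNat_natCast] at hk
      have hkR : k ≤ R := by
        have := hst.cnt 27 (by decide)
        rw [hrt.r27, toNat_natCast] at this; omega
      have hru := hrt.of_frame hu (by decide)
      have hsu : (u.setReg 20 k).BddOn R [20, 1] [1, 26, 27] [6, 5] :=
        (((hst.of_subset (A' := [5]) (fun _ h => h) (fun _ h => h) (by decide)).of_frame hu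
          (by decide) (by decide) (by decide)).addArr hI.2.1).setReg (by decide)
          (abs_natCast_le_two_pow hkR)
      refine flStep_spec (hru.setReg (by decide)) (hsu.of_subset (by decide) (by decide)
        (by decide)) (by simp) hR ?_ hI.1 (hB _ (by omega)) hI.2.2
      rw [setReg_arr, hu.arr 5 (by decide), hf.arr 5 (by decide)]; exact hA
  have hfu := frame (forTo 20 27 flStep) t
  obtain ⟨l1, l2, l3, l4⟩ := hloop
  rw [hrt.r27, toNat_natCast] at l2
  set u := (forTo 20 27 flStep).exec t with hu
  have hru := hrt.of_frame hfu (by decide)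
  have hsu : u.BddOn R [1] [1, 26, 27] [6, 5] :=
    ((hst.of_subset (A' := [5]) (fun _ h => h) (fun _ h => h) (by decide)).of_frame hfu
      (by decide) (by decide) (by decide)).addArr l3
  refine ⟨⟨g1.mono (by omega), l1, set_ok hsu (by decide)
    ((Nat.mul_le_mul_left _ (by decide : _ ≤ 100)).trans (by omega))⟩, l2, l3, l4, ?_⟩
  show (u.setReg 18 ((sum 22 1 (get 5 (reg 22) * get 6 (reg 1 * reg 22))).eval u)).reg 18 = _
  simp only [setReg_self, eval_sum, eval_mul, eval_get, eval_reg, setReg_reg, setReg_arr, hru.r1]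
  norm_num only [if_true, if_false]
  have hA' : IsFlat (u.arr 5) A := by
    rw [hfu.arr 5 (by decide), hf.arr 5 (by decide)]; exact hA
  rw [Matrix.mul_apply, toNat_natCast, sum_range]
  refine sum_congr rfl fun l _ => ?_
  rw [← hA', ← l2]
  congr 2
  · simp
  · have : (d : ℤ) * (l : ℕ) = ((l * d + 0 : ℕ) : ℤ) := by push_cast; ring
    rw [this, toNat_natCast]

end FProg

/-! ### Straight-line programs -/

/-- The growth of the bound for the bit lengths in a single step of a straight-line program. -/
def grow (R : ℕ) : ℕ := (R + 1) * 1000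

theorem le_grow (R : ℕ) : R ≤ grow R := by unfold grow; omega

theorem le_grow_iterate (k R : ℕ) : R ≤ grow^[k] R := by
  induction k with
  | zero => rfl
  | succ k ih => rw [iterate_succ_apply']; exact ih.trans (le_grow _)

theorem grow_iterate_mono {k l : ℕ} (h : k ≤ l) (R : ℕ) : grow^[k] R ≤ grow^[l] R := by
  obtain ⟨m, rfl⟩ := Nat.exists_eq_add_of_le h
  rw [Nat.add_comm, iterate_add_apply]
  exact le_grow_iterate m _

namespace FExpr

/-- The powers of an expression. -/
def pow (e : FExpr) : ℕ → FExpr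
  | 0 => lit 1
  | k + 1 => e.pow k * e

theorem eval_pow (e : FExpr) (k : ℕ) (s : RamState) : (e.pow k).eval s = e.eval s ^ k := by
  induction k with
  | zero => simp [pow, eval]
  | succ k ih => rw [pow, eval_mul, ih, pow_succ]

end FExpr

theorem RamState.Bdd.mono {K R R' : ℕ} {s : RamState} (h : s.Bdd K R) (hR : R ≤ R') :
    s.Bdd K R' :=
  have h2 : (2 : ℤ) ^ R ≤ 2 ^ R' := pow_le_pow_right₀ (by norm_num) hR
  ⟨fun x hx => (h.reg x hx).trans h2, fun a i => (h.arr a i).trans h2⟩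

namespace FProg
open RamState FExpr

/-- The condition on the expressions in a straight-line program with the counters `C`. -/
def goodExpr (C : List ℕ) (e : FExpr) : Bool :=
  decide (e.Side (List.range 40) C (List.range 40) ∧ e.size ≤ 1000)

/-- The program is a sequence of assignments and of fillings of array segments, the lengths of
which are in registers of the list `C` that do not change. -/
def straight (C : List ℕ) : FProg → Bool
  | set x e | bits x e => decide (x < 40 ∧ x ∉ C ∧ e.maxReg ≤ 40) && goodExpr C e
  | put _ i e => decide (i.maxReg ≤ 40 ∧ e.maxReg ≤ 40) && goodExpr C i && goodExpr C e
  | seq p q => p.straight C && q.straight C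
  | forTo y x (put a (.reg z) e) => decide (z = y ∧ y < 40 ∧ x < 40 ∧ e.maxReg ≤ 40 ∧
      FillSide (List.range 40) C (List.range 40) y x a e ∧ e.size ≤ 1000)
  | _ => false

/-- The number of steps of a straight-line program. -/
def atoms : FProg → ℕ
  | seq p q => p.atoms + q.atoms
  | _ => 1

theorem straight_regs {C : List ℕ} {p : FProg} (hp : p.straight C = true) :
    (∀ c ∈ C, c ∉ p.wregs) ∧ p.maxReg ≤ 40 := by
  induction p with
  | set x e | bits x e =>
    simp only [straight, Bool.and_eq_true, decide_eq_true_eq] at hp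
    refine ⟨fun c hc hcx => ?_, by simp only [maxReg]; omega⟩
    simp only [wregs, List.mem_singleton] at hcx
    exact hp.1.2.1 (hcx ▸ hc)
  | put a i e =>
    simp only [straight, Bool.and_eq_true, decide_eq_true_eq] at hp
    exact ⟨fun c _ => by simp [wregs], by simp only [maxReg]; omega⟩
  | seq p q ihp ihq =>
    simp only [straight, Bool.and_eq_true] at hp
    have h1 := ihp hp.1
    have h2 := ihq hp.2
    exact ⟨fun c hc => by simp [wregs, h1.1 c hc, h2.1 c hc], max_le h1.2 h2.2⟩
  | ite e p q => simp [straight] at hp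
  | forTo y x p =>
    unfold straight at hp
    split at hp <;> simp_all only [decide_eq_true_eq, reduceCtorEq]
    refine ⟨fun c hc hcx => ?_, ?_⟩
    · simp only [wregs, List.mem_singleton] at hcx
      exact hp.2.2.2.2.1.2.2.2 (hcx ▸ hc)
    · simp only [maxReg, FExpr.maxReg]; omega

/-- Straight-line programs increase the bit lengths only by constant factors. -/
theorem straight_ok {C : List ℕ} {p : FProg} (hp : p.straight C = true) {R : ℕ} {s : RamState}
    (hs : s.Bdd 40 R) (hc : ∀ c ∈ C, (s.reg c).toNat ≤ R) : p.Ok (grow^[p.atoms] R) s := by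
  have hside : ∀ {e : FExpr} {R : ℕ} {s : RamState}, goodExpr C e = true → s.Bdd 40 R →
      (∀ c ∈ C, (s.reg c).toNat ≤ R) → e.Ok (grow R) s ∧ |e.eval s| ≤ 2 ^ grow R := by
    intro e R s he hs hc
    simp only [goodExpr, decide_eq_true_eq] at he
    have h := hs.bddOn (List.range 40) (X := List.range 40) (fun x hx => List.mem_range.1 hx) hc
    exact ⟨(he.1.ok h).mono (le_grow R), (he.1.abs_eval_le h).trans
      (pow_le_pow_right₀ (by norm_num) (Nat.mul_le_mul_left _ he.2))⟩
  induction p generalizing R s with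
  | set x e | bits x e =>
    simp only [straight, Bool.and_eq_true] at hp
    exact hside hp.2 hs hc
  | put a i e =>
    simp only [straight, Bool.and_eq_true] at hp
    exact ⟨(hside hp.1.2 hs hc).1, hside hp.2 hs hc⟩
  | seq p q ihp ihq =>
    simp only [straight, Bool.and_eq_true] at hp
    have h1 := ihp hp.1 hs hc
    have hmono := le_grow_iterate p.atoms R
    have h2 := h1.bdd (straight_regs hp.1).2 (hs.mono hmono)
    have h3 := ihq hp.2 h2 fun c hcC => by
      rw [(frame p s).reg c ((straight_regs hp.1).1 c hcC)]
      exact (hc c hcC).trans hmono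
    rw [atoms, Nat.add_comm, iterate_add_apply]
    exact ⟨h1.mono (le_grow_iterate _ _), h3⟩
  | ite e p q => simp [straight] at hp
  | forTo y x p =>
    cases p with
    | put a i e =>
      cases i with
      | reg z =>
        simp only [straight, decide_eq_true_eq] at hp
        obtain ⟨rfl, -, -, -, h1, h2⟩ := hp
        have h := hs.bddOn (List.range 40) (X := List.range 40)
          (fun x hx => List.mem_range.1 hx) hc
        exact fill_ok h h1 (Nat.mul_le_mul_left _ h2)
      | _ => simp [straight] at hp
    | _ => simp [straight] at hp

theorem straight_bdd {C : List ℕ} {p : FProg} (hp : p.straight C = true) {R : ℕ} {s : RamState}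
    (hs : s.Bdd 40 R) (hc : ∀ c ∈ C, (s.reg c).toNat ≤ R) :
    (p.exec s).Bdd 40 (grow^[p.atoms] R) :=
  (straight_ok hp hs hc).bdd (straight_regs hp).2 (hs.mono (le_grow_iterate _ _))

end FProg

/-! ### The program for the parameters -/

theorem mul_add_lt_mul {m n i j : ℕ} (hi : i < m) (hj : j < n) : i * n + j < m * n := by nlinarith

namespace FProg
open RamState FExpr

/-- The registers that serve as numbers of rounds. -/
abbrev ctxCounters : List ℕ := [1, 9, 10, 13, 15, 26, 27, 28, 29, 34]

/-- The registers with the parameters. -/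
abbrev ctxRegs : List ℕ :=
  [0, 1, 2, 3, 4, 5, 6, 7, 8, 9, 10, 11, 12, 13, 14, 15, 26, 27, 28, 29, 34]

/-- The memory contains the parameters of the problem: the scaled mean and covariance matrix are
in the array `3`, and the digits of the grid points in the array `19`. -/
structure Ctx (n d : ℕ) (D a₁ b₁ a₂ b₂ : ℤ) (u : Fin d → ℤ) (S : Matrix (Fin d) (Fin d) ℤ)
    (s : RamState) : Prop where
  r0 : s.reg 0 = n
  r1 : s.reg 1 = d
  r2 : s.reg 2 = a₁
  r3 : s.reg 3 = b₁
  r4 : s.reg 4 = a₂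
  r5 : s.reg 5 = b₂
  r6 : s.reg 6 = D
  r7 : s.reg 7 = (n : ℤ) ^ 4
  r8 : s.reg 8 = gridB n
  r9 : s.reg 9 = gridV n d
  r10 : s.reg 10 = (n * gridV n d : ℕ)
  r11 : s.reg 11 = gridE n d
  r12 : s.reg 12 = (gridV n d ^ 33 : ℕ)
  r13 : s.reg 13 = (5 * gridV n d : ℕ)
  r14 : s.reg 14 = gridSlack n d
  r15 : s.reg 15 = (d + d * d : ℕ)
  r26 : s.reg 26 = (d * d : ℕ)
  r27 : s.reg 27 = (d - 1 : ℕ)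
  r28 : s.reg 28 = (n * gridV n d * d : ℕ)
  r29 : s.reg 29 = (5 * gridV n d * (n * gridV n d) : ℕ)
  r34 : s.reg 34 = (n * (d + 1) : ℕ)
  mean : ∀ i : Fin d, s.arr 3 i = u i
  cov : ∀ i j : Fin d, s.arr 3 (d + (i * d + j)) = S i j
  digit : ∀ j < n * gridV n d, ∀ i < d, s.arr 19 (j * d + i) = dig n j i

section Ctx

variable {n d : ℕ} {D a₁ b₁ a₂ b₂ : ℤ} {u : Fin d → ℤ} {S : Matrix (Fin d) (Fin d) ℤ}
  {s t : RamState}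

theorem Ctx.of_eq (h : Ctx n d D a₁ b₁ a₂ b₂ u S s) (hr : ∀ x ∈ ctxRegs, t.reg x = s.reg x)
    (h3 : t.arr 3 = s.arr 3) (h19 : t.arr 19 = s.arr 19) : Ctx n d D a₁ b₁ a₂ b₂ u S t := by
  simp only [ctxRegs, List.forall_mem_cons, List.not_mem_nil, false_implies, implies_true,
    and_true] at hr
  obtain ⟨h0, h1, h2, h3', h4, h5, h6, h7, h8, h9, h10, h11, h12, h13, h14, h15, h26, h27, h28,
    h29, h34⟩ := hr
  exact ⟨h0 ▸ h.r0, h1 ▸ h.r1, h2 ▸ h.r2, h3' ▸ h.r3, h4 ▸ h.r4, h5 ▸ h.r5, h6 ▸ h.r6, h7 ▸ h.r7,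
    h8 ▸ h.r8, h9 ▸ h.r9, h10 ▸ h.r10, h11 ▸ h.r11, h12 ▸ h.r12, h13 ▸ h.r13, h14 ▸ h.r14,
    h15 ▸ h.r15, h26 ▸ h.r26, h27 ▸ h.r27, h28 ▸ h.r28, h29 ▸ h.r29, h34 ▸ h.r34,
    h3 ▸ h.mean, h3 ▸ h.cov, h19 ▸ h.digit⟩

theorem Ctx.of_frame (h : Ctx n d D a₁ b₁ a₂ b₂ u S s) {p : FProg} (hf : Frame p s t)
    (hp : (∀ x ∈ ctxRegs, x ∉ p.wregs) ∧ 3 ∉ p.warrs ∧ 19 ∉ p.warrs) :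
    Ctx n d D a₁ b₁ a₂ b₂ u S t :=
  h.of_eq (fun x hx => hf.reg x (hp.1 x hx)) (hf.arr 3 hp.2.1) (hf.arr 19 hp.2.2)

theorem Ctx.setReg (h : Ctx n d D a₁ b₁ a₂ b₂ u S s) {x : ℕ} (hx : x ∉ ctxRegs) (z : ℤ) :
    Ctx n d D a₁ b₁ a₂ b₂ u S (s.setReg x z) :=
  h.of_eq (fun y hy => setReg_ne _ (by rintro rfl; exact hx hy) z) rfl rfl

theorem Ctx.flRegs (h : Ctx n d D a₁ b₁ a₂ b₂ u S s) : FlRegs d s := ⟨h.r1, h.r26, h.r27⟩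

theorem grid_counts_le (hd : 1 ≤ d) (hn : 1 ≤ n) {R : ℕ} (hR : gridV n d ^ 33 ≤ R) :
    d ≤ R ∧ gridV n d ≤ R ∧ n * gridV n d ≤ R ∧ 5 * gridV n d ≤ R ∧ d + d * d ≤ R ∧
      n * gridV n d * d ≤ R ∧ 5 * gridV n d * (n * gridV n d) ≤ R ∧ n * (d + 1) ≤ R ∧ n ≤ R := by
  obtain ⟨h1, h2, h3, h4⟩ := grid_le hd hn
  set V := gridV n d
  have hV : V ^ 5 ≤ R := (Nat.pow_le_pow_right (by omega) (by norm_num)).trans hR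
  have e1 : n * V ≤ V * V := Nat.mul_le_mul_right _ h1
  have e2 : n * V * d ≤ V * V * V := Nat.mul_le_mul e1 h3
  have e3 : 5 * V * (n * V) ≤ 5 * V * (V * V) := Nat.mul_le_mul_left _ e1
  have e4 : 5 * (V * V * V) ≤ V ^ 5 := by
    have : 5 ≤ V * V := by nlinarith
    calc 5 * (V * V * V) ≤ V * V * (V * V * V) := Nat.mul_le_mul_right _ this
      _ = V ^ 5 := by ring
  have e5 : d * d ≤ V * V := Nat.mul_le_mul h3 h3
  have e6 : n * (d + 1) ≤ V * (V + 1) := Nat.mul_le_mul h1 (by omega)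
  have e7 : V * V * 3 ≤ V * V * V := Nat.mul_le_mul_left _ h4
  have e8 : V * 3 ≤ V * V := Nat.mul_le_mul_left _ h4
  have e9 : 5 * V * (V * V) = 5 * (V * V * V) := by ring
  refine ⟨by omega, by omega, by omega, by omega, ?_, by omega, by omega, ?_, by omega⟩
  · omega
  · have e10 : V * (V + 1) = V * V + V := by ring
    omega

theorem Ctx.counters_le (h : Ctx n d D a₁ b₁ a₂ b₂ u S s) (hd : 1 ≤ d) (hn : 1 ≤ n) {R : ℕ}
    (hR : gridV n d ^ 33 ≤ R) : ∀ c ∈ ctxCounters, (s.reg c).toNat ≤ R := by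
  obtain ⟨h1, h2, h3, h4, h5, h6, h7, h8, -⟩ := grid_counts_le hd hn hR
  simp only [ctxCounters, List.forall_mem_cons, h.r1, h.r9, h.r10, h.r13, h.r15, h.r26, h.r27,
    h.r28, h.r29, h.r34, toNat_natCast]
  refine ⟨h1, h2, h3, h4, h5, by omega, by omega, h6, h7, h8, by simp⟩

end Ctx

/-- The memory contains the input: the numerators and denominators of the entries of the mean
and of the covariance matrix are `p` and `q`. -/
structure IsInput (n d : ℕ) (a₁ b₁ a₂ b₂ : ℤ) (p q : ℕ → ℤ) (s : RamState) : Prop where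
  i0 : s.arr 0 0 = n
  i1 : s.arr 0 1 = d + 1
  i2 : s.arr 0 2 = a₁
  i3 : s.arr 0 3 = b₁
  i4 : s.arr 0 4 = a₂
  i5 : s.arr 0 5 = b₂
  num : ∀ e < d + d * d, s.arr 0 (6 + 2 * e) = p e
  den : ∀ e < d + d * d, s.arr 0 (7 + 2 * e) = q e

/-- Read the dimensions and the error parameters. -/
def readProg : FProg :=
  seq (set 0 (get 0 (lit 0))) <| seq (set 1 (get 0 (lit 1) - lit 1)) <|
  seq (set 2 (get 0 (lit 2))) <| seq (set 3 (get 0 (lit 3))) <|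
  seq (set 4 (get 0 (lit 4))) <| set 5 (get 0 (lit 5))

/-- Compute the parameters that do not depend on the size of the grid. -/
def dimProg : FProg :=
  seq (set 7 ((reg 0).pow 4)) <| seq (set 8 (lit 2 * reg 7 + lit 1)) <|
  seq (set 15 (reg 1 + reg 1 * reg 1)) <| seq (set 26 (reg 1 * reg 1)) <|
  seq (set 27 (reg 1 - lit 1)) <| put 4 (lit 0) (lit 1)

/-- Compute the powers of the base of the grid. -/
def powersProg : FProg :=
  forTo 20 1 (put 4 (reg 20 + lit 1) (get 4 (reg 20) * reg 8))

/-- Compute the parameters that depend on the size of the grid. -/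
def gridProg : FProg :=
  seq (set 9 (get 4 (reg 1))) <| seq (set 10 (reg 0 * reg 9)) <|
  seq (set 11 (lit 2 * reg 10 * reg 10 + lit 1)) <| seq (set 12 ((reg 9).pow 33)) <|
  seq (set 13 (lit 5 * reg 9)) <|
  seq (set 14 (lit 3 * reg 1 * reg 0 * (reg 7 * reg 7) * (lit 2 * reg 7))) <|
  seq (set 28 (reg 10 * reg 1)) <| seq (set 29 (reg 13 * reg 10)) <|
  seq (set 34 (reg 0 * (reg 1 + lit 1))) <| set 6 (lit 1)

/-- Compute the digits of the grid points. -/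
def digitProg : FProg :=
  fill 20 28 19 (reg 20 / reg 1 / get 4 (colOf (reg 20)) -
    reg 8 * (reg 20 / reg 1 / get 4 (colOf (reg 20)) / reg 8))

/-- Compute the common denominator. -/
def denProg : FProg := forTo 20 15 (set 6 (reg 6 * get 0 (lit 7 + lit 2 * reg 20)))

/-- Compute the scaled parameters. -/
def scaleProg : FProg :=
  fill 20 15 3 (reg 6 * get 0 (lit 6 + lit 2 * reg 20) / get 0 (lit 7 + lit 2 * reg 20))

/-- Compute all parameters. -/
def setupProg : FProg :=
  seq dimProg <| seq powersProg <| seq gridProg <| seq digitProg <| seq denProg scaleProg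

section Setup

variable {n d : ℕ} {a₁ b₁ a₂ b₂ : ℤ} {p q : ℕ → ℤ} {s t : RamState}

theorem IsInput.of_frame (h : IsInput n d a₁ b₁ a₂ b₂ p q s) {P : FProg} (hf : Frame P s t)
    (hP : 0 ∉ P.warrs) : IsInput n d a₁ b₁ a₂ b₂ p q t := by
  have h0 := hf.arr 0 hP
  exact ⟨h0 ▸ h.i0, h0 ▸ h.i1, h0 ▸ h.i2, h0 ▸ h.i3, h0 ▸ h.i4, h0 ▸ h.i5, h0 ▸ h.num, h0 ▸ h.den⟩

theorem readProg_spec (h : IsInput n d a₁ b₁ a₂ b₂ p q s) :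
    (readProg.exec s).reg 0 = n ∧ (readProg.exec s).reg 1 = d ∧ (readProg.exec s).reg 2 = a₁ ∧
    (readProg.exec s).reg 3 = b₁ ∧ (readProg.exec s).reg 4 = a₂ ∧ (readProg.exec s).reg 5 = b₂ := by
  simp [readProg, exec, eval_get, eval_lit, eval_sub, h.i0, h.i1, h.i2, h.i3, h.i4,
    h.i5]

theorem powersProg_spec {R : ℕ} (hd : s.reg 1 = d) (hB : s.reg 8 = gridB n) (h0 : s.arr 4 0 = 1)
    (hR : gridV n d ≤ R) (hdR : d ≤ R) : powersProg.Ok R s ∧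
      ∀ i ≤ d, (powersProg.exec s).arr 4 i = (gridB n ^ i : ℕ) := by
  have h := forTo_spec (R := R) (y := 20) (x := 1)
    (p := put 4 (reg 20 + lit 1) (get 4 (reg 20) * reg 8)) (s := s)
    (fun m t => ∀ i ≤ m, t.arr 4 i = (gridB n ^ i : ℕ)) (by simpa [hd] using hdR)
    (by simp [h0]) fun m hm t ht hI => ?_
  · rw [hd, toNat_natCast] at h; exact h
  · rw [hd, toNat_natCast] at hm
    have h8 : t.reg 8 = gridB n := by rw [ht.reg 8 (by decide), hB]
    have hidx : (reg 20 + lit 1 : FExpr).eval (t.setReg 20 m) = (m + 1 : ℕ) := by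
      simp [eval_add, eval_reg, eval_lit]
    have hval : (get 4 (reg 20) * reg 8 : FExpr).eval (t.setReg 20 m) =
        (gridB n ^ (m + 1) : ℕ) := by
      simp only [eval_mul, eval_get, eval_reg, setReg_reg, setReg_arr]
      norm_num only [if_true, if_false]
      rw [toNat_natCast, hI m le_rfl, h8]
      push_cast; ring
    refine ⟨⟨⟨trivial, trivial⟩, ⟨trivial, trivial⟩, ?_⟩, fun i hi => ?_⟩
    · rw [hval]
      refine abs_natCast_le_two_pow (le_trans ?_ hR)
      exact Nat.pow_le_pow_right (gridB_pos n) hm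
    · simp only [exec, setArr_arr, hidx, hval, toNat_natCast, true_and, setReg_arr]
      split_ifs with him
      · rw [him]
      · exact hI i (by omega)

theorem denProg_spec {R : ℕ} (hs : s.Bdd 40 R) (h : IsInput n d a₁ b₁ a₂ b₂ p q s)
    (h15 : s.reg 15 = (d + d * d : ℕ)) (h6 : s.reg 6 = 1) (hR : d + d * d ≤ R) :
    denProg.Ok (R * R + R) s ∧ (denProg.exec s).reg 6 = ∏ e ∈ range (d + d * d), q e := by
  have hq : ∀ e < d + d * d, |q e| ≤ 2 ^ R := fun e he => by rw [← h.den e he]; exact hs.arr _ _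
  have hprod : ∀ m ≤ d + d * d, |∏ e ∈ range m, q e| ≤ 2 ^ (R * R + R) := fun m hm => by
    rw [abs_prod]
    calc ∏ e ∈ range m, |q e| ≤ ∏ e ∈ range m, (2 : ℤ) ^ R :=
          prod_le_prod (fun _ _ => abs_nonneg _) fun e he =>
            hq e ((mem_range.1 he).trans_le hm)
      _ = 2 ^ (R * m) := by rw [prod_const, card_range, ← pow_mul]
      _ ≤ _ := pow_le_pow_right₀ (by norm_num) (by nlinarith)
  have h := forTo_spec (R := R * R + R) (y := 20) (x := 15)
    (p := set 6 (reg 6 * get 0 (lit 7 + lit 2 * reg 20))) (s := s)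
    (fun m t => t.reg 6 = ∏ e ∈ range m, q e)
    (by rw [h15, toNat_natCast]; omega) (by simp [h6]) fun m hm t ht hI => ?_
  · rw [h15, toNat_natCast] at h; exact h
  · rw [h15, toNat_natCast] at hm
    have hval : (reg 6 * get 0 (lit 7 + lit 2 * reg 20) : FExpr).eval (t.setReg 20 m) =
        ∏ e ∈ range (m + 1), q e := by
      simp only [eval_mul, eval_get, eval_reg, eval_add, eval_lit, setReg_reg, setReg_arr]
      norm_num only [if_true, if_false]
      rw [ht.arr 0 (by decide), prod_range_succ, hI, ← h.den m hm]
      congr 2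
    refine ⟨⟨⟨trivial, trivial, trivial, trivial⟩, ?_⟩, ?_⟩
    · rw [hval]; exact hprod _ hm
    · simp only [exec, setReg_self, hval]

/-- The bound for the bit lengths during the computation of the parameters. -/
def setupBound (R : ℕ) : ℕ :=
  grow (grow^[17] R * grow^[17] R + grow^[17] R)

theorem setupProg_spec {R : ℕ} (hd : 1 ≤ d) (hn : 1 ≤ n) (hR : gridV n d ^ 33 ≤ R)
    (hs : s.Bdd 40 R) (h : IsInput n d a₁ b₁ a₂ b₂ p q s) (h0 : s.reg 0 = n) (h1 : s.reg 1 = d)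
    (h2 : s.reg 2 = a₁) (h3 : s.reg 3 = b₁) (h4 : s.reg 4 = a₂) (h5 : s.reg 5 = b₂) :
    setupProg.Ok (setupBound R) s ∧
      Ctx n d (∏ e ∈ range (d + d * d), q e) a₁ b₁ a₂ b₂
        (fun i => (∏ e ∈ range (d + d * d), q e) * p i / q i)
        (of fun i j => (∏ e ∈ range (d + d * d), q e) * p (d + (i * d + j)) /
          q (d + (i * d + j))) (setupProg.exec s) := by
  obtain ⟨c1, c2, c3, c4, c5, c6, c7, c8, c9⟩ := grid_counts_le hd hn hR
  have hle : ∀ k, R ≤ grow^[k] R := fun k => le_grow_iterate k R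
  -- the dimensions
  have ok1 := straight_ok (C := []) (p := dimProg) (by decide) hs (by simp)
  have bd1 := straight_bdd (C := []) (p := dimProg) (by decide) hs (by simp)
  have f1 := frame dimProg s
  have i1 := h.of_frame f1 (by decide)
  have v1 : (dimProg.exec s).reg 7 = (n : ℤ) ^ 4 ∧ (dimProg.exec s).reg 8 = gridB n ∧
      (dimProg.exec s).reg 15 = (d + d * d : ℕ) ∧ (dimProg.exec s).reg 26 = (d * d : ℕ) ∧
      (dimProg.exec s).reg 27 = (d - 1 : ℕ) ∧ (dimProg.exec s).arr 4 0 = 1 := by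
    simp [dimProg, exec, eval_lit, eval_sub, eval_add, eval_mul, eval_reg, eval_pow,
      setArr_arr, h0, h1, gridB]
    omega
  have r1 : ∀ x ∈ [0, 1, 2, 3, 4, 5], (dimProg.exec s).reg x = s.reg x := fun x hx =>
    f1.reg x (by revert x; decide)
  set s1 := dimProg.exec s with hs1
  -- the powers
  obtain ⟨ok2, v2⟩ := powersProg_spec (s := s1) (n := n) (d := d)
    (by rw [r1 1 (by decide), h1]) v1.2.1 v1.2.2.2.2.2 c2 c1
  have f2 := frame powersProg s1
  have bd2 := (ok2.mono (hle 6)).bdd (by decide) bd1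
  have i2 := i1.of_frame f2 (by decide)
  set s2 := powersProg.exec s1 with hs2
  have r2 : ∀ x ∈ [0, 1, 2, 3, 4, 5, 7, 8, 15, 26, 27], s2.reg x = s1.reg x := fun x hx =>
    f2.reg x (by revert x; decide)
  -- the size of the grid
  have ok3 := straight_ok (C := []) (p := gridProg) (by decide) bd2 (by simp)
  have bd3 := straight_bdd (C := []) (p := gridProg) (by decide) bd2 (by simp)
  have f3 := frame gridProg s2
  have i3 := i2.of_frame f3 (by decide)
  have e0 : s2.reg 0 = n := by rw [r2 0 (by decide), r1 0 (by decide), h0]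
  have e1 : s2.reg 1 = d := by rw [r2 1 (by decide), r1 1 (by decide), h1]
  have e7 : s2.reg 7 = (n : ℤ) ^ 4 := by rw [r2 7 (by decide), v1.1]
  have v3 : (gridProg.exec s2).reg 9 = gridV n d ∧ (gridProg.exec s2).reg 10 = (n * gridV n d : ℕ) ∧
      (gridProg.exec s2).reg 11 = gridE n d ∧ (gridProg.exec s2).reg 12 = (gridV n d ^ 33 : ℕ) ∧
      (gridProg.exec s2).reg 13 = (5 * gridV n d : ℕ) ∧
      (gridProg.exec s2).reg 14 = gridSlack n d ∧
      (gridProg.exec s2).reg 28 = (n * gridV n d * d : ℕ) ∧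
      (gridProg.exec s2).reg 29 = (5 * gridV n d * (n * gridV n d) : ℕ) ∧
      (gridProg.exec s2).reg 34 = (n * (d + 1) : ℕ) ∧ (gridProg.exec s2).reg 6 = 1 := by
    have e4 := v2 d le_rfl
    have e4' : s2.arr 4 d = (gridV n d : ℤ) := e4
    simp [gridProg, exec, eval_get, eval_lit, eval_add, eval_mul, eval_reg, eval_pow,
      e0, e1, e7, e4', gridE, gridSlack]
    exact Or.inl (Or.inl (by ring))
  set s3 := gridProg.exec s2 with hs3
  have r3 : ∀ x ∈ [0, 1, 2, 3, 4, 5, 7, 8, 15, 26, 27], s3.reg x = s2.reg x := fun x hx =>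
    f3.reg x (by revert x; decide)
  obtain ⟨v9, v10, v11, v12, v13, v14, v28, v29, v34, v6⟩ := v3
  have w1 : s3.reg 1 = d := by rw [r3 1 (by decide), e1]
  have w8 : s3.reg 8 = gridB n := by rw [r3 8 (by decide), r2 8 (by decide), v1.2.1]
  have w15 : s3.reg 15 = (d + d * d : ℕ) := by
    rw [r3 15 (by decide), r2 15 (by decide), v1.2.2.1]
  -- the digits
  have hC4 : ∀ c ∈ [28], (s3.reg c).toNat ≤ grow^[16] R := by
    simp only [List.mem_singleton, forall_eq, v28, toNat_natCast]; exact c6.trans (hle _)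
  have bd3' : s3.Bdd 40 (grow^[16] R) := by
    rw [← iterate_add_apply] at bd3; exact bd3
  have ok4 := straight_ok (C := [28]) (p := digitProg) (by decide) bd3' hC4
  have bd4 := straight_bdd (C := [28]) (p := digitProg) (by decide) bd3' hC4
  rw [← iterate_add_apply] at ok4 bd4
  have f4 := frame digitProg s3
  have i4 := i3.of_frame f4 (by decide)
  have v4 : ∀ j < n * gridV n d, ∀ i < d, (digitProg.exec s3).arr 19 (j * d + i) = dig n j i := by
    intro j hj i hi
    rw [digitProg, fill_val (by decide), v28, toNat_natCast, if_pos (mul_add_lt_mul hj hi)]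
    simp only [eval_mul, eval_get, eval_sub, eval_div, eval_reg, setReg_reg, setReg_arr, w1, w8]
    norm_num only [if_true, if_false]
    have hdiv : ((j * d + i : ℕ) : ℤ) / d = j := by
      rw [← Int.natCast_div, (mul_add_div_mod hi).1]
    have hmod : ((j * d + i : ℕ) : ℤ) - d * j = i := by push_cast; ring
    rw [hdiv, hmod, toNat_natCast, f3.arr 4 (by decide), v2 i hi.le, dig]
    push_cast
    rw [Int.emod_def]
  set s4 := digitProg.exec s3 with hs4
  -- the common denominator
  obtain ⟨ok5, v5⟩ := denProg_spec bd4 i4 (by rw [f4.reg 15 (by decide), w15])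
    (by rw [f4.reg 6 (by decide), v6]) (c5.trans (hle _))
  have f5 := frame denProg s4
  have i5 := i4.of_frame f5 (by decide)
  have bd5 := ok5.bdd (K := 40) (by decide) (bd4.mono (by
    show grow^[17] R ≤ grow^[17] R * grow^[17] R + grow^[17] R; omega))
  set s5 := denProg.exec s4 with hs5
  have z15 : s5.reg 15 = (d + d * d : ℕ) := by
    rw [f5.reg 15 (by decide), f4.reg 15 (by decide), w15]
  have hC6 : ∀ c ∈ [15], (s5.reg c).toNat ≤ grow^[17] R * grow^[17] R + grow^[17] R := by
    simp only [List.mem_singleton, forall_eq, z15, toNat_natCast]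
    exact (c5.trans (hle 17)).trans (by omega)
  have ok6 := straight_ok (C := [15]) (p := scaleProg) (by decide) bd5 hC6
  have f6 := frame scaleProg s5
  have v6' : ∀ e < d + d * d, (scaleProg.exec s5).arr 3 e =
      (∏ e ∈ range (d + d * d), q e) * p e / q e := by
    intro e he
    rw [scaleProg, fill_val (by decide), z15, toNat_natCast, if_pos he]
    simp only [eval_mul, eval_get, eval_add, eval_div, eval_reg, eval_lit, setReg_reg, setReg_arr]
    norm_num only [if_true, if_false]
    rw [show (6 + 2 * (e : ℤ)).toNat = 6 + 2 * e by omega,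
      show (7 + 2 * (e : ℤ)).toNat = 7 + 2 * e by omega, i5.num e he, i5.den e he, v5]
  set s6 := scaleProg.exec s5 with hs6
  have hfin : ∀ x ∈ ctxRegs.filter (· ≠ 6), s6.reg x = s3.reg x := fun x hx => by
    rw [f6.reg x (by revert x; decide), f5.reg x (by revert x; decide),
      f4.reg x (by revert x; decide)]
  have hmid : ∀ x ∈ [0, 1, 2, 3, 4, 5, 7, 8, 15, 26, 27], s6.reg x = s1.reg x := fun x hx => by
    rw [hfin x (by revert x; decide), r3 x hx, r2 x hx]
  have hlow : ∀ x ∈ [0, 1, 2, 3, 4, 5], s6.reg x = s.reg x := fun x hx => by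
    rw [hmid x (by revert x; decide), r1 x hx]
  have hsB : grow^[17] R ≤ setupBound R := le_trans (by omega) (le_grow _)
  have g19 : s6.arr 19 = s4.arr 19 := by rw [f6.arr 19 (by decide), f5.arr 19 (by decide)]
  refine ⟨⟨ok1.mono ((grow_iterate_mono (by decide) R).trans hsB), ok2.mono ((hle 17).trans hsB),
    ok3.mono (le_trans ?_ hsB), ok4.mono hsB, ok5.mono (le_grow _), ok6⟩,
    (hlow 0 (by decide)).trans h0, (hlow 1 (by decide)).trans h1, (hlow 2 (by decide)).trans h2,
    (hlow 3 (by decide)).trans h3, (hlow 4 (by decide)).trans h4, (hlow 5 (by decide)).trans h5,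
    (f6.reg 6 (by decide)).trans v5, (hmid 7 (by decide)).trans v1.1,
    (hmid 8 (by decide)).trans v1.2.1, (hfin 9 (by decide)).trans v9,
    (hfin 10 (by decide)).trans v10, (hfin 11 (by decide)).trans v11,
    (hfin 12 (by decide)).trans v12, (hfin 13 (by decide)).trans v13,
    (hfin 14 (by decide)).trans v14, (hmid 15 (by decide)).trans v1.2.2.1,
    (hmid 26 (by decide)).trans v1.2.2.2.1, (hmid 27 (by decide)).trans v1.2.2.2.2.1,
    (hfin 28 (by decide)).trans v28, (hfin 29 (by decide)).trans v29,
    (hfin 34 (by decide)).trans v34, fun i => v6' i (by have := i.2; omega),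
    fun i j => v6' _ (Nat.add_lt_add_left (mul_add_lt_mul i.2 j.2) d), g19 ▸ v4⟩
  rw [← iterate_add_apply]; exact grow_iterate_mono (by decide) R

end Setup

end FProg

/-! ### The program for the bounds on the variance -/

/-- The growth of the bound for the bit lengths in the Faddeev–LeVerrier recursion. -/
def flGrow (R : ℕ) : ℕ := 3 * (R + 1) ^ 2

theorem abs_flSeq_le_two_pow {d R : ℕ} {A : Matrix (Fin d) (Fin d) ℤ}
    (hA : ∀ i j, |A i j| ≤ 2 ^ R) (hd : d ≤ R) {k : ℕ} (hk : k < d) (i j : Fin d) :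
    |flSeq A k i j| ≤ 2 ^ flGrow R := by
  have h2 : (d : ℤ) ≤ 2 ^ R := by exact_mod_cast hd.trans Nat.lt_two_pow_self.le
  refine (abs_flSeq_le hA k i j).trans ?_
  calc (2 * (d : ℤ) ^ 2 * 2 ^ R) ^ k ≤ (2 * (2 ^ R) ^ 2 * 2 ^ R) ^ k := by gcongr
    _ = 2 ^ ((1 + 3 * R) * k) := by rw [pow_mul]; ring
    _ ≤ 2 ^ flGrow R := by
      refine pow_le_pow_right₀ (by norm_num) ?_
      have h1 : k ≤ R := by omega
      have : (1 + 3 * R) * k ≤ (1 + 3 * R) * R := Nat.mul_le_mul_left _ h1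
      unfold flGrow; nlinarith

theorem le_flGrow (R : ℕ) : R ≤ flGrow R := by unfold flGrow; nlinarith

namespace FProg
open RamState FExpr

section

variable {n d : ℕ} {D a₁ b₁ a₂ b₂ : ℤ} {u : Fin d → ℤ} {S : Matrix (Fin d) (Fin d) ℤ}
  {s t : RamState}

theorem flProg_stage {R : ℕ} (hd : 1 ≤ d) (hdR : d * d ≤ R) (hr : FlRegs d s) (hs : s.Bdd 40 R)
    {A : Matrix (Fin d) (Fin d) ℤ} (hA : IsFlat (s.arr 5) A) :
    flProg.Ok (grow^[2] (flGrow R)) s ∧ IsFlat ((flProg.exec s).arr 6) (flSeq A (d - 1)) ∧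
      (flProg.exec s).reg 18 = (A * flSeq A (d - 1)) ⟨0, hd⟩ ⟨0, hd⟩ := by
  have h1 := le_flGrow R
  have h2 : d ≤ R := by nlinarith
  have hb : s.Bdd 40 (flGrow R) := hs.mono h1
  have hc : ∀ c ∈ [1, 26, 27], (s.reg c).toNat ≤ flGrow R := by
    simp only [List.forall_mem_cons, hr.r1, hr.r26, hr.r27, toNat_natCast]
    exact ⟨h2.trans h1, hdR.trans h1, by omega, by simp⟩
  obtain ⟨g1, g2, -, -, g3⟩ := flProg_spec (R := flGrow R) (R' := grow^[2] (flGrow R)) hd hr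
    (hb.bddOn _ (by decide) hc) (by simp only [iterate_succ, iterate_zero,
      Function.comp_apply, id_eq, grow]; omega) hA
    (fun k hk i j => abs_flSeq_le_two_pow (fun i j => by rw [← hA]; exact hs.arr _ _) h2 hk i j)
    ((hb.mono (show flGrow R ≤ (flGrow R + 1) * 100 by omega)).arr 7)
  exact ⟨g1, g2, g3⟩

/-- The coordinate with the index in the register `y` of the direction with the index in the
register `20`. -/
def dirE (y : ℕ) : FExpr := get 19 (reg 20 * reg 1 + reg y) - reg 7

/-- The square of the length of the direction with the index in the register `20`. -/
def lenE : FExpr := sum 21 1 (dirE 21 * dirE 21)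

/-- The value of the quadratic form in the array `a`, shifted by `o`, at the direction with the
index in the register `20`. -/
def formE (a : ℕ) (o : FExpr) : FExpr :=
  sum 21 1 (dirE 21 * sum 22 1 (get a (o + (reg 21 * reg 1 + reg 22)) * dirE 22))

theorem Ctx.eval_dirE (h : Ctx n d D a₁ b₁ a₂ b₂ u S s) {y j i : ℕ} (h20 : s.reg 20 = j)
    (hy : s.reg y = i) (hj : j < n * gridV n d) (hi : i < d) :
    (dirE y).eval s = gridDir n d j ⟨i, hi⟩ := by
  rw [dirE, eval_sub, eval_get, eval_add, eval_mul, eval_reg, eval_reg, eval_reg, eval_reg, h20,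
    h.r1, hy, h.r7, gridDir]
  have : (j : ℤ) * d + i = ((j * d + i : ℕ) : ℤ) := by push_cast; ring
  rw [this, toNat_natCast, h.digit j hj i hi]

theorem Ctx.eval_lenE (h : Ctx n d D a₁ b₁ a₂ b₂ u S s) {j : ℕ} (h20 : s.reg 20 = j)
    (hj : j < n * gridV n d) : lenE.eval s = gridDir n d j ⬝ᵥ gridDir n d j := by
  rw [lenE, eval_sum, h.r1, toNat_natCast, dotProduct, sum_range]
  refine sum_congr rfl fun i _ => ?_
  rw [eval_mul, (h.setReg (by decide) _).eval_dirE (j := j) (i := i)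
    (by rw [setReg_ne _ (by decide), h20]) (by simp) hj i.2]

theorem Ctx.eval_formE (h : Ctx n d D a₁ b₁ a₂ b₂ u S s) {j : ℕ} (h20 : s.reg 20 = j)
    (hj : j < n * gridV n d) {a o' : ℕ} {o : FExpr}
    (ho : ∀ t : RamState, t.reg 1 = d → o.eval t = o') {M : Matrix (Fin d) (Fin d) ℤ}
    (hM : ∀ i j : Fin d, s.arr a (o' + (i * d + j)) = M i j) :
    (formE a o).eval s = gridDir n d j ⬝ᵥ M *ᵥ gridDir n d j := by
  rw [formE, eval_sum, h.r1, toNat_natCast, dotProduct, sum_range]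
  refine sum_congr rfl fun i _ => ?_
  have h1 := h.setReg (x := 21) (by decide) (i : ℕ)
  rw [eval_mul, h1.eval_dirE (j := j) (i := i)
    (by rw [setReg_ne _ (by decide), h20]) (by simp) hj i.2, eval_sum, h1.r1,
    toNat_natCast, mulVec, dotProduct, sum_range]
  congr 1
  refine sum_congr rfl fun l _ => ?_
  have h2 := h1.setReg (x := 22) (by decide) (l : ℕ)
  rw [eval_mul, h2.eval_dirE (j := j) (i := l)
    (by rw [setReg_ne _ (by decide), setReg_ne _ (by decide), h20]) (by simp) hj l.2,
    eval_get, eval_add, eval_add, eval_mul, eval_reg, eval_reg, eval_reg, ho _ h2.r1, h2.r1,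
    setReg_ne _ (by decide), setReg_self, setReg_self, setReg_arr, setReg_arr]
  have : (o' : ℤ) + (((i : ℕ) : ℤ) * d + (l : ℕ)) = ((o' + (i * d + l) : ℕ) : ℤ) := by
    push_cast; ring
  rw [this, toNat_natCast, hM]

/-- Compute the matrix `capMat`. -/
def capFill : FProg :=
  fill 21 26 5 (isDiag (reg 21) * (reg 0 * reg 0 * reg 5 * reg 6) +
    (reg 4 + reg 5) * get 3 (reg 1 + reg 21))

/-- Compute the upper bounds for the variance. -/
def upperFill : FProg :=
  fill 20 9 16 (lit 4 * reg 7 * reg 7 * (reg 0 * reg 0 + reg 0) *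
    (lenE * (reg 18 * reg 18) - reg 0 * reg 0 * reg 5 * reg 6 * formE 6 (lit 0) * reg 18) /
    (reg 18 * reg 18) + lit 1 + reg 14)

/-- Compute the lower bounds for the variance. -/
def lowerFill : FProg :=
  fill 20 9 17 (lit 4 * reg 7 * reg 7 * (ind (reg 5 - reg 4) * (reg 5 - reg 4)) *
    formE 3 (reg 1) / (reg 5 * reg 6) - reg 14)

/-- Compute the bounds for the variance. -/
def capProg : FProg := seq capFill (seq flProg (seq upperFill lowerFill))

theorem Ctx.capFill_spec (h : Ctx n d D a₁ b₁ a₂ b₂ u S s) :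
    IsFlat ((capFill.exec s).arr 5) (capMat n D a₂ b₂ S) := by
  refine isFlat_of_forall fun e he => ?_
  rw [capFill, fill_val (by decide), if_pos (h.flRegs.zero_of_forall.2 he)]
  simp only [eval_mul, eval_get, eval_add, eval_sub, eval_div, eval_reg, eval_ind, eval_lit,
    setReg_reg, setReg_arr, h.r0, h.r1, h.r4, h.r5, h.r6]
  norm_num only [if_true, if_false]
  rw [eval_colOf, eval_isDiag, capMat, Matrix.add_apply, Matrix.smul_apply, Matrix.smul_apply,
    Matrix.one_apply, ← h.cov]
  simp only [Fin.mk.injEq, smul_eq_mul]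
  rw [(divMod_lt he).2.2, show ((d : ℤ) + e).toNat = d + e by omega]
  split_ifs <;> ring

theorem Ctx.upperFill_spec (h : Ctx n d D a₁ b₁ a₂ b₂ u S s) (hn : 1 ≤ n)
    {M : Matrix (Fin d) (Fin d) ℤ} (hM : IsFlat (s.arr 6) M) {j : ℕ} (hj : j < gridV n d) :
    (upperFill.exec s).arr 16 j = upperBound n D b₂ (s.reg 18) M j := by
  have h1 := h.setReg (x := 20) (by decide) j
  have h2 : j < n * gridV n d := hj.trans_le (Nat.le_mul_of_pos_left _ hn)
  rw [upperFill, fill_val (by decide), h.r9, toNat_natCast, if_pos hj]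
  simp only [eval_mul, eval_add, eval_sub, eval_div, eval_reg, eval_lit, h1.r0, h1.r7, h1.r5,
    h1.r6, h1.r14, h1.eval_lenE (setReg_self _ _ _) h2,
    h1.eval_formE (a := 6) (o' := 0) (o := lit 0) (setReg_self _ _ _) h2 (fun _ _ => rfl)
    (M := M) (fun i k => by rw [Nat.zero_add]; exact hM i k)]
  rw [setReg_ne _ (by decide), upperBound]
  congr 3 <;> ring

theorem Ctx.lowerFill_spec (h : Ctx n d D a₁ b₁ a₂ b₂ u S s) (hn : 1 ≤ n)
    {j : ℕ} (hj : j < gridV n d) :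
    (lowerFill.exec s).arr 17 j = lowerBound n D a₂ b₂ S j := by
  have h1 := h.setReg (x := 20) (by decide) j
  have h2 : j < n * gridV n d := hj.trans_le (Nat.le_mul_of_pos_left _ hn)
  rw [lowerFill, fill_val (by decide), h.r9, toNat_natCast, if_pos hj]
  simp only [eval_mul, eval_sub, eval_div, eval_reg, eval_lit, eval_ind, h1.r7, h1.r5,
    h1.r6, h1.r14, h1.r4,
    h1.eval_formE (a := 3) (o' := d) (o := reg 1) (setReg_self _ _ _) h2 (fun _ h => h)
    (M := S) h.cov]
  have hmax : (if 0 < b₂ - a₂ then (1 : ℤ) else 0) * (b₂ - a₂) = max (b₂ - a₂) 0 := by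
    split_ifs with h3
    · rw [max_eq_left h3.le, one_mul]
    · rw [max_eq_right (by omega), zero_mul]
  rw [hmax, lowerBound]
  congr 3; ring

/-- The bound for the bit lengths during the computation of the bounds for the variance. -/
def capBound (R : ℕ) : ℕ := grow^[4] (flGrow (grow R))

theorem capProg_spec {R : ℕ} (hd : 1 ≤ d) (hn : 1 ≤ n) (hR : gridV n d ^ 33 ≤ R)
    (hs : s.Bdd 40 R) (h : Ctx n d D a₁ b₁ a₂ b₂ u S s) :
    capProg.Ok (capBound R) s ∧ Ctx n d D a₁ b₁ a₂ b₂ u S (capProg.exec s) ∧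
      ∃ E, E = (capMat n D a₂ b₂ S * flSeq (capMat n D a₂ b₂ S) (d - 1)) ⟨0, hd⟩ ⟨0, hd⟩ ∧
      (∀ j < gridV n d, (capProg.exec s).arr 16 j =
        upperBound n D b₂ E (flSeq (capMat n D a₂ b₂ S) (d - 1)) j) ∧
      ∀ j < gridV n d, (capProg.exec s).arr 17 j = lowerBound n D a₂ b₂ S j := by
  have hc : ∀ {t : RamState} {R' : ℕ}, Ctx n d D a₁ b₁ a₂ b₂ u S t → R ≤ R' →
      ∀ c ∈ ctxCounters, (t.reg c).toNat ≤ R' := fun ht hR' => ht.counters_le hd hn (hR.trans hR')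
  have ok1 := straight_ok (C := ctxCounters) (p := capFill) (by decide) hs (hc h le_rfl)
  have bd1 := straight_bdd (C := ctxCounters) (p := capFill) (by decide) hs (hc h le_rfl)
  have v1 := h.capFill_spec
  have h1 := h.of_frame (frame capFill s) (by decide)
  set s1 := capFill.exec s
  have hg : R ≤ grow R := le_grow R
  obtain ⟨ok2, v2, w2⟩ := flProg_stage hd (by
    have := (grid_counts_le hd hn hR).2.2.2.2.1
    show d * d ≤ grow R
    omega) h1.flRegs bd1 v1
  have bd2 := ok2.bdd (K := 40) (by decide)
    (bd1.mono ((le_flGrow _).trans (le_grow_iterate 2 _)))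
  have h2 := h1.of_frame (frame flProg s1) (by decide)
  set s2 := flProg.exec s1
  change flProg.Ok (grow^[2] (flGrow (grow R))) s1 at ok2
  have hR2 : R ≤ grow^[2] (flGrow (grow R)) :=
    (hg.trans (le_flGrow _)).trans (le_grow_iterate 2 _)
  have ok3 := straight_ok (C := ctxCounters) (p := seq upperFill lowerFill) (by decide) bd2
    (hc h2 hR2)
  have h3 := h2.of_frame (frame (seq upperFill lowerFill) s2) (by decide)
  have h3' := h2.of_frame (frame upperFill s2) (by decide)
  refine ⟨⟨ok1.mono ?_, ok2.mono ?_, ok3⟩, h3, _, w2, fun j hj => ?_, fun j hj => ?_⟩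
  · exact (le_flGrow _).trans (le_grow_iterate 4 _)
  · exact grow_iterate_mono (by norm_num) _
  · show (lowerFill.exec (upperFill.exec s2)).arr 16 j = _
    rw [(frame lowerFill _).arr 16 (by decide)]
    exact h2.upperFill_spec hn v2 hj
  · exact h3'.lowerFill_spec hn hj

end

end FProg

/-! ### The program for the good means -/

namespace FProg
open RamState FExpr

/-- The vector that is tested for the grid point with the index in the register `20`: the
product of the matrix in the array `6` with the scaled difference of the means. -/
def testVec (y : ℕ) : FExpr :=
  sum 23 1 (get 6 (reg y * reg 1 + reg 23) *
    (reg 6 * get 19 (reg 20 * reg 1 + reg 23) - get 3 (reg 23)))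

/-- The indicator of the grid points that pass the test `MeanTest`. -/
def testE : FExpr :=
  ind (reg 18 * reg 18 * reg 6 + lit 1 - reg 3 * reg 3 * (reg 2 * reg 2) *
    sum 21 1 (testVec 21 * sum 22 1 (get 3 (reg 1 + (reg 21 * reg 1 + reg 22)) * testVec 22))) *
  ind (lit 4 * reg 1 * (reg 18 * reg 18) + lit 1 - reg 17 * reg 17 * (reg 3).pow 4 *
    sum 21 1 (testVec 21 * testVec 21))

/-- Compute the matrix `meanMat` for the parameter in the register `17`. -/
def meanFill : FProg :=
  fill 21 26 5 (isDiag (reg 21) * (reg 17 * reg 3 * reg 3 * reg 6) +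
    reg 2 * reg 2 * get 3 (reg 1 + reg 21))

/-- Test all grid points, and update the indicators of the good means. -/
def testFill : FProg := fill 20 9 30 (ind (get 8 (reg 20) + testE))

/-- Store the updated indicators. -/
def copyFill : FProg := fill 20 9 8 (get 30 (reg 20))

/-- Test all grid points for a single parameter. -/
def meanStep : FProg :=
  seq meanFill (seq flProg (seq testFill (seq copyFill (set 17 (lit 2 * reg 17)))))

/-- Compute the number of the parameters that have to be tried. -/
def meanInit : FProg :=
  seq (bits 16 (sum 21 1 (lit 2 * (reg 6 * reg 8 * (reg 6 * reg 8) +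
    get 3 (reg 21) * get 3 (reg 21))))) <|
  seq (set 16 (reg 16 + lit 1)) <| seq (fill 20 9 8 (lit 0)) <| set 17 (lit 1)

/-- Compute the indicators of the good means. -/
def meanProg : FProg := seq meanInit (forTo 24 16 meanStep)

section

variable {n d : ℕ} {D a₁ b₁ a₂ b₂ : ℤ} {u : Fin d → ℤ} {S : Matrix (Fin d) (Fin d) ℤ}
  {s t : RamState}

theorem Ctx.eval_testVec (h : Ctx n d D a₁ b₁ a₂ b₂ u S s) {y g i : ℕ} (h20 : s.reg 20 = g)
    (hy : s.reg y = i) (hy' : y ≠ 23) (hg : g < n * gridV n d) (hi : i < d)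
    {M : Matrix (Fin d) (Fin d) ℤ} (hM : IsFlat (s.arr 6) M) :
    (testVec y).eval s = (M *ᵥ (D • (fun l : Fin d => (dig n g l : ℤ)) - u)) ⟨i, hi⟩ := by
  rw [testVec, eval_sum, h.r1, toNat_natCast, mulVec, dotProduct, sum_range]
  refine sum_congr rfl fun l _ => ?_
  have h1 := h.setReg (x := 23) (by decide) (l : ℕ)
  simp only [eval_mul, eval_sub, eval_get, eval_add, eval_reg, h1.r1, h1.r6, setReg_arr,
    setReg_self]
  rw [setReg_ne _ hy', setReg_ne _ (by decide), hy, h20]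
  have e1 : (i : ℤ) * d + (l : ℕ) = ((i * d + l : ℕ) : ℤ) := by push_cast; ring
  have e2 : (g : ℤ) * d + (l : ℕ) = ((g * d + l : ℕ) : ℤ) := by push_cast; ring
  rw [e1, e2, toNat_natCast, toNat_natCast, toNat_natCast, h.digit g hg l l.2,
    h.mean, ← hM]
  rfl

theorem Ctx.eval_testVec_form (h : Ctx n d D a₁ b₁ a₂ b₂ u S s) {g : ℕ} (h20 : s.reg 20 = g)
    (hg : g < n * gridV n d) {M : Matrix (Fin d) (Fin d) ℤ} (hM : IsFlat (s.arr 6) M) :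
    (sum 21 1 (testVec 21 * sum 22 1 (get 3 (reg 1 + (reg 21 * reg 1 + reg 22)) *
      testVec 22))).eval s = (M *ᵥ (D • (fun l : Fin d => (dig n g l : ℤ)) - u)) ⬝ᵥ
        S *ᵥ (M *ᵥ (D • (fun l : Fin d => (dig n g l : ℤ)) - u)) := by
  have hS : ∀ (v : Fin d → ℤ) i, (S *ᵥ v) i = ∑ j, S i j * v j := fun _ _ => rfl
  rw [eval_sum, h.r1, toNat_natCast, dotProduct, sum_range]
  refine sum_congr rfl fun i _ => ?_
  have h1 := h.setReg (x := 21) (by decide) (i : ℕ)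
  rw [eval_mul, h1.eval_testVec (g := g) (i := i) (by rw [setReg_ne _ (by decide), h20])
    (by simp) (by decide) hg i.2 (by exact hM), eval_sum, h1.r1, toNat_natCast,
    hS, sum_range]
  congr 1
  refine sum_congr rfl fun l _ => ?_
  have h2 := h1.setReg (x := 22) (by decide) (l : ℕ)
  rw [eval_mul, h2.eval_testVec (g := g) (i := l)
    (by rw [setReg_ne _ (by decide), setReg_ne _ (by decide), h20]) (by simp) (by decide)
    hg l.2 (by exact hM), eval_get, eval_add, eval_add, eval_mul, eval_reg, eval_reg, eval_reg,
    h2.r1, setReg_ne _ (by decide), setReg_self, setReg_self, setReg_arr, setReg_arr]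
  have : (d : ℤ) + (((i : ℕ) : ℤ) * d + (l : ℕ)) = ((d + (i * d + l) : ℕ) : ℤ) := by
    push_cast; ring
  rw [this, toNat_natCast, h.cov]

theorem Ctx.eval_testVec_sq (h : Ctx n d D a₁ b₁ a₂ b₂ u S s) {g : ℕ} (h20 : s.reg 20 = g)
    (hg : g < n * gridV n d) {M : Matrix (Fin d) (Fin d) ℤ} (hM : IsFlat (s.arr 6) M) :
    (sum 21 1 (testVec 21 * testVec 21)).eval s =
      (M *ᵥ (D • (fun l : Fin d => (dig n g l : ℤ)) - u)) ⬝ᵥ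
        (M *ᵥ (D • (fun l : Fin d => (dig n g l : ℤ)) - u)) := by
  rw [eval_sum, h.r1, toNat_natCast, dotProduct, sum_range]
  refine sum_congr rfl fun i _ => ?_
  have h1 := h.setReg (x := 21) (by decide) (i : ℕ)
  rw [eval_mul, h1.eval_testVec (g := g) (i := i) (by rw [setReg_ne _ (by decide), h20])
    (by simp) (by decide) hg i.2 (by exact hM)]

open Classical in
theorem Ctx.eval_testE (h : Ctx n d D a₁ b₁ a₂ b₂ u S s) (hd : 0 < d) {g : ℕ} {lam E : ℤ}
    (h20 : s.reg 20 = g) (hg : g < n * gridV n d) (h17 : s.reg 17 = lam) (h18 : s.reg 18 = E)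
    (hM : IsFlat (s.arr 6) (flSeq (meanMat D a₁ b₁ S lam) (d - 1))) (hE : E ≠ 0)
    (hEM : meanMat D a₁ b₁ S lam * flSeq (meanMat D a₁ b₁ S lam) (d - 1) = E • 1) :
    testE.eval s = if MeanTest D a₁ b₁ u S lam (fun l => (dig n g l : ℤ)) then 1 else 0 := by
  have huniq : ∀ E' : ℤ, meanMat D a₁ b₁ S lam * flSeq (meanMat D a₁ b₁ S lam) (d - 1) = E' • 1 →
      E' = E := fun E' h' => by
    have := congrFun (congrFun (h'.symm.trans hEM) ⟨0, hd⟩) ⟨0, hd⟩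
    simpa using this
  rw [testE, eval_mul, eval_ind, eval_ind]
  simp only [eval_sub, eval_add, eval_mul, eval_pow, eval_reg, eval_lit, h.eval_testVec_form h20 hg
    hM, h.eval_testVec_sq h20 hg hM, h17, h18, h.r6, h.r3, h.r2, h.r1]
  by_cases hT : MeanTest D a₁ b₁ u S lam (fun l => (dig n g l : ℤ))
  · obtain ⟨E', h1, h2, h3, h4⟩ := hT
    obtain rfl := huniq E' h2
    have hT : MeanTest D a₁ b₁ u S lam (fun l => (dig n g l : ℤ)) := ⟨E', h1, h2, h3, h4⟩
    rw [if_pos hT, if_pos, if_pos, one_mul]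
    · nlinarith
    · nlinarith
  · rw [if_neg hT]
    split_ifs with h1 h2 <;> try rfl
    exact absurd ⟨E, hE, hEM, by nlinarith, by nlinarith⟩ hT

theorem Ctx.meanFill_spec (h : Ctx n d D a₁ b₁ a₂ b₂ u S s) {lam : ℤ} (h17 : s.reg 17 = lam) :
    IsFlat ((meanFill.exec s).arr 5) (meanMat D a₁ b₁ S lam) := by
  refine isFlat_of_forall fun e he => ?_
  rw [meanFill, fill_val (by decide), if_pos (h.flRegs.zero_of_forall.2 he)]
  simp only [eval_mul, eval_get, eval_add, eval_sub, eval_div, eval_reg, eval_ind, eval_lit,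
    setReg_reg, setReg_arr, h.r2, h.r1, h.r3, h.r6, h17]
  norm_num only [if_true, if_false]
  rw [eval_colOf, eval_isDiag, meanMat, Matrix.add_apply, Matrix.smul_apply, Matrix.smul_apply,
    Matrix.one_apply, ← h.cov]
  simp only [Fin.mk.injEq, smul_eq_mul]
  rw [(divMod_lt he).2.2, show ((d : ℤ) + e).toNat = d + e by omega]
  split_ifs <;> ring

/-- The bounds that are preserved by the tests. -/
structure MeanBdd (R : ℕ) (s : RamState) : Prop where
  b5 : ∀ i, |s.arr 5 i| ≤ 2 ^ grow R
  b6 : ∀ i, |s.arr 6 i| ≤ 2 ^ flGrow (grow R)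
  b7 : ∀ i, |s.arr 7 i| ≤ 2 ^ ((flGrow (grow R) + 1) * 100)
  b8 : ∀ i, |s.arr 8 i| ≤ 2 ^ R
  b30 : ∀ i, |s.arr 30 i| ≤ 2 ^ R

/-- The bound for the bit lengths during the tests. -/
def meanGrow (R : ℕ) : ℕ := grow^[3] (flGrow (grow R))

open Classical in
theorem meanStep_spec {R : ℕ} {lam E : ℤ} (hd : 1 ≤ d) (hn : 1 ≤ n) (hR : gridV n d ^ 33 ≤ R)
    (h : Ctx n d D a₁ b₁ a₂ b₂ u S s) (h17 : s.reg 17 = lam)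
    (hs : s.BddOn R (17 :: ctxRegs) ctxCounters [3, 19]) (hb : MeanBdd R s) (hE : E ≠ 0)
    (hEM : meanMat D a₁ b₁ S lam * flSeq (meanMat D a₁ b₁ S lam) (d - 1) = E • 1)
    (h8 : ∀ g < gridV n d, s.arr 8 g = 0 ∨ s.arr 8 g = 1) :
    meanStep.Ok (meanGrow R) s ∧ (meanStep.exec s).reg 17 = 2 * lam ∧
      MeanBdd R (meanStep.exec s) ∧ ∀ g < gridV n d, (meanStep.exec s).arr 8 g =
        if s.arr 8 g = 1 ∨ MeanTest D a₁ b₁ u S lam (fun l => (dig n g l : ℤ)) then 1 else 0 := by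
  obtain ⟨c1, c2, c3, c4, c5, c6, c7, c8, c9⟩ := grid_counts_le hd hn hR
  set Q := flGrow (grow R) with hQ
  have hRg : R ≤ grow R := le_grow R
  have hgQ : grow R ≤ Q := le_flGrow _
  -- the matrix
  obtain ⟨ok1, val1, bd1⟩ := fill_auto (R' := grow R) hs (y := 21) (x := 26) (a := 5)
    (e := isDiag (reg 21) * (reg 17 * reg 3 * reg 3 * reg 6) +
      reg 2 * reg 2 * get 3 (reg 1 + reg 21)) (by decide) (Nat.mul_le_mul_left _ (by decide))
  change meanFill.Ok (grow R) s at ok1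
  have f1 := frame meanFill s
  have v1 := h.meanFill_spec h17
  have h1 := h.of_frame f1 (by decide)
  have b1 : ∀ i, |(meanFill.exec s).arr 5 i| ≤ 2 ^ grow R := fill_arr_bdd hb.b5 val1 bd1
  set s1 := meanFill.exec s with hs1
  have hs1' : s1.BddOn R (17 :: ctxRegs) ctxCounters [3, 19] :=
    hs.of_frame f1 (by decide) (by decide) (by decide)
  -- the adjugate matrix
  have hflB : ∀ k < d, ∀ i j, |flSeq (meanMat D a₁ b₁ S lam) k i j| ≤ 2 ^ Q := fun k hk i j =>
    abs_flSeq_le_two_pow (fun i j => by rw [← v1]; exact b1 _) (c1.trans hRg) hk i j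
  have hin : s1.BddOn Q [1] [1, 26, 27] [5, 6] :=
    ((((hs1'.of_subset (A' := []) (by decide) (by decide) (by simp)).mono hRg).mono hgQ).addArr
      (fun i => by rw [f1.arr 6 (by decide)]; exact hb.b6 i)).addArr
      fun i => (b1 i).trans (pow_le_pow_right₀ (by norm_num) hgQ)
  obtain ⟨ok2, v2, b2, b2', w2⟩ := flProg_spec (R' := grow^[2] Q) hd h1.flRegs hin
    (by simp only [iterate_succ, iterate_zero, Function.comp_apply, id_eq,
      grow]; omega) v1 hflB (fun i => by rw [f1.arr 7 (by decide)]; exact hb.b7 i)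
  have f2 := frame flProg s1
  have ok2' : |(flProg.exec s1).reg 18| ≤ 2 ^ grow^[2] Q := by
    exact ok2.2.2.2
  have h2 := h1.of_frame f2 (by decide)
  set s2 := flProg.exec s1 with hs2
  have hw : s2.reg 18 = E := by rw [w2, hEM]; simp
  have hs2' : s2.BddOn R (17 :: ctxRegs) ctxCounters [3, 19] :=
    hs1'.of_frame f2 (by decide) (by decide) (by decide)
  have e8 : s2.arr 8 = s.arr 8 := by rw [f2.arr 8 (by decide), f1.arr 8 (by decide)]
  have e30 : s2.arr 30 = s.arr 30 := by rw [f2.arr 30 (by decide), f1.arr 30 (by decide)]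
  have e5 : s2.arr 5 = s1.arr 5 := f2.arr 5 (by decide)
  have e17 : s2.reg 17 = lam := by rw [f2.reg 17 (by decide), f1.reg 17 (by decide), h17]
  -- the test
  have hRQ : R ≤ grow^[2] Q := (hRg.trans hgQ).trans (le_grow_iterate 2 _)
  have hin3 : s2.BddOn (grow^[2] Q) (18 :: 17 :: ctxRegs) ctxCounters [8, 6, 3, 19] := by
    have h3 := ((hs2'.mono hRQ).addArr (a := 6) fun i =>
      (b2 i).trans (pow_le_pow_right₀ (by norm_num) (le_grow_iterate 2 _))).addArr (a := 8) fun i =>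
      (by rw [e8]; exact hb.b8 i : |s2.arr 8 i| ≤ 2 ^ R).trans
        (pow_le_pow_right₀ (by norm_num) hRQ)
    exact ⟨fun x hx => (List.mem_cons.1 hx).elim (fun e => e ▸ ok2') (h3.reg x), h3.cnt, h3.arr⟩
  obtain ⟨ok3, val3, -⟩ := fill_auto (R' := grow^[3] Q) hin3 (y := 20) (x := 9) (a := 30)
    (e := ind (get 8 (reg 20) + testE)) (by decide) (by
      rw [iterate_succ_apply' grow 2]; exact Nat.mul_le_mul_left _ (by decide))
  change testFill.Ok (grow^[3] Q) s2 at ok3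
  have f3 := frame testFill s2
  have h3 := h2.of_frame f3 (by decide)
  have v3 : ∀ g < gridV n d, (testFill.exec s2).arr 30 g =
      if s.arr 8 g = 1 ∨ MeanTest D a₁ b₁ u S lam (fun l => (dig n g l : ℤ)) then 1 else 0 := by
    intro g hg
    have h2g := h2.setReg (x := 20) (by decide) g
    have hg' : g < n * gridV n d := hg.trans_le (Nat.le_mul_of_pos_left _ hn)
    rw [testFill, fill_val (by decide), h2.r9, toNat_natCast, if_pos hg, eval_ind, eval_add,
      eval_get, eval_reg, setReg_self, setReg_arr, toNat_natCast, e8,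
      h2g.eval_testE hd (setReg_self _ _ _) hg' (by rw [setReg_ne _ (by decide), e17])
        (by rw [setReg_ne _ (by decide), hw]) (by exact v2) hE hEM]
    by_cases hT : MeanTest D a₁ b₁ u S lam (fun l => (dig n g l : ℤ))
    · rw [if_pos hT, if_pos (Or.inr hT), if_pos]
      rcases h8 g hg with h | h <;> rw [h] <;> norm_num
    · rw [if_neg hT]
      rcases h8 g hg with h | h <;> rw [h] <;> simp [hT]
  have b3 : ∀ i, |(testFill.exec s2).arr 30 i| ≤ 2 ^ R := fun i => by
    by_cases hi : i < gridV n d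
    · rw [v3 i hi]; split_ifs
      · rw [abs_one]; exact one_le_pow₀ (by norm_num)
      · simp
    · rw [testFill, fill_val (by decide), h2.r9, toNat_natCast, if_neg hi, e30]; exact hb.b30 i
  set s3 := testFill.exec s2 with hs3
  have hs3' : s3.BddOn R (17 :: ctxRegs) ctxCounters [30] :=
    ((hs2'.of_frame f3 (by decide) (by decide) (by decide)).of_subset (A' := []) (fun _ h => h)
      (fun _ h => h) (by simp)).addArr b3
  -- the copy
  obtain ⟨ok4, val4, -⟩ := fill_auto (R' := grow R) hs3' (y := 20) (x := 9) (a := 8)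
    (e := get 30 (reg 20)) (by decide) (Nat.mul_le_mul_left _ (by decide))
  change copyFill.Ok (grow R) s3 at ok4
  have f4 := frame copyFill s3
  have h4 := h3.of_frame f4 (by decide)
  have v4 : ∀ i, (copyFill.exec s3).arr 8 i = if i < gridV n d then s3.arr 30 i else s.arr 8 i := by
    intro i
    rw [copyFill, fill_val (by decide), h3.r9, toNat_natCast, eval_get, eval_reg,
      setReg_self, setReg_arr, toNat_natCast, f3.arr 8 (by decide), e8]
  set s4 := copyFill.exec s3 with hs4
  have hs4' : s4.BddOn R (17 :: ctxRegs) ctxCounters [] :=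
    (hs3'.of_subset (A' := []) (fun _ h => h) (fun _ h => h) (by simp)).of_frame f4 (by decide)
      (by decide) (by simp)
  have ok5 : (set 17 (lit 2 * reg 17)).Ok (grow R) s4 :=
    set_ok hs4' (by decide) (Nat.mul_le_mul_left _ (by decide))
  have hexec : meanStep.exec s = s4.setReg 17 ((lit 2 * reg 17 : FExpr).eval s4) := rfl
  have hg3 : grow R ≤ grow^[3] Q := hgQ.trans (le_grow_iterate 3 _)
  refine ⟨⟨ok1.mono hg3, ok2.mono (grow_iterate_mono (by norm_num) _), ok3, ok4.mono hg3,
    ok5.mono hg3⟩, ?_, ?_, ?_⟩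
  · rw [hexec, setReg_self, eval_mul, eval_reg, f4.reg 17 (by decide), f3.reg 17 (by decide),
      e17, eval_lit]
  · rw [hexec]
    refine ⟨fun i => ?_, fun i => ?_, fun i => ?_, fun i => ?_, fun i => ?_⟩ <;> rw [setReg_arr]
    · rw [f4.arr 5 (by decide), f3.arr 5 (by decide), e5]; exact b1 i
    · rw [f4.arr 6 (by decide), f3.arr 6 (by decide)]; exact b2 i
    · rw [f4.arr 7 (by decide), f3.arr 7 (by decide)]; exact b2' i
    · rw [v4]; split_ifs
      · exact b3 i
      · exact hb.b8 i
    · rw [f4.arr 30 (by decide)]; exact b3 i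
  · intro g hg
    rw [hexec, setReg_arr, v4, if_pos hg, v3 g hg]

end

end FProg

namespace FProg
open RamState FExpr

section

variable {n d : ℕ} {D a₁ b₁ a₂ b₂ : ℤ} {u : Fin d → ℤ} {S : Matrix (Fin d) (Fin d) ℤ}
  {s t : RamState}

/-- The number whose bit length bounds the number of parameters that have to be tried. -/
theorem Ctx.eval_meanBits (h : Ctx n d D a₁ b₁ a₂ b₂ u S s) :
    (sum 21 1 (lit 2 * (reg 6 * reg 8 * (reg 6 * reg 8) +
      get 3 (reg 21) * get 3 (reg 21)))).eval s =
      ∑ i : Fin d, 2 * (D * gridB n * (D * gridB n) + u i * u i) := by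
  rw [eval_sum, h.r1, toNat_natCast, sum_range]
  refine sum_congr rfl fun i _ => ?_
  have h1 := h.setReg (x := 21) (by decide) (i : ℕ)
  simp only [eval_mul, eval_get, eval_add, eval_reg, eval_lit, h1.r6, h1.r8, setReg_self,
    setReg_arr, toNat_natCast, h.mean]

theorem sq_grid_sub_le (D : ℤ) (u : Fin d → ℤ) (g : ℕ) :
    (D • (fun l : Fin d => (dig n g l : ℤ)) - u) ⬝ᵥ (D • (fun l : Fin d => (dig n g l : ℤ)) - u) ≤
      ∑ i : Fin d, 2 * (D * gridB n * (D * gridB n) + u i * u i) := by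
  rw [dotProduct]
  refine sum_le_sum fun i _ => ?_
  simp only [Pi.sub_apply, Pi.smul_apply, smul_eq_mul]
  have h1 : (dig n g i : ℤ) ≤ gridB n := by exact_mod_cast (dig_lt n g i).le
  have h0 : (0 : ℤ) ≤ dig n g i := by positivity
  have h2 : (dig n g i : ℤ) ^ 2 ≤ (gridB n : ℤ) ^ 2 := by gcongr
  nlinarith [sq_nonneg (D * (dig n g i : ℤ) + u i), mul_le_mul_of_nonneg_left h2 (sq_nonneg D)]

/-- The bound for the bit lengths during the computation of the good means. -/
def meanBound (R : ℕ) : ℕ := meanGrow (grow^[4] R)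

theorem meanProg_spec {R : ℕ} (hd : 1 ≤ d) (hn : 1 ≤ n) (hR : gridV n d ^ 33 ≤ R)
    (hs : s.Bdd 40 R) (h : Ctx n d D a₁ b₁ a₂ b₂ u S s)
    (hM : ∀ lam : ℤ, 0 < lam → ∃ E : ℤ, E ≠ 0 ∧
      meanMat D a₁ b₁ S lam * flSeq (meanMat D a₁ b₁ S lam) (d - 1) = E • 1) :
    meanProg.Ok (meanBound R) s ∧ ∃ b : ℕ,
      (∀ g : ℕ, (D • (fun l : Fin d => (dig n g l : ℤ)) - u) ⬝ᵥ
        (D • (fun l : Fin d => (dig n g l : ℤ)) - u) ≤ 2 ^ b) ∧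
      ∀ g < gridV n d, ((meanProg.exec s).arr 8 g = 0 ∨ (meanProg.exec s).arr 8 g = 1) ∧
        ((meanProg.exec s).arr 8 g = 1 ↔
          ∃ t ≤ b, MeanTest D a₁ b₁ u S (2 ^ t) fun l => (dig n g l : ℤ)) := by
  classical
  have hc := h.counters_le hd hn hR
  have ok1 := straight_ok (C := ctxCounters) (p := meanInit) (by decide) hs hc
  have bd1 := straight_bdd (C := ctxCounters) (p := meanInit) (by decide) hs hc
  have hbits := (straight_ok (C := ctxCounters) (p := bits 16 (sum 21 1 (lit 2 *
    (reg 6 * reg 8 * (reg 6 * reg 8) + get 3 (reg 21) * get 3 (reg 21))))) (by decide) hs hc).2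
  rw [h.eval_meanBits] at hbits
  change _ ≤ 2 ^ grow R at hbits
  set W := ∑ i : Fin d, 2 * (D * gridB n * (D * gridB n) + u i * u i) with hW
  set b := Nat.size W.toNat with hb
  have hW0 : 0 ≤ W := sum_nonneg fun i _ => by
    nlinarith [mul_self_nonneg (D * gridB n), mul_self_nonneg (u i)]
  have hWb : W ≤ 2 ^ b := by
    have h1 : W.toNat < 2 ^ b := Nat.lt_size_self _
    have h2 : (W.toNat : ℤ) < 2 ^ b := by exact_mod_cast h1
    omega
  have hbR : b + 1 ≤ grow^[4] R := by
    have h1 : b ≤ grow R + 1 := by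
      rw [hb, Nat.size_le, pow_succ]
      have h2 : (W.toNat : ℤ) ≤ 2 ^ grow R := by
        rw [Int.toNat_of_nonneg hW0]; exact (le_abs_self _).trans hbits
      have h3 : W.toNat ≤ 2 ^ grow R := by exact_mod_cast h2
      have := Nat.pow_pos (n := grow R) (show 0 < 2 by norm_num)
      omega
    have h4 : grow R + 2 ≤ grow^[2] R := by
      simp only [iterate_succ, iterate_zero, Function.comp_apply, id_eq]
      unfold grow; omega
    have := grow_iterate_mono (show 2 ≤ 4 by norm_num) R
    omega
  have f1 := frame meanInit s
  have h1 := h.of_frame f1 (by decide)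
  have v16 : (meanInit.exec s).reg 16 = (b + 1 : ℕ) := by
    show ((fill 20 9 8 (lit 0)).exec _).reg 16 = _
    rw [(frame (fill 20 9 8 (lit 0)) _).reg 16 (by decide)]
    simp only [exec, setReg_self, eval_add, eval_reg, eval_lit, h.eval_meanBits, ← hW, ← hb]
    push_cast; rfl
  have v17 : (meanInit.exec s).reg 17 = 1 := rfl
  have v8 : ∀ g < gridV n d, (meanInit.exec s).arr 8 g = 0 := fun g hg => by
    show ((fill 20 9 8 (lit 0)).exec (((set 16 (reg 16 + lit 1)).exec
      ((bits 16 _).exec s)))).arr 8 g = 0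
    rw [fill_val (by decide), if_pos]
    · rfl
    · simp only [exec]
      rw [setReg_ne _ (by decide), setReg_ne _ (by decide), h.r9, toNat_natCast]
      exact hg
  set s1 := meanInit.exec s with hs1
  set R1 := grow^[4] R with hR1
  change s1.Bdd 40 R1 at bd1
  have hRR : R ≤ R1 := le_grow_iterate _ _
  have hmono : ∀ {R' : ℕ}, R1 ≤ R' → ∀ a i, |s1.arr a i| ≤ 2 ^ R' := fun h => (bd1.mono h).arr
  have hg1 := le_grow R1
  have hg2 := hg1.trans (le_flGrow (grow R1))
  have hloop := forTo_spec (R := meanGrow R1) (y := 24) (x := 16) (p := meanStep) (s := s1)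
    (fun k t => t.reg 17 = 2 ^ k ∧ MeanBdd R1 t ∧ ∀ g < gridV n d, t.arr 8 g =
      if ∃ l < k, MeanTest D a₁ b₁ u S (2 ^ l) (fun l => (dig n g l : ℤ)) then 1 else 0)
    (by
      rw [v16, toNat_natCast]
      exact hbR.trans (hg2.trans (le_grow_iterate 3 _)))
    ⟨by rw [v17, pow_zero], ⟨hmono hg1 _, hmono hg2 _, hmono (by omega) _, bd1.arr _, bd1.arr _⟩,
      fun g hg => by rw [v8 g hg]; simp⟩ fun k hk t ht hI => ?_
  · obtain ⟨ok2, -, -, v2⟩ := hloop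
    rw [v16, toNat_natCast] at v2
    refine ⟨⟨ok1.mono (hg2.trans (le_grow_iterate 3 _)), ok2⟩, b,
      fun g => (sq_grid_sub_le D u g).trans hWb, fun g hg => ?_⟩
    have e : (meanProg.exec s).arr 8 g = ((forTo 24 16 meanStep).exec s1).arr 8 g := rfl
    rw [e, v2 g hg]
    simp only [Nat.lt_succ_iff]
    split_ifs with h3 <;> simp [h3]
  · rw [v16, toNat_natCast] at hk
    obtain ⟨i17, iB, i8⟩ := hI
    have ht' := h1.of_frame ht (by decide)
    obtain ⟨E, hE, hEM⟩ := hM (2 ^ k) (by positivity)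
    have hbd : (t.setReg 24 k).BddOn R1 (17 :: ctxRegs) ctxCounters [3, 19] := by
      have hb1 : t.BddOn R1 ctxRegs ctxCounters [3, 19] :=
        (bd1.bddOn (X := ctxRegs) [3, 19] (by decide)
          (h1.counters_le hd hn (hR.trans hRR))).of_frame ht (by decide) (by decide) (by decide)
      have hb2 : (t.setReg 24 k).BddOn R1 (24 :: ctxRegs) ctxCounters [3, 19] :=
        hb1.setReg (by decide) (abs_natCast_le_two_pow (by omega))
      refine ⟨fun x hx => (List.mem_cons.1 hx).elim (fun e => ?_)
        fun h => hb2.reg x (List.mem_cons_of_mem _ h), hb2.cnt, hb2.arr⟩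
      rw [e, setReg_ne _ (by decide), i17, abs_of_nonneg (by positivity)]
      exact pow_le_pow_right₀ (by norm_num) (by omega)
    obtain ⟨ok2, w17, wB, w8⟩ := meanStep_spec (s := t.setReg 24 k) (R := R1) hd hn (hR.trans hRR)
      (ht'.setReg (by decide) _) (by rw [setReg_ne _ (by decide), i17]) hbd
      ⟨iB.b5, iB.b6, iB.b7, iB.b8, iB.b30⟩ hE hEM (fun g hg => by
        rw [setReg_arr, i8 g hg]; split_ifs <;> simp)
    refine ⟨ok2, by rw [w17, pow_succ, mul_comm], wB, fun g hg => ?_⟩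
    rw [w8 g hg, setReg_arr, i8 g hg]
    refine if_congr ?_ rfl rfl
    constructor
    · rintro (h2 | h2)
      · split_ifs at h2 with h3
        · obtain ⟨l, hl, hT⟩ := h3; exact ⟨l, by omega, hT⟩
        · omega
      · exact ⟨k, by omega, h2⟩
    · rintro ⟨l, hl, hT⟩
      rcases Nat.lt_succ_iff_lt_or_eq.1 hl with h2 | rfl
      · left; rw [if_pos ⟨l, h2, hT⟩]
      · exact Or.inr hT

end

end FProg

/-! ### The program for the linear system -/

/-- The indicator, expressed by arithmetic operations, that `g` is good and that `val` is largest
at `g` among the good numbers below `V`. -/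
def bestInd (V : ℕ) (good val : ℕ → ℤ) (g : ℕ) : ℤ :=
  good g * (if 0 < 1 - ∑ f ∈ range V, good f * (if 0 < val f - val g then 1 else 0) then 1 else 0)

/-- The maximum of finitely many numbers, expressed by arithmetic operations: the average of those
numbers that are not exceeded by any other. -/
theorem exists_eq_sum_ediv_sum {V : ℕ} {good val : ℕ → ℤ} (h01 : ∀ g < V, good g = 0 ∨ good g = 1)
    (h : ∃ g < V, good g = 1) : ∃ g < V, good g = 1 ∧
      (∑ g ∈ range V, bestInd V good val g * val g) / (∑ g ∈ range V, bestInd V good val g) =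
        val g ∧
      ∀ f < V, good f = 1 → val f ≤ val g := by
  obtain ⟨g₀, hg₀, h₀⟩ := h
  obtain ⟨g, hg, hmax⟩ := exists_max_image {g ∈ range V | good g = 1} val
    ⟨g₀, by simp [hg₀, h₀]⟩
  simp only [mem_filter, mem_range] at hg hmax
  set w := bestInd V good val
  have hterm : ∀ e f, f ∈ range V → 0 ≤ good f * (if 0 < val f - val e then (1 : ℤ) else 0) :=
    fun e f hf => by
      rcases h01 f (mem_range.1 hf) with h | h <;> rw [h] <;> split_ifs <;> norm_num
  have hw0 : ∀ e < V, 0 ≤ w e := fun e he => by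
    simp only [w, bestInd]
    rcases h01 e he with h | h <;> rw [h] <;> split_ifs <;> norm_num
  have hwg : w g = 1 := by
    simp only [w, bestInd]
    rw [hg.2, sum_eq_zero, if_pos (by norm_num), one_mul]
    intro f hf
    rcases h01 f (mem_range.1 hf) with h | h
    · rw [h, zero_mul]
    · have := hmax f ⟨mem_range.1 hf, h⟩
      rw [if_neg (by omega), mul_zero]
  have hwval : ∀ e ∈ range V, w e * val e = w e * val g := fun e he => by
    have heV := mem_range.1 he
    rcases h01 e heV with h | h
    · simp only [w, bestInd, h, zero_mul]
    · by_cases hval : val e = val g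
      · rw [hval]
      · have hlt := lt_of_le_of_ne (hmax e ⟨heV, h⟩) hval
        have : w e = 0 := by
          simp only [w, bestInd, h, one_mul]
          rw [if_neg]
          have h1 := single_le_sum (hterm e) (mem_range.2 hg.1)
          rw [hg.2, if_pos (by omega), one_mul] at h1
          omega
        rw [this, zero_mul, zero_mul]
  refine ⟨g, hg.1, hg.2, ?_, fun f hf h => hmax f ⟨hf, h⟩⟩
  rw [sum_congr rfl hwval, ← sum_mul, mul_comm, Int.mul_ediv_cancel]
  have := single_le_sum (fun e he => hw0 e (mem_range.1 he)) (mem_range.2 hg.1)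
  omega

namespace FProg
open RamState FExpr

/-- The expression for `gridLin`. -/
def linE (t c : FExpr) : FExpr :=
  sum 21 1 ((get 19 (t * reg 1 + reg 21) - reg 7) * get 19 (c * reg 1 + reg 21))

/-- The expression for `gridQuad`. -/
def quadE (t c : FExpr) : FExpr :=
  lit 2 * reg 7 * sum 21 1 ((get 19 (t * reg 1 + reg 21) - reg 7) *
    (get 19 (t * reg 1 + reg 21) - reg 7) * get 19 (c * reg 1 + reg 21)) - linE t c * linE t c

/-- The indicator of the equality of two numbers. -/
def eqE (e f : FExpr) : FExpr := ind (lit 1 - (e - f) * (e - f))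

/-- The bound for the mean in the direction with the index in the register `20` that comes from
the grid point with the index in the register `y`. -/
def valE (y : ℕ) : FExpr := lit 2 * reg 7 * (linE (reg 20) (reg y) + lit 2 * reg 7 * reg 1)

/-- The indicator of the good means that are best for the direction with the index in the
register `20`. -/
def bestE : FExpr :=
  get 8 (reg 23) * ind (lit 1 - sum 24 9 (get 8 (reg 24) * ind (valE 24 - valE 23)))

/-- Compute the upper bounds for the means. -/
def upperMeanFill : FProg := fill 20 9 15 (sum 23 9 (bestE * valE 23) / sum 23 9 bestE)

/-- The block of rows to which the row `i` of the linear system belongs. -/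
abbrev blockE (i : FExpr) : FExpr := i / reg 9

/-- The direction to which the row `i` of the linear system belongs. -/
abbrev dirIdxE (i : FExpr) : FExpr := i - reg 9 * (i / reg 9)

/-- The index of the row of an entry of the linear system. -/
abbrev lpRow : FExpr := reg 20 / reg 10

/-- The index of the column of an entry of the linear system. -/
abbrev lpCol : FExpr := reg 20 - reg 10 * (reg 20 / reg 10)

/-- Compute the matrix of the linear system. -/
def coefFill : FProg :=
  fill 20 29 10 (reg 11 * (eqE (blockE lpRow) (lit 0) * linE (dirIdxE lpRow) lpCol +
    eqE (blockE lpRow) (lit 1) * quadE (dirIdxE lpRow) lpCol -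
    eqE (blockE lpRow) (lit 2) * quadE (dirIdxE lpRow) lpCol +
    eqE (blockE lpRow) (lit 3) - ind (blockE lpRow - lit 3)))

/-- Compute the right hand sides of the linear system. -/
def boundFill : FProg :=
  fill 20 13 11 (reg 11 * (eqE (blockE (reg 20)) (lit 0) * get 15 (dirIdxE (reg 20)) +
    eqE (blockE (reg 20)) (lit 1) * get 16 (dirIdxE (reg 20)) -
    eqE (blockE (reg 20)) (lit 2) * get 17 (dirIdxE (reg 20)) +
    eqE (blockE (reg 20)) (lit 3) * reg 0 - ind (blockE (reg 20) - lit 3) * reg 0))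

/-- Compute the initial partial assignment. -/
def startFill : FProg :=
  fill 20 10 12 (lit 2 *
    ind (lit 2 * reg 7 + lit 1 - sum 21 1 (get 19 (reg 20 * reg 1 + reg 21))))

/-- Compute the linear system. -/
def lpProg : FProg := seq upperMeanFill (seq coefFill (seq boundFill startFill))

section

variable {n d : ℕ} {D a₁ b₁ a₂ b₂ : ℤ} {u : Fin d → ℤ} {S : Matrix (Fin d) (Fin d) ℤ}
  {s t : RamState}

theorem Ctx.get_digit (h : Ctx n d D a₁ b₁ a₂ b₂ u S s) {a i : ℕ} (ha : a < n * gridV n d)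
    (hi : i < d) : s.arr 19 ((a : ℤ) * d + i).toNat = dig n a i := by
  have e1 : (a : ℤ) * d + i = ((a * d + i : ℕ) : ℤ) := by push_cast; ring
  rw [e1, toNat_natCast, h.digit a ha i hi]

theorem Ctx.eval_linE (h : Ctx n d D a₁ b₁ a₂ b₂ u S s) {e f : FExpr} {a b : ℕ}
    (he : ∀ i : ℕ, e.eval (s.setReg 21 i) = a) (hf : ∀ i : ℕ, f.eval (s.setReg 21 i) = b)
    (ha : a < n * gridV n d) (hb : b < n * gridV n d) : (linE e f).eval s = gridLin n d a b := by
  rw [linE, eval_sum, h.r1, toNat_natCast, gridLin]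
  refine sum_congr rfl fun i hi => ?_
  have hi := mem_range.1 hi
  have h1 := h.setReg (x := 21) (by decide) i
  simp only [eval_mul, eval_sub, eval_get, eval_add, eval_reg, he, hf, h1.r1, h1.r7,
    setReg_self, h1.get_digit ha hi, h1.get_digit hb hi]

theorem Ctx.eval_quadE (h : Ctx n d D a₁ b₁ a₂ b₂ u S s) {e f : FExpr} {a b : ℕ}
    (he : ∀ i : ℕ, e.eval (s.setReg 21 i) = a) (hf : ∀ i : ℕ, f.eval (s.setReg 21 i) = b)
    (ha : a < n * gridV n d) (hb : b < n * gridV n d) : (quadE e f).eval s = gridQuad n d a b := by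
  rw [quadE, eval_sub, eval_mul, eval_mul, eval_mul, h.eval_linE he hf ha hb, eval_sum, h.r1,
    toNat_natCast, gridQuad, gridSq, eval_lit, eval_reg, h.r7, sq (gridLin n d a b)]
  congr 2
  refine sum_congr rfl fun i hi => ?_
  have hi := mem_range.1 hi
  have h1 := h.setReg (x := 21) (by decide) i
  simp only [eval_mul, eval_sub, eval_get, eval_add, eval_reg, he, hf, h1.r1, h1.r7,
    setReg_self, h1.get_digit ha hi, h1.get_digit hb hi, sq]

theorem eval_eqE (e f : FExpr) (s : RamState) :
    (eqE e f).eval s = if e.eval s = f.eval s then 1 else 0 := by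
  simp only [eqE, eval_ind, eval_sub, eval_mul, eval_lit]
  refine if_congr ?_ rfl rfl
  constructor
  · intro h
    by_contra hne
    have := mul_self_pos.2 (sub_ne_zero.2 hne)
    omega
  · intro h; rw [h]; norm_num

theorem Ctx.eval_valE (h : Ctx n d D a₁ b₁ a₂ b₂ u S s) {y a b : ℕ} (h20 : s.reg 20 = a)
    (hy : s.reg y = b) (hy' : y ≠ 21) (ha : a < n * gridV n d) (hb : b < n * gridV n d) :
    (valE y).eval s = gridVal n d a b := by
  rw [valE, eval_mul, eval_mul, eval_add, eval_mul, eval_mul, eval_lit, eval_reg, eval_reg,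
    h.r7, h.r1, gridVal, h.eval_linE (a := a) (b := b) (fun i => ?_) (fun i => ?_) ha hb]
  · rw [eval_reg, setReg_ne _ (by decide), h20]
  · rw [eval_reg, setReg_ne _ hy', hy]

theorem Ctx.eval_bestE (h : Ctx n d D a₁ b₁ a₂ b₂ u S s) {a b : ℕ} (h20 : s.reg 20 = a)
    (h23 : s.reg 23 = b) (ha : a < n * gridV n d) (hb : b < gridV n d) (hn : 1 ≤ n) :
    bestE.eval s = bestInd (gridV n d) (s.arr 8) (gridVal n d a) b := by
  have hV : gridV n d ≤ n * gridV n d := Nat.le_mul_of_pos_left _ hn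
  rw [bestE, eval_mul, eval_ind, eval_sub, eval_sum, eval_get, eval_reg, h23, h.r9,
    toNat_natCast, toNat_natCast, eval_lit, bestInd]
  congr 4
  refine sum_congr rfl fun f hf => ?_
  have hf := mem_range.1 hf
  have h1 := h.setReg (x := 24) (by decide) f
  have e20 : (s.setReg 24 f).reg 20 = a := by rw [setReg_ne _ (by decide), h20]
  have e23 : (s.setReg 24 f).reg 23 = b := by rw [setReg_ne _ (by decide), h23]
  rw [eval_mul, eval_ind, eval_sub, eval_get, eval_reg, setReg_self, setReg_arr,
    toNat_natCast, h1.eval_valE e20 (setReg_self _ _ _) (by decide) ha (hf.trans_le hV),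
    h1.eval_valE e20 e23 (by decide) ha (hb.trans_le hV)]

theorem Ctx.upperMeanFill_spec (h : Ctx n d D a₁ b₁ a₂ b₂ u S s) (hn : 1 ≤ n)
    (h8 : ∀ g < gridV n d, s.arr 8 g = 0 ∨ s.arr 8 g = 1) (hg : ∃ g < gridV n d, s.arr 8 g = 1)
    {a : ℕ} (ha : a < gridV n d) : ∃ g < gridV n d, s.arr 8 g = 1 ∧
      (upperMeanFill.exec s).arr 15 a = gridVal n d a g ∧
      ∀ f < gridV n d, s.arr 8 f = 1 → gridVal n d a f ≤
        (upperMeanFill.exec s).arr 15 a := by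
  have hV : gridV n d ≤ n * gridV n d := Nat.le_mul_of_pos_left _ hn
  obtain ⟨g, h1, h2, h3, h4⟩ := exists_eq_sum_ediv_sum
    (val := gridVal n d a) h8 hg
  have heval : (upperMeanFill.exec s).arr 15 a = gridVal n d a g := by
    have c1 := h.setReg (x := 20) (by decide) a
    rw [upperMeanFill, fill_val (by decide), h.r9, toNat_natCast, if_pos ha, eval_div,
      eval_sum, eval_sum, c1.r9, toNat_natCast, ← h3]
    have hb : ∀ b ∈ range (gridV n d), bestE.eval ((s.setReg 20 a).setReg 23 b) = _ :=
      fun b hb => (c1.setReg (x := 23) (by decide) b).eval_bestE (a := a) (b := b)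
        (by rw [setReg_ne _ (by decide), setReg_self]) (by rw [setReg_self])
        (ha.trans_le hV) (mem_range.1 hb) hn
    congr 1
    · refine sum_congr rfl fun b hb' => ?_
      rw [eval_mul, hb b hb', (c1.setReg (x := 23) (by decide) b).eval_valE (a := a) (b := b)
        (by rw [setReg_ne _ (by decide), setReg_self]) (by rw [setReg_self])
        (by decide) (ha.trans_le hV) ((mem_range.1 hb').trans_le hV)]
      rfl
    · exact sum_congr rfl fun b hb' => hb b hb'
  exact ⟨g, h1, h2, heval, fun f hf hf' => by rw [heval]; exact h4 f hf hf'⟩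

theorem block_ite (q : ℕ) (x y z v w : ℤ) :
    (if (q : ℤ) = 0 then 1 else 0) * x + (if (q : ℤ) = 1 then 1 else 0) * y -
      (if (q : ℤ) = 2 then 1 else 0) * z + (if (q : ℤ) = 3 then 1 else 0) * v -
      (if 0 < (q : ℤ) - 3 then 1 else 0) * w =
    if q = 0 then x else if q = 1 then y else if q = 2 then -z else if q = 3 then v else -w := by
  rcases q with _ | _ | _ | _ | q
  · simp
  · simp
  · simp
  · simp
  · rw [if_neg (by omega), if_neg (by omega), if_neg (by omega), if_neg (by omega),
      if_pos (by omega), if_neg (by omega), if_neg (by omega), if_neg (by omega),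
      if_neg (by omega)]
    ring

theorem Ctx.coefFill_spec (h : Ctx n d D a₁ b₁ a₂ b₂ u S s) (hn : 1 ≤ n) {i j : ℕ}
    (hi : i < 5 * gridV n d) (hj : j < n * gridV n d) :
    (coefFill.exec s).arr 10 (i * (n * gridV n d) + j) = rowCoef n d i j := by
  have hV : gridV n d ≤ n * gridV n d := Nat.le_mul_of_pos_left _ hn
  set N := n * gridV n d with hN
  have hlt : i * N + j < 5 * gridV n d * N := mul_add_lt_mul hi hj
  have hrow : ∀ t : RamState, t.reg 10 = (N : ℕ) → t.reg 20 = ((i * N + j : ℕ) : ℤ) →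
      lpRow.eval t = i ∧ lpCol.eval t = j := fun t h10 h20 => by
    simp only [eval_sub, eval_mul, eval_div, eval_reg, h10, h20]
    have hdiv : ((i * N + j : ℕ) : ℤ) / (N : ℕ) = i := by
      rw [← Int.natCast_div, (mul_add_div_mod hj).1]
    rw [hdiv]
    refine ⟨rfl, ?_⟩
    push_cast; ring
  have c1 := h.setReg (x := 20) (by decide) ((i * N + j : ℕ) : ℤ)
  have hmod : (i : ℤ) - gridV n d * ((i : ℤ) / gridV n d) = ((i % gridV n d : ℕ) : ℤ) := by
    push_cast; rw [Int.emod_def]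
  have e1 : ∀ k : ℕ, (dirIdxE lpRow).eval
      ((s.setReg 20 ((i * N + j : ℕ) : ℤ)).setReg 21 k) = ((i % gridV n d : ℕ) : ℤ) := fun k => by
    have c2 := c1.setReg (x := 21) (by decide) (k : ℤ)
    rw [eval_sub, eval_mul, eval_div lpRow, (hrow _ c2.r10 rfl).1, eval_reg, c2.r9, hmod]
  have e2 : ∀ k : ℕ, lpCol.eval ((s.setReg 20 ((i * N + j : ℕ) : ℤ)).setReg 21 k) = j := fun k =>
    (hrow _ (c1.setReg (x := 21) (by decide) (k : ℤ)).r10 rfl).2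
  have ht : i % gridV n d < N := (Nat.mod_lt _ (gridV_pos n d)).trans_le hV
  have e3 : (blockE lpRow).eval (s.setReg 20 ((i * N + j : ℕ) : ℤ)) =
      ((i / gridV n d : ℕ) : ℤ) := by
    rw [eval_div lpRow, (hrow _ c1.r10 rfl).1, eval_reg, c1.r9]; push_cast; rfl
  rw [coefFill, fill_val (by decide), h.r29, toNat_natCast, if_pos hlt, eval_mul, eval_sub,
    eval_add, eval_sub, eval_add, eval_mul, eval_mul, eval_mul, eval_eqE, eval_eqE, eval_eqE,
    eval_eqE, eval_ind, eval_sub, c1.eval_linE e1 e2 ht hj, c1.eval_quadE e1 e2 ht hj, e3,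
    eval_reg, c1.r11, rowCoef]
  simp only [eval_lit]
  congr 1
  have := block_ite (i / gridV n d) (gridLin n d (i % gridV n d) j)
    (gridQuad n d (i % gridV n d) j) (gridQuad n d (i % gridV n d) j) 1 1
  rw [mul_one, mul_one] at this
  exact this

theorem Ctx.boundFill_spec (h : Ctx n d D a₁ b₁ a₂ b₂ u S s) {i : ℕ}
    (hi : i < 5 * gridV n d) : (boundFill.exec s).arr 11 i =
      rowBound n d (s.arr 15) (s.arr 16) (s.arr 17) i := by
  have c1 := h.setReg (x := 20) (by decide) (i : ℤ)
  have hmod : (i : ℤ) - gridV n d * ((i : ℤ) / gridV n d) = ((i % gridV n d : ℕ) : ℤ) := by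
    push_cast; rw [Int.emod_def]
  have hdiv : (i : ℤ) / gridV n d = ((i / gridV n d : ℕ) : ℤ) := by push_cast; rfl
  rw [boundFill, fill_val (by decide), h.r13, toNat_natCast, if_pos hi]
  simp only [eval_mul, eval_sub, eval_add, eval_eqE, eval_ind, eval_get, eval_div, eval_reg,
    eval_lit, c1.r9, c1.r11, c1.r0, setReg_self, setReg_arr, hmod, toNat_natCast]
  rw [hdiv, block_ite, rowBound]

theorem Ctx.startFill_spec (h : Ctx n d D a₁ b₁ a₂ b₂ u S s) {j : ℕ}
    (hj : j < n * gridV n d) : (startFill.exec s).arr 12 j = gridStart n d j := by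
  have c1 := h.setReg (x := 20) (by decide) (j : ℤ)
  have hsum : (sum 21 1 (get 19 (reg 20 * reg 1 + reg 21))).eval (s.setReg 20 j) =
      ∑ i ∈ range d, (dig n j i : ℤ) := by
    rw [eval_sum, c1.r1, toNat_natCast]
    refine sum_congr rfl fun i hi => ?_
    have c2 := c1.setReg (x := 21) (by decide) (i : ℤ)
    rw [eval_get, eval_add, eval_mul, eval_reg, eval_reg, eval_reg, setReg_self,
      setReg_ne _ (by decide), setReg_self, c2.r1,
      c2.get_digit hj (mem_range.1 hi)]
  rw [startFill, fill_val (by decide), h.r10, toNat_natCast, if_pos hj, eval_mul, eval_ind,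
    eval_sub, hsum, eval_add, eval_mul, eval_reg, eval_lit, eval_lit, c1.r7, gridStart]
  split_ifs <;> omega

set_option maxRecDepth 4000 in
/-- The computation of the linear system. -/
theorem lpProg_spec {R : ℕ} (hd : 1 ≤ d) (hn : 1 ≤ n) (hR : gridV n d ^ 33 ≤ R)
    (hs : s.Bdd 40 R) (h : Ctx n d D a₁ b₁ a₂ b₂ u S s)
    (h8 : ∀ g < gridV n d, s.arr 8 g = 0 ∨ s.arr 8 g = 1)
    (hg : ∃ g < gridV n d, s.arr 8 g = 1) :
    lpProg.Ok (grow^[4] R) s ∧ ∃ hm : ℕ → ℤ,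
      (∀ a < gridV n d, ∃ g < gridV n d, s.arr 8 g = 1 ∧
        hm a = gridVal n d a g ∧
        ∀ f < gridV n d, s.arr 8 f = 1 → gridVal n d a f ≤ hm a) ∧
      (∀ i < 5 * gridV n d, ∀ j < n * gridV n d,
        (lpProg.exec s).arr 10 (i * (n * gridV n d) + j) = rowCoef n d i j) ∧
      (∀ i < 5 * gridV n d,
        (lpProg.exec s).arr 11 i = rowBound n d hm (s.arr 16) (s.arr 17) i) ∧
      ∀ j < n * gridV n d, (lpProg.exec s).arr 12 j = gridStart n d j := by
  have ok1 := straight_ok (C := ctxCounters) (p := lpProg) (by decide) hs (h.counters_le hd hn hR)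
  have f1 := frame upperMeanFill s
  have h1 := h.of_frame f1 (by decide)
  have f2 := frame coefFill (upperMeanFill.exec s)
  have h2 := h1.of_frame f2 (by decide)
  have f3 := frame boundFill (coefFill.exec (upperMeanFill.exec s))
  have h3 := h2.of_frame f3 (by decide)
  have f4 := frame startFill (boundFill.exec (coefFill.exec (upperMeanFill.exec s)))
  have hexec : lpProg.exec s = startFill.exec (boundFill.exec (coefFill.exec
    (upperMeanFill.exec s))) := rfl
  refine ⟨ok1, (upperMeanFill.exec s).arr 15, fun a ha => h.upperMeanFill_spec hn h8 hg ha,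
    fun i hi j hj => ?_, fun i hi => ?_, fun j hj => ?_⟩
  · rw [hexec, f4.arr 10 (by decide), f3.arr 10 (by decide)]
    exact h1.coefFill_spec hn hi hj
  · rw [hexec, f4.arr 11 (by decide), h2.boundFill_spec hi, f2.arr 15 (by decide),
      f2.arr 16 (by decide), f2.arr 17 (by decide), f1.arr 16 (by decide), f1.arr 17 (by decide)]
  · rw [hexec]
    exact h3.startFill_spec hj

end

end FProg

/-! ### The program for the rounding procedure -/

theorem vertexSel_congr {a : ℕ → ℕ → ℤ} {m : ℕ} {F r r' : ℕ → ℤ} (h : ∀ i < m, r i = r' i) (j : ℕ) :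
    vertexSel a m F r j = vertexSel a m F r' j := by
  unfold vertexSel
  rw [sum_congr rfl fun i hi => by rw [h i (mem_range.1 hi)]]

theorem IsPartial.roundPasses {a : ℕ → ℕ → ℤ} {h : ℕ → ℤ} {m N T : ℕ} {F : ℕ → ℤ}
    (hF : IsPartial N F) (A : ℕ) : IsPartial N (roundPasses a h m N T F A) := by
  induction A with
  | zero => exact hF
  | succ A ih => exact ih.roundPass N

namespace FProg
open RamState FExpr

/-- The memory contains the linear system with the matrix `a` and the right hand side `h`. -/
structure LPMem (m N T : ℕ) (a : ℕ → ℕ → ℤ) (h : ℕ → ℤ) (R : ℕ) (s : RamState) : Prop where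
  r10 : s.reg 10 = N
  r12 : s.reg 12 = T
  r13 : s.reg 13 = m
  coef : ∀ i < m, ∀ j < N, s.arr 10 (i * N + j) = a i j
  bound : ∀ i < m, s.arr 11 i = h i
  bdd : s.BddOn R [10, 12, 13, 19] [10, 12, 13] [10, 11, 12, 13, 14, 20]

/-- Compute the vertex `vertexSel`. -/
def selFill : FProg :=
  fill 20 10 14 (ind (get 12 (reg 20) - lit 1) * ind (lit 0 - sum 21 13
    (ind (get 13 (reg 21)) * get 13 (reg 21) * get 10 (reg 21 * reg 10 + reg 20))) +
    (lit 1 - ind (get 12 (reg 20) - lit 1)) * get 12 (reg 20))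

/-- Compute the new accumulated violations. -/
def violationFill : FProg :=
  fill 20 13 20 (get 13 (reg 20) + (sum 21 10 (get 10 (reg 20 * reg 10 + reg 21) *
    get 14 (reg 21)) - get 11 (reg 20) - reg 19))

/-- Store the new accumulated violations. -/
def violationCopy : FProg := fill 20 13 13 (get 20 (reg 20))

/-- One round of the greedy selection. -/
def greedyStep : FProg := seq selFill (seq violationFill violationCopy)

/-- The greedy selection. -/
def greedyProg : FProg := seq (fill 20 13 13 (lit 0)) (forTo 22 12 greedyStep)

/-- The new value of the variable with the index in the register `24`: the value `v`, if the
variable was free and all accumulated violations are small, and the old value otherwise. -/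
def keepExpr (v : ℤ) : FExpr :=
  reg 35 + ind (reg 35 - lit 1) *
    ind (lit 1 - sum 20 13 (ind (get 13 (reg 20) - reg 12))) * lit (v - 2)

/-- Try to fix the variable with the index in the register `24` to the value `v`. -/
def tryProg (v : ℤ) : FProg :=
  seq (set 35 (get 12 (reg 24))) <| seq (put 12 (reg 24) (lit v)) <| seq greedyProg <|
    seq (put 12 (reg 24) (keepExpr v)) (set 19 (reg 19 + lit 1))

/-- One pass over all variables. -/
def passProg : FProg := forTo 24 10 (seq (tryProg 0) (tryProg 1))

/-- The rounding procedure. -/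
def roundProg : FProg := seq (set 19 (lit 0)) (forTo 23 10 passProg)

section

variable {m N T B R : ℕ} {a : ℕ → ℕ → ℤ} {h : ℕ → ℤ} {s t : RamState}

theorem LPMem.of_frame (hL : LPMem m N T a h R s) {p : FProg} (hf : Frame p s t)
    (hp : ∀ x ∈ [10, 12, 13, 19], x ∉ p.wregs) (b : ℕ)
    (hb : ∀ c ∈ [10, 11, 12, 13, 14, 20], c ∈ p.warrs → c = b ∧ c ≠ 10 ∧ c ≠ 11)
    (hb' : ∀ i, |t.arr b i| ≤ 2 ^ R) : LPMem m N T a h R t := by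
  have hr := fun x hx => hf.reg x (hp x hx)
  have h10 := hf.arr 10 fun hc => (hb 10 (by simp) hc).2.1 rfl
  have h11 := hf.arr 11 fun hc => (hb 11 (by simp) hc).2.2 rfl
  refine ⟨(hr 10 (by simp)).trans hL.r10, (hr 12 (by simp)).trans hL.r12,
    (hr 13 (by simp)).trans hL.r13, h10 ▸ hL.coef, h11 ▸ hL.bound,
    fun x hx => by rw [hr x hx]; exact hL.bdd.reg x hx, fun x hx => ?_, fun c hc i => ?_⟩
  · rw [hr x (by simp only [List.mem_cons] at hx ⊢; tauto)]; exact hL.bdd.cnt x hx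
  · by_cases hcb : c = b
    · exact hcb ▸ hb' i
    · rw [hf.arr c fun hc' => hcb (hb c hc hc').1]; exact hL.bdd.arr c hc i

theorem LPMem.setReg (hL : LPMem m N T a h R s) {x : ℕ} (hx : x ∉ [10, 12, 13]) (z : ℤ)
    (hz : x = 19 → |z| ≤ 2 ^ R := by simp) : LPMem m N T a h R (s.setReg x z) := by
  have hc : ∀ y ∈ [10, 12, 13], (s.setReg x z).reg y = s.reg y := fun y hy =>
    setReg_ne _ (by rintro rfl; exact hx hy) _
  refine ⟨(hc 10 (by simp)).trans hL.r10, (hc 12 (by simp)).trans hL.r12,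
    (hc 13 (by simp)).trans hL.r13, hL.coef, hL.bound, fun y hy => ?_,
    fun y hy => by rw [hc y hy]; exact hL.bdd.cnt y hy, hL.bdd.arr⟩
  rw [setReg_reg]; split_ifs with hyx
  · simp only [List.mem_cons, List.not_mem_nil, or_false] at hx hy
    exact hz (by omega)
  · exact hL.bdd.reg y hy

theorem LPMem.setArr (hL : LPMem m N T a h R s) (J : ℕ) {z : ℤ} (hz : |z| ≤ 2 ^ R) :
    LPMem m N T a h R (s.setArr 12 J z) :=
  ⟨hL.r10, hL.r12, hL.r13, by simpa using hL.coef, by simpa using hL.bound, hL.bdd.reg,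
    hL.bdd.cnt, fun b hb i => by
      rw [setArr_arr]; split_ifs
      · exact hz
      · exact hL.bdd.arr b hb i⟩

theorem LPMem.get_coef (hL : LPMem m N T a h R s) {i j : ℕ} (hi : i < m) (hj : j < N) :
    s.arr 10 ((i : ℤ) * N + j).toNat = a i j := by
  have e1 : (i : ℤ) * N + j = ((i * N + j : ℕ) : ℤ) := by push_cast; ring
  rw [e1, toNat_natCast, hL.coef i hi j hj]

theorem LPMem.selFill_spec (hL : LPMem m N T a h R s) (hF : IsPartial N (s.arr 12)) :
    selFill.Ok (grow R) s ∧ LPMem m N T a h R (selFill.exec s) ∧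
      ∀ j < N, (selFill.exec s).arr 14 j = vertexSel a m (s.arr 12) (s.arr 13) j := by
  have ok1 : selFill.Ok (grow R) s :=
    fill_ok hL.bdd (by decide) (Nat.mul_le_mul_left _ (by decide))
  have hf := frame selFill s
  have hval : ∀ j < N, (selFill.exec s).arr 14 j = vertexSel a m (s.arr 12) (s.arr 13) j := by
    intro j hj
    rw [selFill, fill_val (by decide), hL.r10, toNat_natCast, if_pos hj, vertexSel]
    have hsum : (sum 21 13 (ind (get 13 (reg 21)) * get 13 (reg 21) *
        get 10 (reg 21 * reg 10 + reg 20))).eval (s.setReg 20 j) =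
        ∑ i ∈ range m, (if 0 < s.arr 13 i then s.arr 13 i else 0) * a i j := by
      have c1 := hL.setReg (x := 20) (by decide) (j : ℤ)
      rw [eval_sum, c1.r13, toNat_natCast]
      refine sum_congr rfl fun i hi => ?_
      have c2 := c1.setReg (x := 21) (by decide) (i : ℤ)
      have h20 : ((s.setReg 20 j).setReg 21 i).reg 20 = j := rfl
      simp only [eval_mul, eval_ind, eval_get, eval_add, eval_reg, setReg_self, c2.r10, h20,
        setReg_arr, toNat_natCast, hL.get_coef (mem_range.1 hi) hj]
      split_ifs <;> simp
    rw [eval_add, eval_mul, eval_mul, eval_sub, eval_ind, eval_ind, eval_sub (lit 0), hsum]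
    simp only [eval_sub, eval_lit, eval_get, eval_reg, setReg_self, setReg_arr,
      toNat_natCast]
    by_cases h1 : 1 < s.arr 12 j
    · rw [if_pos (by omega : 0 < s.arr 12 j - 1), if_pos h1, one_mul, sub_self, zero_mul, add_zero]
      exact if_congr Iff.rfl rfl rfl
    · rw [if_neg (by omega : ¬ 0 < s.arr 12 j - 1), if_neg h1]; ring
  refine ⟨ok1, hL.of_frame hf (by decide) 14 (by decide) fun i => ?_, hval⟩
  by_cases hi : i < N
  · rw [hval i hi]
    rcases vertexSel_eq (a := a) (m := m) hF (s.arr 13) hi with h1 | h1 <;> rw [h1]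
    · simp
    · rw [abs_one]; exact one_le_pow₀ (by norm_num)
  · rw [selFill, fill_val (by decide), hL.r10, toNat_natCast, if_neg hi]
    exact hL.bdd.arr 14 (by decide) i

theorem LPMem.violationFill_spec (hL : LPMem m N T a h R s) {σ : ℤ} (h19 : s.reg 19 = σ)
    {r : ℕ → ℤ} (hr : ∀ i < m, r i = s.arr 13 i +
      (∑ j ∈ range N, a i j * s.arr 14 j - h i - σ)) (hrB : ∀ i < m, |r i| ≤ 2 ^ R) :
    violationFill.Ok (grow R) s ∧ LPMem m N T a h R (violationFill.exec s) ∧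
      ∀ i < m, (violationFill.exec s).arr 20 i = r i := by
  have ok1 : violationFill.Ok (grow R) s :=
    fill_ok hL.bdd (by decide) (Nat.mul_le_mul_left _ (by decide))
  have hf := frame violationFill s
  have hval : ∀ i < m, (violationFill.exec s).arr 20 i = r i := by
    intro i hi
    rw [violationFill, fill_val (by decide), hL.r13, toNat_natCast, if_pos hi, hr i hi]
    have hsum : (sum 21 10 (get 10 (reg 20 * reg 10 + reg 21) *
        get 14 (reg 21))).eval (s.setReg 20 i) =
        ∑ j ∈ range N, a i j * s.arr 14 j := by
      have c1 := hL.setReg (x := 20) (by decide) (i : ℤ)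
      rw [eval_sum, c1.r10, toNat_natCast]
      refine sum_congr rfl fun j hj => ?_
      have c2 := c1.setReg (x := 21) (by decide) (j : ℤ)
      have h20 : ((s.setReg 20 i).setReg 21 j).reg 20 = i := rfl
      simp only [eval_mul, eval_get, eval_add, eval_reg, setReg_self, c2.r10, h20,
        setReg_arr, toNat_natCast, hL.get_coef hi (mem_range.1 hj)]
    rw [eval_add, eval_sub, eval_sub, hsum]
    simp only [eval_get, eval_reg, setReg_self, setReg_arr, toNat_natCast]
    rw [setReg_ne _ (by decide), h19, hL.bound i hi]
  refine ⟨ok1, hL.of_frame hf (by decide) 20 (by decide) fun i => ?_, hval⟩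
  by_cases hi : i < m
  · rw [hval i hi]; exact hrB i hi
  · rw [violationFill, fill_val (by decide), hL.r13, toNat_natCast, if_neg hi]
    exact hL.bdd.arr 20 (by decide) i

theorem LPMem.fill13_spec (hL : LPMem m N T a h R s) {e : FExpr}
    (he : FillSide [10, 12, 13, 19] [10, 12, 13] [10, 11, 12, 13, 14, 20] 20 13 13 e)
    (hsize : e.size ≤ 1000) {r : ℕ → ℤ} (hr : ∀ i < m, e.eval (s.setReg 20 i) = r i)
    (hrB : ∀ i < m, |r i| ≤ 2 ^ R) :
    (fill 20 13 13 e).Ok (grow R) s ∧ LPMem m N T a h R ((fill 20 13 13 e).exec s) ∧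
      ∀ i < m, ((fill 20 13 13 e).exec s).arr 13 i = r i := by
  have hval : ∀ i < m, ((fill 20 13 13 e).exec s).arr 13 i = r i := by
    intro i hi
    rw [fill_val he.2.1, hL.r13, toNat_natCast, if_pos hi, hr i hi]
  have hw : (fill 20 13 13 e).wregs = [20] := rfl
  have hw' : (fill 20 13 13 e).warrs = [13] := rfl
  refine ⟨fill_ok hL.bdd he (Nat.mul_le_mul_left _ hsize), hL.of_frame (frame _ s)
    (by rw [hw]; decide) 13 (by rw [hw']; decide) fun i => ?_, hval⟩
  by_cases hi : i < m
  · rw [hval i hi]; exact hrB i hi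
  · rw [fill_val he.2.1, hL.r13, toNat_natCast, if_neg hi]
    exact hL.bdd.arr 13 (by decide) i

theorem LPMem.greedyStep_spec (hL : LPMem m N T a h R s) (hF : IsPartial N (s.arr 12)) {σ : ℤ}
    (h19 : s.reg 19 = σ) {k : ℕ} (hr : ∀ i < m, s.arr 13 i = violation a h m N (s.arr 12) σ k i)
    (hB : ∀ i < m, |violation a h m N (s.arr 12) σ (k + 1) i| ≤ 2 ^ R) :
    greedyStep.Ok (grow R) s ∧ LPMem m N T a h R (greedyStep.exec s) ∧
      ∀ i < m, (greedyStep.exec s).arr 13 i = violation a h m N (s.arr 12) σ (k + 1) i := by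
  obtain ⟨ok1, L1, v1⟩ := hL.selFill_spec hF
  have f1 := frame selFill s
  set s1 := selFill.exec s
  obtain ⟨ok2, L2, v2⟩ := L1.violationFill_spec (σ := σ) (by rw [f1.reg 19 (by decide), h19])
    (r := violation a h m N (s.arr 12) σ (k + 1)) (fun i hi => by
      rw [violation, f1.arr 13 (by decide), hr i hi]
      congr 3
      refine sum_congr rfl fun j hj => ?_
      rw [v1 j (mem_range.1 hj), vertexSel_congr hr]) hB
  set s2 := violationFill.exec s1
  obtain ⟨ok3, L3, v3⟩ := L2.fill13_spec (e := get 20 (reg 20)) (by decide) (by decide)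
    (r := violation a h m N (s.arr 12) σ (k + 1)) (fun i hi => by
      rw [eval_get, eval_reg, setReg_self, setReg_arr, toNat_natCast, v2 i hi]) hB
  exact ⟨⟨ok1, ok2, ok3⟩, L3, v3⟩

theorem LPMem.greedyProg_spec (hL : LPMem m N T a h R s) (hF : IsPartial N (s.arr 12)) {σ : ℤ}
    (h19 : s.reg 19 = σ) (hB : ∀ k ≤ T, ∀ i < m, |violation a h m N (s.arr 12) σ k i| ≤ 2 ^ R) :
    greedyProg.Ok (grow R) s ∧ LPMem m N T a h R (greedyProg.exec s) ∧
      ∀ i < m, (greedyProg.exec s).arr 13 i = violation a h m N (s.arr 12) σ T i := by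
  obtain ⟨ok1, L1, v1⟩ := hL.fill13_spec (e := lit 0) (by decide) (by decide) (r := fun _ => 0)
    (fun i _ => rfl) (by simp)
  have f1 := frame (fill 20 13 13 (lit 0)) s
  set s1 := (fill 20 13 13 (lit 0)).exec s
  have hTR : T ≤ R := by
    have := hL.bdd.cnt 12 (by decide)
    rwa [hL.r12, toNat_natCast] at this
  have hloop := forTo_spec (R := grow R) (y := 22) (x := 12) (p := greedyStep) (s := s1)
    (fun k t => LPMem m N T a h R t ∧
      ∀ i < m, t.arr 13 i = violation a h m N (s.arr 12) σ k i)
    (by rw [L1.r12, toNat_natCast]; exact hTR.trans (le_grow R))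
    ⟨L1, fun i hi => by rw [v1 i hi, violation]⟩ fun k hk t ht hI => by
      rw [L1.r12, toNat_natCast] at hk
      have e12 : (t.setReg 22 k).arr 12 = s.arr 12 := by
        rw [setReg_arr, ht.arr 12 (by decide), f1.arr 12 (by decide)]
      have := (hI.1.setReg (x := 22) (by decide) (k : ℤ)).greedyStep_spec (k := k) (σ := σ)
        (by rw [e12]; exact hF)
        (by rw [setReg_ne _ (by decide), ht.reg 19 (by decide), f1.reg 19 (by decide), h19])
        (by rw [e12]; exact hI.2) (by rw [e12]; exact hB (k + 1) hk)
      rw [e12] at this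
      exact this
  rw [L1.r12, toNat_natCast] at hloop
  exact ⟨⟨ok1, hloop.1⟩, hloop.2⟩

/-- All violations stay bounded, for tolerances up to `2 N ^ 2`. -/
theorem _root_.DetectsUpTo.abs_violation_le_two_pow (hD : DetectsUpTo a h m N T B) (hR : T * B ≤ R)
    {F : ℕ → ℤ} (hF : IsPartial N F) {σ : ℤ} (h0 : 0 ≤ σ) (hσ : σ ≤ 2 * N * N) :
    ∀ k ≤ T, ∀ i < m, |violation a h m N F σ k i| ≤ 2 ^ R := by
  intro k hk i hi
  refine (abs_violation_le hF (hD.2 σ h0 hσ) k hi).trans ?_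
  have h1 : k * B ≤ 2 ^ R := (Nat.mul_le_mul_right B hk).trans (hR.trans Nat.lt_two_pow_self.le)
  exact_mod_cast h1

theorem LPMem.tryProg_spec (hL : LPMem m N T a h R s) (hD : DetectsUpTo a h m N T B)
    (hR : T * B ≤ R) (hNR : 2 * N * N ≤ R) (hF : IsPartial N (s.arr 12)) {σ v : ℤ}
    (hv : v = 0 ∨ v = 1) (h19 : s.reg 19 = σ) (h0 : 0 ≤ σ) (hσ : σ < 2 * N * N) {J : ℕ}
    (hJ : J < N) (h24 : s.reg 24 = J) :
    (tryProg v).Ok (grow R) s ∧ LPMem m N T a h R ((tryProg v).exec s) ∧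
      ((tryProg v).exec s).arr 12 = tryFix a h m N T (s.arr 12) σ J v ∧
      ((tryProg v).exec s).reg 19 = σ + 1 := by
  have h1R : (1 : ℤ) ≤ 2 ^ R := one_le_pow₀ (by norm_num)
  have hmR : m ≤ R := by
    have := hL.bdd.cnt 13 (by decide)
    rwa [hL.r13, toNat_natCast] at this
  have hσR : |σ + 1| ≤ 2 ^ R := by
    have h2 : (σ + 1).toNat ≤ R := by
      have : ((2 * N * N : ℕ) : ℤ) ≤ R := by exact_mod_cast hNR
      push_cast at this; omega
    have := abs_natCast_le_two_pow h2
    rwa [Int.toNat_of_nonneg (by omega)] at this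
  have hRg : (2 : ℤ) ^ R ≤ 2 ^ grow R := pow_le_pow_right₀ (by norm_num) (le_grow R)
  have hvR : |v| ≤ 2 ^ R := le_trans (by rcases hv with rfl | rfl <;> simp) h1R
  obtain ⟨s0, hs0⟩ : ∃ s0, s0 = (s.setReg 35 (s.arr 12 J)).setArr 12 J v := ⟨_, rfl⟩
  have L0 : LPMem m N T a h R s0 := hs0 ▸ (hL.setReg (by decide) _).setArr J hvR
  have e12 : s0.arr 12 = update (s.arr 12) J v := by simp [hs0, RamState.setArr]
  have hr0 : ∀ x ≠ 35, s0.reg x = s.reg x := fun x hx => by rw [hs0, setArr_reg, setReg_ne _ hx]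
  have hF' := hF.update J hv
  obtain ⟨ok1, L1, v1⟩ := L0.greedyProg_spec (σ := σ) (by rw [e12]; exact hF')
    (by rw [hr0 19 (by decide), h19])
    (by rw [e12]; exact hD.abs_violation_le_two_pow hR hF' h0 hσ.le)
  rw [e12] at v1
  have f1 := frame greedyProg s0
  set s1 := greedyProg.exec s0 with hs1
  have e24 : s1.reg 24 = J := by rw [f1.reg 24 (by decide), hr0 24 (by decide), h24]
  have e35 : s1.reg 35 = s.arr 12 J := by rw [f1.reg 35 (by decide), hs0, setArr_reg, setReg_self]
  have hsum : 0 < (lit 1 - sum 20 13 (ind (get 13 (reg 20) - reg 12)) : FExpr).eval s1 ↔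
      ∀ i < m, violation a h m N (update (s.arr 12) J v) σ T i ≤ T := by
    have : (sum 20 13 (ind (get 13 (reg 20) - reg 12))).eval s1 = ∑ i ∈ range m,
        if (T : ℤ) < violation a h m N (update (s.arr 12) J v) σ T i then (1 : ℤ) else 0 := by
      rw [eval_sum, L1.r13, toNat_natCast]
      refine sum_congr rfl fun i hi => ?_
      rw [eval_ind, eval_sub, eval_get, eval_reg, eval_reg, setReg_self,
        setReg_ne _ (by decide), L1.r12, setReg_arr, toNat_natCast, v1 i (mem_range.1 hi)]
      exact if_congr (by omega) rfl rfl
    rw [eval_sub, eval_lit, this, sum_boole, sub_pos, ← Nat.cast_one, Nat.cast_lt, Nat.lt_one_iff,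
      card_eq_zero, filter_eq_empty_iff]
    simp only [mem_range, not_lt]
  obtain ⟨w, hw⟩ : ∃ w, w = (keepExpr v).eval s1 := ⟨_, rfl⟩
  have hfix : update (s.arr 12) J w = tryFix a h m N T (s.arr 12) σ J v ∧ |w| ≤ 2 ^ R := by
    rw [keepExpr, eval_add, eval_mul, eval_mul, eval_ind, eval_ind, eval_sub, eval_reg, e35,
      eval_lit, eval_lit] at hw
    simp only [hsum, sub_pos] at hw
    rw [tryFix]
    by_cases hc : 1 < s.arr 12 J ∧ ∀ i < m, violation a h m N (update (s.arr 12) J v) σ T i ≤ T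
    · rw [if_pos hc.1, if_pos hc.2] at hw
      rw [if_pos hc, show w = v by rcases hF J hJ with h | h | h <;> omega]
      exact ⟨rfl, hvR⟩
    · rw [if_neg hc, show w = s.arr 12 J by
        rcases not_and_or.1 hc with h | h <;> rw [hw, if_neg h] <;> ring, update_eq_self]
      exact ⟨rfl, hL.bdd.arr 12 (by decide) J⟩
  have x0 : (put 12 (reg 24) (lit v)).exec ((set 35 (get 12 (reg 24))).exec s) = s0 := by
    simp only [exec, eval_reg, eval_get, eval_lit, h24, toNat_natCast, hs0,
      setReg_ne _ (show 24 ≠ 35 by decide)]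
  have x1 : (put 12 (reg 24) (keepExpr v)).exec s1 = s1.setArr 12 J w := by
    simp only [exec, eval_reg, e24, toNat_natCast, hw]
  have x2 : (reg 19 + lit 1 : FExpr).eval (s1.setArr 12 J w) = σ + 1 := by
    rw [eval_add, eval_reg, eval_lit, setArr_reg, f1.reg 19 (by decide), hr0 19 (by decide), h19]
  have hx : (tryProg v).exec s = (s1.setArr 12 J w).setReg 19 (σ + 1) := by
    rw [← x2, ← x1, hs1, ← x0]; rfl
  rw [hx]
  refine ⟨⟨⟨trivial, (hL.bdd.arr 12 (by decide) _).trans hRg⟩, ⟨trivial, trivial, hvR.trans hRg⟩,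
    ?_⟩, (L1.setArr J hfix.2).setReg (by decide) _ fun _ => hσR, ?_, setReg_self _ _ _⟩
  · rw [x0]
    refine ⟨ok1, ⟨trivial, ⟨trivial, ⟨⟨trivial, trivial⟩, trivial, ?_,
      fun _ _ => ⟨trivial, trivial⟩⟩,
      trivial⟩, ?_⟩, ?_⟩
    · rw [← hs1, L1.r13, toNat_natCast]; exact hmR.trans (le_grow R)
    · rw [← hs1, ← hw]; exact hfix.2.trans hRg
    · rw [← hs1, x1]
      exact ⟨⟨trivial, trivial⟩, by rw [x2]; exact hσR.trans hRg⟩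
  · rw [← hfix.1, setReg_arr]
    simp [RamState.setArr, f1.arr 12 (by decide), e12]

theorem LPMem.passProg_spec (hL : LPMem m N T a h R s) (hD : DetectsUpTo a h m N T B)
    (hR : T * B ≤ R) (hNR : 2 * N * N ≤ R) (hF : IsPartial N (s.arr 12)) {A : ℕ} (hA : A < N)
    (h19 : s.reg 19 = 2 * N * A) :
    passProg.Ok (grow R) s ∧ LPMem m N T a h R (passProg.exec s) ∧
      (passProg.exec s).arr 12 = roundPass a h m N T (s.arr 12) (2 * N * A) N ∧
      (passProg.exec s).reg 19 = 2 * N * (A + 1 : ℕ) := by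
  have hNR' : N ≤ R := by nlinarith
  have hlt : ∀ J < N, 2 * (N : ℤ) * A + 2 * J + 1 < 2 * N * N := fun J hJ => by
    have h1 : (A : ℤ) + 1 ≤ N := by exact_mod_cast hA
    have h2 : (J : ℤ) + 1 ≤ N := by exact_mod_cast hJ
    nlinarith
  have hloop := forTo_spec (R := grow R) (y := 24) (x := 10) (p := seq (tryProg 0) (tryProg 1))
    (s := s) (fun J t => LPMem m N T a h R t ∧
      t.arr 12 = roundPass a h m N T (s.arr 12) (2 * N * A) J ∧ t.reg 19 = 2 * N * A + 2 * J)
    (by rw [hL.r10, toNat_natCast]; exact hNR'.trans (le_grow R))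
    ⟨hL, rfl, by rw [h19]; simp⟩ fun J hJ t _ hI => by
      rw [hL.r10, toNat_natCast] at hJ
      obtain ⟨L, e12, e19⟩ := hI
      have hFJ := hF.roundPass (a := a) (h := h) (m := m) (T := T) (σ := 2 * N * A) J
      have hJ' := hlt J hJ
      have h0 : (0 : ℤ) ≤ 2 * N * A := by positivity
      obtain ⟨ok1, L1, v1, w1⟩ := (L.setReg (x := 24) (by decide) (J : ℤ)).tryProg_spec
        (σ := 2 * N * A + 2 * J) hD hR hNR (by rw [setReg_arr, e12]; exact hFJ) (Or.inl rfl)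
        (by rw [setReg_ne _ (by decide), e19]) (by omega) (by omega) hJ
        (setReg_self _ _ _)
      rw [setReg_arr, e12] at v1
      have f1 := frame (tryProg 0) (t.setReg 24 J)
      obtain ⟨ok2, L2, v2, w2⟩ := L1.tryProg_spec
        (σ := 2 * N * A + 2 * J + 1) hD hR hNR
        (by rw [v1]; exact hFJ.tryFix J (Or.inl rfl)) (Or.inr rfl)
        w1 (by omega) (by omega) hJ
        (by rw [f1.reg 24 (by decide), setReg_self])
      rw [v1] at v2
      refine ⟨⟨ok1, ok2⟩, L2, v2, ?_⟩
      rw [exec, w2]; push_cast; ring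
  rw [hL.r10, toNat_natCast] at hloop
  refine ⟨hloop.1, hloop.2.1, hloop.2.2.1, ?_⟩
  rw [passProg, hloop.2.2.2]; push_cast; ring

/-- The program performs `N` passes of the rounding procedure. -/
theorem LPMem.roundProg_spec (hL : LPMem m N T a h R s) (hD : DetectsUpTo a h m N T B)
    (hR : T * B ≤ R) (hNR : 2 * N * N ≤ R) (hF : IsPartial N (s.arr 12)) :
    roundProg.Ok (grow R) s ∧ LPMem m N T a h R (roundProg.exec s) ∧
      (roundProg.exec s).arr 12 = roundPasses a h m N T (s.arr 12) N := by
  have hNR' : N ≤ R := by nlinarith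
  have ok0 : (set 19 (lit 0)).Ok (grow R) s :=
    ⟨trivial, by rw [eval_lit, abs_zero]; positivity⟩
  have L0 : LPMem m N T a h R (s.setReg 19 0) := hL.setReg (by decide) 0 (by simp)
  have hloop := forTo_spec (R := grow R) (y := 23) (x := 10) (p := passProg)
    (s := s.setReg 19 0) (fun A t => LPMem m N T a h R t ∧
      t.arr 12 = roundPasses a h m N T (s.arr 12) A ∧ t.reg 19 = 2 * N * A)
    (by rw [L0.r10, toNat_natCast]; exact hNR'.trans (le_grow R))
    ⟨L0, rfl, by rw [setReg_self]; simp⟩ fun A hA t _ hI => by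
      rw [L0.r10, toNat_natCast] at hA
      obtain ⟨L, e12, e19⟩ := hI
      have := (L.setReg (x := 23) (by decide) (A : ℤ)).passProg_spec hD hR hNR
        (by rw [setReg_arr, e12]; exact hF.roundPasses A) hA
        (by rw [setReg_ne _ (by decide), e19])
      rw [setReg_arr, e12] at this
      exact this
  rw [L0.r10, toNat_natCast] at hloop
  exact ⟨⟨ok0, hloop.1⟩, hloop.2.1, hloop.2.2.1⟩

end

end FProg

/-! ### Reading off the distribution -/

/-- The number of columns that come before the column `j`, when the columns fixed to the value one
come first, and the free columns after them. -/
def colRank (N : ℕ) (F : ℕ → ℤ) (j : ℕ) : ℕ :=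
  {l ∈ range N | F l ≠ 0 ∧ F l * N + l < F j * N + j}.card

/-- Selecting the first `n` columns in the order of `colRank` completes the partial assignment. -/
theorem exists_completion {n N : ℕ} {F : ℕ → ℤ} (hF : IsPartial N F)
    (h1 : {j ∈ range N | F j = 1}.card ≤ n)
    (h2 : n ≤ {j ∈ range N | F j = 1}.card + (freeVars N F).card) :
    ∃ (J : Fin n → ℕ) (F' : ℕ → ℤ),
      (∀ i : Fin n, ∀ j < N, F j ≠ 0 ∧ colRank N F j = i ↔ j = J i) ∧ (∀ i, J i < N ∧ F (J i) ≠ 0) ∧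
      (∀ j < N, (F' j = 0 ∨ F' j = 1) ∧ (F j ≠ 2 → F' j = F j)) ∧
      ∀ G : ℕ → ℝ, ∑ i, G (J i) = ∑ j ∈ range N, (F' j : ℝ) * G j := by
  classical
  set s := {l ∈ range N | F l ≠ 0} with hs
  -- `F j * N + j` compares the columns by the value of `F` first, and then by the index
  have hlt : ∀ j ∈ s, ∀ l, F j * N + j < F l * N + l → colRank N F j < colRank N F l := by
    intro j hj l hjl
    rw [hs, mem_filter] at hj
    refine card_lt_card ((ssubset_iff_of_subset fun x hx => ?_).2 ⟨j, ?_, ?_⟩)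
    · rw [mem_filter] at hx ⊢
      exact ⟨hx.1, hx.2.1, hx.2.2.trans hjl⟩
    · rw [mem_filter]; exact ⟨hj.1, hj.2, hjl⟩
    · simp
  have hkey : ∀ j < N, ∀ l < N, F j * N + j = F l * N + l → j = l := by
    intro j hj l hl h
    have h3 : ((j : ℤ) + N * F j) % N = ((l : ℤ) + N * F l) % N := by
      congr 1; linarith
    rw [Int.add_mul_emod_self_left, Int.add_mul_emod_self_left] at h3
    rw [Int.emod_eq_of_lt (by omega) (by omega), Int.emod_eq_of_lt (by omega) (by omega)] at h3
    omega
  have hinj : Set.InjOn (colRank N F) s := by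
    intro j hj l hl h
    have hj' := (mem_filter.1 (mem_coe.1 hj)).1
    have hl' := (mem_filter.1 (mem_coe.1 hl)).1
    rcases lt_trichotomy (F j * N + j) (F l * N + l) with h3 | h3 | h3
    · exact absurd h (hlt j hj l h3).ne
    · exact hkey j (mem_range.1 hj') l (mem_range.1 hl') h3
    · exact absurd h (hlt l hl j h3).ne'
  have hcard : s.card = {j ∈ range N | F j = 1}.card + (freeVars N F).card := by
    rw [freeVars, ← card_union_of_disjoint]
    · congr 1
      ext j
      simp only [hs, mem_filter, mem_union, mem_range]
      constructor
      · rintro ⟨h3, h4⟩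
        rcases hF j h3 with h5 | h5 | h5
        · exact absurd h5 h4
        · exact Or.inl ⟨h3, h5⟩
        · exact Or.inr ⟨h3, h5⟩
      · rintro (⟨h3, h4⟩ | ⟨h3, h4⟩) <;> exact ⟨h3, by omega⟩
    · refine disjoint_filter.2 fun j _ h3 => by omega
  have hmaps : Set.MapsTo (colRank N F) s (range s.card) := by
    intro j hj
    have hj' := mem_coe.1 hj
    rw [coe_range, Set.mem_Iio]
    refine card_lt_card ((ssubset_iff_of_subset fun x hx => ?_).2 ⟨j, hj', by simp⟩)
    rw [mem_filter] at hx
    exact mem_filter.2 ⟨hx.1, hx.2.1⟩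
  have hsurj := surjOn_of_injOn_of_card_le _ hmaps hinj (by rw [card_range])
  have hex : ∀ i : Fin n, ∃ j, j ∈ s ∧ colRank N F j = i := fun i => by
    obtain ⟨j, hj, h⟩ := hsurj (mem_coe.2 (mem_range.2
      (show (i : ℕ) < s.card by have := i.2; omega)))
    exact ⟨j, hj, h⟩
  choose J hJs hJ using hex
  have hJF : ∀ i, J i < N ∧ F (J i) ≠ 0 := fun i => by
    simpa [hs] using hJs i
  have hJu : ∀ i : Fin n, ∀ j < N, F j ≠ 0 ∧ colRank N F j = i ↔ j = J i := by
    refine fun i j hj => ⟨fun h => hinj ?_ (hJs i) (h.2.trans (hJ i).symm), ?_⟩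
    · simp [hs, hj, h.1]
    · rintro rfl
      exact ⟨(hJF i).2, hJ i⟩
  refine ⟨J, fun j => if F j ≠ 0 ∧ colRank N F j < n then 1 else 0, hJu, hJF, fun j hj => ⟨?_, ?_⟩,
    fun G => ?_⟩
  · dsimp only; split_ifs <;> simp
  · intro h3
    dsimp only
    rcases hF j hj with h4 | h4 | h4
    · simp [h4]
    · rw [if_pos, h4]
      refine ⟨by omega, lt_of_lt_of_le (card_lt_card
        ((ssubset_iff_of_subset fun x hx => ?_).2 ⟨j, ?_, by simp⟩)) h1⟩
      · -- a column with the value two comes after all those with the value one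
        rw [mem_filter, mem_range] at hx ⊢
        refine ⟨hx.1, ?_⟩
        rcases hF x hx.1 with h5 | h5 | h5
        · exact absurd h5 hx.2.1
        · exact h5
        · have := hx.2.2
          rw [h4, h5] at this
          omega
      · rw [mem_filter, mem_range]; exact ⟨hj, h4⟩
    · exact absurd h4 h3
  · push_cast
    simp_rw [ite_mul, one_mul, zero_mul]
    rw [← sum_filter]
    refine sum_bij (fun i _ => J i) (fun i _ => ?_) (fun i _ i' _ h => ?_) (fun j hj => ?_)
      fun _ _ => rfl
    · rw [mem_filter, mem_range, hJ]
      exact ⟨(hJF i).1, (hJF i).2, i.2⟩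
    · exact Fin.ext (by rw [← hJ i, ← hJ i', h])
    · rw [mem_filter, mem_range] at hj
      exact ⟨⟨_, hj.2.2⟩, mem_univ _, ((hJu _ j hj.1).1 ⟨hj.2.1, rfl⟩).symm⟩

/-- The probability vector of the column `j`. -/
noncomputable def gridRow (n d j : ℕ) : Fin (d + 1) → ℝ :=
  Fin.snoc (α := fun _ => ℝ) (gridType n d j) (1 - ∑ i, gridType n d j i)

theorem gridRow_mem_stdSimplex {n d j : ℕ} (hn : 0 < n) (hj : gridStart n d j ≠ 0) :
    gridRow n d j ∈ stdSimplex ℝ (Fin (d + 1)) := by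
  obtain ⟨h1, h2⟩ := isSubprob_gridType hn hj
  refine ⟨fun i => ?_, ?_⟩
  · refine Fin.lastCases ?_ (fun i => ?_) i
    · rw [gridRow, Fin.snoc_last]; linarith
    · rw [gridRow, Fin.snoc_castSucc]; exact h1 i
  · rw [Fin.sum_univ_castSucc]
    simp only [gridRow, Fin.snoc_castSucc, Fin.snoc_last]
    ring

theorem gridRow_eq {n d : ℕ} (hn : 0 < n) (j : ℕ) (c : Fin (d + 1)) : gridRow n d j c =
    ((if (c : ℕ) < d then (dig n j c : ℤ)
      else 2 * n ^ 4 - ∑ i ∈ range d, (dig n j i : ℤ) : ℤ) : ℝ) / (2 * n ^ 4 : ℤ) := by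
  have h0 : (0 : ℝ) < n := by exact_mod_cast hn
  refine Fin.lastCases ?_ (fun i => ?_) c
  · rw [gridRow, Fin.snoc_last, Fin.val_last, if_neg (lt_irrefl d), ← Fin.sum_univ_eq_sum_range
      (fun i => (dig n j i : ℤ))]
    simp only [gridType]
    rw [← sum_div]
    push_cast
    field_simp
  · rw [gridRow, Fin.snoc_castSucc, Fin.val_castSucc, if_pos i.2, gridType]
    push_cast; rfl

namespace FProg
open RamState FExpr

/-- The rank of each column, plus one, and zero for the columns fixed to zero. -/
def rankFill : FProg :=
  fill 20 10 21 (ind (get 12 (reg 20)) * (lit 1 + sum 21 10 (ind (get 12 (reg 21)) *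
    ind (get 12 (reg 20) * reg 10 + reg 20 - (get 12 (reg 21) * reg 10 + reg 21)))))

/-- The row of an entry of the output with the index in the register `20`. -/
abbrev outRow : FExpr := reg 20 / (reg 1 + lit 1)

/-- The column of an entry of the output with the index in the register `20`. -/
abbrev outCol : FExpr := reg 20 - (reg 1 + lit 1) * (reg 20 / (reg 1 + lit 1))

/-- The numerators of the output. -/
def numFill : FProg :=
  fill 20 34 1 (sum 21 10 (eqE (get 21 (reg 21)) (outRow + lit 1) *
    (ind (reg 1 - outCol) * get 19 (reg 21 * reg 1 + outCol) + (lit 1 - ind (reg 1 - outCol)) *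
      (lit 2 * reg 7 - sum 22 1 (get 19 (reg 21 * reg 1 + reg 22))))))

/-- Write the output. -/
def outProg : FProg := seq rankFill (seq numFill (fill 20 34 2 (lit 2 * reg 7)))

/-- Write the output for the distribution that is concentrated at zero. -/
def trivialProg : FProg :=
  seq (set 34 (reg 0 * (reg 1 + lit 1))) (seq (fill 20 34 1 (ind (lit 1 - (reg 1 - outCol))))
    (fill 20 34 2 (lit 1)))

variable {n d : ℕ} {D a₁ b₁ a₂ b₂ : ℤ} {u : Fin d → ℤ} {S : Matrix (Fin d) (Fin d) ℤ}
  {s : RamState}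

theorem eval_outRow {e : ℕ} : (e : ℤ) / ((d : ℤ) + 1) = ((e / (d + 1) : ℕ) : ℤ) := by
  push_cast; rfl

theorem eval_outCol {e : ℕ} :
    (e : ℤ) - ((d : ℤ) + 1) * ((e : ℤ) / ((d : ℤ) + 1)) = ((e % (d + 1) : ℕ) : ℤ) := by
  rw [← Int.emod_def]; push_cast; rfl

theorem Ctx.rankFill_spec (h : Ctx n d D a₁ b₁ a₂ b₂ u S s)
    (hF : IsPartial (n * gridV n d) (s.arr 12)) {j : ℕ} (hj : j < n * gridV n d) :
    (rankFill.exec s).arr 21 j =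
      if s.arr 12 j ≠ 0 then 1 + (colRank (n * gridV n d) (s.arr 12) j : ℤ) else 0 := by
  rw [rankFill, fill_val (by decide), h.r10, toNat_natCast, if_pos hj, eval_mul, eval_ind,
    eval_add, eval_sum]
  have h1 := h.setReg (x := 20) (by decide) (j : ℤ)
  rw [h1.r10, toNat_natCast, colRank, card_filter]
  have hsum : ∀ l ∈ range (n * gridV n d), (ind (get 12 (reg 21)) *
      ind (get 12 (reg 20) * reg 10 + reg 20 - (get 12 (reg 21) * reg 10 + reg 21)) : FExpr).eval
      ((s.setReg 20 j).setReg 21 l) = ((if s.arr 12 l ≠ 0 ∧ s.arr 12 l * (n * gridV n d : ℕ) + l <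
        s.arr 12 j * (n * gridV n d : ℕ) + j then 1 else 0 : ℕ) : ℤ) := by
    intro l hl
    have h2 := h1.setReg (x := 21) (by decide) (l : ℤ)
    have h20 : ((s.setReg 20 j).setReg 21 l).reg 20 = j := rfl
    simp only [eval_mul, eval_ind, eval_sub, eval_add, eval_get, eval_reg, h20, setReg_self,
      h2.r10, toNat_natCast, setReg_arr, sub_pos]
    have h0 : 0 < s.arr 12 l ↔ s.arr 12 l ≠ 0 := by
      rcases hF l (mem_range.1 hl) with h | h | h <;> omega
    simp only [h0, ite_and]
    split_ifs <;> simp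
  rw [sum_congr rfl hsum]
  simp only [eval_get, eval_reg, setReg_self, toNat_natCast, setReg_arr, eval_lit]
  have h0 : 0 < s.arr 12 j ↔ s.arr 12 j ≠ 0 := by
    rcases hF j hj with h | h | h <;> omega
  simp only [h0]
  push_cast
  split_ifs <;> simp

theorem Ctx.numFill_spec (h : Ctx n d D a₁ b₁ a₂ b₂ u S s) {J : Fin n → ℕ} {i : Fin n}
    {c : Fin (d + 1)} (hJ : ∀ j < n * gridV n d, s.arr 21 j = (i : ℤ) + 1 ↔ j = J i)
    (hJi : J i < n * gridV n d) : (numFill.exec s).arr 1 (i * (d + 1) + c) =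
      if (c : ℕ) < d then (dig n (J i) c : ℤ)
      else 2 * n ^ 4 - ∑ l ∈ range d, (dig n (J i) l : ℤ) := by
  have hlt : i * (d + 1) + c < n * (d + 1) := mul_add_lt_mul i.2 c.2
  obtain ⟨hdiv, hmod⟩ := mul_add_div_mod (q := i) c.2
  set e := (i : ℕ) * (d + 1) + c
  rw [numFill, fill_val (by decide), h.r34, toNat_natCast, if_pos hlt, eval_sum]
  have h1 := h.setReg (x := 20) (by decide) (e : ℤ)
  rw [h1.r10, toNat_natCast, sum_eq_single_of_mem _ (mem_range.2 hJi)]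
  all_goals
    have key : ∀ j : ℕ, (eqE (get 21 (reg 21)) (outRow + lit 1)).eval
        ((s.setReg 20 e).setReg 21 j) = if s.arr 21 j = (i : ℤ) + 1 then 1 else 0 := fun j => by
      have h2 := h1.setReg (x := 21) (by decide) (j : ℤ)
      have h20 : ((s.setReg 20 e).setReg 21 j).reg 20 = e := rfl
      rw [eval_eqE]
      simp only [eval_add, eval_get, eval_reg, eval_lit, eval_div, h20, setReg_self, h2.r1,
        toNat_natCast, setReg_arr, eval_outRow, hdiv]
  · rw [eval_mul, key, if_pos ((hJ _ hJi).2 rfl), one_mul]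
    have h2 := h1.setReg (x := 21) (by decide) (J i : ℤ)
    have h20 : ((s.setReg 20 e).setReg 21 (J i)).reg 20 = e := rfl
    have hsum : (sum 22 1 (get 19 (reg 21 * reg 1 + reg 22))).eval
        ((s.setReg 20 e).setReg 21 (J i)) = ∑ l ∈ range d, (dig n (J i) l : ℤ) := by
      rw [eval_sum, h2.r1, toNat_natCast]
      refine sum_congr rfl fun l hl => ?_
      have h3 := h2.setReg (x := 22) (by decide) (l : ℤ)
      have h21 : (((s.setReg 20 e).setReg 21 (J i)).setReg 22 l).reg 21 = J i := rfl
      rw [eval_get, eval_add, eval_mul, eval_reg, eval_reg, eval_reg, h21, h3.r1, setReg_self,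
        h3.get_digit hJi (mem_range.1 hl)]
    simp only [eval_add, eval_mul, eval_sub, hsum, eval_ind, eval_get, eval_reg, eval_lit,
      eval_div, h20, setReg_self, h2.r1, h2.r7, eval_outCol, hmod]
    by_cases hc : (c : ℕ) < d
    · rw [if_pos (by omega), if_pos hc, h2.get_digit hJi hc]; ring
    · rw [if_neg (by omega), if_neg hc]; ring
  · intro j hj hji
    rw [eval_mul, key, if_neg fun h3 => hji ((hJ j (mem_range.1 hj)).1 h3), zero_mul]

theorem outProg_spec {R : ℕ} (hd : 1 ≤ d) (hn : 1 ≤ n) (hR : gridV n d ^ 33 ≤ R)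
    (hs : s.Bdd 40 R) (h : Ctx n d D a₁ b₁ a₂ b₂ u S s)
    (hF : IsPartial (n * gridV n d) (s.arr 12)) {J : Fin n → ℕ}
    (hJ : ∀ i : Fin n, ∀ j < n * gridV n d,
      s.arr 12 j ≠ 0 ∧ colRank (n * gridV n d) (s.arr 12) j = i ↔ j = J i)
    (hJF : ∀ i, J i < n * gridV n d) :
    outProg.Ok (grow^[3] R) s ∧ (outProg.exec s).Outputs fun i => gridRow n d (J i) := by
  refine ⟨straight_ok (C := ctxCounters) (p := outProg) (by decide) hs
    (h.counters_le hd hn hR), fun i c => ?_⟩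
  have h1 := h.of_frame (frame rankFill s) (by decide)
  have v1 := fun j (hj : j < n * gridV n d) => h.rankFill_spec hF hj
  set s1 := rankFill.exec s
  have h2 := h1.of_frame (frame numFill s1) (by decide)
  have v2 := h1.numFill_spec (J := J) (i := i) (c := c) (fun j hj => by
    rw [v1 j hj, ← hJ i j hj]
    split_ifs with h0
    · simp only [h0, ne_eq, not_false_eq_true, true_and]; omega
    · simp only [h0, false_and, iff_false]; omega) (hJF i)
  set s2 := numFill.exec s1
  have hlt : i * (d + 1) + c < n * (d + 1) := mul_add_lt_mul i.2 c.2
  have e1 : (outProg.exec s).arr 1 (i * (d + 1) + c) = s2.arr 1 (i * (d + 1) + c) :=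
    congrFun ((frame (fill 20 34 2 (lit 2 * reg 7)) s2).arr 1 (by decide)) _
  have e2 : (outProg.exec s).arr 2 (i * (d + 1) + c) = 2 * n ^ 4 := by
    show ((fill 20 34 2 (lit 2 * reg 7)).exec s2).arr 2 _ = _
    rw [fill_val (by decide), h2.r34, toNat_natCast, if_pos hlt, eval_mul, eval_lit, eval_reg,
      (h2.setReg (x := 20) (by decide) _).r7]
  rw [e1, e2, v2]
  exact ⟨by positivity, gridRow_eq hn _ _⟩

theorem trivialProg_spec {R : ℕ} (hs : s.Bdd 40 R) (h0 : s.reg 0 = n) (h1 : s.reg 1 = d)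
    (hR : n * (d + 1) ≤ R) : trivialProg.Ok (grow^[2] R) s ∧
      (trivialProg.exec s).Outputs fun _ : Fin n => Pi.single (Fin.last d) 1 := by
  have hval : (reg 0 * (reg 1 + lit 1) : FExpr).eval s = (n * (d + 1) : ℕ) := by
    rw [eval_mul, eval_reg, eval_add, eval_reg, eval_lit, h0, h1]; push_cast; rfl
  have hexec : (set 34 (reg 0 * (reg 1 + lit 1))).exec s = s.setReg 34 (n * (d + 1) : ℕ) := by
    simp only [exec, hval]
  have ok1 : (set 34 (reg 0 * (reg 1 + lit 1))).Ok R s :=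
    ⟨⟨trivial, trivial, trivial⟩, hval ▸ abs_natCast_le_two_pow hR⟩
  have bd1 := hs.setReg (x := 34) (abs_natCast_le_two_pow hR)
  have ok2 := straight_ok (C := [34]) (p := seq (fill 20 34 1 (ind (lit 1 - (reg 1 - outCol))))
    (fill 20 34 2 (lit 1))) (by decide) bd1 (by
      simp only [List.forall_mem_cons, setReg_self, toNat_natCast]
      exact ⟨hR, by simp⟩)
  refine ⟨⟨ok1.mono (le_grow_iterate 2 R), by rw [hexec]; exact ok2⟩, fun i c => ?_⟩
  have hlt : i * (d + 1) + c < n * (d + 1) := mul_add_lt_mul i.2 c.2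
  have hmod := (mul_add_div_mod (q := i) c.2).2
  set t := s.setReg 34 (n * (d + 1) : ℕ) with ht
  have t34 : t.reg 34 = (n * (d + 1) : ℕ) := setReg_self _ _ _
  have t1 : t.reg 1 = d := by rw [ht, setReg_ne _ (by decide), h1]
  set t' := (fill 20 34 1 (ind (lit 1 - (reg 1 - outCol)))).exec t with ht'
  have hf := frame (fill 20 34 1 (ind (lit 1 - (reg 1 - outCol)))) t
  have hx : trivialProg.exec s = (fill 20 34 2 (lit 1)).exec t' := by
    simp only [trivialProg, exec, hval, ht', ht]
  have e2 : (trivialProg.exec s).arr 2 (i * (d + 1) + c) = 1 := by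
    rw [hx, fill_val (by decide), hf.reg 34 (by decide), t34, toNat_natCast, if_pos hlt,
      eval_lit]
  have e1 : (trivialProg.exec s).arr 1 (i * (d + 1) + c) = if (c : ℕ) = d then 1 else 0 := by
    rw [hx, (frame (fill 20 34 2 (lit 1)) t').arr 1 (by decide), ht', fill_val (by decide), t34,
      toNat_natCast, if_pos hlt]
    simp only [eval_ind, eval_sub, eval_mul, eval_add, eval_div, eval_lit, eval_reg,
      setReg_self, setReg_ne _ (show 1 ≠ 20 by decide), t1, eval_outCol, hmod]
    have := c.2
    exact if_congr (by omega) rfl rfl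
  rw [e1, e2]
  refine ⟨one_pos, ?_⟩
  show Pi.single (M := fun _ => ℝ) (Fin.last d) 1 c = _
  rw [Pi.single_apply]
  simp only [Fin.ext_iff, Fin.val_last]
  split_ifs <;> simp

end FProg

/-! ### The nontrivial branch of the program -/

theorem FaceFeasible.congr {a : ℕ → ℕ → ℤ} {h : ℕ → ℤ} {m N : ℕ} {F F' : ℕ → ℤ} {σ : ℤ}
    (hF : FaceFeasible a h m N F σ) (he : ∀ j < N, F' j = F j) : FaceFeasible a h m N F' σ := by
  obtain ⟨f, h1, h2⟩ := hF
  exact ⟨f, fun j hj => he j hj ▸ h1 j hj, h2⟩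

theorem freeVars_congr {N : ℕ} {F F' : ℕ → ℤ} (he : ∀ j < N, F' j = F j) :
    freeVars N F' = freeVars N F :=
  filter_congr fun j hj => by rw [he j (mem_range.1 hj)]

theorem RoundInv.congr {a : ℕ → ℕ → ℤ} {h : ℕ → ℤ} {m N : ℕ} {F₀ F₀' F F' : ℕ → ℤ} {σ : ℤ}
    (hI : RoundInv a h m N F₀ F σ) (h0 : ∀ j < N, F₀' j = F₀ j) (he : ∀ j < N, F' j = F j) :
    RoundInv a h m N F₀' F' σ :=
  ⟨fun j hj => he j hj ▸ hI.isPartial j hj, hI.feasible.congr he,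
    fun j hj h1 => by rw [he j hj, h0 j hj, hI.keeps j hj (h0 j hj ▸ h1)],
    by rw [freeVars_congr he, freeVars_congr h0]; exact hI.subset⟩

theorem rowBound_congr {n d : ℕ} {hm hu hu' hl hl' : ℕ → ℤ} (h1 : ∀ t < gridV n d, hu' t = hu t)
    (h2 : ∀ t < gridV n d, hl' t = hl t) (i : ℕ) :
    rowBound n d hm hu' hl' i = rowBound n d hm hu hl i := by
  have := Nat.mod_lt i (gridV_pos n d)
  rw [rowBound, rowBound, h1 _ this, h2 _ this]

namespace FProg
open RamState FExpr

theorem le_setupBound (R : ℕ) : R ≤ setupBound R :=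
  (le_grow_iterate 17 R).trans ((Nat.le_add_left _ _).trans (le_grow _))

theorem le_capBound (R : ℕ) : R ≤ capBound R :=
  (le_grow R).trans ((le_flGrow _).trans (le_grow_iterate 4 _))

theorem le_meanBound (R : ℕ) : R ≤ meanBound R :=
  (le_grow_iterate 4 R).trans ((le_grow _).trans ((le_flGrow _).trans (le_grow_iterate 3 _)))

theorem setupProg_maxReg : setupProg.maxReg ≤ 40 := by
  set_option maxRecDepth 4000 in decide

theorem exec_seq (p q : FProg) (s : RamState) : (seq p q).exec s = q.exec (p.exec s) := rfl

theorem ok_seq {p q : FProg} {s : RamState} {R : ℕ} (hp : p.Ok R s) (hq : q.Ok R (p.exec s)) :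
    (seq p q).Ok R s := ⟨hp, hq⟩

/-- The bit length of the numbers at the end of the nontrivial branch. -/
def branchBound (R : ℕ) : ℕ := grow^[8] (meanBound (capBound (setupBound R)))

/-- The nontrivial branch of the program. -/
def branchProg : FProg :=
  seq setupProg <| seq capProg <| seq meanProg <| seq lpProg <| seq roundProg outProg

theorem branchProg_spec {n d : ℕ} {μ : Fin d → ℝ} {Y : Matrix (Fin d) (Fin d) ℝ} {ε₁ ε₂ : ℝ}
    {a₁ b₁ a₂ b₂ : ℤ} {p q : ℕ → ℤ} {s : RamState} {R : ℕ} {π₀ : Fin n → Fin (d + 1) → ℝ}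
    (hd : 1 ≤ d) (hn : 2 * (d + 1) ^ 2 < n) (hR : gridV n d ^ 48 ≤ R)
    (hs : s.Bdd 40 R) (h : IsInput n d a₁ b₁ a₂ b₂ p q s) (h0 : s.reg 0 = n) (h1 : s.reg 1 = d)
    (h2 : s.reg 2 = a₁) (h3 : s.reg 3 = b₁) (h4 : s.reg 4 = a₂) (h5 : s.reg 5 = b₂)
    (hD : IsScaled μ Y ε₁ ε₂ (∏ e ∈ range (d + d * d), q e) a₁ b₁ a₂ b₂
        (fun i => (∏ e ∈ range (d + d * d), q e) * p i / q i)
        (of fun i j => (∏ e ∈ range (d + d * d), q e) * p (d + (i * d + j)) /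
          q (d + (i * d + j)))) (H : IsRealizedBy μ Y ε₁ ε₂ π₀) :
    branchProg.Ok (branchBound R) s ∧ ∃ π : Fin n → Fin (d + 1) → ℝ,
      (branchProg.exec s).Outputs π ∧ IsRowStochastic π ∧
      SpectrallyClose μ Y (gmdLaw π) ε₁ ε₂ (3 * ((d : ℝ) + 1) ^ (5 / 2 : ℝ))
        (3 * ((d : ℝ) + 1) ^ 3) := by
  have hn1 : 1 ≤ n := by omega
  have hV1 : 1 ≤ gridV n d := gridV_pos n d
  obtain ⟨g1, -, -, g4⟩ := grid_le hd hn1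
  have hpow : ∀ {k}, k ≤ 48 → gridV n d ^ k ≤ R := fun hk => (Nat.pow_le_pow_right hV1 hk).trans hR
  have hR33 : gridV n d ^ 33 ≤ R := hpow (by norm_num)
  set D := ∏ e ∈ range (d + d * d), q e
  set u : Fin d → ℤ := fun i => D * p i / q i
  set S : Matrix (Fin d) (Fin d) ℤ :=
    of fun i j => D * p (d + (i * d + j)) / q (d + (i * d + j))
  -- the parameters
  obtain ⟨ok1, c1⟩ := setupProg_spec hd hn1 hR33 hs h h0 h1 h2 h3 h4 h5
  set R1 := setupBound R
  have hR1 : R ≤ R1 := le_setupBound R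
  have bd1 := ok1.bdd setupProg_maxReg (hs.mono hR1)
  set s1 := setupProg.exec s
  -- the bounds for the covariance
  obtain ⟨ok2, c2, E, hE, v16, v17⟩ := capProg_spec hd hn1 (hR33.trans hR1) bd1 c1
  set R2 := capBound R1
  have hR2 : R1 ≤ R2 := le_capBound R1
  have bd2 := ok2.bdd (K := 40) (by decide) (bd1.mono hR2)
  set s2 := capProg.exec s1
  obtain ⟨E', hE0, hEM⟩ := hD.exists_capMat hd hn1 H.posSemidef_upper
  have hEE : E = E' := by rw [hE, hEM]; simp
  subst hEE
  set M := flSeq (capMat n D a₂ b₂ S) (d - 1)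
  have hP := hD.cap_inverse hE0 hEM
  -- the good means
  obtain ⟨ok3, b, hb, v8⟩ := meanProg_spec hd hn1 (hR33.trans (hR1.trans hR2)) bd2 c2
    fun lam hlam => hD.exists_meanMat hd H.posSemidef hlam
  have f3 := frame meanProg s2
  have c3 := c2.of_frame f3 (by decide)
  set R3 := meanBound R2
  have hR3 : R2 ≤ R3 := le_meanBound R2
  have bd3 := ok3.bdd (K := 40) (by decide) (bd2.mono hR3)
  set s3 := meanProg.exec s2
  have hRR3 : R ≤ R3 := hR1.trans (hR2.trans hR3)
  have hgood : ∃ g < gridV n d, s3.arr 8 g = 1 := by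
    obtain ⟨g, hg, h, -⟩ := H.exists_good (good := fun g => s3.arr 8 g = 1) fun g hg hv =>
      (v8 g hg).2.2 (hD.meanTest_complete hd H.posSemidef (fun v => by
        simp only [Int.cast_natCast]; exact hv v) (hb g))
    exact ⟨g, hg, h⟩
  -- the linear system
  obtain ⟨ok4, hm, hhm, v10, v11, v12⟩ := lpProg_spec hd hn1 (hR33.trans hRR3) bd3 c3
    (fun g hg => (v8 g hg).1) hgood
  have f4 := frame lpProg s3
  have c4 := c3.of_frame f4 (by decide)
  set R4 := grow^[4] R3
  have hR4 : R3 ≤ R4 := le_grow_iterate 4 R3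
  have bd4 := ok4.bdd (K := 40) (by decide) (bd3.mono hR4)
  set s4 := lpProg.exec s3
  have hB := hD.gridBounds hd hn1 H.posSemidef hb hE0 (M := M)
    (good := fun g => s3.arr 8 g = 1) (fun g hg => (v8 g hg).2) (hm := hm)
    (fun _ t ht => by
      obtain ⟨g, hg, h1, h2, -⟩ := hhm t ht
      exact ⟨g, hg, h1, h2.le⟩)
    (fun t ht g hg h1 => by
      obtain ⟨-, -, -, -, h2⟩ := hhm t ht
      exact h2 g hg h1)
  set hu := upperBound n D b₂ E M
  set hl := lowerBound n D a₂ b₂ S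
  have hdet := detectsUpTo_grid hd hn1 (hB.abs_le hd hn1 H hP)
  have hstart := hB.roundInv_start H hn1 hP
  have hI0 := hstart.congr v12 v12
  -- the rounding procedure
  have hL : LPMem (5 * gridV n d) (n * gridV n d) (gridV n d ^ 33) (rowCoef n d)
      (rowBound n d hm hu hl) R4 s4 := by
    refine ⟨c4.r10, c4.r12, c4.r13, v10, fun i hi => ?_, bd4.bddOn _ (by decide) ?_⟩
    · rw [v11 i hi]
      refine rowBound_congr (fun t ht => ?_) (fun t ht => ?_) i
      · rw [f3.arr 16 (by decide), v16 t ht]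
      · rw [f3.arr 17 (by decide), v17 t ht]
    · obtain ⟨-, -, e3, e4, -⟩ := grid_counts_le hd hn1 (hR33.trans (hRR3.trans hR4))
      simp only [List.forall_mem_cons, c4.r10, c4.r12, c4.r13, toNat_natCast]
      exact ⟨e3, hR33.trans (hRR3.trans hR4), e4, by simp⟩
  have hTB : gridV n d ^ 33 * gridV n d ^ 15 ≤ R4 := by
    rw [← pow_add]; exact hR.trans (hRR3.trans hR4)
  have hNN : 2 * (n * gridV n d) * (n * gridV n d) ≤ R4 := by
    refine le_trans ?_ ((hpow (show 5 ≤ 48 by norm_num)).trans (hRR3.trans hR4))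
    calc 2 * (n * gridV n d) * (n * gridV n d) ≤ gridV n d * (gridV n d * gridV n d) *
          (gridV n d * gridV n d) := by gcongr; omega
      _ = gridV n d ^ 5 := by ring
  obtain ⟨ok5, -, w12⟩ := hL.roundProg_spec hdet hTB hNN hI0.isPartial
  have f5 := frame roundProg s4
  have c5 := c4.of_frame f5 (by decide)
  set R5 := grow R4
  have hR5 : R4 ≤ R5 := le_grow R4
  have bd5 := ok5.bdd (K := 40) (by decide) (bd4.mono hR5)
  set s5 := roundProg.exec s4
  have hT : 0 < gridV n d ^ 33 := pow_pos hV1 33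
  have hI := hI0.roundPasses hT (n * gridV n d)
  obtain ⟨cu, cw, hrank⟩ := rowCoef_rank n d
  have hcard := card_freeVars_roundPasses_le hdet (fun i _ j _ => hrank i j) hT hI0
  rw [← w12] at hI hcard
  have hI' := hI.congr (fun j hj => (v12 j hj).symm) fun _ _ => rfl
  obtain ⟨k1, k2⟩ := count_ones_of_roundInv hI'
  obtain ⟨J, F', j1, j2, j3, j4⟩ := exists_completion hI'.isPartial k1 k2
  have hvalid : ∀ i, gridStart n d (J i) ≠ 0 := fun i h0 => by
    have := hI'.keeps (J i) (j2 i).1 (by rw [h0]; norm_num)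
    exact (j2 i).2 (this.trans h0)
  -- the output
  obtain ⟨ok6, hout⟩ := outProg_spec hd hn1 (hR33.trans (hRR3.trans (hR4.trans hR5))) bd5 c5
    hI'.isPartial j1 fun i => (j2 i).1
  have hπ : IsRowStochastic fun i => gridRow n d (J i) :=
    fun i => gridRow_mem_stdSimplex hn1 (hvalid i)
  have hx : branchProg.exec s = outProg.exec s5 := by
    rw [branchProg, exec_seq, exec_seq, exec_seq, exec_seq, exec_seq]
  have hb3 : R3 ≤ branchBound R := le_grow_iterate 8 R3
  have hb4 : R4 ≤ branchBound R := grow_iterate_mono (by norm_num) R3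
  have hb5 : R5 ≤ branchBound R := (grow_iterate_mono (show 5 ≤ 8 by norm_num) R3 :)
  have hb6 : grow^[3] R5 ≤ branchBound R := le_rfl
  have hok : branchProg.Ok (branchBound R) s := ok_seq (ok1.mono (hR2.trans (hR3.trans hb3))) <|
    ok_seq (ok2.mono (hR3.trans hb3)) <| ok_seq (ok3.mono hb3) <| ok_seq (ok4.mono hb4) <|
    ok_seq (ok5.mono hb5) (ok6.mono hb6)
  have hclose := hB.spectrallyClose H hd hn hP hI' hcard j3 hπ fun g => by
    rw [← j4 fun j => g (gridType n d j)]
    refine sum_congr rfl fun i _ => congrArg g (funext fun j => ?_)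
    exact Fin.snoc_castSucc (α := fun _ => ℝ) _ _ _
  rw [← hx] at hout
  exact ⟨hok, _, hout, hπ, hclose⟩

end FProg

/-! ### The input -/

/-- The entries of the mean and of the covariance matrix, in the order of the input. -/
def inputEntries {d : ℕ} (μ : Fin d → ℚ) (S : Matrix (Fin d) (Fin d) ℚ) : List ℚ :=
  List.ofFn μ ++ (List.ofFn fun i => List.ofFn (S i)).flatten

theorem getD_flatMap_encodeRat (L : List ℚ) {e : ℕ} (he : e < L.length) :
    (L.flatMap encodeRat).getD (2 * e) 0 = (L.getD e 0).num ∧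
      (L.flatMap encodeRat).getD (2 * e + 1) 0 = (L.getD e 0).den := by
  induction L generalizing e with
  | nil => simp at he
  | cons x L ih =>
    cases e with
    | zero => simp [encodeRat]
    | succ e =>
      have := ih (e := e) (by simpa using he)
      simpa [encodeRat, Nat.mul_succ] using this

section Input

variable {n d : ℕ} {μ : Fin d → ℚ} {S : Matrix (Fin d) (Fin d) ℚ} {ε₁ ε₂ : ℚ}

theorem inputEntries_eq_ofFn : inputEntries μ S =
    List.ofFn (Fin.append μ fun e : Fin (d * d) => S e.divNat e.modNat) := by
  rw [List.ofFn_fin_append, List.ofFn_mul, inputEntries]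
  congr 3
  refine funext fun i => congrArg List.ofFn (funext fun j => ?_)
  have h : (⟨i * d + j, mul_add_lt_mul i.2 j.2⟩ : Fin (d * d)) = i.mkDivMod j :=
    Fin.ext (by rw [Fin.mkDivMod]; simp [mul_comm])
  rw [h, Fin.divNat_mkDivMod, Fin.modNat_mkDivMod]

theorem inputEntries_length : (inputEntries μ S).length = d + d * d := by
  rw [inputEntries_eq_ofFn, List.length_ofFn]

theorem getD_inputEntries_mean (i : Fin d) : (inputEntries μ S).getD i 0 = μ i := by
  rw [inputEntries_eq_ofFn, List.getD_eq_getElem _ _ (by rw [List.length_ofFn]; omega),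
    List.getElem_ofFn]
  exact Fin.append_left μ _ i

theorem getD_inputEntries_cov (i j : Fin d) :
    (inputEntries μ S).getD (d + (i * d + j)) 0 = S i j := by
  have hlt : (i : ℕ) * d + j < d * d := mul_add_lt_mul i.2 j.2
  rw [inputEntries_eq_ofFn, List.getD_eq_getElem _ _ (by rw [List.length_ofFn]; omega),
    List.getElem_ofFn]
  have h : (⟨i * d + j, hlt⟩ : Fin (d * d)) = i.mkDivMod j :=
    Fin.ext (by rw [Fin.mkDivMod]; simp [mul_comm])
  refine (Fin.append_right μ _ (⟨i * d + j, hlt⟩ : Fin (d * d))).trans ?_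
  rw [h, Fin.divNat_mkDivMod, Fin.modNat_mkDivMod]

theorem encodeInput_eq : encodeInput n μ S ε₁ ε₂ =
    [(n : ℤ), (d : ℤ) + 1, ε₁.num, ε₁.den, ε₂.num, ε₂.den] ++
      (inputEntries μ S).flatMap encodeRat := by
  have h : ∀ l : List (List ℚ), l.flatten.flatMap encodeRat =
      (l.map fun x => x.flatMap encodeRat).flatten := fun l => by
    induction l with
    | nil => rfl
    | cons x l ih => simp [ih]
  rw [encodeInput, inputEntries, List.flatMap_append, h, List.map_ofFn]
  simp [encodeRat, comp_def]

theorem isInput_ramInit : FProg.IsInput n d ε₁.num ε₁.den ε₂.num ε₂.den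
    (fun e => ((inputEntries μ S).getD e 0).num) (fun e => ((inputEntries μ S).getD e 0).den)
    (ramInit (encodeInput n μ S ε₁ ε₂)) := by
  have h0 : ∀ i, (ramInit (encodeInput n μ S ε₁ ε₂)).arr 0 i =
      (encodeInput n μ S ε₁ ε₂).getD i 0 := fun i => by
    simp [ramInit]
  have h6 : ∀ e, (encodeInput n μ S ε₁ ε₂).getD (e + 6) 0 =
      ((inputEntries μ S).flatMap encodeRat).getD e 0 := fun e => by
    rw [encodeInput_eq]; simp
  refine ⟨?_, ?_, ?_, ?_, ?_, ?_, fun e he => ?_, fun e he => ?_⟩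
  any_goals rw [h0, encodeInput_eq]; rfl
  · rw [h0, add_comm, h6, (getD_flatMap_encodeRat _ (inputEntries_length ▸ he)).1]
  · rw [h0, show 7 + 2 * e = 2 * e + 1 + 6 by ring, h6,
      (getD_flatMap_encodeRat _ (inputEntries_length ▸ he)).2]

/-- The products of the entries by their common denominator are integers. -/
theorem isScaled_of_entries (D : ℤ) (p q : ℕ → ℤ)
    (hp : p = fun e => ((inputEntries μ S).getD e 0).num)
    (hq : q = fun e => (((inputEntries μ S).getD e 0).den : ℤ))
    (hD : D = ∏ e ∈ range (d + d * d), q e) :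
    IsScaled (fun j => (μ j : ℝ)) (S.map fun x : ℚ => (x : ℝ)) ε₁ ε₂ D ε₁.num ε₁.den ε₂.num ε₂.den
      (fun i => D * p i / q i)
      (of fun i j => D * p (d + (i * d + j)) / q (d + (i * d + j))) := by
  have hq0 : ∀ e, 0 < q e := fun e => by
    rw [hq]; exact Int.natCast_pos.2 (Rat.den_pos _)
  have key : ∀ e < d + d * d, ((D * p e / q e : ℤ) : ℝ) =
      D * (((inputEntries μ S).getD e 0 : ℚ) : ℝ) := fun e he => by
    have h1 : q e ∣ D := hD ▸ dvd_prod_of_mem q (mem_range.2 he)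
    have h2 : ((q e : ℤ) : ℝ) ≠ 0 := by exact_mod_cast (hq0 e).ne'
    rw [Int.cast_div (h1.mul_right _) h2, Rat.cast_def, hp, hq]
    push_cast
    rw [mul_div_assoc]
  refine ⟨hD ▸ prod_pos fun e _ => hq0 e, by exact_mod_cast ε₁.den_pos,
    by exact_mod_cast ε₂.den_pos, by rw [Rat.cast_def]; simp, by rw [Rat.cast_def]; simp,
    fun i => ?_, fun i j => ?_⟩
  · rw [key _ (by omega), getD_inputEntries_mean]
  · have hlt : (i : ℕ) * d + j < d * d := mul_add_lt_mul i.2 j.2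
    rw [Matrix.of_apply, key _ (by omega), getD_inputEntries_cov, Matrix.map_apply]

theorem bdd_ramInit {l : List ℤ} {R : ℕ} (h : maxBitLen l ≤ R) (K : ℕ) :
    (ramInit l).Bdd K R := by
  have h1 : ∀ z ∈ l, |z| ≤ 2 ^ R := fun z hz => by
    have h2 : z.natAbs.size ≤ maxBitLen l :=
      List.le_max_of_le' 0 (List.mem_map_of_mem hz) le_rfl
    rw [Int.abs_eq_natAbs]
    exact_mod_cast (Nat.size_le.1 (h2.trans h)).le
  refine ⟨fun x _ => ?_, fun a i => ?_⟩
  · show |(0 : ℤ)| ≤ _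
    rw [abs_zero]; positivity
  · show |if a = 0 then l.getD i 0 else 0| ≤ _
    split_ifs
    · by_cases hi : i < l.length
      · rw [List.getD_eq_getElem _ _ hi]; exact h1 _ (List.getElem_mem hi)
      · rw [List.getD_eq_default _ _ (by omega), abs_zero]; positivity
    · rw [abs_zero]; positivity

theorem one_le_maxBitLen : 1 ≤ maxBitLen (encodeInput n μ S ε₁ ε₂) := by
  have h2 : bitLen ((d : ℤ) + 1) ≤ maxBitLen (encodeInput n μ S ε₁ ε₂) :=
    List.le_max_of_le' 0 (List.mem_map_of_mem (by rw [encodeInput_eq]; simp)) le_rfl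
  refine le_trans ?_ h2
  exact Nat.size_pos.2 (by omega)

end Input

/-! ### The program -/

namespace FProg
open RamState FExpr

/-- The test whether the dimension is positive, and the number of random vectors large. -/
def largeTest : FExpr := reg 1 * (reg 0 - lit 2 * (reg 1 + lit 1) * (reg 1 + lit 1))

/-- The algorithm. -/
def gmdProg : FProg := seq readProg (ite largeTest branchProg trivialProg)

theorem gmdProg_maxReg : gmdProg.maxReg ≤ 40 := by
  have h1 : readProg.maxReg ≤ 40 := by decide
  have h2 : capProg.maxReg ≤ 40 := by decide
  have h3 : meanProg.maxReg ≤ 40 := by decide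
  have h4 : lpProg.maxReg ≤ 40 := by decide
  have h5 : roundProg.maxReg ≤ 40 := by decide
  have h6 : outProg.maxReg ≤ 40 := by decide
  have h7 : trivialProg.maxReg ≤ 40 := by decide
  have h8 : largeTest.maxReg ≤ 40 := by decide
  simp only [gmdProg, branchProg, maxReg, max_le_iff]
  exact ⟨h1, h8, ⟨setupProg_maxReg, h2, h3, h4, h5, h6⟩, h7⟩

/-- The bit length of the numbers that occur in the algorithm. -/
def gmdBound (R : ℕ) : ℕ := branchBound (grow^[6] R)

theorem le_branchBound (R : ℕ) : R ≤ branchBound R :=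
  (le_setupBound R).trans ((le_capBound _).trans ((le_meanBound _).trans (le_grow_iterate 8 _)))

theorem grow_iterate_le_branchBound (R : ℕ) : grow^[2] R ≤ branchBound R := by
  have h1 : Monotone grow := fun a b h => by unfold grow; omega
  refine le_trans (h1.iterate 2 ((le_setupBound R).trans ((le_capBound _).trans (le_meanBound _))))
    (grow_iterate_mono (by norm_num) _)

theorem gmdProg_spec {n d : ℕ} {μ : Fin d → ℚ} {S : Matrix (Fin d) (Fin d) ℚ} {ε₁ ε₂ : ℚ} {R : ℕ}
    {π₀ : Fin n → Fin (d + 1) → ℝ}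
    (H : IsRealizedBy (fun j => (μ j : ℝ)) (S.map fun x : ℚ => (x : ℝ)) ε₁ ε₂ π₀)
    (hb : maxBitLen (encodeInput n μ S ε₁ ε₂) ≤ R) (hV : gridV n d ^ 48 ≤ R)
    (hR : n * (d + 1) ≤ R) :
    gmdProg.Ok (gmdBound R) (ramInit (encodeInput n μ S ε₁ ε₂)) ∧
    ∃ π : Fin n → Fin (d + 1) → ℝ,
      (gmdProg.exec (ramInit (encodeInput n μ S ε₁ ε₂))).Outputs π ∧ IsRowStochastic π ∧
      SpectrallyClose (fun j => (μ j : ℝ)) (S.map fun x : ℚ => (x : ℝ)) (gmdLaw π) ε₁ ε₂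
        (3 * ((d : ℝ) + 1) ^ (5 / 2 : ℝ)) (3 * ((d : ℝ) + 1) ^ 3) := by
  have hin := isInput_ramInit (n := n) (μ := μ) (S := S) (ε₁ := ε₁) (ε₂ := ε₂)
  set s := ramInit (encodeInput n μ S ε₁ ε₂)
  have hs : s.Bdd 40 R := bdd_ramInit hb 40
  have ok1 := straight_ok (C := []) (p := readProg) (by decide) hs (by simp)
  have bd1 := straight_bdd (C := []) (p := readProg) (by decide) hs (by simp)
  obtain ⟨h0, h1, h2, h3, h4, h5⟩ := readProg_spec hin
  have hin1 := hin.of_frame (frame readProg s) (by decide)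
  have hx : gmdProg.exec s = (ite largeTest branchProg trivialProg).exec (readProg.exec s) := by
    rw [gmdProg, exec_seq]
  rw [hx]
  set s1 := readProg.exec s
  change s1.Bdd 40 (grow^[6] R) at bd1
  change readProg.Ok (grow^[6] R) s at ok1
  have hRR : R ≤ grow^[6] R := le_grow_iterate 6 R
  have htest : largeTest.eval s1 = d * (n - 2 * (d + 1) ^ 2 : ℤ) := by
    simp only [largeTest, eval_mul, eval_sub, eval_add, eval_reg, eval_lit, h0, h1]; ring
  have hread := ok1.mono (le_branchBound _)
  have htok : largeTest.Ok (gmdBound R) s1 :=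
    ⟨trivial, trivial, ⟨trivial, trivial, trivial⟩, trivial, trivial⟩
  by_cases hlarge : 0 < largeTest.eval s1
  · rw [show (ite largeTest branchProg trivialProg).exec s1 = _ from if_pos hlarge]
    rw [htest] at hlarge
    have hd : 1 ≤ d := by
      by_contra h
      have : d = 0 := by omega
      subst this
      simp at hlarge
    have hn : 2 * (d + 1) ^ 2 < n := by
      have := pos_of_mul_pos_right hlarge (by positivity)
      zify; linarith
    obtain ⟨ok2, hπ⟩ := branchProg_spec hd hn (hV.trans hRR) bd1 hin1 h0 h1 h2 h3 h4 h5
      (isScaled_of_entries _ _ _ rfl rfl rfl) H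
    refine ⟨ok_seq hread ⟨htok, ?_⟩, hπ⟩
    rw [htest, if_pos hlarge]
    exact ok2
  · rw [show (ite largeTest branchProg trivialProg).exec s1 = _ from if_neg hlarge]
    obtain ⟨ok2, hout⟩ := trivialProg_spec bd1 h0 h1 (hR.trans hRR)
    refine ⟨ok_seq hread ⟨htok, ?_⟩, _, hout, fun _ => single_mem_stdSimplex ℝ _,
      H.spectrallyClose_single (by rw [htest] at hlarge; omega)⟩
    rw [if_neg hlarge]
    exact ok2.mono (grow_iterate_le_branchBound _)

/-! ### The running time -/

theorem PolyBdd.comp {f g : ℕ → ℕ} (hf : PolyBdd f) (hg : PolyBdd g) :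
    PolyBdd fun R => f (g R) := by
  obtain ⟨c, h, H⟩ := hf
  obtain ⟨c', h', H'⟩ := hg
  refine ⟨c * (c' + 1) ^ h, h' * h, fun R => (H _).trans ?_⟩
  have h1 : g R + 1 ≤ (c' + 1) * (R + 1) ^ h' := by
    have := H' R
    have : 1 ≤ (R + 1) ^ h' := Nat.one_le_pow _ _ (by omega)
    rw [add_mul]; omega
  calc c * (g R + 1) ^ h ≤ c * ((c' + 1) * (R + 1) ^ h') ^ h := by gcongr
    _ = _ := by rw [mul_pow, pow_mul]; ring

theorem polyBdd_grow_iterate (k : ℕ) : PolyBdd grow^[k] := by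
  induction k with
  | zero => exact .id
  | succ k ih =>
    rw [iterate_succ]
    exact ih.comp ((PolyBdd.id.add (.const 1)).mul (.const 1000))

theorem polyBdd_flGrow : PolyBdd flGrow := by
  have h := (PolyBdd.const 3).mul ((PolyBdd.id.add (.const 1)).mul (PolyBdd.id.add (.const 1)))
  simp only [← sq] at h
  exact h

theorem polyBdd_gmdBound : PolyBdd gmdBound := by
  have h1 := polyBdd_grow_iterate 1
  have hs : PolyBdd setupBound :=
    h1.comp (((polyBdd_grow_iterate 17).mul (polyBdd_grow_iterate 17)).add
      (polyBdd_grow_iterate 17))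
  have hc : PolyBdd capBound := (polyBdd_grow_iterate 4).comp (polyBdd_flGrow.comp h1)
  have hm : PolyBdd meanBound := ((polyBdd_grow_iterate 3).comp (polyBdd_flGrow.comp h1)).comp
    (polyBdd_grow_iterate 4)
  exact ((polyBdd_grow_iterate 8).comp (hm.comp (hc.comp hs))).comp (polyBdd_grow_iterate 6)

end FProg

theorem gridV_le (n d : ℕ) : gridV n d ≤ (n + 1) ^ (5 * d) := by
  rw [gridV, pow_mul]
  refine Nat.pow_le_pow_left ?_ d
  rw [gridB]
  have : (n + 1) ^ 5 = n ^ 5 + 5 * n ^ 4 + 10 * n ^ 3 + 10 * n ^ 2 + 5 * n + 1 := by ring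
  omega

/-- The size of the linear system is `n ^ O(d)`. -/
theorem size_le (n d : ℕ) {b : ℕ} (hb : 1 ≤ b) :
    gridV n d ^ 48 + n * (d + 1) + b + 1 ≤ (n + 1) ^ (240 * (d + 1)) * (b + 1) ^ 3 := by
  set A := (n + 1) ^ (240 * (d + 1))
  have hA : 1 ≤ A := Nat.one_le_pow _ _ (by omega)
  have h1 : gridV n d ^ 48 ≤ A := by
    refine (Nat.pow_le_pow_left (gridV_le n d) 48).trans ?_
    rw [← pow_mul]
    exact Nat.pow_le_pow_right (by omega) (by omega)
  have h2 : n * (d + 1) ≤ A := by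
    have h3 : ((1 : ℤ) + (d + 1 : ℕ) * n) ≤ (1 + n) ^ (d + 1) :=
      one_add_mul_le_pow (by omega) (d + 1)
    have h4 : 1 + (d + 1) * n ≤ (n + 1) ^ (d + 1) := by
      rw [add_comm n]; exact_mod_cast h3
    have h5 : (n + 1) ^ (d + 1) ≤ A := Nat.pow_le_pow_right (by omega) (by omega)
    rw [mul_comm]; omega
  have h6 : 3 ≤ (b + 1) ^ 2 := by nlinarith
  have h7 : A + A + (b + 1) ≤ 3 * (A * (b + 1)) := by nlinarith
  calc gridV n d ^ 48 + n * (d + 1) + b + 1 ≤ 3 * (A * (b + 1)) := by omega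
    _ ≤ (b + 1) ^ 2 * (A * (b + 1)) := Nat.mul_le_mul_right _ h6
    _ = A * (b + 1) ^ 3 := by ring

theorem mainTheorem10 :
    ∃ (P : RamProg) (C : ℕ),
      ∀ (n d : ℕ) (μ : Fin d → ℚ) (S : Matrix (Fin d) (Fin d) ℚ) (ε₁ ε₂ : ℚ),
        (S.map (fun q : ℚ => (q : ℝ))).PosSemidef →
        (∃ ρ : MeasureTheory.Measure (Fin d → ℝ), IsGMD n ρ ∧
          SpectrallyClose (fun j => (μ j : ℝ)) (S.map (fun q : ℚ => (q : ℝ))) ρ ε₁ ε₂ 0 0) →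
        ∃ (t : ℕ) (s : RamState) (π : Fin n → Fin (d + 1) → ℝ),
          RamRuns P (ramInit (encodeInput n μ S ε₁ ε₂)) t s ∧
          t ≤ (n + 1) ^ (C * (d + 1)) * (maxBitLen (encodeInput n μ S ε₁ ε₂) + 1) ^ C ∧
          s.Outputs π ∧
          IsRowStochastic π ∧
          SpectrallyClose (fun j => (μ j : ℝ)) (S.map (fun q : ℚ => (q : ℝ))) (gmdLaw π) ε₁ ε₂
            (3 * ((d : ℝ) + 1) ^ (5 / 2 : ℝ)) (3 * ((d : ℝ) + 1) ^ 3) := by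
  obtain ⟨c, h, hpoly⟩ := (FProg.polyBdd_time FProg.gmdProg).comp FProg.polyBdd_gmdBound
  refine ⟨FProg.gmdProg.comp 40, 240 * h + (c + 3 * h), fun n d μ S ε₁ ε₂ hS hρ => ?_⟩
  obtain ⟨π₀, H⟩ := exists_isRealizedBy hS hρ
  set l := encodeInput n μ S ε₁ ε₂
  set b := maxBitLen l
  set R := gridV n d ^ 48 + n * (d + 1) + b
  have hb : 1 ≤ b := one_le_maxBitLen
  obtain ⟨hok, π, hout, hπ, hclose⟩ :=
    FProg.gmdProg_spec (R := R) H (show b ≤ R by omega) (by omega) (by omega)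
  have hRg : R ≤ FProg.gmdBound R := (le_grow_iterate 6 R).trans (FProg.le_branchBound _)
  obtain ⟨t, s, hrun, ht, hs, -, -⟩ := FProg.comp_spec
    (FProg.below_of_maxReg_le FProg.gmdProg_maxReg) le_rfl (.refl 40 (ramInit l))
    (bdd_ramInit (show b ≤ FProg.gmdBound R by omega) 40) hok
  refine ⟨t, s, π, hrun, ?_, fun i j => ?_, hπ, hclose⟩
  · have hc : c ≤ (b + 1) ^ c := (Nat.lt_pow_self (by omega)).le
    have hn : 1 ≤ n + 1 := by omega
    calc t ≤ c * (R + 1) ^ h := ht.trans (hpoly R)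
      _ ≤ (b + 1) ^ c * ((n + 1) ^ (240 * (d + 1)) * (b + 1) ^ 3) ^ h :=
        Nat.mul_le_mul hc (Nat.pow_le_pow_left (size_le n d hb) h)
      _ = (n + 1) ^ (240 * h * (d + 1)) * (b + 1) ^ (c + 3 * h) := by
        rw [mul_pow, ← pow_mul, ← pow_mul, pow_add, mul_right_comm 240 (d + 1) h]
        exact mul_left_comm _ _ _
      _ ≤ _ := Nat.mul_le_mul (Nat.pow_le_pow_right hn (Nat.mul_le_mul_right _ (by omega)))
        (Nat.pow_le_pow_right (by omega) (by omega))
  · rw [hs.arr]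
    exact hout i j
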